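/- **Parameters.** Fix sets of node names $n,m$, channels $c,d$, locations $h,k$, sensors $s$, actuators $a$ and values $v,w$. Node names and actuators are infinitely many, there are at least two values, and each location $h$ is denoted by a value, again written $h$. Every channel $c$ has a range $\mathrm{rng}(c)\in\mathbb N\cup\{-1,\infty\}$, and for every channel there are infinitely many channels with the same range. $D(h,k)\in\mathbb N$ is a symmetric distance on locations with $D(h,h)=0$, and $\delta\in\mathbb N$ is fixed. Each sensor $s$ has a domain of values; sensors are split into location-dependent and node-dependent ones. **Syntax.** Processes: $P,Q::=\mathsf{nil}\mid\sigma.P\mid @(x).P\mid s?(x).P\mid a!e.P\mid P|Q\mid\lfloor\pi.P\rfloor Q\mid[b]P;Q\mid X\mid\mathsf{fix}\,X.P$ with $\pi::=c!\langle e\rangle\mid c?(x)$, where $e$ is a value or a variable and $b$ is a decidable condition on finitely many values and variables. $@(x)$, $s?(x)$ and $c?(x)$ bind $x$, and $\mathsf{fix}\,X$ binds $X$. Networks: $M,N::=\mathbf 0\mid n[I\bowtie P]^\mu_h\mid M|N\mid(\nu c)M$, where $P$ is closed, $\mu\in\{\mathsf s,\mathsf m\}$ (stationary, mobile), $I$ is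 a partial map from sensors and actuators to values, and $(\nu c)$ binds $c$. In $\mathsf{fix}\,X.P$ all free occurrences of $X$ in $P$ are time-guarded, i.e. lie in the $Q$ of some $\sigma.Q$ or $\lfloor\pi.P'\rfloor Q$. A network is *well-formed* if: distinct nodes have distinct names, have no common actuator in their interfaces and no common node-dependent sensor; if $s?(x)$ (resp. $a!e$) occurs in the process of a node with interface $I$, then $I(s)$ (resp. $I(a)$) is defined; a node with $I(s)$ defined for a location-dependent $s$ is stationary; each $I(s)$, if defined, is in the domain of $s$; each $I$ is defined on finitely many actuators. All networks below are well-formed. **Reductions.** Structural congruence $\equiv$ is the congruence on processes generated by the commutative monoid laws of $(|,\mathsf{nil})$, $[b]P;Q\equiv P$ if $b$ is true, $[b]P;Q\equiv Q$ if $b$ is false, and $\mathsf{fix}\,X.P\equiv P\{\mathsf{fix}\,X.P/X\}$; and on networks by $P\equiv Q\Rightarrow n[I\bowtie P]^\mu_h\equiv n[I\bowtie Q]^\mu_h$, the commutative monoid laws of $(|,\mathbf 0)$, $(\nu c)\mathbf 0\equiv\mathbf 0$, $(\nu c)(\nu d)M\equiv(\nu d)(\nu c)M$, $(\nu c)(M|N)\equiv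 M|(\nu c)N$ for $c$ not free in $M$, and range-preserving $\alpha$-conversion of restricted channels. The reductions $\to_\tau$ and $\to_a$ are the least relations closed under the following axioms and rules. (Only the changing part of a node is shown.) - $@(x).P\to_\tau P\{h/x\}$ in a node at $h$; $s?(x).P\to_\tau P\{v/x\}$ if $I(s)=v$; $a!v.P\to_\tau P$ if $I(a)=v$; $a!v.P\to_a P$, with $I$ replaced by $I[a\mapsto v]$, if $I(a)$ is defined and $\ne v$. - $\lfloor c!v.P\rfloor R\mid\lfloor c?(x).Q\rfloor T\to_\tau P|Q\{v/x\}$ within one node if $\mathrm{rng}(c)=-1$. - $n[I\bowtie\lfloor c!v.P\rfloor R]^\mu_h\mid m[J\bowtie\lfloor c?(x).Q\rfloor T]^{\nu}_k\to_\tau n[I\bowtie P]^\mu_h\mid m[J\bowtie Q\{v/x\}]^{\nu}_k$ if $D(h,k)\le\mathrm{rng}(c)$. - Both are closed under $\equiv$, $-|N$, $(\nu c)-$, and under adding a parallel process to each node: if $\prod_i n_i[I_i\bowtie P_i]^{\mu_i}_{h_i}\to_\omega\prod_i n_i[I_i'\bowtie P_i']^{\mu_i'}_{h_i'}$, then $\prod_i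 n_i[I_i\bowtie P_i|Q_i]^{\mu_i}_{h_i}\to_\omega\prod_i n_i[I_i'\bowtie P_i'|Q_i]^{\mu_i'}_{h_i'}$. The timed reduction $\to_\sigma$ is the least relation, closed under $\equiv$ and restriction, such that: $\mathbf 0\to_\sigma\mathbf 0$; $n[I\bowtie\prod_i\lfloor\pi_i.P_i\rfloor Q_i|\prod_j\sigma.R_j]^\mu_h\to_\sigma n[I\bowtie\prod_iQ_i|\prod_jR_j]^\mu_k$ if the source has no $\to_\tau$ and either $\mu=\mathsf s$, $k=h$ or $\mu=\mathsf m$, $D(h,k)\le\delta$; and $M|N\to_\sigma M'|N'$ if $M\to_\sigma M'$, $N\to_\sigma N'$ and $M|N$ has no $\to_\tau$. Put $\to\;=\;\to_\tau\cup\to_\sigma$. **Contextual equivalence.** $M\downarrow_{a@h!v}$ means $M\equiv(\nu\tilde g)(n[I\bowtie P]^\mu_h|M')$ with $I(a)=v$. The network $M[s@h\mapsto v]$ is $M$ with $I(s)$ set to $v$ in every node at $h$ where $I(s)$ is defined. *Reduction barbed congruence* $\cong$ is the largest symmetric relation $R$ on well-formed networks such that $M\,R\,N$ implies: 1. (reduction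 closure) if $M\to M'$ then $N\to^*N'$ with $M'\,R\,N'$ for some $N'$; if $M\to_aM'$ then $N\to^*\to_a\to^*N'$ with $M'\,R\,N'$ for some $N'$; 2. (barb preservation) if $M\downarrow_{a@h!v}$ then $N\to^*N'\downarrow_{a@h!v}$ for some $N'$; 3. (contextuality) $M|O\;R\;N|O$ for all $O$ such that both are well-formed; $(\nu c)M\;R\;(\nu c)N$ for all $c$; $M[s@h\mapsto v]\;R\;N[s@h\mapsto v]$ for all $s,h$ and all $v$ in the domain of $s$. **Labelled semantics.** Untimed process transitions: $\lfloor c!v.P\rfloor Q\xrightarrow{c!v}P$; $\lfloor c?(x).P\rfloor Q\xrightarrow{c?v}P\{v/x\}$; $s?(x).P\xrightarrow{s?v}P\{v/x\}$; $a!v.P\xrightarrow{a!v}P$; $@(x).P\xrightarrow{@h}P\{h/x\}$; $P|Q\xrightarrow{\tau}P'|Q'$ if $\mathrm{rng}(c)=-1$, $P\xrightarrow{c!v}P'$, $Q\xrightarrow{c?v}Q'$, or symmetrically; closure under $|$. Timed ones: $\mathsf{nil}\xrightarrow{\sigma}\mathsf{nil}$, $\sigma.P\xrightarrow{\sigma}P$,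 $\lfloor\pi.P\rfloor Q\xrightarrow{\sigma}Q$, and $P|Q\xrightarrow{\sigma}P'|Q'$ if $P\xrightarrow\sigma P'$, $Q\xrightarrow\sigma Q'$ and $P|Q$ has no $\tau$. Moreover $\mathsf{fix}\,X.P$ has the transitions of $P\{\mathsf{fix}\,X.P/X\}$, and $[b]P;Q$ those of $P$ or $Q$ according to the truth value of $b$. A node $n[I\bowtie P]^\mu_h$ with $P\xrightarrow\lambda P'$ makes the following transition to the same node with $P'$ for $P$: $\tau$ if $\lambda=\tau$, $\lambda=@h$, $\lambda=s?v$ with $I(s)=v$, or $\lambda=a!v$ with $I(a)=v$; $a$ (also replacing $I$ by $I[a\mapsto v]$) if $\lambda=a!v$ and $I(a)$ is defined and $\neq v$; $\overline cv@h$ if $\lambda=c!v$ and $\mathrm{rng}(c)\ge0$; $cv@h$ if $\lambda=c?v$ and $\mathrm{rng}(c)\ge0$; $\sigma$ if $\lambda=\sigma$ and the node has no $\tau$, where a mobile node also moves to some $k$ with $D(h,k)\le\delta$. If $M\xrightarrow{\overline cv@k}M'$, $N\xrightarrow{cv@h}N'$ and $D(h,k)\le\mathrm{rng}(c)$, then $M|N\xrightarrow\tau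 M'|N'$, and symmetrically. Untimed transitions are closed under $|$. $\mathbf 0\xrightarrow\sigma\mathbf 0$; $M|N\xrightarrow\sigma M'|N'$ if $M\xrightarrow\sigma M'$, $N\xrightarrow\sigma N'$ and $M|N$ has no $\tau$. If $M\xrightarrow\nu N$ and $\nu$ is not a communication along $c$, then $(\nu c)M\xrightarrow\nu(\nu c)N$. The *extensional* transitions are the $\tau$-, $\sigma$- and $a$-transitions together with: $M\xrightarrow{\overline cv\triangleright k}M'$ if $M\xrightarrow{\overline cv@h}M'$ and $D(h,k)\le\mathrm{rng}(c)$; $M\xrightarrow{cv\triangleright k}M'$ if $M\xrightarrow{cv@h}M'$ and $D(k,h)\le\mathrm{rng}(c)$; $M\xrightarrow{s@h?v}M[s@h\mapsto v]$ for $v$ in the domain of $s$; $M\xrightarrow{a@h!v}M$ if $M\downarrow_{a@h!v}$. Let $\Rightarrow$ be the reflexive-transitive closure of $\xrightarrow\tau$, let $\stackrel{\hat\tau}\Rightarrow$ be $\Rightarrow$, and for $\alpha\ne\tau$ let $\stackrel{\hat\alpha}\Rightarrow$ be $\Rightarrow\xrightarrow\alpha\Rightarrow$. A symmetric relation $R$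 on well-formed networks is a *bisimulation* if $M\,R\,N$ and $M\xrightarrow\alpha M'$ (extensional) imply $N\stackrel{\hat\alpha}\Rightarrow N'$ with $M'\,R\,N'$ for some $N'$. $M\approx N$ means that some bisimulation relates $M$ and $N$. **Theorem (Full abstraction).** For all well-formed networks $M,N$: $M\approx N$ if and only if $M\cong N$. -/

import Mathlib

set_option linter.unusedVariables false

universe u

namespace IoT

/-- Transmission ranges of channels: the set `ℕ ∪ {-1, ∞}`. -/
inductive Range where
  /-- range `-1`: intra-node channel -/
  | intra
  /-- finite range: short-range inter-node channel -/
  | short (r : ℕ)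
  /-- range `∞`: Internet channel -/
  | internet

/-- `r.Covers d` is `d ≤ r`, for a distance `d ∈ ℕ`. -/
def Range.Covers : Range → ℕ → Prop
  | .intra, _ => False
  | .short r, d => d ≤ r
  | .internet, _ => True

/-- The parameters of the calculus: the sets of names and values, and the globally fixed data. -/
structure Sig where
  Node : Type u
  Chan : Type u
  Loc : Type u
  Sens : Type u
  Act : Type u
  Val : Type u
  /-- transmission range of a channel -/
  rng : Chan → Range
  /-- distance between locations -/
  dist : Loc → Loc → ℕ
  /-- maximal distance covered by a mobile node in one time unit -/
  delta : ℕ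
  /-- domain of admissible values of a sensor -/
  dom : Sens → Set Val
  /-- the location-dependent sensors; the other ones are node-dependent -/
  locDep : Set Sens
  /-- the value (coordinates) of a location -/
  coord : Loc → Val
  dist_self : ∀ h, dist h h = 0
  dist_comm : ∀ h k, dist h k = dist k h
  /-- fresh node names are always available -/
  infinite_node : Infinite Node
  /-- fresh actuator names are always available -/
  infinite_act : Infinite Act
  /-- fresh channels are available for (range-preserving) alpha-conversion -/
  infinite_chan : ∀ c, {c' | rng c' = rng c}.Infinite
  nontrivial_val : Nontrivial Val

variable (S : Sig.{u})

/-! ### Syntax of processes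

Data variables and process variables are well-scoped de Bruijn indices: a process in `Proc S n m`
has its free data variables in `Fin n` and its free process variables in `Fin m`. A binder binds
the index `0`. Closed processes are the elements of `Proc S 0 0`. -/

/-- Value terms: variables and values. -/
inductive Term (n : ℕ) where
  | var (i : Fin n)
  | val (v : S.Val)

/-- Boolean guards: a decidable predicate applied to finitely many value terms. -/
structure Guard (n : ℕ) where
  args : List (Term S n)
  pred : List S.Val → Bool

inductive Proc : ℕ → ℕ → Type u where
  /-- termination -/
  | nil {n m : ℕ} : Proc n m
  /-- `σ.P` -/
  | sleep {n m : ℕ} (P : Proc n m) : Proc n m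
  /-- `@(x).P` -/
  | pos {n m : ℕ} (P : Proc (n + 1) m) : Proc n m
  /-- `s?(x).P` -/
  | sense {n m : ℕ} (s : S.Sens) (P : Proc (n + 1) m) : Proc n m
  /-- `a!e.P` -/
  | write {n m : ℕ} (a : S.Act) (e : Term S n) (P : Proc n m) : Proc n m
  /-- `P | Q` -/
  | par {n m : ℕ} (P Q : Proc n m) : Proc n m
  /-- `⌊c!⟨e⟩.P⌋Q` -/
  | send {n m : ℕ} (c : S.Chan) (e : Term S n) (P Q : Proc n m) : Proc n m
  /-- `⌊c?(x).P⌋Q` -/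
  | recv {n m : ℕ} (c : S.Chan) (P : Proc (n + 1) m) (Q : Proc n m) : Proc n m
  /-- `[b]P;Q` -/
  | cond {n m : ℕ} (b : Guard S n) (P Q : Proc n m) : Proc n m
  /-- process variable -/
  | pvar {n m : ℕ} (X : Fin m) : Proc n m
  /-- `fix X.P` -/
  | fix {n m : ℕ} (P : Proc n (m + 1)) : Proc n m

variable {S}

/-! ### Substitution -/

/-- Simultaneous substitution in a value term. -/
def Term.subst {n n' : ℕ} (f : Fin n → Term S n') : Term S n → Term S n'
  | .var i => f i
  | .val v => .val v

/-- Value of a term under an assignment of its variables. -/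
def Term.eval {n : ℕ} (ρ : Fin n → S.Val) : Term S n → S.Val
  | .var i => ρ i
  | .val v => v

def Guard.subst {n n' : ℕ} (f : Fin n → Term S n') (b : Guard S n) : Guard S n' :=
  ⟨b.args.map (Term.subst f), b.pred⟩

/-- Truth value of a guard under an assignment of its variables. -/
def Guard.eval {n : ℕ} (ρ : Fin n → S.Val) (b : Guard S n) : Bool :=
  b.pred (b.args.map (Term.eval ρ))

/-- Lifting of a substitution of terms under a binder. -/
def liftTerm {n n' : ℕ} (f : Fin n → Term S n') : Fin (n + 1) → Term S (n' + 1) :=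
  Fin.cases (.var 0) (fun i => (f i).subst (fun j => .var j.succ))

/-- Simultaneous substitution of terms for data variables. -/
def Proc.subst : {n n' m : ℕ} → (Fin n → Term S n') → Proc S n m → Proc S n' m
  | _, _, _, _, .nil => .nil
  | _, _, _, f, .sleep P => .sleep (P.subst f)
  | _, _, _, f, .pos P => .pos (P.subst (liftTerm f))
  | _, _, _, f, .sense s P => .sense s (P.subst (liftTerm f))
  | _, _, _, f, .write a e P => .write a (e.subst f) (P.subst f)
  | _, _, _, f, .par P Q => .par (P.subst f) (Q.subst f)
  | _, _, _, f, .send c e P Q => .send c (e.subst f) (P.subst f) (Q.subst f)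
  | _, _, _, f, .recv c P Q => .recv c (P.subst (liftTerm f)) (Q.subst f)
  | _, _, _, f, .cond b P Q => .cond (b.subst f) (P.subst f) (Q.subst f)
  | _, _, _, _, .pvar X => .pvar X
  | _, _, _, f, .fix P => .fix (P.subst f)

/-- Lifting of a renaming of process variables under a binder. -/
def liftRen {m m' : ℕ} (f : Fin m → Fin m') : Fin (m + 1) → Fin (m' + 1) :=
  Fin.cases 0 (fun i => (f i).succ)

/-- Renaming of process variables. -/
def Proc.prename : {n m m' : ℕ} → (Fin m → Fin m') → Proc S n m → Proc S n m'
  | _, _, _, _, .nil => .nil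
  | _, _, _, f, .sleep P => .sleep (P.prename f)
  | _, _, _, f, .pos P => .pos (P.prename f)
  | _, _, _, f, .sense s P => .sense s (P.prename f)
  | _, _, _, f, .write a e P => .write a e (P.prename f)
  | _, _, _, f, .par P Q => .par (P.prename f) (Q.prename f)
  | _, _, _, f, .send c e P Q => .send c e (P.prename f) (Q.prename f)
  | _, _, _, f, .recv c P Q => .recv c (P.prename f) (Q.prename f)
  | _, _, _, f, .cond b P Q => .cond b (P.prename f) (Q.prename f)
  | _, _, _, f, .pvar X => .pvar (f X)
  | _, _, _, f, .fix P => .fix (P.prename (liftRen f))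

/-- Weakening of a process by one fresh data variable (the index `0`). -/
def Proc.weaken {n m : ℕ} (P : Proc S n m) : Proc S (n + 1) m :=
  P.subst (fun i => .var i.succ)

/-- Lifting of a substitution of processes under a process-variable binder. -/
def liftProc {n m m' : ℕ} (f : Fin m → Proc S n m') : Fin (m + 1) → Proc S n (m' + 1) :=
  Fin.cases (.pvar 0) (fun i => (f i).prename Fin.succ)

/-- Simultaneous (capture-avoiding) substitution of processes for process variables. -/
def Proc.psubst : {n m m' : ℕ} → (Fin m → Proc S n m') → Proc S n m → Proc S n m'
  | _, _, _, _, .nil => .nil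
  | _, _, _, f, .sleep P => .sleep (P.psubst f)
  | _, _, _, f, .pos P => .pos (P.psubst (fun X => (f X).weaken))
  | _, _, _, f, .sense s P => .sense s (P.psubst (fun X => (f X).weaken))
  | _, _, _, f, .write a e P => .write a e (P.psubst f)
  | _, _, _, f, .par P Q => .par (P.psubst f) (Q.psubst f)
  | _, _, _, f, .send c e P Q => .send c e (P.psubst f) (Q.psubst f)
  | _, _, _, f, .recv c P Q => .recv c (P.psubst (fun X => (f X).weaken)) (Q.psubst f)
  | _, _, _, f, .cond b P Q => .cond b (P.psubst f) (Q.psubst f)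
  | _, _, _, f, .pvar X => f X
  | _, _, _, f, .fix P => .fix (P.psubst (liftProc f))

/-- `P{v/x}`, where `x` is the last bound data variable. -/
def Proc.inst {n m : ℕ} (P : Proc S (n + 1) m) (v : S.Val) : Proc S n m :=
  P.subst (Fin.cases (.val v) (fun i => .var i))

/-- `P{fix X.P / X}`. -/
def Proc.unfold {n m : ℕ} (P : Proc S n (m + 1)) : Proc S n m :=
  P.psubst (Fin.cases (.fix P) (fun i => .pvar i))

/-- Renaming of a channel in a process (processes do not bind channels). -/
noncomputable def Proc.renameChan (c c' : S.Chan) : {n m : ℕ} → Proc S n m → Proc S n m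
  | _, _, .nil => .nil
  | _, _, .sleep P => .sleep (P.renameChan c c')
  | _, _, .pos P => .pos (P.renameChan c c')
  | _, _, .sense s P => .sense s (P.renameChan c c')
  | _, _, .write a e P => .write a e (P.renameChan c c')
  | _, _, .par P Q => .par (P.renameChan c c') (Q.renameChan c c')
  | _, _, .send d e P Q =>
      .send (open Classical in if d = c then c' else d) e
        (P.renameChan c c') (Q.renameChan c c')
  | _, _, .recv d P Q =>
      .recv (open Classical in if d = c then c' else d)
        (P.renameChan c c') (Q.renameChan c c')
  | _, _, .cond b P Q => .cond b (P.renameChan c c') (Q.renameChan c c')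
  | _, _, .pvar X => .pvar X
  | _, _, .fix P => .fix (P.renameChan c c')

/-! ### Syntactic predicates on processes -/

/-- The channel `c` occurs in the process. -/
def Proc.HasChan (c : S.Chan) : {n m : ℕ} → Proc S n m → Prop
  | _, _, .nil => False
  | _, _, .sleep P => P.HasChan c
  | _, _, .pos P => P.HasChan c
  | _, _, .sense _ P => P.HasChan c
  | _, _, .write _ _ P => P.HasChan c
  | _, _, .par P Q => P.HasChan c ∨ Q.HasChan c
  | _, _, .send d _ P Q => d = c ∨ P.HasChan c ∨ Q.HasChan c
  | _, _, .recv d P Q => d = c ∨ P.HasChan c ∨ Q.HasChan c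
  | _, _, .cond _ P Q => P.HasChan c ∨ Q.HasChan c
  | _, _, .pvar _ => False
  | _, _, .fix P => P.HasChan c

/-- A prefix `s?(x)` occurs in the process. -/
def Proc.Reads (s : S.Sens) : {n m : ℕ} → Proc S n m → Prop
  | _, _, .nil => False
  | _, _, .sleep P => P.Reads s
  | _, _, .pos P => P.Reads s
  | _, _, .sense s' P => s' = s ∨ P.Reads s
  | _, _, .write _ _ P => P.Reads s
  | _, _, .par P Q => P.Reads s ∨ Q.Reads s
  | _, _, .send _ _ P Q => P.Reads s ∨ Q.Reads s
  | _, _, .recv _ P Q => P.Reads s ∨ Q.Reads s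
  | _, _, .cond _ P Q => P.Reads s ∨ Q.Reads s
  | _, _, .pvar _ => False
  | _, _, .fix P => P.Reads s

/-- A prefix `a!e` occurs in the process. -/
def Proc.Writes (a : S.Act) : {n m : ℕ} → Proc S n m → Prop
  | _, _, .nil => False
  | _, _, .sleep P => P.Writes a
  | _, _, .pos P => P.Writes a
  | _, _, .sense _ P => P.Writes a
  | _, _, .write a' _ P => a' = a ∨ P.Writes a
  | _, _, .par P Q => P.Writes a ∨ Q.Writes a
  | _, _, .send _ _ P Q => P.Writes a ∨ Q.Writes a
  | _, _, .recv _ P Q => P.Writes a ∨ Q.Writes a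
  | _, _, .cond _ P Q => P.Writes a ∨ Q.Writes a
  | _, _, .pvar _ => False
  | _, _, .fix P => P.Writes a

/-- All free occurrences of the process variable `X` are time-guarded, that is, lie in the
continuation of a prefix `σ` or in the second component `Q` of a `⌊π.P⌋Q`. -/
def Proc.TimeGuarded : {n m : ℕ} → Fin m → Proc S n m → Prop
  | _, _, _, .nil => True
  | _, _, _, .sleep _ => True
  | _, _, X, .pos P => P.TimeGuarded X
  | _, _, X, .sense _ P => P.TimeGuarded X
  | _, _, X, .write _ _ P => P.TimeGuarded X
  | _, _, X, .par P Q => P.TimeGuarded X ∧ Q.TimeGuarded X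
  | _, _, X, .send _ _ P _ => P.TimeGuarded X
  | _, _, X, .recv _ P _ => P.TimeGuarded X
  | _, _, X, .cond _ P Q => P.TimeGuarded X ∧ Q.TimeGuarded X
  | _, _, X, .pvar Y => Y ≠ X
  | _, _, X, .fix P => P.TimeGuarded X.succ

/-- Every recursion in the process is time-guarded. -/
def Proc.GuardedRec : {n m : ℕ} → Proc S n m → Prop
  | _, _, .nil => True
  | _, _, .sleep P => P.GuardedRec
  | _, _, .pos P => P.GuardedRec
  | _, _, .sense _ P => P.GuardedRec
  | _, _, .write _ _ P => P.GuardedRec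
  | _, _, .par P Q => P.GuardedRec ∧ Q.GuardedRec
  | _, _, .send _ _ P Q => P.GuardedRec ∧ Q.GuardedRec
  | _, _, .recv _ P Q => P.GuardedRec ∧ Q.GuardedRec
  | _, _, .cond _ P Q => P.GuardedRec ∧ Q.GuardedRec
  | _, _, .pvar _ => True
  | _, _, .fix P => P.TimeGuarded 0 ∧ P.GuardedRec

/-! ### Networks -/

variable (S) in
/-- Physical interfaces: partial mappings from sensor and actuator names to values. -/
structure Iface where
  sens : S.Sens → Option S.Val
  act : S.Act → Option S.Val

/-- `I[s ↦ v]` -/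
noncomputable def Iface.setSens (I : Iface S) (s : S.Sens) (v : S.Val) : Iface S where
  sens := open Classical in fun s' => if s' = s then some v else I.sens s'
  act := I.act

/-- `I[a ↦ v]` -/
noncomputable def Iface.setAct (I : Iface S) (a : S.Act) (v : S.Val) : Iface S where
  sens := I.sens
  act := open Classical in fun a' => if a' = a then some v else I.act a'

/-- Mobility tags. -/
inductive Mob where
  | stat
  | mob

variable (S) in
/-- A node (device) `n[I ⋈ P]^μ_h`. -/
structure Dev where
  name : S.Node
  iface : Iface S
  proc : Proc S 0 0
  mob : Mob
  loc : S.Loc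

variable (S) in
inductive Net where
  | zero
  | node (d : Dev S)
  | par (M N : Net)
  | res (c : S.Chan) (M : Net)

/-- The nodes of a network. -/
def Net.devs : Net S → List (Dev S)
  | .zero => []
  | .node d => [d]
  | .par M N => M.devs ++ N.devs
  | .res _ M => M.devs

/-- The channel `c` occurs free in the network. -/
def Net.FreeChan (c : S.Chan) : Net S → Prop
  | .zero => False
  | .node d => d.proc.HasChan c
  | .par M N => M.FreeChan c ∨ N.FreeChan c
  | .res d M => d ≠ c ∧ M.FreeChan c

/-- The channel `c` occurs (free, bound or binding) in the network. -/
def Net.HasChan (c : S.Chan) : Net S → Prop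
  | .zero => False
  | .node d => d.proc.HasChan c
  | .par M N => M.HasChan c ∨ N.HasChan c
  | .res d M => d = c ∨ M.HasChan c

/-- Renaming of the free occurrences of `c` to `c'`; used only when `c'` does not occur. -/
noncomputable def Net.renameChan (c c' : S.Chan) : Net S → Net S
  | .zero => .zero
  | .node d => .node { d with proc := d.proc.renameChan c c' }
  | .par M N => .par (M.renameChan c c') (N.renameChan c c')
  | .res d M => open Classical in if d = c then .res d M else .res d (M.renameChan c c')

/-- Well-formedness of a single node. -/
structure Dev.WF (d : Dev S) : Prop where
  guarded : d.proc.GuardedRec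
  reads : ∀ s, d.proc.Reads s → ∃ v, d.iface.sens s = some v
  writes : ∀ a, d.proc.Writes a → ∃ v, d.iface.act a = some v
  stationary : ∀ s ∈ S.locDep, (∃ v, d.iface.sens s = some v) → d.mob = Mob.stat
  /-- sensors carry values of their domain -/
  typed : ∀ s v, d.iface.sens s = some v → v ∈ S.dom s
  /-- a device has finitely many actuators -/
  finite_act : {a | d.iface.act a ≠ none}.Finite

/-- Well-formed networks. -/
structure Net.WF (M : Net S) : Prop where
  names : M.devs.Pairwise (fun d e => d.name ≠ e.name)
  acts : M.devs.Pairwise (fun d e => ∀ a, d.iface.act a = none ∨ e.iface.act a = none)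
  sens : M.devs.Pairwise
    (fun d e => ∀ s, s ∉ S.locDep → d.iface.sens s = none ∨ e.iface.sens s = none)
  dev : ∀ d ∈ M.devs, d.WF

/-! ### Structural congruence -/

/-- Structural congruence of (possibly open) processes: the congruence induced by the axioms. On
a closed guard, the assignments `ρ` range over a one-element set. -/
inductive PCong : {n m : ℕ} → Proc S n m → Proc S n m → Prop where
  | refl {n m : ℕ} (P : Proc S n m) : PCong P P
  | symm {n m : ℕ} {P Q : Proc S n m} : PCong P Q → PCong Q P
  | trans {n m : ℕ} {P Q R : Proc S n m} : PCong P Q → PCong Q R → PCong P R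
  | par_nil {n m : ℕ} (P : Proc S n m) : PCong (.par P .nil) P
  | par_comm {n m : ℕ} (P Q : Proc S n m) : PCong (.par P Q) (.par Q P)
  | par_assoc {n m : ℕ} (P Q R : Proc S n m) :
      PCong (.par (.par P Q) R) (.par P (.par Q R))
  | cond_true {n m : ℕ} (b : Guard S n) (P Q : Proc S n m) :
      (∀ ρ, b.eval ρ = true) → PCong (.cond b P Q) P
  | cond_false {n m : ℕ} (b : Guard S n) (P Q : Proc S n m) :
      (∀ ρ, b.eval ρ = false) → PCong (.cond b P Q) Q
  | unfold {n m : ℕ} (P : Proc S n (m + 1)) : PCong (.fix P) P.unfold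
  | congr_sleep {n m : ℕ} {P P' : Proc S n m} : PCong P P' → PCong (.sleep P) (.sleep P')
  | congr_pos {n m : ℕ} {P P' : Proc S (n + 1) m} : PCong P P' → PCong (.pos P) (.pos P')
  | congr_sense {n m : ℕ} (s : S.Sens) {P P' : Proc S (n + 1) m} :
      PCong P P' → PCong (.sense s P) (.sense s P')
  | congr_write {n m : ℕ} (a : S.Act) (e : Term S n) {P P' : Proc S n m} :
      PCong P P' → PCong (.write a e P) (.write a e P')
  | congr_par {n m : ℕ} {P P' Q Q' : Proc S n m} :
      PCong P P' → PCong Q Q' → PCong (.par P Q) (.par P' Q')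
  | congr_send {n m : ℕ} (c : S.Chan) (e : Term S n) {P P' Q Q' : Proc S n m} :
      PCong P P' → PCong Q Q' → PCong (.send c e P Q) (.send c e P' Q')
  | congr_recv {n m : ℕ} (c : S.Chan) {P P' : Proc S (n + 1) m} {Q Q' : Proc S n m} :
      PCong P P' → PCong Q Q' → PCong (.recv c P Q) (.recv c P' Q')
  | congr_cond {n m : ℕ} (b : Guard S n) {P P' Q Q' : Proc S n m} :
      PCong P P' → PCong Q Q' → PCong (.cond b P Q) (.cond b P' Q')
  | congr_fix {n m : ℕ} {P P' : Proc S n (m + 1)} : PCong P P' → PCong (.fix P) (.fix P')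

/-- Structural congruence of networks; it includes alpha-conversion of restricted channels. -/
inductive NCong : Net S → Net S → Prop where
  | refl (M : Net S) : NCong M M
  | symm {M N : Net S} : NCong M N → NCong N M
  | trans {M N O : Net S} : NCong M N → NCong N O → NCong M O
  | alpha (c c' : S.Chan) (M : Net S) : S.rng c' = S.rng c → ¬ M.HasChan c' →
      NCong (.res c M) (.res c' (M.renameChan c c'))
  | node (d : Dev S) {Q : Proc S 0 0} : PCong d.proc Q →
      NCong (.node d) (.node { d with proc := Q })
  | par_zero (M : Net S) : NCong (.par M .zero) M
  | par_comm (M N : Net S) : NCong (.par M N) (.par N M)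
  | par_assoc (M N O : Net S) : NCong (.par (.par M N) O) (.par M (.par N O))
  | res_zero (c : S.Chan) : NCong (.res c .zero) .zero
  | res_comm (c d : S.Chan) (M : Net S) : NCong (.res c (.res d M)) (.res d (.res c M))
  | res_par (c : S.Chan) (M N : Net S) : ¬ M.FreeChan c →
      NCong (.res c (.par M N)) (.par M (.res c N))
  | congr_par {M M' N N' : Net S} : NCong M M' → NCong N N' → NCong (.par M N) (.par M' N')
  | congr_res (c : S.Chan) {M M' : Net S} : NCong M M' → NCong (.res c M) (.res c M')

/-! ### Reduction semantics -/

/-- `∏ P_i` -/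
def Proc.prod {n m : ℕ} (L : List (Proc S n m)) : Proc S n m := L.foldr .par .nil

/-- `∏ M_i` -/
def Net.prod (L : List (Net S)) : Net S := L.foldr .par .zero

/-- The node with `Q` running in parallel with its process. -/
def Dev.addPar (d : Dev S) (Q : Proc S 0 0) : Dev S := { d with proc := .par d.proc Q }

/-- `IsTimeout R Q`: the process `R` is of the form `⌊π.P⌋Q`. -/
inductive IsTimeout : Proc S 0 0 → Proc S 0 0 → Prop where
  | send (c : S.Chan) (e : Term S 0) (P Q : Proc S 0 0) : IsTimeout (.send c e P Q) Q
  | recv (c : S.Chan) (P : Proc S 1 0) (Q : Proc S 0 0) : IsTimeout (.recv c P Q) Q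

variable (S) in
/-- Labels of instantaneous reductions: `τ`, or an actuator whose value changes. -/
inductive ILabel where
  | tau
  | act (a : S.Act)

/-- Instantaneous reductions `→_τ` and `→_a`. -/
inductive RedI : ILabel S → Net S → Net S → Prop where
  | pos (n : S.Node) (I : Iface S) (P : Proc S 1 0) (μ : Mob) (h : S.Loc) :
      RedI .tau (.node ⟨n, I, .pos P, μ, h⟩) (.node ⟨n, I, P.inst (S.coord h), μ, h⟩)
  | sensread (n : S.Node) (I : Iface S) (s : S.Sens) (v : S.Val) (P : Proc S 1 0) (μ : Mob)
      (h : S.Loc) : I.sens s = some v →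
      RedI .tau (.node ⟨n, I, .sense s P, μ, h⟩) (.node ⟨n, I, P.inst v, μ, h⟩)
  | actunchg (n : S.Node) (I : Iface S) (a : S.Act) (v : S.Val) (P : Proc S 0 0) (μ : Mob)
      (h : S.Loc) : I.act a = some v →
      RedI .tau (.node ⟨n, I, .write a (.val v) P, μ, h⟩) (.node ⟨n, I, P, μ, h⟩)
  | actchg (n : S.Node) (I : Iface S) (a : S.Act) (v w : S.Val) (P : Proc S 0 0) (μ : Mob)
      (h : S.Loc) : I.act a = some w → w ≠ v →
      RedI (.act a) (.node ⟨n, I, .write a (.val v) P, μ, h⟩) (.node ⟨n, I.setAct a v, P, μ, h⟩)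
  | loccom (n : S.Node) (I : Iface S) (c : S.Chan) (v : S.Val) (P R : Proc S 0 0)
      (Q : Proc S 1 0) (T : Proc S 0 0) (μ : Mob) (h : S.Loc) : S.rng c = .intra →
      RedI .tau (.node ⟨n, I, .par (.send c (.val v) P R) (.recv c Q T), μ, h⟩)
        (.node ⟨n, I, .par P (Q.inst v), μ, h⟩)
  | glbcom (n m : S.Node) (I J : Iface S) (c : S.Chan) (v : S.Val) (P R : Proc S 0 0)
      (Q : Proc S 1 0) (T : Proc S 0 0) (μ ν : Mob) (h k : S.Loc) :
      (S.rng c).Covers (S.dist h k) →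
      RedI .tau
        (.par (.node ⟨n, I, .send c (.val v) P R, μ, h⟩) (.node ⟨m, J, .recv c Q T, ν, k⟩))
        (.par (.node ⟨n, I, P, μ, h⟩) (.node ⟨m, J, Q.inst v, ν, k⟩))
  | parp (ω : ILabel S) (L : List (Dev S × Dev S × Proc S 0 0)) :
      (∀ t ∈ L, t.1.name = t.2.1.name) →
      RedI ω (Net.prod (L.map fun t => .node t.1)) (Net.prod (L.map fun t => .node t.2.1)) →
      RedI ω (Net.prod (L.map fun t => .node (t.1.addPar t.2.2)))
        (Net.prod (L.map fun t => .node (t.2.1.addPar t.2.2)))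
  | parn (ω : ILabel S) (M M' N : Net S) : RedI ω M M' → RedI ω (.par M N) (.par M' N)
  | res (ω : ILabel S) (c : S.Chan) (M M' : Net S) : RedI ω M M' → RedI ω (.res c M) (.res c M')
  | struct (ω : ILabel S) (M N N' M' : Net S) : NCong M N → RedI ω N N' → NCong N' M' →
      RedI ω M M'

/-- Timed reductions `→_σ`. In the first two rules, `A` lists the pairs `(⌊π_i.P_i⌋Q_i, Q_i)` and
`R` lists the processes `R_j`. -/
inductive RedT : Net S → Net S → Prop where
  | timestat (n : S.Node) (I : Iface S) (h : S.Loc) (A : List (Proc S 0 0 × Proc S 0 0))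
      (R : List (Proc S 0 0)) : (∀ p ∈ A, IsTimeout p.1 p.2) →
      (¬ ∃ M, RedI .tau
        (.node ⟨n, I, .par (.prod (A.map Prod.fst)) (.prod (R.map .sleep)), .stat, h⟩) M) →
      RedT (.node ⟨n, I, .par (.prod (A.map Prod.fst)) (.prod (R.map .sleep)), .stat, h⟩)
        (.node ⟨n, I, .par (.prod (A.map Prod.snd)) (.prod R), .stat, h⟩)
  | timemob (n : S.Node) (I : Iface S) (h k : S.Loc) (A : List (Proc S 0 0 × Proc S 0 0))
      (R : List (Proc S 0 0)) : (∀ p ∈ A, IsTimeout p.1 p.2) →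
      (¬ ∃ M, RedI .tau
        (.node ⟨n, I, .par (.prod (A.map Prod.fst)) (.prod (R.map .sleep)), .mob, h⟩) M) →
      S.dist h k ≤ S.delta →
      RedT (.node ⟨n, I, .par (.prod (A.map Prod.fst)) (.prod (R.map .sleep)), .mob, h⟩)
        (.node ⟨n, I, .par (.prod (A.map Prod.snd)) (.prod R), .mob, k⟩)
  | timepar (M M' N N' : Net S) : RedT M M' → RedT N N' →
      (¬ ∃ O, RedI .tau (.par M N) O) → RedT (.par M N) (.par M' N')
  | timezero : RedT .zero .zero
  | res (c : S.Chan) (M M' : Net S) : RedT M M' → RedT (.res c M) (.res c M')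
  | struct (M N N' M' : Net S) : NCong M N → RedT N N' → NCong N' M' → RedT M M'

/-- The reduction relation `→ = →_τ ∪ →_σ`. -/
def Red (M N : Net S) : Prop := RedI .tau M N ∨ RedT M N

/-! ### Barbs and sensor updates -/

/-- `(ν c₁)…(ν c_k) M` -/
def Net.resList (L : List S.Chan) (M : Net S) : Net S := L.foldr .res M

/-- The barb `M ↓ a@h!v`. -/
def Barb (M : Net S) (a : S.Act) (h : S.Loc) (v : S.Val) : Prop :=
  ∃ (L : List S.Chan) (d : Dev S) (M' : Net S),
    NCong M (Net.resList L (.par (.node d) M')) ∧ d.loc = h ∧ d.iface.act a = some v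

/-- `d[s@h ↦ v]` for a single node. -/
noncomputable def Dev.update (s : S.Sens) (h : S.Loc) (v : S.Val) (d : Dev S) : Dev S :=
  open Classical in
  if d.loc = h ∧ ∃ w, d.iface.sens s = some w then { d with iface := d.iface.setSens s v } else d

/-- The sensor update `M[s@h ↦ v]`. -/
noncomputable def Net.update (s : S.Sens) (h : S.Loc) (v : S.Val) : Net S → Net S
  | .zero => .zero
  | .node d => .node (d.update s h v)
  | .par M N => .par (M.update s h v) (N.update s h v)
  | .res c M => .res c (M.update s h v)

/-! ### Intensional labelled transition semantics -/

variable (S) in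
/-- Untimed labels of process transitions. -/
inductive PLabel where
  | tau
  | send (c : S.Chan) (v : S.Val)
  | recv (c : S.Chan) (v : S.Val)
  | pos (h : S.Loc)
  | sense (s : S.Sens) (v : S.Val)
  | write (a : S.Act) (v : S.Val)

/-- Untimed process transitions. The rules `condT` and `condF` render the convention that
`[b]P;Q` is `P` if `b` holds, and `Q` otherwise. -/
inductive PTrans : PLabel S → Proc S 0 0 → Proc S 0 0 → Prop where
  | snd (c : S.Chan) (v : S.Val) (P Q : Proc S 0 0) :
      PTrans (.send c v) (.send c (.val v) P Q) P
  | rcv (c : S.Chan) (v : S.Val) (P : Proc S 1 0) (Q : Proc S 0 0) :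
      PTrans (.recv c v) (.recv c P Q) (P.inst v)
  | sensor (s : S.Sens) (v : S.Val) (P : Proc S 1 0) :
      PTrans (.sense s v) (.sense s P) (P.inst v)
  | actuator (a : S.Act) (v : S.Val) (P : Proc S 0 0) :
      PTrans (.write a v) (.write a (.val v) P) P
  | pos (h : S.Loc) (P : Proc S 1 0) : PTrans (.pos h) (.pos P) (P.inst (S.coord h))
  | comL (c : S.Chan) (v : S.Val) (P P' Q Q' : Proc S 0 0) : PTrans (.send c v) P P' →
      PTrans (.recv c v) Q Q' → S.rng c = .intra → PTrans .tau (.par P Q) (.par P' Q')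
  | comR (c : S.Chan) (v : S.Val) (P P' Q Q' : Proc S 0 0) : PTrans (.recv c v) P P' →
      PTrans (.send c v) Q Q' → S.rng c = .intra → PTrans .tau (.par P Q) (.par P' Q')
  | parL (l : PLabel S) (P P' Q : Proc S 0 0) : PTrans l P P' → PTrans l (.par P Q) (.par P' Q)
  | parR (l : PLabel S) (P Q Q' : Proc S 0 0) : PTrans l Q Q' → PTrans l (.par P Q) (.par P Q')
  | fix (l : PLabel S) (P : Proc S 0 1) (Q : Proc S 0 0) : PTrans l P.unfold Q →
      PTrans l (.fix P) Q
  | condT (l : PLabel S) (b : Guard S 0) (P Q R : Proc S 0 0) : b.eval Fin.elim0 = true →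
      PTrans l P R → PTrans l (.cond b P Q) R
  | condF (l : PLabel S) (b : Guard S 0) (P Q R : Proc S 0 0) : b.eval Fin.elim0 = false →
      PTrans l Q R → PTrans l (.cond b P Q) R

/-- Timed process transitions, labelled `σ`. -/
inductive PTime : Proc S 0 0 → Proc S 0 0 → Prop where
  | timenil : PTime .nil .nil
  | delay (P : Proc S 0 0) : PTime (.sleep P) P
  | timeout (R Q : Proc S 0 0) : IsTimeout R Q → PTime R Q
  | timepar (P P' Q Q' : Proc S 0 0) : PTime P P' → PTime Q Q' →
      (¬ ∃ R, PTrans .tau (.par P Q) R) → PTime (.par P Q) (.par P' Q')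
  | fix (P : Proc S 0 1) (Q : Proc S 0 0) : PTime P.unfold Q → PTime (.fix P) Q
  | condT (b : Guard S 0) (P Q R : Proc S 0 0) : b.eval Fin.elim0 = true → PTime P R →
      PTime (.cond b P Q) R
  | condF (b : Guard S 0) (P Q R : Proc S 0 0) : b.eval Fin.elim0 = false → PTime Q R →
      PTime (.cond b P Q) R

variable (S) in
/-- Untimed labels of network transitions. -/
inductive NLabel where
  | tau
  | act (a : S.Act)
  | send (c : S.Chan) (v : S.Val) (h : S.Loc)
  | recv (c : S.Chan) (v : S.Val) (h : S.Loc)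

/-- The label is not a communication along `c`. -/
def NLabel.Avoids (c : S.Chan) : NLabel S → Prop
  | .tau => True
  | .act _ => True
  | .send d _ _ => d ≠ c
  | .recv d _ _ => d ≠ c

/-- Untimed network transitions. -/
inductive NTrans : NLabel S → Net S → Net S → Prop where
  | pos (n : S.Node) (I : Iface S) (P P' : Proc S 0 0) (μ : Mob) (h : S.Loc) :
      PTrans (.pos h) P P' → NTrans .tau (.node ⟨n, I, P, μ, h⟩) (.node ⟨n, I, P', μ, h⟩)
  | sensread (n : S.Node) (I : Iface S) (P P' : Proc S 0 0) (μ : Mob) (h : S.Loc)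
      (s : S.Sens) (v : S.Val) : I.sens s = some v → PTrans (.sense s v) P P' →
      NTrans .tau (.node ⟨n, I, P, μ, h⟩) (.node ⟨n, I, P', μ, h⟩)
  | actunchg (n : S.Node) (I : Iface S) (P P' : Proc S 0 0) (μ : Mob) (h : S.Loc)
      (a : S.Act) (v : S.Val) : I.act a = some v → PTrans (.write a v) P P' →
      NTrans .tau (.node ⟨n, I, P, μ, h⟩) (.node ⟨n, I, P', μ, h⟩)
  | loccom (n : S.Node) (I : Iface S) (P P' : Proc S 0 0) (μ : Mob) (h : S.Loc) :
      PTrans .tau P P' → NTrans .tau (.node ⟨n, I, P, μ, h⟩) (.node ⟨n, I, P', μ, h⟩)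
  | actchg (n : S.Node) (I : Iface S) (P P' : Proc S 0 0) (μ : Mob) (h : S.Loc)
      (a : S.Act) (v w : S.Val) : I.act a = some w → w ≠ v → PTrans (.write a v) P P' →
      NTrans (.act a) (.node ⟨n, I, P, μ, h⟩) (.node ⟨n, I.setAct a v, P', μ, h⟩)
  | snd (n : S.Node) (I : Iface S) (P P' : Proc S 0 0) (μ : Mob) (h : S.Loc)
      (c : S.Chan) (v : S.Val) : PTrans (.send c v) P P' → S.rng c ≠ .intra →
      NTrans (.send c v h) (.node ⟨n, I, P, μ, h⟩) (.node ⟨n, I, P', μ, h⟩)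
  | rcv (n : S.Node) (I : Iface S) (P P' : Proc S 0 0) (μ : Mob) (h : S.Loc)
      (c : S.Chan) (v : S.Val) : PTrans (.recv c v) P P' → S.rng c ≠ .intra →
      NTrans (.recv c v h) (.node ⟨n, I, P, μ, h⟩) (.node ⟨n, I, P', μ, h⟩)
  | glbcomL (M M' N N' : Net S) (c : S.Chan) (v : S.Val) (h k : S.Loc) :
      NTrans (.send c v k) M M' → NTrans (.recv c v h) N N' →
      (S.rng c).Covers (S.dist h k) → NTrans .tau (.par M N) (.par M' N')
  | glbcomR (M M' N N' : Net S) (c : S.Chan) (v : S.Val) (h k : S.Loc) :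
      NTrans (.recv c v h) M M' → NTrans (.send c v k) N N' →
      (S.rng c).Covers (S.dist h k) → NTrans .tau (.par M N) (.par M' N')
  | parL (l : NLabel S) (M M' N : Net S) : NTrans l M M' → NTrans l (.par M N) (.par M' N)
  | parR (l : NLabel S) (M N N' : Net S) : NTrans l N N' → NTrans l (.par M N) (.par M N')
  | res (l : NLabel S) (c : S.Chan) (M M' : Net S) : NTrans l M M' → l.Avoids c →
      NTrans l (.res c M) (.res c M')

/-- Timed network transitions, labelled `σ`. -/
inductive NTime : Net S → Net S → Prop where
  | timestat (n : S.Node) (I : Iface S) (P P' : Proc S 0 0) (h : S.Loc) : PTime P P' →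
      (¬ ∃ M, NTrans .tau (.node ⟨n, I, P, .stat, h⟩) M) →
      NTime (.node ⟨n, I, P, .stat, h⟩) (.node ⟨n, I, P', .stat, h⟩)
  | timemob (n : S.Node) (I : Iface S) (P P' : Proc S 0 0) (h k : S.Loc) : PTime P P' →
      (¬ ∃ M, NTrans .tau (.node ⟨n, I, P, .mob, h⟩) M) → S.dist h k ≤ S.delta →
      NTime (.node ⟨n, I, P, .mob, h⟩) (.node ⟨n, I, P', .mob, k⟩)
  | timepar (M M' N N' : Net S) : NTime M M' → NTime N N' →
      (¬ ∃ O, NTrans .tau (.par M N) O) → NTime (.par M N) (.par M' N')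
  | timezero : NTime .zero .zero
  | res (c : S.Chan) (M M' : Net S) : NTime M M' → NTime (.res c M) (.res c M')

/-! ### Extensional labelled transition semantics -/

variable (S) in
/-- Labels of the extensional semantics. -/
inductive ELabel where
  | tau
  | tick
  | act (a : S.Act)
  /-- `c!v ▷ k`: output observable at location `k` -/
  | sendObs (c : S.Chan) (v : S.Val) (k : S.Loc)
  /-- `c?v ▷ k`: input of a message sent from location `k` -/
  | recvObs (c : S.Chan) (v : S.Val) (k : S.Loc)
  /-- `s@h?v`: the environment sets the sensor `s` at `h` to `v` -/
  | sensEnv (s : S.Sens) (h : S.Loc) (v : S.Val)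
  /-- `a@h!v`: the environment observes the value `v` on the actuator `a` at `h` -/
  | actEnv (a : S.Act) (h : S.Loc) (v : S.Val)

/-- Extensional transitions. -/
inductive ETrans : ELabel S → Net S → Net S → Prop where
  | tau (M M' : Net S) : NTrans .tau M M' → ETrans .tau M M'
  | tick (M M' : Net S) : NTime M M' → ETrans .tick M M'
  | act (a : S.Act) (M M' : Net S) : NTrans (.act a) M M' → ETrans (.act a) M M'
  | sndObs (c : S.Chan) (v : S.Val) (h k : S.Loc) (M M' : Net S) :
      NTrans (.send c v h) M M' → (S.rng c).Covers (S.dist h k) → ETrans (.sendObs c v k) M M'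
  | rcvObs (c : S.Chan) (v : S.Val) (h k : S.Loc) (M M' : Net S) :
      NTrans (.recv c v h) M M' → (S.rng c).Covers (S.dist k h) → ETrans (.recvObs c v k) M M'
  | sensEnv (s : S.Sens) (h : S.Loc) (v : S.Val) (M : Net S) : v ∈ S.dom s →
      ETrans (.sensEnv s h v) M (M.update s h v)
  | actEnv (a : S.Act) (h : S.Loc) (v : S.Val) (M : Net S) : Barb M a h v →
      ETrans (.actEnv a h v) M M

/-! ### Well-formed networks and operations on them -/

variable (S) in
/-- The well-formed networks. -/
def WNet := {M : Net S // M.WF}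

theorem Dev.WF.update {d : Dev S} (hd : d.WF) {s : S.Sens} {v : S.Val} (hv : v ∈ S.dom s)
    (h : S.Loc) : (d.update s h v).WF := by
  unfold Dev.update
  split_ifs with hc
  · have key : ∀ s', (∃ w, (d.iface.setSens s v).sens s' = some w) ↔
        ∃ w, d.iface.sens s' = some w := by
      intro s'
      by_cases hs : s' = s
      · subst hs
        simp [Iface.setSens, hc.2]
      · simp [Iface.setSens, hs]
    refine ⟨hd.guarded, fun s' hs' => (key s').2 (hd.reads s' hs'), hd.writes,
      fun s' hs' hw => hd.stationary s' hs' ((key s').1 hw), ?_, hd.finite_act⟩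
    intro s' w hw
    by_cases hs : s' = s
    · subst hs
      simp [Iface.setSens] at hw
      exact hw ▸ hv
    · simp [Iface.setSens, hs] at hw
      exact hd.typed s' w hw
  · exact hd

theorem Dev.update_name (d : Dev S) (s : S.Sens) (h : S.Loc) (v : S.Val) :
    (d.update s h v).name = d.name := by
  unfold Dev.update
  split_ifs <;> rfl

theorem Dev.update_act (d : Dev S) (s : S.Sens) (h : S.Loc) (v : S.Val) :
    (d.update s h v).iface.act = d.iface.act := by
  unfold Dev.update
  split_ifs <;> rfl

theorem Dev.update_sens_none (d : Dev S) (s : S.Sens) (h : S.Loc) (v : S.Val) (s' : S.Sens) :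
    (d.update s h v).iface.sens s' = none ↔ d.iface.sens s' = none := by
  unfold Dev.update
  split_ifs with hc
  · by_cases hs : s' = s
    · subst hs
      obtain ⟨_, w, hw⟩ := hc
      simp [Iface.setSens, hw]
    · simp [Iface.setSens, hs]
  · rfl

theorem Net.devs_update (s : S.Sens) (h : S.Loc) (v : S.Val) (M : Net S) :
    (M.update s h v).devs = M.devs.map (Dev.update s h v) := by
  induction M with
  | zero => rfl
  | node d => rfl
  | par M N ihM ihN => simp [Net.update, Net.devs, ihM, ihN]
  | res c M ih => simpa [Net.update, Net.devs] using ih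

theorem Net.WF.update {M : Net S} (hM : M.WF) {s : S.Sens} {v : S.Val} (hv : v ∈ S.dom s)
    (h : S.Loc) : (M.update s h v).WF := by
  refine ⟨?_, ?_, ?_, ?_⟩
  · rw [Net.devs_update, List.pairwise_map]
    simpa only [Dev.update_name] using hM.names
  · rw [Net.devs_update, List.pairwise_map]
    simpa only [Dev.update_act] using hM.acts
  · rw [Net.devs_update, List.pairwise_map]
    simpa only [Dev.update_sens_none] using hM.sens
  · intro d hd
    rw [Net.devs_update, List.mem_map] at hd
    obtain ⟨e, he, rfl⟩ := hd
    exact (hM.dev e he).update hv h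

theorem Net.WF.res {M : Net S} (hM : M.WF) (c : S.Chan) : (Net.res c M).WF :=
  ⟨hM.names, hM.acts, hM.sens, hM.dev⟩

/-- `M[s@h ↦ v]` for a well-formed network and a value in the domain of the sensor. -/
noncomputable def WNet.update (M : WNet S) (s : S.Sens) (h : S.Loc) (v : S.Val)
    (hv : v ∈ S.dom s) : WNet S := ⟨M.1.update s h v, M.2.update hv h⟩

/-- `(ν c) M` for a well-formed network. -/
def WNet.res (c : S.Chan) (M : WNet S) : WNet S := ⟨.res c M.1, M.2.res c⟩

/-- `→` on well-formed networks. -/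
def WNet.Red (M N : WNet S) : Prop := IoT.Red M.1 N.1

/-- `→_a` on well-formed networks. -/
def WNet.RedAct (a : S.Act) (M N : WNet S) : Prop := RedI (.act a) M.1 N.1

/-- `→*` on well-formed networks. -/
def WNet.Reds : WNet S → WNet S → Prop := Relation.ReflTransGen WNet.Red

/-- Extensional transitions on well-formed networks. -/
def WNet.Trans (α : ELabel S) (M N : WNet S) : Prop := ETrans α M.1 N.1

/-! ### Reduction barbed congruence -/

def BarbPreserving (R : WNet S → WNet S → Prop) : Prop :=
  ∀ M N, R M N → ∀ a h v, Barb M.1 a h v → ∃ N', WNet.Reds N N' ∧ Barb N'.1 a h v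

def ReductionClosed (R : WNet S → WNet S → Prop) : Prop :=
  ∀ M N, R M N →
    (∀ M', WNet.Red M M' → ∃ N', WNet.Reds N N' ∧ R M' N') ∧
    (∀ a M', WNet.RedAct a M M' →
      ∃ N₁ N₂ N', WNet.Reds N N₁ ∧ WNet.RedAct a N₁ N₂ ∧ WNet.Reds N₂ N' ∧ R M' N')

/-- Closure under parallel contexts (which keep both networks well-formed), channel restriction
and sensor updates. -/
def Contextual (R : WNet S → WNet S → Prop) : Prop :=
  ∀ M N, R M N →
    (∀ (O : Net S) (hM : (Net.par M.1 O).WF) (hN : (Net.par N.1 O).WF),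
      R ⟨.par M.1 O, hM⟩ ⟨.par N.1 O, hN⟩) ∧
    (∀ c, R (WNet.res c M) (WNet.res c N)) ∧
    (∀ s h v (hv : v ∈ S.dom s), R (M.update s h v hv) (N.update s h v hv))

/-- The symmetric relations that are reduction closed, barb preserving and contextual. -/
structure IsBarbedRel (R : WNet S → WNet S → Prop) : Prop where
  symm : ∀ M N, R M N → R N M
  red : ReductionClosed R
  barb : BarbPreserving R
  ctx : Contextual R

/-- Reduction barbed congruence `≅`: the largest symmetric relation that is reduction closed, barb
preserving and contextual, that is, the union of all of them. -/
def BarbedCong (M N : WNet S) : Prop := ∃ R : WNet S → WNet S → Prop, IsBarbedRel R ∧ R M N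

/-- The union of all these relations is one of them, hence the largest one. -/
theorem isGreatest_barbedCong :
    IsGreatest {R : WNet S → WNet S → Prop | IsBarbedRel R} BarbedCong := by
  refine ⟨⟨?_, ?_, ?_, ?_⟩, fun R hR M N h => ⟨R, hR, h⟩⟩
  · rintro M N ⟨R, hR, h⟩
    exact ⟨R, hR, hR.symm M N h⟩
  · rintro M N ⟨R, hR, h⟩
    refine ⟨fun M' hM => ?_, fun a M' hM => ?_⟩
    · obtain ⟨N', h1, h2⟩ := (hR.red M N h).1 M' hM
      exact ⟨N', h1, R, hR, h2⟩
    · obtain ⟨N₁, N₂, N', h1, h2, h3, h4⟩ := (hR.red M N h).2 a M' hM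
      exact ⟨N₁, N₂, N', h1, h2, h3, R, hR, h4⟩
  · rintro M N ⟨R, hR, h⟩
    exact hR.barb M N h
  · rintro M N ⟨R, hR, h⟩
    obtain ⟨h1, h2, h3⟩ := hR.ctx M N h
    exact ⟨fun O hM hN => ⟨R, hR, h1 O hM hN⟩, fun c => ⟨R, hR, h2 c⟩,
      fun s l v hv => ⟨R, hR, h3 s l v hv⟩⟩

/-! ### Weak bisimilarity -/

/-- `⟹`: the reflexive and transitive closure of the `τ`-transitions. -/
def WNet.WeakTau : WNet S → WNet S → Prop := Relation.ReflTransGen (WNet.Trans .tau)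

/-- The weak transition for `α̂`: it is `⟹` if `α = τ`, and `⟹ α ⟹` otherwise. -/
def WNet.Weak : ELabel S → WNet S → WNet S → Prop
  | .tau, M, M' => WNet.WeakTau M M'
  | α, M, M' => ∃ M₁ M₂, WNet.WeakTau M M₁ ∧ WNet.Trans α M₁ M₂ ∧ WNet.WeakTau M₂ M'

/-- Symmetric (weak) bisimulations over the extensional semantics. -/
structure IsBisim (R : WNet S → WNet S → Prop) : Prop where
  symm : ∀ M N, R M N → R N M
  sim : ∀ M N, R M N → ∀ α M', WNet.Trans α M M' → ∃ N', WNet.Weak α N N' ∧ R M' N'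

/-- Weak bisimilarity `≈`. -/
def Bisimilar (M N : WNet S) : Prop := ∃ R : WNet S → WNet S → Prop, IsBisim R ∧ R M N

end IoT

set_option linter.unusedVariables false

namespace IoT

variable {S : Sig.{u}}

/-! ### Substitution calculus -/

/-! Both inclusions are proved on the labelled semantics, so the first task is harmony between
reductions and transitions. `NTrans.redI` and `NTime.redT` turn transitions into reductions;
`RedI.ntrans` and `RedT.ntime` turn reductions into transitions up to `NEq`, which is structural
congruence with node processes taken up to strong bisimilarity. That `NEq` is a strong bisimulation
(`NEq.sim`, `NEq.simTime`) rests on `PCong.pbisim`, whose hard case is congruence under `fix`. The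
reduction rule that adds a process to every node is the other obstacle: it needs a node-by-node
reading of `NEq` (`NEq.hSim`, `NEq.addPar_prod`).

Bisimilarity implies congruence once it is closed under contexts. For parallel composition the point
is that a tick has a negative premise, and the absence of `τ` has to be carried from one side to the
other (`Bis.par_not_tau`). Restriction is direct. Sensor updates are delicate: the weak answer to
the label `s@h?v` may contain `τ`-transitions before and after the update, so it says nothing
immediate about the updated network itself. Here time-guardedness helps: it bounds the untimed
activity before the next tick (`NTrans.work_lt`), so every bisimilarity class has a rank, the least
work of its members. A member of minimal work cannot afford a `τ`-transition along a path that keeps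
the rank, so it must answer by bare updates; this identifies the two updated networks
(`Bis.update`).

Conversely, contexts can test every label. Since `→` mixes `τ` and `σ`, time has to be controlled: a
clock is a node with a pending write on a fresh actuator, and a pending change of an actuator is not
a `τ` but still blocks time. Next to an idle clock, `→*` is `⟹`; firing the clock, letting time
pass, and firing it again forces exactly one tick (`CongE.tick`). Outputs and inputs are tested by a
node at the observing location which communicates and then changes another fresh actuator
(`Test.sim`); when spent, it is inert and remains as garbage. Actuator changes, actuator values and
sensor updates are covered by `→_a`, barbs and contextuality. Hence the networks that are congruent
next to an idle clock and some garbage form a bisimulation (`ClockCong.sim`). -/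

theorem Term.subst_subst {n n' n'' : ℕ} (f : Fin n → Term S n') (g : Fin n' → Term S n'')
    (e : Term S n) : (e.subst f).subst g = e.subst fun i => (f i).subst g := by
  cases e <;> rfl

theorem Term.subst_var {n : ℕ} (e : Term S n) : e.subst Term.var = e := by
  cases e <;> rfl

theorem Guard.subst_subst {n n' n'' : ℕ} (f : Fin n → Term S n') (g : Fin n' → Term S n'')
    (b : Guard S n) : (b.subst f).subst g = b.subst fun i => (f i).subst g := by
  simp [Guard.subst, Term.subst_subst]

theorem Guard.subst_var {n : ℕ} (b : Guard S n) : b.subst Term.var = b := by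
  have : Term.subst (Term.var : Fin n → Term S n) = id := funext Term.subst_var
  simp [Guard.subst, this]

theorem Guard.eval_subst {n n' : ℕ} (f : Fin n → Term S n') (ρ : Fin n' → S.Val)
    (b : Guard S n) : (b.subst f).eval ρ = b.eval fun i => (f i).eval ρ := by
  simp only [Guard.subst, Guard.eval, List.map_map]
  congr 1
  apply List.map_congr_left
  intro e _
  cases e <;> rfl

theorem liftTerm_var {n : ℕ} : liftTerm (Term.var : Fin n → Term S n) = Term.var := by
  funext i
  refine Fin.cases rfl (fun i => rfl) i

theorem liftTerm_comp {n n' n'' : ℕ} (f : Fin n → Term S n') (g : Fin n' → Term S n'') :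
    (fun i => (liftTerm f i).subst (liftTerm g)) = liftTerm fun i => (f i).subst g := by
  funext i
  refine Fin.cases rfl (fun i => ?_) i
  simp only [liftTerm, Fin.cases_succ, Term.subst_subst]
  rfl

theorem Proc.subst_subst : {n n' n'' m : ℕ} → (f : Fin n → Term S n') →
    (g : Fin n' → Term S n'') → (P : Proc S n m) →
    (P.subst f).subst g = P.subst fun i => (f i).subst g
  | _, _, _, _, _, _, .nil => rfl
  | _, _, _, _, f, g, .sleep P => by simp only [Proc.subst, Proc.subst_subst f g P]
  | _, _, _, _, f, g, .pos P => by
      simp only [Proc.subst, Proc.subst_subst _ _ P, liftTerm_comp]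
  | _, _, _, _, f, g, .sense s P => by
      simp only [Proc.subst, Proc.subst_subst _ _ P, liftTerm_comp]
  | _, _, _, _, f, g, .write a e P => by
      simp only [Proc.subst, Proc.subst_subst f g P, Term.subst_subst]
  | _, _, _, _, f, g, .par P Q => by
      simp only [Proc.subst, Proc.subst_subst f g P, Proc.subst_subst f g Q]
  | _, _, _, _, f, g, .send c e P Q => by
      simp only [Proc.subst, Proc.subst_subst f g P, Proc.subst_subst f g Q, Term.subst_subst]
  | _, _, _, _, f, g, .recv c P Q => by
      simp only [Proc.subst, Proc.subst_subst _ _ P, Proc.subst_subst f g Q, liftTerm_comp]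
  | _, _, _, _, f, g, .cond b P Q => by
      simp only [Proc.subst, Proc.subst_subst f g P, Proc.subst_subst f g Q, Guard.subst_subst]
  | _, _, _, _, _, _, .pvar X => rfl
  | _, _, _, _, f, g, .fix P => by simp only [Proc.subst, Proc.subst_subst f g P]

theorem Proc.subst_var : {n m : ℕ} → (P : Proc S n m) → P.subst Term.var = P
  | _, _, .nil => rfl
  | _, _, .sleep P => by simp only [Proc.subst, Proc.subst_var P]
  | _, _, .pos P => by simp only [Proc.subst, liftTerm_var, Proc.subst_var P]
  | _, _, .sense s P => by simp only [Proc.subst, liftTerm_var, Proc.subst_var P]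
  | _, _, .write a e P => by simp only [Proc.subst, Proc.subst_var P, Term.subst_var]
  | _, _, .par P Q => by simp only [Proc.subst, Proc.subst_var P, Proc.subst_var Q]
  | _, _, .send c e P Q => by
      simp only [Proc.subst, Proc.subst_var P, Proc.subst_var Q, Term.subst_var]
  | _, _, .recv c P Q => by
      simp only [Proc.subst, liftTerm_var, Proc.subst_var P, Proc.subst_var Q]
  | _, _, .cond b P Q => by
      simp only [Proc.subst, Proc.subst_var P, Proc.subst_var Q, Guard.subst_var]
  | _, _, .pvar X => rfl
  | _, _, .fix P => by simp only [Proc.subst, Proc.subst_var P]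

theorem Proc.subst_weaken {n n' m : ℕ} (f : Fin n → Term S n') (P : Proc S n m) :
    P.weaken.subst (liftTerm f) = (P.subst f).weaken := by
  simp only [Proc.weaken, Proc.subst_subst]
  rfl

theorem Proc.weaken_inst {n m : ℕ} (P : Proc S n m) (v : S.Val) : P.weaken.inst v = P := by
  simp only [Proc.weaken, Proc.inst, Proc.subst_subst]
  exact P.subst_var

theorem liftRen_comp {m m' m'' : ℕ} (r : Fin m → Fin m') (q : Fin m' → Fin m'') :
    liftRen q ∘ liftRen r = liftRen (q ∘ r) := by
  funext i
  refine Fin.cases rfl (fun i => rfl) i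

theorem Proc.prename_prename : {n m m' m'' : ℕ} → (r : Fin m → Fin m') →
    (q : Fin m' → Fin m'') → (P : Proc S n m) → (P.prename r).prename q = P.prename (q ∘ r)
  | _, _, _, _, _, _, .nil => rfl
  | _, _, _, _, r, q, .sleep P => by simp only [Proc.prename, Proc.prename_prename r q P]
  | _, _, _, _, r, q, .pos P => by simp only [Proc.prename, Proc.prename_prename r q P]
  | _, _, _, _, r, q, .sense s P => by simp only [Proc.prename, Proc.prename_prename r q P]
  | _, _, _, _, r, q, .write a e P => by simp only [Proc.prename, Proc.prename_prename r q P]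
  | _, _, _, _, r, q, .par P Q => by
      simp only [Proc.prename, Proc.prename_prename r q P, Proc.prename_prename r q Q]
  | _, _, _, _, r, q, .send c e P Q => by
      simp only [Proc.prename, Proc.prename_prename r q P, Proc.prename_prename r q Q]
  | _, _, _, _, r, q, .recv c P Q => by
      simp only [Proc.prename, Proc.prename_prename r q P, Proc.prename_prename r q Q]
  | _, _, _, _, r, q, .cond b P Q => by
      simp only [Proc.prename, Proc.prename_prename r q P, Proc.prename_prename r q Q]
  | _, _, _, _, _, _, .pvar X => rfl
  | _, _, _, _, r, q, .fix P => by
      simp only [Proc.prename, Proc.prename_prename _ _ P, liftRen_comp]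

theorem Proc.subst_prename : {n n' m m' : ℕ} → (r : Fin m → Fin m') →
    (f : Fin n → Term S n') → (P : Proc S n m) →
    (P.prename r).subst f = (P.subst f).prename r
  | _, _, _, _, _, _, .nil => rfl
  | _, _, _, _, r, f, .sleep P => by
      simp only [Proc.prename, Proc.subst, Proc.subst_prename r _ P]
  | _, _, _, _, r, f, .pos P => by
      simp only [Proc.prename, Proc.subst, Proc.subst_prename r _ P]
  | _, _, _, _, r, f, .sense s P => by
      simp only [Proc.prename, Proc.subst, Proc.subst_prename r _ P]
  | _, _, _, _, r, f, .write a e P => by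
      simp only [Proc.prename, Proc.subst, Proc.subst_prename r _ P]
  | _, _, _, _, r, f, .par P Q => by
      simp only [Proc.prename, Proc.subst, Proc.subst_prename r _ P, Proc.subst_prename r _ Q]
  | _, _, _, _, r, f, .send c e P Q => by
      simp only [Proc.prename, Proc.subst, Proc.subst_prename r _ P, Proc.subst_prename r _ Q]
  | _, _, _, _, r, f, .recv c P Q => by
      simp only [Proc.prename, Proc.subst, Proc.subst_prename r _ P, Proc.subst_prename r _ Q]
  | _, _, _, _, r, f, .cond b P Q => by
      simp only [Proc.prename, Proc.subst, Proc.subst_prename r _ P, Proc.subst_prename r _ Q]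
  | _, _, _, _, _, _, .pvar X => rfl
  | _, _, _, _, r, f, .fix P => by
      simp only [Proc.prename, Proc.subst, Proc.subst_prename _ _ P]

theorem liftProc_liftRen {n m m' m'' : ℕ} (r : Fin m → Fin m') (g : Fin m' → Proc S n m'') :
    (fun X => liftProc g (liftRen r X)) = liftProc fun X => g (r X) := by
  funext i
  refine Fin.cases rfl (fun i => rfl) i

theorem Proc.psubst_of_prename : {n m m' m'' : ℕ} → (r : Fin m → Fin m') →
    (g : Fin m' → Proc S n m'') → (P : Proc S n m) →
    (P.prename r).psubst g = P.psubst fun X => g (r X)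
  | _, _, _, _, _, _, .nil => rfl
  | _, _, _, _, r, g, .sleep P => by
      simp only [Proc.prename, Proc.psubst, Proc.psubst_of_prename r _ P]
  | _, _, _, _, r, g, .pos P => by
      simp only [Proc.prename, Proc.psubst, Proc.psubst_of_prename r _ P]
  | _, _, _, _, r, g, .sense s P => by
      simp only [Proc.prename, Proc.psubst, Proc.psubst_of_prename r _ P]
  | _, _, _, _, r, g, .write a e P => by
      simp only [Proc.prename, Proc.psubst, Proc.psubst_of_prename r _ P]
  | _, _, _, _, r, g, .par P Q => by
      simp only [Proc.prename, Proc.psubst, Proc.psubst_of_prename r _ P,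
        Proc.psubst_of_prename r _ Q]
  | _, _, _, _, r, g, .send c e P Q => by
      simp only [Proc.prename, Proc.psubst, Proc.psubst_of_prename r _ P,
        Proc.psubst_of_prename r _ Q]
  | _, _, _, _, r, g, .recv c P Q => by
      simp only [Proc.prename, Proc.psubst, Proc.psubst_of_prename r _ P,
        Proc.psubst_of_prename r _ Q]
  | _, _, _, _, r, g, .cond b P Q => by
      simp only [Proc.prename, Proc.psubst, Proc.psubst_of_prename r _ P,
        Proc.psubst_of_prename r _ Q]
  | _, _, _, _, _, _, .pvar X => rfl
  | _, _, _, _, r, g, .fix P => by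
      simp only [Proc.prename, Proc.psubst, Proc.psubst_of_prename _ _ P, liftProc_liftRen]

theorem liftProc_prename {n m m' m'' : ℕ} (g : Fin m → Proc S n m') (r : Fin m' → Fin m'') :
    (fun X => (liftProc g X).prename (liftRen r)) = liftProc fun X => (g X).prename r := by
  funext i
  refine Fin.cases rfl (fun i => ?_) i
  simp only [liftProc, Fin.cases_succ, Proc.prename_prename]
  rfl

theorem Proc.psubst_prename : {n m m' m'' : ℕ} → (g : Fin m → Proc S n m') →
    (r : Fin m' → Fin m'') → (P : Proc S n m) →
    (P.psubst g).prename r = P.psubst fun X => (g X).prename r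
  | _, _, _, _, _, _, .nil => rfl
  | _, _, _, _, g, r, .sleep P => by
      simp only [Proc.prename, Proc.psubst, Proc.psubst_prename _ r P]
  | _, _, _, _, g, r, .pos P => by
      simp only [Proc.prename, Proc.psubst, Proc.psubst_prename _ r P, Proc.weaken,
        Proc.subst_prename]
  | _, _, _, _, g, r, .sense s P => by
      simp only [Proc.prename, Proc.psubst, Proc.psubst_prename _ r P, Proc.weaken,
        Proc.subst_prename]
  | _, _, _, _, g, r, .write a e P => by
      simp only [Proc.prename, Proc.psubst, Proc.psubst_prename _ r P]
  | _, _, _, _, g, r, .par P Q => by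
      simp only [Proc.prename, Proc.psubst, Proc.psubst_prename _ r P, Proc.psubst_prename _ r Q]
  | _, _, _, _, g, r, .send c e P Q => by
      simp only [Proc.prename, Proc.psubst, Proc.psubst_prename _ r P, Proc.psubst_prename _ r Q]
  | _, _, _, _, g, r, .recv c P Q => by
      simp only [Proc.prename, Proc.psubst, Proc.psubst_prename _ r P, Proc.psubst_prename _ r Q,
        Proc.weaken, Proc.subst_prename]
  | _, _, _, _, g, r, .cond b P Q => by
      simp only [Proc.prename, Proc.psubst, Proc.psubst_prename _ r P, Proc.psubst_prename _ r Q]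
  | _, _, _, _, _, _, .pvar X => rfl
  | _, _, _, _, g, r, .fix P => by
      simp only [Proc.prename, Proc.psubst, Proc.psubst_prename _ _ P, liftProc_prename]

theorem liftProc_subst {n n' m m' : ℕ} (g : Fin m → Proc S n m') (f : Fin n → Term S n') :
    (fun X => (liftProc g X).subst f) = liftProc fun X => (g X).subst f := by
  funext i
  refine Fin.cases rfl (fun i => ?_) i
  simp only [liftProc, Fin.cases_succ, Proc.subst_prename]

theorem Proc.subst_psubst : {n n' m m' : ℕ} → (g : Fin m → Proc S n m') →
    (f : Fin n → Term S n') → (P : Proc S n m) →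
    (P.psubst g).subst f = (P.subst f).psubst fun X => (g X).subst f
  | _, _, _, _, _, _, .nil => rfl
  | _, _, _, _, g, f, .sleep P => by
      simp only [Proc.subst, Proc.psubst, Proc.subst_psubst _ f P]
  | _, _, _, _, g, f, .pos P => by
      simp only [Proc.subst, Proc.psubst, Proc.subst_psubst _ _ P, Proc.subst_weaken]
  | _, _, _, _, g, f, .sense s P => by
      simp only [Proc.subst, Proc.psubst, Proc.subst_psubst _ _ P, Proc.subst_weaken]
  | _, _, _, _, g, f, .write a e P => by
      simp only [Proc.subst, Proc.psubst, Proc.subst_psubst _ f P]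
  | _, _, _, _, g, f, .par P Q => by
      simp only [Proc.subst, Proc.psubst, Proc.subst_psubst _ f P, Proc.subst_psubst _ f Q]
  | _, _, _, _, g, f, .send c e P Q => by
      simp only [Proc.subst, Proc.psubst, Proc.subst_psubst _ f P, Proc.subst_psubst _ f Q]
  | _, _, _, _, g, f, .recv c P Q => by
      simp only [Proc.subst, Proc.psubst, Proc.subst_psubst _ _ P, Proc.subst_psubst _ f Q,
        Proc.subst_weaken]
  | _, _, _, _, g, f, .cond b P Q => by
      simp only [Proc.subst, Proc.psubst, Proc.subst_psubst _ f P, Proc.subst_psubst _ f Q]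
  | _, _, _, _, _, _, .pvar X => rfl
  | _, _, _, _, g, f, .fix P => by
      simp only [Proc.subst, Proc.psubst, Proc.subst_psubst _ _ P, liftProc_subst]

theorem Proc.psubst_weaken {n m m' : ℕ} (g : Fin m → Proc S n m') (P : Proc S n m) :
    (P.weaken.psubst fun X => (g X).weaken) = (P.psubst g).weaken :=
  (Proc.subst_psubst g _ P).symm

theorem liftProc_psubst {n m m' m'' : ℕ} (f : Fin m → Proc S n m') (g : Fin m' → Proc S n m'') :
    (fun X => (liftProc f X).psubst (liftProc g)) = liftProc fun X => (f X).psubst g := by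
  funext i
  refine Fin.cases rfl (fun i => ?_) i
  simp only [liftProc, Fin.cases_succ, Proc.psubst_of_prename, Proc.psubst_prename]

theorem Proc.psubst_psubst : {n m m' m'' : ℕ} → (f : Fin m → Proc S n m') →
    (g : Fin m' → Proc S n m'') → (P : Proc S n m) →
    (P.psubst f).psubst g = P.psubst fun X => (f X).psubst g
  | _, _, _, _, _, _, .nil => rfl
  | _, _, _, _, f, g, .sleep P => by simp only [Proc.psubst, Proc.psubst_psubst _ _ P]
  | _, _, _, _, f, g, .pos P => by
      simp only [Proc.psubst, Proc.psubst_psubst _ _ P, Proc.psubst_weaken]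
  | _, _, _, _, f, g, .sense s P => by
      simp only [Proc.psubst, Proc.psubst_psubst _ _ P, Proc.psubst_weaken]
  | _, _, _, _, f, g, .write a e P => by simp only [Proc.psubst, Proc.psubst_psubst _ _ P]
  | _, _, _, _, f, g, .par P Q => by
      simp only [Proc.psubst, Proc.psubst_psubst _ _ P, Proc.psubst_psubst _ _ Q]
  | _, _, _, _, f, g, .send c e P Q => by
      simp only [Proc.psubst, Proc.psubst_psubst _ _ P, Proc.psubst_psubst _ _ Q]
  | _, _, _, _, f, g, .recv c P Q => by
      simp only [Proc.psubst, Proc.psubst_psubst _ _ P, Proc.psubst_psubst _ _ Q,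
        Proc.psubst_weaken]
  | _, _, _, _, f, g, .cond b P Q => by
      simp only [Proc.psubst, Proc.psubst_psubst _ _ P, Proc.psubst_psubst _ _ Q]
  | _, _, _, _, _, _, .pvar X => rfl
  | _, _, _, _, f, g, .fix P => by
      simp only [Proc.psubst, Proc.psubst_psubst _ _ P, liftProc_psubst]

theorem liftProc_pvar {n m : ℕ} :
    liftProc (Proc.pvar : Fin m → Proc S n m) = Proc.pvar := by
  funext i
  refine Fin.cases rfl (fun i => rfl) i

theorem Proc.psubst_pvar : {n m : ℕ} → (P : Proc S n m) → P.psubst Proc.pvar = P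
  | _, _, .nil => rfl
  | _, _, .sleep P => by simp only [Proc.psubst, Proc.psubst_pvar P]
  | _, _, .pos P => by simp only [Proc.psubst, Proc.weaken, Proc.subst, Proc.psubst_pvar P]
  | _, _, .sense s P => by simp only [Proc.psubst, Proc.weaken, Proc.subst, Proc.psubst_pvar P]
  | _, _, .write a e P => by simp only [Proc.psubst, Proc.psubst_pvar P]
  | _, _, .par P Q => by simp only [Proc.psubst, Proc.psubst_pvar P, Proc.psubst_pvar Q]
  | _, _, .send c e P Q => by simp only [Proc.psubst, Proc.psubst_pvar P, Proc.psubst_pvar Q]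
  | _, _, .recv c P Q => by
      simp only [Proc.psubst, Proc.weaken, Proc.subst, Proc.psubst_pvar P, Proc.psubst_pvar Q]
  | _, _, .cond b P Q => by simp only [Proc.psubst, Proc.psubst_pvar P, Proc.psubst_pvar Q]
  | _, _, .pvar X => rfl
  | _, _, .fix P => by simp only [Proc.psubst, liftProc_pvar, Proc.psubst_pvar P]

/-- Substituting under a binder and then filling the bound variable amounts to one simultaneous
substitution. This is what makes unfolding commute with substitution. -/
theorem Proc.psubst_liftProc_cons {n m m' : ℕ} (g : Fin m → Proc S n m') (R : Proc S n m')
    (P : Proc S n (m + 1)) :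
    (P.psubst (liftProc g)).psubst (Fin.cases R fun i => .pvar i) =
      P.psubst (Fin.cases R g) := by
  rw [Proc.psubst_psubst]
  congr 1
  funext i
  refine Fin.cases rfl (fun i => ?_) i
  simp only [liftProc, Fin.cases_succ, Proc.psubst_of_prename]
  exact Proc.psubst_pvar _

theorem Proc.unfold_psubst {n m m' : ℕ} (g : Fin m → Proc S n m') (P : Proc S n (m + 1)) :
    P.unfold.psubst g = (P.psubst (liftProc g)).unfold := by
  rw [Proc.unfold, Proc.unfold, Proc.psubst_liftProc_cons, Proc.psubst_psubst]
  congr 1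
  funext i
  refine Fin.cases rfl (fun i => rfl) i

theorem Proc.unfold_subst {n n' m : ℕ} (f : Fin n → Term S n') (P : Proc S n (m + 1)) :
    P.unfold.subst f = (P.subst f).unfold := by
  rw [Proc.unfold, Proc.unfold, Proc.subst_psubst]
  congr 1
  funext i
  refine Fin.cases rfl (fun i => rfl) i

theorem Proc.inst_psubst {n m m' : ℕ} (g : Fin m → Proc S n m') (P : Proc S (n + 1) m)
    (v : S.Val) : (P.psubst fun X => (g X).weaken).inst v = (P.inst v).psubst g := by
  rw [Proc.inst, Proc.subst_psubst, Proc.inst]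
  congr 1
  funext X
  exact Proc.weaken_inst _ _

theorem Proc.inst_subst_lift {n n' m : ℕ} (f : Fin n → Term S n') (P : Proc S (n + 1) m)
    (v : S.Val) : (P.subst (liftTerm f)).inst v = P.subst (Fin.cases (.val v) f) := by
  rw [Proc.inst, Proc.subst_subst]
  congr 1
  funext i
  refine Fin.cases rfl (fun i => ?_) i
  simp only [liftTerm, Fin.cases_succ, Term.subst_subst]
  exact Term.subst_var _

/-! ### Names occurring in processes -/

/-- The channel, sensor or actuator `u` occurs in the process. -/
def Proc.Uses (u : S.Chan ⊕ S.Sens ⊕ S.Act) : {n m : ℕ} → Proc S n m → Prop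
  | _, _, .nil => False
  | _, _, .sleep P => P.Uses u
  | _, _, .pos P => P.Uses u
  | _, _, .sense s P => .inr (.inl s) = u ∨ P.Uses u
  | _, _, .write a _ P => .inr (.inr a) = u ∨ P.Uses u
  | _, _, .par P Q => P.Uses u ∨ Q.Uses u
  | _, _, .send d _ P Q => .inl d = u ∨ P.Uses u ∨ Q.Uses u
  | _, _, .recv d P Q => .inl d = u ∨ P.Uses u ∨ Q.Uses u
  | _, _, .cond _ P Q => P.Uses u ∨ Q.Uses u
  | _, _, .pvar _ => False
  | _, _, .fix P => P.Uses u

theorem Proc.hasChan_iff (c : S.Chan) {n m : ℕ} (P : Proc S n m) :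
    P.HasChan c ↔ P.Uses (.inl c) := by
  induction P <;> simp_all [Proc.HasChan, Proc.Uses]

theorem Proc.reads_iff (s : S.Sens) {n m : ℕ} (P : Proc S n m) :
    P.Reads s ↔ P.Uses (.inr (.inl s)) := by
  induction P <;> simp_all [Proc.Reads, Proc.Uses]

theorem Proc.writes_iff (a : S.Act) {n m : ℕ} (P : Proc S n m) :
    P.Writes a ↔ P.Uses (.inr (.inr a)) := by
  induction P <;> simp_all [Proc.Writes, Proc.Uses]

theorem Proc.uses_subst (u : S.Chan ⊕ S.Sens ⊕ S.Act) {n m : ℕ} (P : Proc S n m) :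
    ∀ {n' : ℕ} (f : Fin n → Term S n'), (P.subst f).Uses u ↔ P.Uses u := by
  induction P <;> simp_all [Proc.subst, Proc.Uses]

theorem Proc.uses_prename (u : S.Chan ⊕ S.Sens ⊕ S.Act) {n m : ℕ} (P : Proc S n m) :
    ∀ {m' : ℕ} (r : Fin m → Fin m'), (P.prename r).Uses u ↔ P.Uses u := by
  induction P <;> simp_all [Proc.prename, Proc.Uses]

theorem Proc.uses_inst (u : S.Chan ⊕ S.Sens ⊕ S.Act) {n m : ℕ} (P : Proc S (n + 1) m)
    (v : S.Val) : (P.inst v).Uses u ↔ P.Uses u := P.uses_subst u _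

theorem Proc.uses_psubst (u : S.Chan ⊕ S.Sens ⊕ S.Act) {n m : ℕ} (P : Proc S n m) :
    ∀ {m' : ℕ} (g : Fin m → Proc S n m'), (P.psubst g).Uses u →
      P.Uses u ∨ ∃ X, (g X).Uses u := by
  induction P with
  | nil => exact fun g h => Or.inl h
  | sleep P ih => exact fun g h => ih g h
  | pos P ih =>
    intro m' g h
    have := ih _ h
    simp only [Proc.weaken, Proc.uses_subst] at this
    exact this
  | sense s P ih =>
    rintro m' g (h | h)
    · exact Or.inl (Or.inl h)
    · have := ih _ h
      simp only [Proc.weaken, Proc.uses_subst] at this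
      exact this.imp_left Or.inr
  | write a e P ih =>
    rintro m' g (h | h)
    · exact Or.inl (Or.inl h)
    · exact (ih g h).imp_left Or.inr
  | par P Q ihP ihQ =>
    rintro m' g (h | h)
    · exact (ihP g h).imp_left Or.inl
    · exact (ihQ g h).imp_left Or.inr
  | send c e P Q ihP ihQ =>
    rintro m' g (h | h | h)
    · exact Or.inl (Or.inl h)
    · exact (ihP g h).imp_left (Or.inr ∘ Or.inl)
    · exact (ihQ g h).imp_left (Or.inr ∘ Or.inr)
  | recv c P Q ihP ihQ =>
    rintro m' g (h | h | h)
    · exact Or.inl (Or.inl h)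
    · have := ihP _ h
      simp only [Proc.weaken, Proc.uses_subst] at this
      exact this.imp_left (Or.inr ∘ Or.inl)
    · exact (ihQ g h).imp_left (Or.inr ∘ Or.inr)
  | cond b P Q ihP ihQ =>
    rintro m' g (h | h)
    · exact (ihP g h).imp_left Or.inl
    · exact (ihQ g h).imp_left Or.inr
  | pvar X => exact fun g h => Or.inr ⟨X, h⟩
  | fix P ih =>
    intro m' g h
    rcases ih _ h with h | ⟨X, h⟩
    · exact Or.inl h
    · revert h
      refine Fin.cases (fun h => h.elim) (fun i h => ?_) X
      exact Or.inr ⟨i, ((g i).uses_prename u _).1 h⟩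

theorem Proc.uses_unfold {u : S.Chan ⊕ S.Sens ⊕ S.Act} {n m : ℕ} {P : Proc S n (m + 1)}
    (h : P.unfold.Uses u) : P.Uses u := by
  rcases P.uses_psubst u _ h with h | ⟨X, h⟩
  · exact h
  · revert h
    exact Fin.cases id (fun i h => h.elim) X

theorem PTrans.uses {l : PLabel S} {P P' : Proc S 0 0} (h : PTrans l P P')
    {u : S.Chan ⊕ S.Sens ⊕ S.Act} : P'.Uses u → P.Uses u := by
  induction h with
  | snd c v P Q => exact fun h => Or.inr (Or.inl h)
  | rcv c v P Q => exact fun h => Or.inr (Or.inl ((P.uses_inst u v).1 h))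
  | sensor s v P => exact fun h => Or.inr ((P.uses_inst u v).1 h)
  | actuator a v P => exact fun h => Or.inr h
  | pos h P => exact fun h' => (P.uses_inst u _).1 h'
  | comL c v P P' Q Q' _ _ _ ih1 ih2 => exact Or.imp ih1 ih2
  | comR c v P P' Q Q' _ _ _ ih1 ih2 => exact Or.imp ih1 ih2
  | parL l P P' Q _ ih => exact Or.imp_left ih
  | parR l P Q Q' _ ih => exact Or.imp_right ih
  | fix l P Q _ ih => exact fun h => Proc.uses_unfold (ih h)
  | condT l b P Q R _ _ ih => exact fun h => Or.inl (ih h)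
  | condF l b P Q R _ _ ih => exact fun h => Or.inr (ih h)

theorem PTime.uses {P P' : Proc S 0 0} (h : PTime P P')
    {u : S.Chan ⊕ S.Sens ⊕ S.Act} : P'.Uses u → P.Uses u := by
  induction h with
  | timenil => exact id
  | delay P => exact id
  | timeout R Q h =>
    cases h with
    | send c e P Q => exact fun h => Or.inr (Or.inr h)
    | recv c P Q => exact fun h => Or.inr (Or.inr h)
  | timepar P P' Q Q' _ _ _ ih1 ih2 => exact Or.imp ih1 ih2
  | fix P Q _ ih => exact fun h => Proc.uses_unfold (ih h)
  | condT b P Q R _ _ ih => exact fun h => Or.inl (ih h)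
  | condF b P Q R _ _ ih => exact fun h => Or.inr (ih h)

/-- The communication `l` is along the channel `c`. -/
def PLabel.On (c : S.Chan) : PLabel S → Prop
  | .send d _ => d = c
  | .recv d _ => d = c
  | _ => False

theorem PTrans.hasChan_of_on {c : S.Chan} {l : PLabel S} {P P' : Proc S 0 0}
    (h : PTrans l P P') : l.On c → P.HasChan c := by
  induction h with
  | snd d v P Q => exact fun h => Or.inl h
  | rcv d v P Q => exact fun h => Or.inl h
  | sensor s v P => exact fun h => h.elim
  | actuator a v P => exact fun h => h.elim
  | pos h P => exact fun h => h.elim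
  | comL d v P P' Q Q' _ _ _ ih1 ih2 => exact fun h => h.elim
  | comR d v P P' Q Q' _ _ _ ih1 ih2 => exact fun h => h.elim
  | parL l P P' Q _ ih => exact fun h => Or.inl (ih h)
  | parR l P Q Q' _ ih => exact fun h => Or.inr (ih h)
  | fix l P Q _ ih =>
    intro h
    have := ih h
    rw [Proc.hasChan_iff] at this
    exact (P.hasChan_iff c).2 (Proc.uses_unfold this)
  | condT l b P Q R _ _ ih => exact fun h => Or.inl (ih h)
  | condF l b P Q R _ _ ih => exact fun h => Or.inr (ih h)

/-! ### Time-guarded recursion -/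

theorem Proc.timeGuarded_subst {n m : ℕ} (P : Proc S n m) :
    ∀ {n' : ℕ} (f : Fin n → Term S n') (X : Fin m),
      (P.subst f).TimeGuarded X ↔ P.TimeGuarded X := by
  induction P <;> simp_all [Proc.subst, Proc.TimeGuarded]

theorem Proc.timeGuarded_prename {n m : ℕ} (P : Proc S n m) :
    ∀ {m' : ℕ} (r : Fin m → Fin m') (Y : Fin m'), (∀ X, r X = Y → P.TimeGuarded X) →
      (P.prename r).TimeGuarded Y := by
  induction P with
  | nil => exact fun r Y h => trivial
  | sleep P ih => exact fun r Y h => trivial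
  | pos P ih => exact fun r Y h => ih r Y h
  | sense s P ih => exact fun r Y h => ih r Y h
  | write a e P ih => exact fun r Y h => ih r Y h
  | par P Q ihP ihQ =>
    exact fun r Y h => ⟨ihP r Y fun X hX => (h X hX).1, ihQ r Y fun X hX => (h X hX).2⟩
  | send c e P Q ihP ihQ => exact fun r Y h => ihP r Y h
  | recv c P Q ihP ihQ => exact fun r Y h => ihP r Y h
  | cond b P Q ihP ihQ =>
    exact fun r Y h => ⟨ihP r Y fun X hX => (h X hX).1, ihQ r Y fun X hX => (h X hX).2⟩
  | pvar X => exact fun r Y h hX => h X hX rfl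
  | fix P ih =>
    intro m' r Y h
    refine ih (liftRen r) Y.succ fun X => ?_
    refine Fin.cases (fun hX => ?_) (fun i hX => ?_) X
    · exact absurd hX.symm (Fin.succ_ne_zero Y)
    · exact h i (Fin.succ_injective _ hX)

theorem Proc.timeGuarded_psubst {n m : ℕ} (P : Proc S n m) :
    ∀ {m' : ℕ} (g : Fin m → Proc S n m') (Y : Fin m'),
      (∀ X, P.TimeGuarded X ∨ (g X).TimeGuarded Y) → (P.psubst g).TimeGuarded Y := by
  induction P with
  | nil => exact fun g Y h => trivial
  | sleep P ih => exact fun g Y h => trivial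
  | pos P ih =>
    exact fun g Y h => ih _ Y fun X => (h X).imp_right ((g X).timeGuarded_subst _ Y).2
  | sense s P ih =>
    exact fun g Y h => ih _ Y fun X => (h X).imp_right ((g X).timeGuarded_subst _ Y).2
  | write a e P ih => exact fun g Y h => ih g Y h
  | par P Q ihP ihQ =>
    exact fun g Y h => ⟨ihP g Y fun X => (h X).imp_left And.left,
      ihQ g Y fun X => (h X).imp_left And.right⟩
  | send c e P Q ihP ihQ => exact fun g Y h => ihP g Y h
  | recv c P Q ihP ihQ =>
    exact fun g Y h => ihP _ Y fun X => (h X).imp_right ((g X).timeGuarded_subst _ Y).2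
  | cond b P Q ihP ihQ =>
    exact fun g Y h => ⟨ihP g Y fun X => (h X).imp_left And.left,
      ihQ g Y fun X => (h X).imp_left And.right⟩
  | pvar X => exact fun g Y h => (h X).elim (fun h => (h rfl).elim) id
  | fix P ih =>
    intro m' g Y h
    refine ih (liftProc g) Y.succ fun X => ?_
    refine Fin.cases (Or.inr (Fin.succ_ne_zero Y).symm) (fun i => (h i).imp_right fun hi => ?_) X
    exact Proc.timeGuarded_prename _ _ _ fun X hX => Fin.succ_injective _ hX ▸ hi

theorem Proc.guardedRec_subst {n m : ℕ} (P : Proc S n m) :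
    ∀ {n' : ℕ} (f : Fin n → Term S n'), (P.subst f).GuardedRec ↔ P.GuardedRec := by
  induction P <;> simp_all [Proc.subst, Proc.GuardedRec, Proc.timeGuarded_subst]

theorem Proc.guardedRec_prename {n m : ℕ} (P : Proc S n m) :
    ∀ {m' : ℕ} (r : Fin m → Fin m'), P.GuardedRec → (P.prename r).GuardedRec := by
  induction P with
  | fix P ih =>
    intro m' r h
    refine ⟨Proc.timeGuarded_prename _ _ _ fun X => ?_, ih _ h.2⟩
    exact Fin.cases (fun _ => h.1) (fun i hi => absurd hi (Fin.succ_ne_zero _)) X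
  | _ => simp_all [Proc.prename, Proc.GuardedRec]

theorem Proc.guardedRec_psubst {n m : ℕ} (P : Proc S n m) :
    ∀ {m' : ℕ} (g : Fin m → Proc S n m'), P.GuardedRec → (∀ X, (g X).GuardedRec) →
      (P.psubst g).GuardedRec := by
  induction P with
  | fix P ih =>
    intro m' g h hg
    refine ⟨Proc.timeGuarded_psubst _ _ _ fun X => ?_, ih _ h.2 fun X => ?_⟩
    · refine Fin.cases (Or.inl h.1) (fun i => Or.inr ?_) X
      exact Proc.timeGuarded_prename _ _ _ fun X hX => absurd hX (Fin.succ_ne_zero _)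
    · exact Fin.cases trivial (fun i => (g i).guardedRec_prename _ (hg i)) X
  | _ => simp_all [Proc.psubst, Proc.GuardedRec, Proc.weaken, Proc.guardedRec_subst]

theorem Proc.guardedRec_unfold {n m : ℕ} {P : Proc S n (m + 1)} (h : (Proc.fix P).GuardedRec) :
    P.unfold.GuardedRec :=
  P.guardedRec_psubst _ h.2 fun X => Fin.cases h (fun i => trivial) X

theorem PTrans.guardedRec {l : PLabel S} {P P' : Proc S 0 0} (h : PTrans l P P') :
    P.GuardedRec → P'.GuardedRec := by
  induction h with
  | snd c v P Q => exact And.left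
  | rcv c v P Q => exact fun h => (P.guardedRec_subst _).2 h.1
  | sensor s v P => exact (P.guardedRec_subst _).2
  | actuator a v P => exact id
  | pos h P => exact (P.guardedRec_subst _).2
  | comL c v P P' Q Q' _ _ _ ih1 ih2 => exact And.imp ih1 ih2
  | comR c v P P' Q Q' _ _ _ ih1 ih2 => exact And.imp ih1 ih2
  | parL l P P' Q _ ih => exact And.imp_left ih
  | parR l P Q Q' _ ih => exact And.imp_right ih
  | fix l P Q _ ih => exact fun h => ih (Proc.guardedRec_unfold h)
  | condT l b P Q R _ _ ih => exact fun h => ih h.1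
  | condF l b P Q R _ _ ih => exact fun h => ih h.2

theorem PTime.guardedRec {P P' : Proc S 0 0} (h : PTime P P') :
    P.GuardedRec → P'.GuardedRec := by
  induction h with
  | timenil => exact id
  | delay P => exact id
  | timeout R Q h => cases h <;> exact And.right
  | timepar P P' Q Q' _ _ _ ih1 ih2 => exact And.imp ih1 ih2
  | fix P Q _ ih => exact fun h => ih (Proc.guardedRec_unfold h)
  | condT b P Q R _ _ ih => exact fun h => ih h.1
  | condF b P Q R _ _ ih => exact fun h => ih h.2

/-! ### Bound on the number of instantaneous actions -/

/-- A bound on the number of untimed actions before the next time step. -/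
def Proc.work : {n m : ℕ} → Proc S n m → ℕ
  | _, _, .nil => 0
  | _, _, .sleep _ => 0
  | _, _, .pos P => P.work + 1
  | _, _, .sense _ P => P.work + 1
  | _, _, .write _ _ P => P.work + 1
  | _, _, .par P Q => P.work + Q.work
  | _, _, .send _ _ P _ => P.work + 1
  | _, _, .recv _ P _ => P.work + 1
  | _, _, .cond _ P Q => P.work + Q.work
  | _, _, .pvar _ => 0
  | _, _, .fix P => P.work

theorem Proc.work_subst {n m : ℕ} (P : Proc S n m) :
    ∀ {n' : ℕ} (f : Fin n → Term S n'), (P.subst f).work = P.work := by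
  induction P <;> simp_all [Proc.subst, Proc.work]

theorem Proc.work_prename {n m : ℕ} (P : Proc S n m) :
    ∀ {m' : ℕ} (r : Fin m → Fin m'), (P.prename r).work = P.work := by
  induction P <;> simp_all [Proc.prename, Proc.work]

/-- A time-guarded variable occurs only after a `sleep` or in a timeout branch, where `work` counts
nothing, so its replacement is never counted. The alternative of zero work is for variables that are
replaced by variables, such as those bound on the way. -/
theorem Proc.work_psubst {n m : ℕ} (P : Proc S n m) :
    ∀ {m' : ℕ} (g : Fin m → Proc S n m'), (∀ X, P.TimeGuarded X ∨ (g X).work = 0) →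
      (P.psubst g).work = P.work := by
  induction P with
  | nil => exact fun g h => rfl
  | sleep P ih => exact fun g h => rfl
  | pos P ih =>
    exact fun g h => congrArg (· + 1) (ih _ fun X =>
      (h X).imp_right fun hX => ((g X).work_subst _).trans hX)
  | sense s P ih =>
    exact fun g h => congrArg (· + 1) (ih _ fun X =>
      (h X).imp_right fun hX => ((g X).work_subst _).trans hX)
  | write a e P ih => exact fun g h => congrArg (· + 1) (ih _ h)
  | par P Q ihP ihQ =>
    exact fun g h => congrArg₂ (· + ·) (ihP g fun X => (h X).imp_left And.left)
      (ihQ g fun X => (h X).imp_left And.right)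
  | send c e P Q ihP ihQ => exact fun g h => congrArg (· + 1) (ihP _ h)
  | recv c P Q ihP ihQ =>
    exact fun g h => congrArg (· + 1) (ihP _ fun X =>
      (h X).imp_right fun hX => ((g X).work_subst _).trans hX)
  | cond b P Q ihP ihQ =>
    exact fun g h => congrArg₂ (· + ·) (ihP g fun X => (h X).imp_left And.left)
      (ihQ g fun X => (h X).imp_left And.right)
  | pvar X => exact fun g h => (h X).elim (fun h => (h rfl).elim) id
  | fix P ih =>
    intro m' g h
    refine ih (liftProc g) fun X => ?_
    exact Fin.cases (Or.inr rfl)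
      (fun i => (h i).imp_right fun hi => ((g i).work_prename _).trans hi) X

theorem Proc.work_unfold {n m : ℕ} {P : Proc S n (m + 1)} (h : P.TimeGuarded 0) :
    P.unfold.work = P.work :=
  P.work_psubst _ fun X => Fin.cases (Or.inl h) (fun i => Or.inr rfl) X

/-- Every rule consumes a counted prefix, and unfolding a time-guarded recursion costs nothing
(`Proc.work_unfold`). This is the only place where time-guardedness enters the argument, apart from
its preservation. -/
theorem PTrans.work_lt {l : PLabel S} {P P' : Proc S 0 0} (h : PTrans l P P') :
    P.GuardedRec → P'.work < P.work := by
  induction h with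
  | snd c v P Q => exact fun _ => Nat.lt_succ_self _
  | rcv c v P Q => exact fun _ => by simp [Proc.inst, Proc.work_subst, Proc.work]
  | sensor s v P => exact fun _ => by simp [Proc.inst, Proc.work_subst, Proc.work]
  | actuator a v P => exact fun _ => Nat.lt_succ_self _
  | pos h P => exact fun _ => by simp [Proc.inst, Proc.work_subst, Proc.work]
  | comL c v P P' Q Q' _ _ _ ih1 ih2 => exact fun h => Nat.add_lt_add (ih1 h.1) (ih2 h.2)
  | comR c v P P' Q Q' _ _ _ ih1 ih2 => exact fun h => Nat.add_lt_add (ih1 h.1) (ih2 h.2)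
  | parL l P P' Q _ ih => exact fun h => Nat.add_lt_add_right (ih h.1) _
  | parR l P Q Q' _ ih => exact fun h => Nat.add_lt_add_left (ih h.2) _
  | fix l P Q _ ih =>
    exact fun h => (ih (Proc.guardedRec_unfold h)).trans_eq (Proc.work_unfold h.1)
  | condT l b P Q R _ _ ih => exact fun h => (ih h.1).trans_le (Nat.le_add_right _ _)
  | condF l b P Q R _ _ ih => exact fun h => (ih h.2).trans_le (Nat.le_add_left _ _)

/-! ### Strong bisimilarity of closed processes -/

/-- Strong bisimulations on closed processes. -/
structure IsPBisim (R : Proc S 0 0 → Proc S 0 0 → Prop) : Prop where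
  symm : ∀ P Q, R P Q → R Q P
  trans : ∀ P Q, R P Q → ∀ l P', PTrans l P P' → ∃ Q', PTrans l Q Q' ∧ R P' Q'
  time : ∀ P Q, R P Q → ∀ P', PTime P P' → ∃ Q', PTime Q Q' ∧ R P' Q'

/-- Strong bisimilarity of closed processes. -/
def PBisim (P Q : Proc S 0 0) : Prop := ∃ R, IsPBisim R ∧ R P Q

theorem PBisim.refl (P : Proc S 0 0) : PBisim P P :=
  ⟨Eq, ⟨fun _ _ h => h.symm, fun P Q h l P' hP => ⟨P', h ▸ hP, rfl⟩,
    fun P Q h P' hP => ⟨P', h ▸ hP, rfl⟩⟩, rfl⟩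

theorem PBisim.symm {P Q : Proc S 0 0} : PBisim P Q → PBisim Q P :=
  fun ⟨R, hR, h⟩ => ⟨R, hR, hR.symm _ _ h⟩

theorem PBisim.sim {P Q : Proc S 0 0} (h : PBisim P Q) {l : PLabel S} {P' : Proc S 0 0}
    (hP : PTrans l P P') : ∃ Q', PTrans l Q Q' ∧ PBisim P' Q' := by
  obtain ⟨R, hR, h⟩ := h
  obtain ⟨Q', h1, h2⟩ := hR.trans _ _ h l P' hP
  exact ⟨Q', h1, R, hR, h2⟩

theorem PBisim.simTime {P Q : Proc S 0 0} (h : PBisim P Q) {P' : Proc S 0 0}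
    (hP : PTime P P') : ∃ Q', PTime Q Q' ∧ PBisim P' Q' := by
  obtain ⟨R, hR, h⟩ := h
  obtain ⟨Q', h1, h2⟩ := hR.time _ _ h P' hP
  exact ⟨Q', h1, R, hR, h2⟩

theorem PBisim.trans {P Q T : Proc S 0 0} (h : PBisim P Q) (h' : PBisim Q T) : PBisim P T := by
  refine ⟨fun P T => ∃ Q, PBisim P Q ∧ PBisim Q T, ⟨?_, ?_, ?_⟩, Q, h, h'⟩
  · rintro P T ⟨Q, h1, h2⟩
    exact ⟨Q, h2.symm, h1.symm⟩
  · rintro P T ⟨Q, h1, h2⟩ l P' hP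
    obtain ⟨Q', hQ, h1'⟩ := h1.sim hP
    obtain ⟨T', hT, h2'⟩ := h2.sim hQ
    exact ⟨T', hT, Q', h1', h2'⟩
  · rintro P T ⟨Q, h1, h2⟩ P' hP
    obtain ⟨Q', hQ, h1'⟩ := h1.simTime hP
    obtain ⟨T', hT, h2'⟩ := h2.simTime hQ
    exact ⟨T', hT, Q', h1', h2'⟩

/-- Strong bisimulation up to strong bisimilarity. -/
theorem PBisim.of_upto (R : Proc S 0 0 → Proc S 0 0 → Prop) (symm : ∀ P Q, R P Q → R Q P)
    (trans : ∀ P Q, R P Q → ∀ l P', PTrans l P P' →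
      ∃ Q', PTrans l Q Q' ∧ Relation.Comp (Relation.Comp PBisim R) PBisim P' Q')
    (time : ∀ P Q, R P Q → ∀ P', PTime P P' →
      ∃ Q', PTime Q Q' ∧ Relation.Comp (Relation.Comp PBisim R) PBisim P' Q')
    {P Q : Proc S 0 0} (h : R P Q) : PBisim P Q := by
  refine ⟨Relation.Comp (Relation.Comp PBisim R) PBisim, ⟨?_, ?_, ?_⟩,
    Q, ⟨P, PBisim.refl P, h⟩, PBisim.refl Q⟩
  · rintro P Q ⟨Q1, ⟨P1, h1, h2⟩, h3⟩
    exact ⟨P1, ⟨Q1, h3.symm, symm _ _ h2⟩, h1.symm⟩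
  · rintro P Q ⟨Q1, ⟨P1, h1, h2⟩, h3⟩ l P' hP
    obtain ⟨P1', hP1, h1'⟩ := h1.sim hP
    obtain ⟨Q1', hQ1, T, ⟨U, h4, h5⟩, h6⟩ := trans _ _ h2 l _ hP1
    obtain ⟨Q', hQ, h3'⟩ := h3.sim hQ1
    exact ⟨Q', hQ, T, ⟨U, h1'.trans h4, h5⟩, h6.trans h3'⟩
  · rintro P Q ⟨Q1, ⟨P1, h1, h2⟩, h3⟩ P' hP
    obtain ⟨P1', hP1, h1'⟩ := h1.simTime hP
    obtain ⟨Q1', hQ1, T, ⟨U, h4, h5⟩, h6⟩ := time _ _ h2 _ hP1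
    obtain ⟨Q', hQ, h3'⟩ := h3.simTime hQ1
    exact ⟨Q', hQ, T, ⟨U, h1'.trans h4, h5⟩, h6.trans h3'⟩

/-- One step of simulation into strong bisimilarity. -/
def PStepSim (P Q : Proc S 0 0) : Prop :=
  (∀ l P', PTrans l P P' → ∃ Q', PTrans l Q Q' ∧ PBisim P' Q') ∧
    ∀ P', PTime P P' → ∃ Q', PTime Q Q' ∧ PBisim P' Q'

/-- The residuals are already bisimilar, so one matching step is enough. Equality is adjoined so
that bisimilar residuals are related up to bisimilarity. -/
theorem PBisim.of_step {P Q : Proc S 0 0} (h : PStepSim P Q) (h' : PStepSim Q P) :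
    PBisim P Q := by
  refine PBisim.of_upto (fun A B => PStepSim A B ∧ PStepSim B A ∨ A = B) ?_ ?_ ?_ (Or.inl ⟨h, h'⟩)
  · rintro A B (⟨h1, h2⟩ | rfl)
    exacts [Or.inl ⟨h2, h1⟩, Or.inr rfl]
  · rintro A B (⟨h1, h2⟩ | rfl) l A' hA
    · obtain ⟨B', hB, h3⟩ := h1.1 l A' hA
      exact ⟨B', hB, B', ⟨B', h3, Or.inr rfl⟩, PBisim.refl _⟩
    · exact ⟨A', hA, A', ⟨A', PBisim.refl _, Or.inr rfl⟩, PBisim.refl _⟩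
  · rintro A B (⟨h1, h2⟩ | rfl) A' hA
    · obtain ⟨B', hB, h3⟩ := h1.2 A' hA
      exact ⟨B', hB, B', ⟨B', h3, Or.inr rfl⟩, PBisim.refl _⟩
    · exact ⟨A', hA, A', ⟨A', PBisim.refl _, Or.inr rfl⟩, PBisim.refl _⟩

/-! ### Congruence and monoid laws for strong bisimilarity -/

theorem PTime.not_tau {P P' : Proc S 0 0} (h : PTime P P') : ¬ ∃ Q, PTrans .tau P Q := by
  induction h with
  | timenil => rintro ⟨Q, hQ⟩; cases hQ
  | delay P => rintro ⟨Q, hQ⟩; cases hQ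
  | timeout R Q h => cases h <;> (rintro ⟨Q, hQ⟩; cases hQ)
  | timepar P P' Q Q' _ _ h => exact h
  | fix P Q _ ih =>
    rintro ⟨T, hT⟩
    cases hT with
    | fix _ _ _ hT => exact ih ⟨T, hT⟩
  | condT b P Q R hb _ ih =>
    rintro ⟨T, hT⟩
    cases hT with
    | condT _ _ _ _ _ _ hT => exact ih ⟨T, hT⟩
    | condF _ _ _ _ _ hb' hT => simp [hb] at hb'
  | condF b P Q R hb _ ih =>
    rintro ⟨T, hT⟩
    cases hT with
    | condF _ _ _ _ _ _ hT => exact ih ⟨T, hT⟩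
    | condT _ _ _ _ _ hb' hT => simp [hb] at hb'

theorem PBisim.par {P P' Q Q' : Proc S 0 0} (h : PBisim P P') (h' : PBisim Q Q') :
    PBisim (.par P Q) (.par P' Q') := by
  let R : Proc S 0 0 → Proc S 0 0 → Prop := fun A B =>
    ∃ P P' Q Q', A = .par P Q ∧ B = .par P' Q' ∧ PBisim P P' ∧ PBisim Q Q'
  have symm : ∀ A B, R A B → R B A := by
    rintro _ _ ⟨P, P', Q, Q', rfl, rfl, h, h'⟩
    exact ⟨P', P, Q', Q, rfl, rfl, h.symm, h'.symm⟩
  -- Isolated because the negative premise of `timepar` uses the untimed part in the opposite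
  -- direction.
  have trans : ∀ A B, R A B → ∀ l A', PTrans l A A' → ∃ B', PTrans l B B' ∧ R A' B' := by
    rintro _ _ ⟨P, P', Q, Q', rfl, rfl, h, h'⟩ l A' hA
    cases hA with
    | comL c v _ P1 _ Q1 hP hQ hc =>
      obtain ⟨P2, hP2, e⟩ := h.sim hP
      obtain ⟨Q2, hQ2, e'⟩ := h'.sim hQ
      exact ⟨_, .comL c v _ _ _ _ hP2 hQ2 hc, _, _, _, _, rfl, rfl, e, e'⟩
    | comR c v _ P1 _ Q1 hP hQ hc =>
      obtain ⟨P2, hP2, e⟩ := h.sim hP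
      obtain ⟨Q2, hQ2, e'⟩ := h'.sim hQ
      exact ⟨_, .comR c v _ _ _ _ hP2 hQ2 hc, _, _, _, _, rfl, rfl, e, e'⟩
    | parL _ _ P1 _ hP =>
      obtain ⟨P2, hP2, e⟩ := h.sim hP
      exact ⟨_, .parL _ _ _ _ hP2, _, _, _, _, rfl, rfl, e, h'⟩
    | parR _ _ _ Q1 hQ =>
      obtain ⟨Q2, hQ2, e⟩ := h'.sim hQ
      exact ⟨_, .parR _ _ _ _ hQ2, _, _, _, _, rfl, rfl, h, e⟩
  refine ⟨R, ⟨symm, trans, ?_⟩, P, P', Q, Q', rfl, rfl, h, h'⟩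
  rintro _ _ ⟨P, P', Q, Q', rfl, rfl, h, h'⟩ A' hA
  cases hA with
  | timeout _ _ h => cases h
  | timepar _ P1 _ Q1 hP hQ hn =>
    obtain ⟨P2, hP2, e⟩ := h.simTime hP
    obtain ⟨Q2, hQ2, e'⟩ := h'.simTime hQ
    refine ⟨_, .timepar _ _ _ _ hP2 hQ2 ?_, _, _, _, _, rfl, rfl, e, e'⟩
    rintro ⟨T, hT⟩
    obtain ⟨U, hU, -⟩ := trans _ _ ⟨_, _, _, _, rfl, rfl, h.symm, h'.symm⟩ _ _ hT
    exact hn ⟨U, hU⟩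

theorem PBisim.par_comm (P Q : Proc S 0 0) : PBisim (.par P Q) (.par Q P) := by
  let R : Proc S 0 0 → Proc S 0 0 → Prop := fun A B => ∃ P Q, A = .par P Q ∧ B = .par Q P
  have trans : ∀ A B, R A B → ∀ l A', PTrans l A A' → ∃ B', PTrans l B B' ∧ R A' B' := by
    rintro _ _ ⟨P, Q, rfl, rfl⟩ l A' hA
    cases hA with
    | comL c v _ P1 _ Q1 hP hQ hc => exact ⟨_, .comR c v _ _ _ _ hQ hP hc, _, _, rfl, rfl⟩
    | comR c v _ P1 _ Q1 hP hQ hc => exact ⟨_, .comL c v _ _ _ _ hQ hP hc, _, _, rfl, rfl⟩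
    | parL _ _ P1 _ hP => exact ⟨_, .parR _ _ _ _ hP, _, _, rfl, rfl⟩
    | parR _ _ _ Q1 hQ => exact ⟨_, .parL _ _ _ _ hQ, _, _, rfl, rfl⟩
  refine ⟨R, ⟨?_, trans, ?_⟩, P, Q, rfl, rfl⟩
  · rintro _ _ ⟨P, Q, rfl, rfl⟩
    exact ⟨Q, P, rfl, rfl⟩
  · rintro _ _ ⟨P, Q, rfl, rfl⟩ A' hA
    cases hA with
    | timeout _ _ h => cases h
    | timepar _ P1 _ Q1 hP hQ hn =>
      refine ⟨_, .timepar _ _ _ _ hQ hP ?_, _, _, rfl, rfl⟩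
      rintro ⟨T, hT⟩
      obtain ⟨U, hU, -⟩ := trans _ _ ⟨_, _, rfl, rfl⟩ _ _ hT
      exact hn ⟨U, hU⟩

theorem PTrans.par_nil {l : PLabel S} {P A' : Proc S 0 0} (h : PTrans l (.par P .nil) A') :
    ∃ P', A' = .par P' .nil ∧ PTrans l P P' := by
  cases h with
  | comL c v _ P1 _ Q1 hP hQ hc => cases hQ
  | comR c v _ P1 _ Q1 hP hQ hc => cases hQ
  | parL _ _ P1 _ hP => exact ⟨P1, rfl, hP⟩
  | parR _ _ _ Q1 hQ => cases hQ

theorem PBisim.par_nil (P : Proc S 0 0) : PBisim (.par P .nil) P := by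
  refine ⟨fun A B => A = .par B .nil ∨ B = .par A .nil, ⟨fun A B h => h.symm, ?_, ?_⟩, Or.inl rfl⟩
  · rintro A B (rfl | rfl) l A' hA
    · obtain ⟨P', rfl, hP⟩ := hA.par_nil
      exact ⟨P', hP, Or.inl rfl⟩
    · exact ⟨_, .parL _ _ _ _ hA, Or.inr rfl⟩
  · rintro A B (rfl | rfl) A' hA
    · cases hA with
      | timeout _ _ h => cases h
      | timepar _ P1 _ Q1 hP hQ hn =>
        cases hQ with
        | timenil => exact ⟨P1, hP, Or.inl rfl⟩
        | timeout _ _ h => cases h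
    · refine ⟨_, .timepar _ _ _ _ hA .timenil ?_, Or.inr rfl⟩
      rintro ⟨T, hT⟩
      obtain ⟨P', -, hP⟩ := hT.par_nil
      exact hA.not_tau ⟨_, hP⟩

theorem PBisim.par_assoc (P Q T : Proc S 0 0) :
    PBisim (.par (.par P Q) T) (.par P (.par Q T)) := by
  let R : Proc S 0 0 → Proc S 0 0 → Prop := fun A B =>
    ∃ P Q T, A = .par (.par P Q) T ∧ B = .par P (.par Q T) ∨
      A = .par P (.par Q T) ∧ B = .par (.par P Q) T
  have trans : ∀ A B, R A B → ∀ l A', PTrans l A A' → ∃ B', PTrans l B B' ∧ R A' B' := by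
    rintro _ _ ⟨P, Q, T, ⟨rfl, rfl⟩ | ⟨rfl, rfl⟩⟩ l A' hA
    · cases hA with
      | comL c v _ P1 _ Q1 hP hQ hc =>
        cases hP with
        | parL _ _ P1 _ hP =>
          exact ⟨_, .comL c v _ _ _ _ hP (.parR _ _ _ _ hQ) hc, _, _, _, Or.inl ⟨rfl, rfl⟩⟩
        | parR _ _ _ P1 hP =>
          exact ⟨_, .parR _ _ _ _ (.comL c v _ _ _ _ hP hQ hc), _, _, _, Or.inl ⟨rfl, rfl⟩⟩
      | comR c v _ P1 _ Q1 hP hQ hc =>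
        cases hP with
        | parL _ _ P1 _ hP =>
          exact ⟨_, .comR c v _ _ _ _ hP (.parR _ _ _ _ hQ) hc, _, _, _, Or.inl ⟨rfl, rfl⟩⟩
        | parR _ _ _ P1 hP =>
          exact ⟨_, .parR _ _ _ _ (.comR c v _ _ _ _ hP hQ hc), _, _, _, Or.inl ⟨rfl, rfl⟩⟩
      | parL _ _ P1 _ hP =>
        cases hP with
        | comL c v _ P1 _ Q1 hP hQ hc =>
          exact ⟨_, .comL c v _ _ _ _ hP (.parL _ _ _ _ hQ) hc, _, _, _, Or.inl ⟨rfl, rfl⟩⟩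
        | comR c v _ P1 _ Q1 hP hQ hc =>
          exact ⟨_, .comR c v _ _ _ _ hP (.parL _ _ _ _ hQ) hc, _, _, _, Or.inl ⟨rfl, rfl⟩⟩
        | parL _ _ P1 _ hP => exact ⟨_, .parL _ _ _ _ hP, _, _, _, Or.inl ⟨rfl, rfl⟩⟩
        | parR _ _ _ P1 hP =>
          exact ⟨_, .parR _ _ _ _ (.parL _ _ _ _ hP), _, _, _, Or.inl ⟨rfl, rfl⟩⟩
      | parR _ _ _ Q1 hQ =>
        exact ⟨_, .parR _ _ _ _ (.parR _ _ _ _ hQ), _, _, _, Or.inl ⟨rfl, rfl⟩⟩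
    · cases hA with
      | comL c v _ P1 _ Q1 hP hQ hc =>
        cases hQ with
        | parL _ _ P1 _ hQ =>
          exact ⟨_, .parL _ _ _ _ (.comL c v _ _ _ _ hP hQ hc), _, _, _, Or.inr ⟨rfl, rfl⟩⟩
        | parR _ _ _ P1 hQ =>
          exact ⟨_, .comL c v _ _ _ _ (.parL _ _ _ _ hP) hQ hc, _, _, _, Or.inr ⟨rfl, rfl⟩⟩
      | comR c v _ P1 _ Q1 hP hQ hc =>
        cases hQ with
        | parL _ _ P1 _ hQ =>
          exact ⟨_, .parL _ _ _ _ (.comR c v _ _ _ _ hP hQ hc), _, _, _, Or.inr ⟨rfl, rfl⟩⟩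
        | parR _ _ _ P1 hQ =>
          exact ⟨_, .comR c v _ _ _ _ (.parL _ _ _ _ hP) hQ hc, _, _, _, Or.inr ⟨rfl, rfl⟩⟩
      | parR _ _ _ P1 hP =>
        cases hP with
        | comL c v _ P1 _ Q1 hP hQ hc =>
          exact ⟨_, .comL c v _ _ _ _ (.parR _ _ _ _ hP) hQ hc, _, _, _, Or.inr ⟨rfl, rfl⟩⟩
        | comR c v _ P1 _ Q1 hP hQ hc =>
          exact ⟨_, .comR c v _ _ _ _ (.parR _ _ _ _ hP) hQ hc, _, _, _, Or.inr ⟨rfl, rfl⟩⟩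
        | parL _ _ P1 _ hP =>
          exact ⟨_, .parL _ _ _ _ (.parR _ _ _ _ hP), _, _, _, Or.inr ⟨rfl, rfl⟩⟩
        | parR _ _ _ P1 hP =>
          exact ⟨_, .parR _ _ _ _ hP, _, _, _, Or.inr ⟨rfl, rfl⟩⟩
      | parL _ _ P1 _ hP =>
        exact ⟨_, .parL _ _ _ _ (.parL _ _ _ _ hP), _, _, _, Or.inr ⟨rfl, rfl⟩⟩
  refine ⟨R, ⟨?_, trans, ?_⟩, P, Q, T, Or.inl ⟨rfl, rfl⟩⟩
  · rintro _ _ ⟨P, Q, T, ⟨rfl, rfl⟩ | ⟨rfl, rfl⟩⟩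
    exacts [⟨P, Q, T, Or.inr ⟨rfl, rfl⟩⟩, ⟨P, Q, T, Or.inl ⟨rfl, rfl⟩⟩]
  · rintro _ _ ⟨P, Q, T, ⟨rfl, rfl⟩ | ⟨rfl, rfl⟩⟩ A' hA
    · cases hA with
      | timeout _ _ h => cases h
      | timepar _ P1 _ Q1 hP hQ hn =>
        have hn' : ¬ ∃ U, PTrans .tau (.par P (.par Q T)) U := by
          rintro ⟨U, hU⟩
          obtain ⟨V, hV, -⟩ := trans _ _ ⟨P, Q, T, Or.inr ⟨rfl, rfl⟩⟩ _ _ hU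
          exact hn ⟨V, hV⟩
        cases hP with
        | timeout _ _ h => cases h
        | timepar _ P2 _ Q2 hP2 hQ2 _ =>
          exact ⟨_, .timepar _ _ _ _ hP2 (.timepar _ _ _ _ hQ2 hQ
            fun ⟨U, hU⟩ => hn' ⟨_, .parR _ _ _ _ hU⟩) hn', _, _, _, Or.inl ⟨rfl, rfl⟩⟩
    · cases hA with
      | timeout _ _ h => cases h
      | timepar _ P1 _ Q1 hP hQ hn =>
        have hn' : ¬ ∃ U, PTrans .tau (.par (.par P Q) T) U := by
          rintro ⟨U, hU⟩
          obtain ⟨V, hV, -⟩ := trans _ _ ⟨P, Q, T, Or.inl ⟨rfl, rfl⟩⟩ _ _ hU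
          exact hn ⟨V, hV⟩
        cases hQ with
        | timeout _ _ h => cases h
        | timepar _ P2 _ Q2 hP2 hQ2 _ =>
          exact ⟨_, .timepar _ _ _ _ (.timepar _ _ _ _ hP hP2
            fun ⟨U, hU⟩ => hn' ⟨_, .parL _ _ _ _ hU⟩) hQ2 hn', _, _, _, Or.inr ⟨rfl, rfl⟩⟩

theorem PBisim.cond_true {b : Guard S 0} (P Q : Proc S 0 0) (hb : b.eval Fin.elim0 = true) :
    PBisim (.cond b P Q) P := by
  refine PBisim.of_step ⟨fun l P' h => ?_, fun P' h => ?_⟩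
    ⟨fun l P' h => ⟨P', .condT _ _ _ _ _ hb h, PBisim.refl _⟩,
      fun P' h => ⟨P', .condT _ _ _ _ hb h, PBisim.refl _⟩⟩
  · cases h with
    | condT _ _ _ _ _ _ h => exact ⟨P', h, PBisim.refl _⟩
    | condF _ _ _ _ _ hb' h => simp [hb] at hb'
  · cases h with
    | condT _ _ _ _ _ h => exact ⟨P', h, PBisim.refl _⟩
    | condF _ _ _ _ hb' h => simp [hb] at hb'
    | timeout _ _ h => cases h

theorem PBisim.cond_false {b : Guard S 0} (P Q : Proc S 0 0) (hb : b.eval Fin.elim0 = false) :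
    PBisim (.cond b P Q) Q := by
  refine PBisim.of_step ⟨fun l P' h => ?_, fun P' h => ?_⟩
    ⟨fun l P' h => ⟨P', .condF _ _ _ _ _ hb h, PBisim.refl _⟩,
      fun P' h => ⟨P', .condF _ _ _ _ hb h, PBisim.refl _⟩⟩
  · cases h with
    | condF _ _ _ _ _ _ h => exact ⟨P', h, PBisim.refl _⟩
    | condT _ _ _ _ _ hb' h => simp [hb] at hb'
  · cases h with
    | condF _ _ _ _ _ h => exact ⟨P', h, PBisim.refl _⟩
    | condT _ _ _ _ hb' h => simp [hb] at hb'
    | timeout _ _ h => cases h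

theorem PBisim.unfold (P : Proc S 0 1) : PBisim (.fix P) P.unfold := by
  refine PBisim.of_step ⟨fun l P' h => ?_, fun P' h => ?_⟩
    ⟨fun l P' h => ⟨P', .fix _ _ _ h, PBisim.refl _⟩, fun P' h => ⟨P', .fix _ _ h, PBisim.refl _⟩⟩
  · cases h with
    | fix _ _ _ h => exact ⟨P', h, PBisim.refl _⟩
  · cases h with
    | fix _ _ h => exact ⟨P', h, PBisim.refl _⟩
    | timeout _ _ h => cases h

theorem PBisim.sleep {P Q : Proc S 0 0} (h : PBisim P Q) : PBisim (.sleep P) (.sleep Q) := by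
  have key : ∀ {P Q : Proc S 0 0}, PBisim P Q → PStepSim (.sleep P) (.sleep Q) := by
    intro P Q h
    refine ⟨fun l P' hP => ?_, fun P' hP => ?_⟩
    · cases hP
    cases hP with
    | delay => exact ⟨_, .delay _, h⟩
    | timeout _ _ h => cases h
  exact .of_step (key h) (key h.symm)

theorem PBisim.pos {P Q : Proc S 1 0} (h : ∀ v, PBisim (P.inst v) (Q.inst v)) :
    PBisim (.pos P) (.pos Q) := by
  have key : ∀ {P Q : Proc S 1 0}, (∀ v, PBisim (P.inst v) (Q.inst v)) →
      PStepSim (.pos P) (.pos Q) := by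
    intro P Q h
    refine ⟨fun l P' hP => ?_, fun P' hP => ?_⟩
    · cases hP with
      | pos k => exact ⟨_, .pos k _, h _⟩
    · cases hP with
      | timeout _ _ h => cases h
  exact .of_step (key h) (key fun v => (h v).symm)

theorem PBisim.sense (s : S.Sens) {P Q : Proc S 1 0} (h : ∀ v, PBisim (P.inst v) (Q.inst v)) :
    PBisim (.sense s P) (.sense s Q) := by
  have key : ∀ {P Q : Proc S 1 0}, (∀ v, PBisim (P.inst v) (Q.inst v)) →
      PStepSim (.sense s P) (.sense s Q) := by
    intro P Q h
    refine ⟨fun l P' hP => ?_, fun P' hP => ?_⟩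
    · cases hP with
      | sensor _ v => exact ⟨_, .sensor s v _, h _⟩
    · cases hP with
      | timeout _ _ h => cases h
  exact .of_step (key h) (key fun v => (h v).symm)

theorem PBisim.write (a : S.Act) (e : Term S 0) {P Q : Proc S 0 0} (h : PBisim P Q) :
    PBisim (.write a e P) (.write a e Q) := by
  have key : ∀ {P Q : Proc S 0 0}, PBisim P Q → PStepSim (.write a e P) (.write a e Q) := by
    intro P Q h
    refine ⟨fun l P' hP => ?_, fun P' hP => ?_⟩
    · cases hP with
      | actuator _ v => exact ⟨_, .actuator a v _, h⟩
    · cases hP with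
      | timeout _ _ h => cases h
  exact .of_step (key h) (key h.symm)

theorem PBisim.send (c : S.Chan) (e : Term S 0) {P P' Q Q' : Proc S 0 0} (h : PBisim P P')
    (h' : PBisim Q Q') : PBisim (.send c e P Q) (.send c e P' Q') := by
  have key : ∀ {P P' Q Q' : Proc S 0 0}, PBisim P P' → PBisim Q Q' →
      PStepSim (.send c e P Q) (.send c e P' Q') := by
    intro P P' Q Q' h h'
    refine ⟨fun l R hP => ?_, fun R hP => ?_⟩
    · cases hP with
      | snd _ v => exact ⟨_, .snd c v _ _, h⟩
    · cases hP with
      | timeout _ _ ht =>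
        cases ht with
        | send => exact ⟨_, .timeout _ _ (.send _ _ _ _), h'⟩
  exact .of_step (key h h') (key h.symm h'.symm)

theorem PBisim.recv (c : S.Chan) {P P' : Proc S 1 0} {Q Q' : Proc S 0 0}
    (h : ∀ v, PBisim (P.inst v) (P'.inst v)) (h' : PBisim Q Q') :
    PBisim (.recv c P Q) (.recv c P' Q') := by
  have key : ∀ {P P' : Proc S 1 0} {Q Q' : Proc S 0 0},
      (∀ v, PBisim (P.inst v) (P'.inst v)) → PBisim Q Q' →
      PStepSim (.recv c P Q) (.recv c P' Q') := by
    intro P P' Q Q' h h'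
    refine ⟨fun l R hP => ?_, fun R hP => ?_⟩
    · cases hP with
      | rcv _ v => exact ⟨_, .rcv c v _ _, h v⟩
    · cases hP with
      | timeout _ _ ht =>
        cases ht with
        | recv => exact ⟨_, .timeout _ _ (.recv _ _ _), h'⟩
  exact .of_step (key h h') (key (fun v => (h v).symm) h'.symm)

theorem PBisim.cond (b : Guard S 0) {P P' Q Q' : Proc S 0 0} (h : PBisim P P')
    (h' : PBisim Q Q') : PBisim (.cond b P Q) (.cond b P' Q') := by
  cases hb : b.eval Fin.elim0 with
  | true => exact ((cond_true P Q hb).trans h).trans (cond_true P' Q' hb).symm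
  | false => exact ((cond_false P Q hb).trans h').trans (cond_false P' Q' hb).symm

/-! ### Strong bisimilarity and recursion -/

theorem Proc.unfold_eq_psubst (A : Proc S 0 1) : A.unfold = A.psubst fun _ => .fix A := by
  unfold Proc.unfold
  congr 1
  funext X
  exact Fin.cases rfl (fun i => i.elim0) X

/-- Induction on the derivation, for all contexts `G` at once. The critical case is a variable `G`:
the transition of `fix A` has a shorter derivation from `A{fix A}`, so the induction hypothesis for
the context `A` gives a transition of `A{fix B}`, and `hAB` carries it over to `B{fix B}`, the
unfolding of `fix B`. Guardedness plays no role. -/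
theorem PTrans.fix_congr {A B : Proc S 0 1}
    (hAB : ∀ R : Proc S 0 0, PBisim (A.psubst fun _ => R) (B.psubst fun _ => R))
    {l : PLabel S} {X P' : Proc S 0 0} (h : PTrans l X P') :
    ∀ G : Proc S 0 1, X = G.psubst (fun _ => .fix A) →
      ∃ (G' : Proc S 0 1) (Q' : Proc S 0 0), PTrans l (G.psubst fun _ => .fix B) Q' ∧
        P' = G'.psubst (fun _ => .fix A) ∧ PBisim (G'.psubst fun _ => .fix B) Q' := by
  have hvar : ∀ {l : PLabel S} {Q P' : Proc S 0 0},
      (∀ G : Proc S 0 1, Q = G.psubst (fun _ => .fix A) →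
        ∃ (G' : Proc S 0 1) (Q' : Proc S 0 0), PTrans l (G.psubst fun _ => .fix B) Q' ∧
        P' = G'.psubst (fun _ => .fix A) ∧ PBisim (G'.psubst fun _ => .fix B) Q') →
      Q = A.unfold → ∃ (G' : Proc S 0 1) (Q' : Proc S 0 0), PTrans l (.fix B) Q' ∧
        P' = G'.psubst (fun _ => .fix A) ∧ PBisim (G'.psubst fun _ => .fix B) Q' := by
    intro l Q P' ih hQ
    obtain ⟨G', Q', h1, h2, h3⟩ := ih A (hQ.trans A.unfold_eq_psubst)
    obtain ⟨Q2, h4, h5⟩ := (hAB (.fix B)).sim h1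
    exact ⟨G', Q2, .fix _ _ _ (B.unfold_eq_psubst ▸ h4), h2, h3.trans h5⟩
  induction h with
  | snd c v P Q =>
    intro G hG
    cases G with
    | send c e G1 G2 =>
      simp only [Proc.psubst, Proc.send.injEq] at hG
      obtain ⟨rfl, rfl, rfl, rfl⟩ := hG
      exact ⟨G1, _, .snd _ _ _ _, rfl, PBisim.refl _⟩
    | pvar X => cases hG
    | _ => cases hG
  | rcv c v P Q =>
    intro G hG
    cases G with
    | recv c G1 G2 =>
      simp only [Proc.psubst, Proc.recv.injEq] at hG
      obtain ⟨rfl, rfl, rfl⟩ := hG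
      exact ⟨G1.inst v, _, .rcv _ _ _ _, Proc.inst_psubst _ _ _,
        (Proc.inst_psubst (fun _ => .fix B) G1 v) ▸ PBisim.refl _⟩
    | _ => cases hG
  | sensor s v P =>
    intro G hG
    cases G with
    | sense s G1 =>
      simp only [Proc.psubst, Proc.sense.injEq] at hG
      obtain ⟨rfl, rfl⟩ := hG
      exact ⟨G1.inst v, _, .sensor _ _ _, Proc.inst_psubst _ _ _,
        (Proc.inst_psubst (fun _ => .fix B) G1 v) ▸ PBisim.refl _⟩
    | _ => cases hG
  | actuator a v P =>
    intro G hG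
    cases G with
    | write a e G1 =>
      simp only [Proc.psubst, Proc.write.injEq] at hG
      obtain ⟨rfl, rfl, rfl⟩ := hG
      exact ⟨G1, _, .actuator _ _ _, rfl, PBisim.refl _⟩
    | _ => cases hG
  | pos k P =>
    intro G hG
    cases G with
    | pos G1 =>
      simp only [Proc.psubst, Proc.pos.injEq] at hG
      subst hG
      exact ⟨G1.inst _, _, .pos k _, Proc.inst_psubst _ _ _,
        (Proc.inst_psubst (fun _ => .fix B) G1 _) ▸ PBisim.refl _⟩
    | _ => cases hG
  | comL c v P P' Q Q' _ _ hc ih1 ih2 =>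
    intro G hG
    cases G with
    | par G1 G2 =>
      simp only [Proc.psubst, Proc.par.injEq] at hG
      obtain ⟨G1', Q1, h1, rfl, h3⟩ := ih1 G1 hG.1
      obtain ⟨G2', Q2, h4, rfl, h6⟩ := ih2 G2 hG.2
      exact ⟨.par G1' G2', _, .comL c v _ _ _ _ h1 h4 hc, rfl, h3.par h6⟩
    | _ => cases hG
  | comR c v P P' Q Q' _ _ hc ih1 ih2 =>
    intro G hG
    cases G with
    | par G1 G2 =>
      simp only [Proc.psubst, Proc.par.injEq] at hG
      obtain ⟨G1', Q1, h1, rfl, h3⟩ := ih1 G1 hG.1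
      obtain ⟨G2', Q2, h4, rfl, h6⟩ := ih2 G2 hG.2
      exact ⟨.par G1' G2', _, .comR c v _ _ _ _ h1 h4 hc, rfl, h3.par h6⟩
    | _ => cases hG
  | parL l P P' Q _ ih =>
    intro G hG
    cases G with
    | par G1 G2 =>
      simp only [Proc.psubst, Proc.par.injEq] at hG
      obtain ⟨rfl', rfl⟩ := hG
      obtain ⟨G1', Q1, h1, rfl, h3⟩ := ih G1 rfl'
      exact ⟨.par G1' G2, _, .parL _ _ _ _ h1, rfl, h3.par (PBisim.refl _)⟩
    | _ => cases hG
  | parR l P Q Q' _ ih =>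
    intro G hG
    cases G with
    | par G1 G2 =>
      simp only [Proc.psubst, Proc.par.injEq] at hG
      obtain ⟨rfl, hG⟩ := hG
      obtain ⟨G2', Q1, h1, rfl, h3⟩ := ih G2 hG
      exact ⟨.par G1 G2', _, .parR _ _ _ _ h1, rfl, (PBisim.refl _).par h3⟩
    | _ => cases hG
  | fix l P Q _ ih =>
    intro G hG
    cases G with
    | fix G1 =>
      simp only [Proc.psubst, Proc.fix.injEq] at hG
      subst hG
      obtain ⟨G', Q', h1, h2, h3⟩ := ih G1.unfold (Proc.unfold_psubst _ _).symm
      exact ⟨G', Q', .fix _ _ _ (Proc.unfold_psubst (fun _ => .fix B) G1 ▸ h1), h2, h3⟩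
    | pvar X =>
      cases hG
      exact hvar ih rfl
    | _ => cases hG
  | condT l b P Q R hb _ ih =>
    intro G hG
    cases G with
    | cond b G1 G2 =>
      simp only [Proc.psubst, Proc.cond.injEq] at hG
      obtain ⟨rfl, hG, rfl⟩ := hG
      obtain ⟨G', Q', h1, h2, h3⟩ := ih G1 hG
      exact ⟨G', Q', .condT _ _ _ _ _ hb h1, h2, h3⟩
    | _ => cases hG
  | condF l b P Q R hb _ ih =>
    intro G hG
    cases G with
    | cond b G1 G2 =>
      simp only [Proc.psubst, Proc.cond.injEq] at hG
      obtain ⟨rfl, rfl, hG⟩ := hG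
      obtain ⟨G', Q', h1, h2, h3⟩ := ih G2 hG
      exact ⟨G', Q', .condF _ _ _ _ _ hb h1, h2, h3⟩
    | _ => cases hG

theorem PTime.fix_congr {A B : Proc S 0 1}
    (hAB : ∀ R : Proc S 0 0, PBisim (A.psubst fun _ => R) (B.psubst fun _ => R))
    {X P' : Proc S 0 0} (h : PTime X P') :
    ∀ G : Proc S 0 1, X = G.psubst (fun _ => .fix A) →
      ∃ (G' : Proc S 0 1) (Q' : Proc S 0 0), PTime (G.psubst fun _ => .fix B) Q' ∧
        P' = G'.psubst (fun _ => .fix A) ∧ PBisim (G'.psubst fun _ => .fix B) Q' := by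
  induction h with
  | timenil =>
    intro G hG
    cases G with
    | nil => exact ⟨.nil, _, .timenil, rfl, PBisim.refl _⟩
    | _ => cases hG
  | delay P =>
    intro G hG
    cases G with
    | sleep G1 =>
      cases hG
      exact ⟨G1, _, .delay _, rfl, PBisim.refl _⟩
    | _ => cases hG
  | timeout R Q h =>
    intro G hG
    cases h with
    | send c e P Q =>
      cases G with
      | send c e G1 G2 =>
        cases hG
        exact ⟨G2, _, .timeout _ _ (.send _ _ _ _), rfl, PBisim.refl _⟩
      | _ => cases hG
    | recv c P Q =>
      cases G with
      | recv c G1 G2 =>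
        cases hG
        exact ⟨G2, _, .timeout _ _ (.recv _ _ _), rfl, PBisim.refl _⟩
      | _ => cases hG
  | timepar P P' Q Q' _ _ hn ih1 ih2 =>
    intro G hG
    cases G with
    | par G1 G2 =>
      simp only [Proc.psubst, Proc.par.injEq] at hG
      obtain ⟨G1', Q1, h1, rfl, h3⟩ := ih1 G1 hG.1
      obtain ⟨G2', Q2, h4, rfl, h6⟩ := ih2 G2 hG.2
      refine ⟨.par G1' G2', _, .timepar _ _ _ _ h1 h4 ?_, rfl, h3.par h6⟩
      -- The negative premise is transferred by the untimed result with `A` and `B` exchanged.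
      rintro ⟨T, hT⟩
      obtain ⟨_, U, hU, -⟩ := PTrans.fix_congr (fun R => (hAB R).symm) hT (.par G1 G2) rfl
      rw [hG.1, hG.2] at hn
      exact hn ⟨U, hU⟩
    | _ => cases hG
  | fix P Q _ ih =>
    intro G hG
    cases G with
    | fix G1 =>
      simp only [Proc.psubst, Proc.fix.injEq] at hG
      subst hG
      obtain ⟨G', Q', h1, h2, h3⟩ := ih G1.unfold (Proc.unfold_psubst _ _).symm
      exact ⟨G', Q', .fix _ _ (Proc.unfold_psubst (fun _ => .fix B) G1 ▸ h1), h2, h3⟩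
    | pvar X =>
      cases hG
      obtain ⟨G', Q', h1, h2, h3⟩ := ih A A.unfold_eq_psubst
      obtain ⟨Q2, h4, h5⟩ := (hAB (.fix B)).simTime h1
      exact ⟨G', Q2, .fix _ _ (B.unfold_eq_psubst ▸ h4), h2, h3.trans h5⟩
    | _ => cases hG
  | condT b P Q R hb _ ih =>
    intro G hG
    cases G with
    | cond b G1 G2 =>
      simp only [Proc.psubst, Proc.cond.injEq] at hG
      obtain ⟨rfl, hG, rfl⟩ := hG
      obtain ⟨G', Q', h1, h2, h3⟩ := ih G1 hG
      exact ⟨G', Q', .condT _ _ _ _ hb h1, h2, h3⟩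
    | _ => cases hG
  | condF b P Q R hb _ ih =>
    intro G hG
    cases G with
    | cond b G1 G2 =>
      simp only [Proc.psubst, Proc.cond.injEq] at hG
      obtain ⟨rfl, rfl, hG⟩ := hG
      obtain ⟨G', Q', h1, h2, h3⟩ := ih G2 hG
      exact ⟨G', Q', .condF _ _ _ _ hb h1, h2, h3⟩
    | _ => cases hG

/-- The pairs `G{fix A}`, `G{fix B}` form a bisimulation only up to bisimilarity, because passing
from `A{fix B}` to `B{fix B}` leaves the exact shape of the context. -/
theorem PBisim.fix {A B : Proc S 0 1}
    (hAB : ∀ R : Proc S 0 0, PBisim (A.psubst fun _ => R) (B.psubst fun _ => R)) :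
    PBisim (.fix A) (.fix B) := by
  let R : Proc S 0 0 → Proc S 0 0 → Prop := fun X Y => ∃ A B G : Proc S 0 1,
    (∀ R : Proc S 0 0, PBisim (A.psubst fun _ => R) (B.psubst fun _ => R)) ∧
      X = G.psubst (fun _ => .fix A) ∧ Y = G.psubst fun _ => .fix B
  refine PBisim.of_upto R ?_ ?_ ?_ ⟨A, B, .pvar 0, hAB, rfl, rfl⟩
  · rintro X Y ⟨A, B, G, h, rfl, rfl⟩
    exact ⟨B, A, G, fun R => (h R).symm, rfl, rfl⟩
  · rintro X Y ⟨A, B, G, h, rfl, rfl⟩ l P' hP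
    obtain ⟨G', Q', h1, rfl, h3⟩ := PTrans.fix_congr h hP G rfl
    exact ⟨Q', h1, _, ⟨_, PBisim.refl _, A, B, G', h, rfl, rfl⟩, h3⟩
  · rintro X Y ⟨A, B, G, h, rfl, rfl⟩ P' hP
    obtain ⟨G', Q', h1, rfl, h3⟩ := PTime.fix_congr h hP G rfl
    exact ⟨Q', h1, _, ⟨_, PBisim.refl _, A, B, G', h, rfl, rfl⟩, h3⟩

/-! ### Structurally congruent processes are strongly bisimilar -/

/-- The closed instance of a process under assignments of its data and process variables. -/
def Proc.close {n m : ℕ} (f : Fin n → S.Val) (g : Fin m → Proc S 0 0) (P : Proc S n m) :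
    Proc S 0 0 := (P.subst fun i => .val (f i)).psubst g

theorem Proc.close_binder {n m : ℕ} (f : Fin n → S.Val) (g : Fin m → Proc S 0 0)
    (P : Proc S (n + 1) m) (v : S.Val) :
    ((P.subst (liftTerm fun i => .val (f i))).psubst fun X => (g X).weaken).inst v =
      P.close (Fin.cases v f : Fin (n + 1) → S.Val) g := by
  rw [Proc.inst_psubst, Proc.inst_subst_lift, Proc.close]
  congr 2
  funext i
  exact Fin.cases rfl (fun i => rfl) i

theorem Proc.close_psubst_const {n m : ℕ} (f : Fin n → S.Val) (g : Fin m → Proc S 0 0)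
    (P : Proc S n (m + 1)) (R : Proc S 0 0) :
    (((P.subst fun i => .val (f i)).psubst (liftProc g)).psubst fun _ => R) =
      P.close f (Fin.cases R g : Fin (m + 1) → Proc S 0 0) := by
  rw [Proc.close, ← Proc.psubst_liftProc_cons]
  congr 1
  funext X
  exact Fin.cases rfl (fun i => i.elim0) X

/-- Structural congruence acts on open processes, so the induction carries all closed instances.
Under a data binder the instance is extended by the value received; under `fix` it is extended by an
arbitrary closed process, which is the hypothesis of `PBisim.fix`. -/
theorem PCong.close {n m : ℕ} {P Q : Proc S n m} (h : PCong P Q) :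
    ∀ (f : Fin n → S.Val) (g : Fin m → Proc S 0 0), PBisim (P.close f g) (Q.close f g) := by
  have eval : ∀ {n : ℕ} (b : Guard S n) (f : Fin n → S.Val),
      (b.subst fun i => .val (f i)).eval Fin.elim0 = b.eval f := fun b f => b.eval_subst _ _
  induction h with
  | refl P => exact fun f g => PBisim.refl _
  | symm _ ih => exact fun f g => (ih f g).symm
  | trans _ _ ih1 ih2 => exact fun f g => (ih1 f g).trans (ih2 f g)
  | par_nil P => exact fun f g => PBisim.par_nil _
  | par_comm P Q => exact fun f g => PBisim.par_comm _ _
  | par_assoc P Q R => exact fun f g => PBisim.par_assoc _ _ _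
  | cond_true b P Q hb =>
    exact fun f g => PBisim.cond_true _ _ ((eval b f).trans (hb f))
  | cond_false b P Q hb =>
    exact fun f g => PBisim.cond_false _ _ ((eval b f).trans (hb f))
  | unfold P =>
    intro f g
    have := PBisim.unfold ((P.subst fun i => .val (f i)).psubst (liftProc g))
    rwa [← Proc.unfold_psubst, ← Proc.unfold_subst] at this
  | congr_sleep _ ih => exact fun f g => (ih f g).sleep
  | congr_pos _ ih =>
    intro f g
    refine PBisim.pos fun v => ?_
    rw [Proc.close_binder, Proc.close_binder]
    exact ih _ g
  | congr_sense s _ ih =>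
    intro f g
    refine PBisim.sense s fun v => ?_
    rw [Proc.close_binder, Proc.close_binder]
    exact ih _ g
  | congr_write a e _ ih => exact fun f g => (ih f g).write a _
  | congr_par _ _ ih1 ih2 => exact fun f g => (ih1 f g).par (ih2 f g)
  | congr_send c e _ _ ih1 ih2 => exact fun f g => (ih1 f g).send c _ (ih2 f g)
  | congr_recv c _ _ ih1 ih2 =>
    intro f g
    refine PBisim.recv c (fun v => ?_) (ih2 f g)
    rw [Proc.close_binder, Proc.close_binder]
    exact ih1 _ g
  | congr_cond b _ _ ih1 ih2 => exact fun f g => (ih1 f g).cond _ (ih2 f g)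
  | congr_fix _ ih =>
    intro f g
    refine PBisim.fix fun R => ?_
    rw [Proc.close_psubst_const, Proc.close_psubst_const]
    exact ih f _

theorem PCong.pbisim {P Q : Proc S 0 0} (h : PCong P Q) : PBisim P Q := by
  have key : ∀ P : Proc S 0 0, P.close Fin.elim0 Fin.elim0 = P := by
    intro P
    have h1 : (fun i => .val ((Fin.elim0 : Fin 0 → S.Val) i)) = (Term.var : Fin 0 → Term S 0) :=
      funext fun i => i.elim0
    have h2 : (Fin.elim0 : Fin 0 → Proc S 0 0) = Proc.pvar := funext fun i => i.elim0
    rw [Proc.close, h1, h2, Proc.subst_var, Proc.psubst_pvar]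
  simpa only [key] using h.close Fin.elim0 Fin.elim0

/-! ### Bisimilarity under hidden channels -/

/-- The label is not a communication along a channel in `H`. -/
def PLabel.Avoids (H : Set S.Chan) (l : PLabel S) : Prop := ∀ c ∈ H, ¬ l.On c

/-- Strong bisimulations on processes with hidden channels. -/
structure IsHBisim (R : Set S.Chan → Proc S 0 0 → Set S.Chan → Proc S 0 0 → Prop) : Prop where
  symm : ∀ H P K Q, R H P K Q → R K Q H P
  trans : ∀ H P K Q, R H P K Q → ∀ l P', PTrans l P P' → l.Avoids H →
    ∃ Q', PTrans l Q Q' ∧ l.Avoids K ∧ R H P' K Q'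
  time : ∀ H P K Q, R H P K Q → ∀ P', PTime P P' → ∃ Q', PTime Q Q' ∧ R H P' K Q'

/-- Strong bisimilarity of processes with hidden channels. -/
def HBisim (H : Set S.Chan) (P : Proc S 0 0) (K : Set S.Chan) (Q : Proc S 0 0) : Prop :=
  ∃ R, IsHBisim R ∧ R H P K Q

theorem PBisim.hbisim {P Q : Proc S 0 0} (h : PBisim P Q) (H : Set S.Chan) :
    HBisim H P H Q := by
  refine ⟨fun H P K Q => H = K ∧ PBisim P Q, ⟨?_, ?_, ?_⟩, rfl, h⟩
  · rintro H P K Q ⟨rfl, h⟩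
    exact ⟨rfl, h.symm⟩
  · rintro H P K Q ⟨rfl, h⟩ l P' hP hl
    obtain ⟨Q', hQ, h'⟩ := h.sim hP
    exact ⟨Q', hQ, hl, rfl, h'⟩
  · rintro H P K Q ⟨rfl, h⟩ P' hP
    obtain ⟨Q', hQ, h'⟩ := h.simTime hP
    exact ⟨Q', hQ, rfl, h'⟩

theorem HBisim.pbisim {P Q : Proc S 0 0} (h : HBisim ∅ P ∅ Q) : PBisim P Q := by
  obtain ⟨R, hR, h⟩ := h
  refine ⟨fun P Q => R ∅ P ∅ Q, ⟨fun P Q h => hR.symm _ _ _ _ h, ?_, ?_⟩, h⟩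
  · intro P Q h l P' hP
    obtain ⟨Q', hQ, -, h'⟩ := hR.trans _ _ _ _ h l P' hP (fun _ h => h.elim)
    exact ⟨Q', hQ, h'⟩
  · intro P Q h P' hP
    exact hR.time _ _ _ _ h P' hP

theorem HBisim.symm {H K : Set S.Chan} {P Q : Proc S 0 0} :
    HBisim H P K Q → HBisim K Q H P :=
  fun ⟨R, hR, h⟩ => ⟨R, hR, hR.symm _ _ _ _ h⟩

theorem HBisim.trans {H K L : Set S.Chan} {P Q T : Proc S 0 0} (h : HBisim H P K Q)
    (h' : HBisim K Q L T) : HBisim H P L T := by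
  obtain ⟨R, hR, h⟩ := h
  obtain ⟨R', hR', h'⟩ := h'
  refine ⟨fun H P L T => ∃ K Q, R H P K Q ∧ R' K Q L T ∨ R' H P K Q ∧ R K Q L T,
    ⟨?_, ?_, ?_⟩, K, Q, Or.inl ⟨h, h'⟩⟩
  · rintro H P L T ⟨K, Q, ⟨h, h'⟩ | ⟨h, h'⟩⟩
    · exact ⟨K, Q, Or.inr ⟨hR'.symm _ _ _ _ h', hR.symm _ _ _ _ h⟩⟩
    · exact ⟨K, Q, Or.inl ⟨hR.symm _ _ _ _ h', hR'.symm _ _ _ _ h⟩⟩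
  · rintro H P L T ⟨K, Q, ⟨h, h'⟩ | ⟨h, h'⟩⟩ l P' hP hl
    · obtain ⟨Q', hQ, hl', h2⟩ := hR.trans _ _ _ _ h l P' hP hl
      obtain ⟨T', hT, hl'', h2'⟩ := hR'.trans _ _ _ _ h' l Q' hQ hl'
      exact ⟨T', hT, hl'', K, Q', Or.inl ⟨h2, h2'⟩⟩
    · obtain ⟨Q', hQ, hl', h2⟩ := hR'.trans _ _ _ _ h l P' hP hl
      obtain ⟨T', hT, hl'', h2'⟩ := hR.trans _ _ _ _ h' l Q' hQ hl'
      exact ⟨T', hT, hl'', K, Q', Or.inr ⟨h2, h2'⟩⟩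
  · rintro H P L T ⟨K, Q, ⟨h, h'⟩ | ⟨h, h'⟩⟩ P' hP
    · obtain ⟨Q', hQ, h2⟩ := hR.time _ _ _ _ h P' hP
      obtain ⟨T', hT, h2'⟩ := hR'.time _ _ _ _ h' Q' hQ
      exact ⟨T', hT, K, Q', Or.inl ⟨h2, h2'⟩⟩
    · obtain ⟨Q', hQ, h2⟩ := hR'.time _ _ _ _ h P' hP
      obtain ⟨T', hT, h2'⟩ := hR.time _ _ _ _ h' Q' hQ
      exact ⟨T', hT, K, Q', Or.inr ⟨h2, h2'⟩⟩

theorem PLabel.avoids_insert {c : S.Chan} {H : Set S.Chan} {l : PLabel S} :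
    l.Avoids (insert c H) ↔ ¬ l.On c ∧ l.Avoids H := by
  simp [PLabel.Avoids]

theorem HBisim.insert {H K : Set S.Chan} {P Q : Proc S 0 0} (h : HBisim H P K Q)
    (c : S.Chan) : HBisim (insert c H) P (insert c K) Q := by
  obtain ⟨R, hR, h⟩ := h
  refine ⟨fun H' P K' Q => ∃ H K, H' = Insert.insert c H ∧ K' = Insert.insert c K ∧ R H P K Q,
    ⟨?_, ?_, ?_⟩, H, K, rfl, rfl, h⟩
  · rintro _ P _ Q ⟨H, K, rfl, rfl, h⟩
    exact ⟨K, H, rfl, rfl, hR.symm _ _ _ _ h⟩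
  · rintro _ P _ Q ⟨H, K, rfl, rfl, h⟩ l P' hP hl
    rw [PLabel.avoids_insert] at hl
    obtain ⟨Q', hQ, hl', h'⟩ := hR.trans _ _ _ _ h l P' hP hl.2
    exact ⟨Q', hQ, PLabel.avoids_insert.2 ⟨hl.1, hl'⟩, H, K, rfl, rfl, h'⟩
  · rintro _ P _ Q ⟨H, K, rfl, rfl, h⟩ P' hP
    obtain ⟨Q', hQ, h'⟩ := hR.time _ _ _ _ h P' hP
    exact ⟨Q', hQ, H, K, rfl, rfl, h'⟩

/-- Hiding excludes no further transition if the channel is already hidden or does not occur, and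
transitions create no occurrences. The relation is stated symmetrically in the two hidden sets,
which agree once `c` is added to both. -/
theorem HBisim.insert_fresh {H : Set S.Chan} {P : Proc S 0 0} {c : S.Chan}
    (h : c ∈ H ∨ ¬ P.HasChan c) : HBisim (Insert.insert c H) P H P := by
  refine ⟨fun H P K Q => P = Q ∧ (c ∈ H ∩ K ∨ ¬ P.HasChan c) ∧
    (Insert.insert c H = Insert.insert c K), ⟨?_, ?_, ?_⟩,
    rfl, h.imp_left fun h => ⟨Set.mem_insert _ _, h⟩, by simp⟩
  · rintro H P K _ ⟨rfl, h, h'⟩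
    exact ⟨rfl, h.imp_left And.symm, h'.symm⟩
  · rintro H P K _ ⟨rfl, h, h'⟩ l P' hP hl
    refine ⟨P', hP, fun d hd hon => ?_, rfl, h.imp_right fun h h2 => h ?_, h'⟩
    · have hd' : d ∈ Insert.insert c H := h' ▸ Set.mem_insert_of_mem c hd
      rcases hd' with rfl | hd'
      · rcases h with h | h
        · exact hl d h.1 hon
        · exact h (hP.hasChan_of_on hon)
      · exact hl d hd' hon
    · rw [Proc.hasChan_iff] at h2 ⊢
      exact hP.uses h2
  · rintro H P K _ ⟨rfl, h, h'⟩ P' hP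
    refine ⟨P', hP, rfl, h.imp_right fun h h2 => h ?_, h'⟩
    rw [Proc.hasChan_iff] at h2 ⊢
    exact hP.uses h2

/-! ### Renaming of channels in processes -/

/-- The renaming of `c` to `c'` on channels. -/
noncomputable def chanRen (c c' d : S.Chan) : S.Chan := open Classical in if d = c then c' else d

theorem chanRen_self (c c' : S.Chan) : chanRen c c' c = c' := by simp [chanRen]

theorem chanRen_of_ne {c d : S.Chan} (c' : S.Chan) (h : d ≠ c) : chanRen c c' d = d := by
  simp [chanRen, h]

theorem rng_chanRen {c c' : S.Chan} (h : S.rng c' = S.rng c) (d : S.Chan) :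
    S.rng (chanRen c c' d) = S.rng d := by
  by_cases hd : d = c
  · rw [hd, chanRen_self, h]
  · rw [chanRen_of_ne c' hd]

theorem chanRen_injective {c c' d e : S.Chan} (hd : d ≠ c') (he : e ≠ c')
    (h : chanRen c c' d = chanRen c c' e) : d = e := by
  by_cases h1 : d = c <;> by_cases h2 : e = c
  · rw [h1, h2]
  · rw [h1, chanRen_self, chanRen_of_ne c' h2] at h
    exact absurd h.symm he
  · rw [h2, chanRen_self, chanRen_of_ne c' h1] at h
    exact absurd h hd
  · rwa [chanRen_of_ne c' h1, chanRen_of_ne c' h2] at h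

section renameChan

variable (c c' : S.Chan)

theorem Proc.renameChan_subst {n m : ℕ} (P : Proc S n m) :
    ∀ {n' : ℕ} (f : Fin n → Term S n'),
      (P.subst f).renameChan c c' = (P.renameChan c c').subst f := by
  induction P <;> simp_all [Proc.subst, Proc.renameChan]

theorem Proc.renameChan_prename {n m : ℕ} (P : Proc S n m) :
    ∀ {m' : ℕ} (r : Fin m → Fin m'),
      (P.prename r).renameChan c c' = (P.renameChan c c').prename r := by
  induction P <;> simp_all [Proc.prename, Proc.renameChan]

theorem liftProc_renameChan {n m m' : ℕ} (g : Fin m → Proc S n m') :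
    (fun X => (liftProc g X).renameChan c c') = liftProc fun X => (g X).renameChan c c' := by
  funext X
  refine Fin.cases rfl (fun i => ?_) X
  exact Proc.renameChan_prename c c' (g i) Fin.succ

theorem Proc.renameChan_psubst {n m : ℕ} (P : Proc S n m) :
    ∀ {m' : ℕ} (g : Fin m → Proc S n m'), (P.psubst g).renameChan c c' =
      (P.renameChan c c').psubst fun X => (g X).renameChan c c' := by
  induction P <;> simp_all [Proc.psubst, Proc.renameChan, Proc.weaken, Proc.renameChan_subst,
    liftProc_renameChan]

theorem Proc.renameChan_inst {n m : ℕ} (P : Proc S (n + 1) m) (v : S.Val) :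
    (P.inst v).renameChan c c' = (P.renameChan c c').inst v := P.renameChan_subst c c' _

theorem Proc.renameChan_unfold {n m : ℕ} (P : Proc S n (m + 1)) :
    P.unfold.renameChan c c' = (P.renameChan c c').unfold := by
  rw [Proc.unfold, Proc.renameChan_psubst, Proc.unfold]
  congr 1
  funext X
  exact Fin.cases rfl (fun i => rfl) X

theorem Proc.renameChan_eq {n m : ℕ} (P : Proc S n m) : P.renameChan c c = P := by
  induction P <;> simp_all [Proc.renameChan]

variable {c c'}

theorem Proc.not_hasChan_renameChan (hc : c ≠ c') {n m : ℕ} (P : Proc S n m) :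
    ¬ (P.renameChan c c').HasChan c := by
  induction P with
  | send d e P Q ihP ihQ =>
    rintro (h | h | h)
    · split_ifs at h with h1
      exacts [hc h.symm, h1 h]
    exacts [ihP h, ihQ h]
  | recv d P Q ihP ihQ =>
    rintro (h | h | h)
    · split_ifs at h with h1
      exacts [hc h.symm, h1 h]
    exacts [ihP h, ihQ h]
  | _ => simp_all [Proc.renameChan, Proc.HasChan]

theorem Proc.renameChan_renameChan {n m : ℕ} (P : Proc S n m) :
    ¬ P.HasChan c' → (P.renameChan c c').renameChan c' c = P := by
  induction P with
  | send d e P Q ihP ihQ =>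
    intro h
    simp only [Proc.HasChan, not_or] at h
    simp only [Proc.renameChan, ihP h.2.1, ihQ h.2.2, Proc.send.injEq, and_true]
    split_ifs <;> simp_all
  | recv d P Q ihP ihQ =>
    intro h
    simp only [Proc.HasChan, not_or] at h
    simp only [Proc.renameChan, ihP h.2.1, ihQ h.2.2, Proc.recv.injEq, and_true]
    split_ifs <;> simp_all
  | _ => simp_all [Proc.renameChan, Proc.HasChan]

end renameChan

/-- Renaming of a channel in a process label. -/
noncomputable def PLabel.rename (c c' : S.Chan) : PLabel S → PLabel S
  | .send d v => .send (chanRen c c' d) v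
  | .recv d v => .recv (chanRen c c' d) v
  | l => l

theorem PLabel.rename_of_not_on {c : S.Chan} (c' : S.Chan) {l : PLabel S} (h : ¬ l.On c) :
    l.rename c c' = l := by
  cases l with
  | send d v => exact congrArg (PLabel.send · v) (chanRen_of_ne c' h)
  | recv d v => exact congrArg (PLabel.recv · v) (chanRen_of_ne c' h)
  | _ => rfl

theorem PLabel.rename_rename {c c' : S.Chan} {l : PLabel S} (h : ¬ l.On c) :
    (l.rename c' c).rename c c' = l := by
  cases l with
  | send d v =>
    by_cases hd : d = c'
    · simp only [PLabel.rename, hd, chanRen_self]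
    · simp only [PLabel.rename, chanRen_of_ne c hd, chanRen_of_ne c' (show d ≠ c from h)]
  | recv d v =>
    by_cases hd : d = c'
    · simp only [PLabel.rename, hd, chanRen_self]
    · simp only [PLabel.rename, chanRen_of_ne c hd, chanRen_of_ne c' (show d ≠ c from h)]
  | _ => rfl

theorem PLabel.rename_eq (c : S.Chan) (l : PLabel S) : l.rename c c = l := by
  have : ∀ d, chanRen c c d = d := fun d => by
    by_cases h : d = c
    · rw [h, chanRen_self]
    · exact chanRen_of_ne c h
  cases l <;> simp [PLabel.rename, this]

theorem PLabel.not_on_of_rename {c c' : S.Chan} {l : PLabel S} (h : ¬ (l.rename c c').On c') :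
    ¬ l.On c := by
  cases l with
  | send d v => exact fun hd => h ((congrArg _ hd).trans (chanRen_self c c'))
  | recv d v => exact fun hd => h ((congrArg _ hd).trans (chanRen_self c c'))
  | _ => exact id

theorem PTrans.rename {c c' : S.Chan} (hc : S.rng c' = S.rng c) {l : PLabel S}
    {P P' : Proc S 0 0} (h : PTrans l P P') :
    PTrans (l.rename c c') (P.renameChan c c') (P'.renameChan c c') := by
  induction h with
  | snd d v P Q => exact .snd _ _ _ _
  | rcv d v P Q =>
    rw [Proc.renameChan_inst]
    exact .rcv _ _ _ _
  | sensor s v P =>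
    rw [Proc.renameChan_inst]
    exact .sensor _ _ _
  | actuator a v P => exact .actuator _ _ _
  | pos h P =>
    rw [Proc.renameChan_inst]
    exact .pos _ _
  | comL d v P P' Q Q' _ _ hd ih1 ih2 =>
    exact .comL _ v _ _ _ _ ih1 ih2 ((rng_chanRen hc d).trans hd)
  | comR d v P P' Q Q' _ _ hd ih1 ih2 =>
    exact .comR _ v _ _ _ _ ih1 ih2 ((rng_chanRen hc d).trans hd)
  | parL l P P' Q _ ih => exact .parL _ _ _ _ ih
  | parR l P Q Q' _ ih => exact .parR _ _ _ _ ih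
  | fix l P Q _ ih =>
    rw [Proc.renameChan_unfold] at ih
    exact .fix _ _ _ ih
  | condT l b P Q R hb _ ih => exact .condT _ _ _ _ _ hb ih
  | condF l b P Q R hb _ ih => exact .condF _ _ _ _ _ hb ih

/-- If `c ≠ c'`, the renamed process no longer contains `c`, so renaming back is again a fresh
renaming and restores `P`; the transition is pulled back along it. -/
theorem PTrans.of_rename {c c' : S.Chan} (hc : S.rng c' = S.rng c) {l : PLabel S}
    {P X : Proc S 0 0} (hP : ¬ P.HasChan c') (h : PTrans l (P.renameChan c c') X) :
    ∃ l₀ P', PTrans l₀ P P' ∧ l = l₀.rename c c' ∧ X = P'.renameChan c c' := by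
  by_cases hcc : c = c'
  · subst hcc
    rw [Proc.renameChan_eq] at h
    exact ⟨l, X, h, (PLabel.rename_eq _ _).symm, (X.renameChan_eq c).symm⟩
  · have hX : ¬ X.HasChan c := fun hX => by
      rw [Proc.hasChan_iff] at hX
      exact P.not_hasChan_renameChan hcc ((Proc.hasChan_iff _ _).2 (h.uses hX))
    have hl : ¬ l.On c := fun hl => P.not_hasChan_renameChan hcc (h.hasChan_of_on hl)
    have h' := h.rename (c := c') (c' := c) hc.symm
    rw [Proc.renameChan_renameChan P hP] at h'
    exact ⟨_, _, h', (PLabel.rename_rename hl).symm, (X.renameChan_renameChan hX).symm⟩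

theorem PTrans.not_tau_rename {c c' : S.Chan} (hc : S.rng c' = S.rng c)
    {P : Proc S 0 0} (hP : ¬ P.HasChan c') (h : ¬ ∃ X, PTrans .tau P X) :
    ¬ ∃ X, PTrans .tau (P.renameChan c c') X := by
  rintro ⟨X, hX⟩
  obtain ⟨l, P', h1, h2, -⟩ := hX.of_rename hc hP
  cases l <;> simp only [PLabel.rename, reduceCtorEq] at h2
  exact h ⟨P', h1⟩

/-- Unlike in `PTrans.rename`, freshness of `c'` is needed: identifying two channels could create a
communication, which would block time. -/
theorem PTime.rename {c c' : S.Chan} (hc : S.rng c' = S.rng c) {P P' : Proc S 0 0}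
    (h : PTime P P') : ¬ P.HasChan c' → PTime (P.renameChan c c') (P'.renameChan c c') := by
  induction h with
  | timenil => exact fun _ => .timenil
  | delay P => exact fun _ => .delay _
  | timeout R Q h =>
    intro _
    cases h with
    | send d e P Q => exact .timeout _ _ (.send _ _ _ _)
    | recv d P Q => exact .timeout _ _ (.recv _ _ _)
  | timepar P P' Q Q' _ _ hn ih1 ih2 =>
    exact fun h => .timepar _ _ _ _ (ih1 fun h' => h (Or.inl h')) (ih2 fun h' => h (Or.inr h'))
      (PTrans.not_tau_rename hc h hn)
  | fix P Q _ ih =>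
    intro h
    rw [Proc.renameChan_unfold] at ih
    refine .fix _ _ (ih fun h' => h ?_)
    rw [Proc.hasChan_iff] at h' ⊢
    exact Proc.uses_unfold h'
  | condT b P Q R hb _ ih => exact fun h => .condT _ _ _ _ hb (ih fun h' => h (Or.inl h'))
  | condF b P Q R hb _ ih => exact fun h => .condF _ _ _ _ hb (ih fun h' => h (Or.inr h'))

theorem PTime.of_rename {c c' : S.Chan} (hc : S.rng c' = S.rng c)
    {P X : Proc S 0 0} (hP : ¬ P.HasChan c') (h : PTime (P.renameChan c c') X) :
    ∃ P', PTime P P' ∧ X = P'.renameChan c c' := by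
  by_cases hcc : c = c'
  · subst hcc
    rw [Proc.renameChan_eq] at h
    exact ⟨X, h, (X.renameChan_eq c).symm⟩
  · have hX : ¬ X.HasChan c := fun hX => by
      rw [Proc.hasChan_iff] at hX
      exact P.not_hasChan_renameChan hcc ((Proc.hasChan_iff _ _).2 (h.uses hX))
    have h' := h.rename (c := c') (c' := c) hc.symm (P.not_hasChan_renameChan hcc)
    rw [Proc.renameChan_renameChan P hP] at h'
    exact ⟨_, h', (X.renameChan_renameChan hX).symm⟩

/-- Labels on the channel being renamed are hidden on either side, and all other labels are fixed by
the renaming. Freshness of `c'` persists because transitions create no channel names. -/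
theorem HBisim.rename {c c' : S.Chan} (hc : S.rng c' = S.rng c) {P : Proc S 0 0}
    (hP : ¬ P.HasChan c') (H : Set S.Chan) :
    HBisim (Insert.insert c H) P (Insert.insert c' H) (P.renameChan c c') := by
  refine ⟨fun H₁ P K Q => ∃ H,
    (H₁ = Insert.insert c H ∧ K = Insert.insert c' H ∧ ¬ P.HasChan c' ∧ Q = P.renameChan c c') ∨
    (K = Insert.insert c H ∧ H₁ = Insert.insert c' H ∧ ¬ Q.HasChan c' ∧ P = Q.renameChan c c'),
    ⟨?_, ?_, ?_⟩, H, Or.inl ⟨rfl, rfl, hP, rfl⟩⟩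
  · rintro _ _ _ _ ⟨H, h⟩
    exact ⟨H, h.symm⟩
  · rintro _ _ _ _ ⟨H, ⟨rfl, rfl, hP, rfl⟩ | ⟨rfl, rfl, hP, rfl⟩⟩ l P' h hl
    · rename_i P
      rw [PLabel.avoids_insert] at hl
      have h' := h.rename hc
      rw [PLabel.rename_of_not_on c' hl.1] at h'
      refine ⟨_, h', PLabel.avoids_insert.2 ⟨fun hon => hP (h.hasChan_of_on hon), hl.2⟩, H,
        Or.inl ⟨rfl, rfl, fun h2 => hP ?_, rfl⟩⟩
      rw [Proc.hasChan_iff] at h2 ⊢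
      exact h.uses h2
    · rename_i P
      rw [PLabel.avoids_insert] at hl
      obtain ⟨l₀, Q, h1, rfl, rfl⟩ := h.of_rename hc hP
      have h0 := PLabel.not_on_of_rename hl.1
      rw [PLabel.rename_of_not_on c' h0] at hl ⊢
      refine ⟨Q, h1, PLabel.avoids_insert.2 ⟨h0, hl.2⟩, H,
        Or.inr ⟨rfl, rfl, fun h2 => hP ?_, rfl⟩⟩
      rw [Proc.hasChan_iff] at h2 ⊢
      exact h1.uses h2
  · rintro _ _ _ _ ⟨H, ⟨rfl, rfl, hP, rfl⟩ | ⟨rfl, rfl, hP, rfl⟩⟩ P' h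
    · refine ⟨_, h.rename hc hP, H, Or.inl ⟨rfl, rfl, fun h2 => hP ?_, rfl⟩⟩
      rw [Proc.hasChan_iff] at h2 ⊢
      exact h.uses h2
    · obtain ⟨Q, h1, rfl⟩ := h.of_rename hc hP
      refine ⟨Q, h1, H, Or.inr ⟨rfl, rfl, fun h2 => hP ?_, rfl⟩⟩
      rw [Proc.hasChan_iff] at h2 ⊢
      exact h1.uses h2

/-! ### Channels and transitions of networks -/

theorem Net.FreeChan.hasChan {c : S.Chan} {M : Net S} (h : M.FreeChan c) : M.HasChan c := by
  induction M with
  | zero => exact h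
  | node d => exact h
  | par M N ihM ihN => exact Or.imp ihM ihN h
  | res d M ih => exact Or.inr (ih h.2)

theorem PTrans.hasChan {c : S.Chan} {l : PLabel S} {P P' : Proc S 0 0} (h : PTrans l P P')
    (h' : P'.HasChan c) : P.HasChan c := by
  rw [Proc.hasChan_iff] at h' ⊢
  exact h.uses h'

theorem PTime.hasChan {c : S.Chan} {P P' : Proc S 0 0} (h : PTime P P')
    (h' : P'.HasChan c) : P.HasChan c := by
  rw [Proc.hasChan_iff] at h' ⊢
  exact h.uses h'

theorem NTrans.hasChan {c : S.Chan} {l : NLabel S} {M M' : Net S} (h : NTrans l M M') :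
    M'.HasChan c → M.HasChan c := by
  induction h with
  | pos n I P P' μ h hP => exact hP.hasChan
  | sensread n I P P' μ h s v _ hP => exact hP.hasChan
  | actunchg n I P P' μ h a v _ hP => exact hP.hasChan
  | loccom n I P P' μ h hP => exact hP.hasChan
  | actchg n I P P' μ h a v w _ _ hP => exact hP.hasChan
  | snd n I P P' μ h d v hP _ => exact hP.hasChan
  | rcv n I P P' μ h d v hP _ => exact hP.hasChan
  | glbcomL _ _ _ _ _ _ _ _ _ _ _ ih1 ih2 => exact Or.imp ih1 ih2
  | glbcomR _ _ _ _ _ _ _ _ _ _ _ ih1 ih2 => exact Or.imp ih1 ih2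
  | parL _ _ _ _ _ ih => exact Or.imp_left ih
  | parR _ _ _ _ _ ih => exact Or.imp_right ih
  | res _ _ _ _ _ _ ih => exact Or.imp_right ih

theorem NTrans.freeChan {c : S.Chan} {l : NLabel S} {M M' : Net S} (h : NTrans l M M') :
    M'.FreeChan c → M.FreeChan c := by
  induction h with
  | pos n I P P' μ h hP => exact hP.hasChan
  | sensread n I P P' μ h s v _ hP => exact hP.hasChan
  | actunchg n I P P' μ h a v _ hP => exact hP.hasChan
  | loccom n I P P' μ h hP => exact hP.hasChan
  | actchg n I P P' μ h a v w _ _ hP => exact hP.hasChan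
  | snd n I P P' μ h d v hP _ => exact hP.hasChan
  | rcv n I P P' μ h d v hP _ => exact hP.hasChan
  | glbcomL _ _ _ _ _ _ _ _ _ _ _ ih1 ih2 => exact Or.imp ih1 ih2
  | glbcomR _ _ _ _ _ _ _ _ _ _ _ ih1 ih2 => exact Or.imp ih1 ih2
  | parL _ _ _ _ _ ih => exact Or.imp_left ih
  | parR _ _ _ _ _ ih => exact Or.imp_right ih
  | res _ _ _ _ _ _ ih => exact And.imp_right ih

theorem NTime.hasChan {c : S.Chan} {M M' : Net S} (h : NTime M M') :
    M'.HasChan c → M.HasChan c := by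
  induction h with
  | timestat n I P P' h hP _ => exact hP.hasChan
  | timemob n I P P' h k hP _ _ => exact hP.hasChan
  | timepar _ _ _ _ _ _ _ ih1 ih2 => exact Or.imp ih1 ih2
  | timezero => exact id
  | res _ _ _ _ ih => exact Or.imp_right ih

theorem NTime.freeChan {c : S.Chan} {M M' : Net S} (h : NTime M M') :
    M'.FreeChan c → M.FreeChan c := by
  induction h with
  | timestat n I P P' h hP _ => exact hP.hasChan
  | timemob n I P P' h k hP _ _ => exact hP.hasChan
  | timepar _ _ _ _ _ _ _ ih1 ih2 => exact Or.imp ih1 ih2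
  | timezero => exact id
  | res _ _ _ _ ih => exact And.imp_right ih

theorem NTrans.avoids {c : S.Chan} {l : NLabel S} {M M' : Net S} (h : NTrans l M M') :
    ¬ M.FreeChan c → l.Avoids c := by
  induction h with
  | snd n I P P' μ h d v hP _ => exact fun hf hd => hf (hP.hasChan_of_on hd)
  | rcv n I P P' μ h d v hP _ => exact fun hf hd => hf (hP.hasChan_of_on hd)
  | parL _ _ _ _ _ ih => exact fun hf => ih fun h => hf (Or.inl h)
  | parR _ _ _ _ _ ih => exact fun hf => ih fun h => hf (Or.inr h)
  | res l d M M' _ hl ih =>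
    intro hf
    by_cases hd : d = c
    · exact hd ▸ hl
    · exact ih fun h => hf ⟨hd, h⟩
  | _ => exact fun _ => trivial

theorem NTime.not_tau {M M' : Net S} (h : NTime M M') : ¬ ∃ N, NTrans .tau M N := by
  induction h with
  | timestat _ _ _ _ _ _ h => exact h
  | timemob _ _ _ _ _ _ _ h _ => exact h
  | timepar _ _ _ _ _ _ h => exact h
  | timezero => rintro ⟨_, h⟩; cases h
  | res _ _ _ _ ih =>
    rintro ⟨_, h⟩
    cases h with
    | res _ _ _ M' h _ => exact ih ⟨_, h⟩

/-! ### Renaming of channels in networks -/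

/-- Renaming of a channel in a network label. -/
noncomputable def NLabel.rename (c c' : S.Chan) : NLabel S → NLabel S
  | .send d v h => .send (chanRen c c' d) v h
  | .recv d v h => .recv (chanRen c c' d) v h
  | l => l

theorem NLabel.rename_of_avoids {c : S.Chan} (c' : S.Chan) {l : NLabel S} (h : l.Avoids c) :
    l.rename c c' = l := by
  cases l with
  | send d v k => exact congrArg (NLabel.send · v k) (chanRen_of_ne c' h)
  | recv d v k => exact congrArg (NLabel.recv · v k) (chanRen_of_ne c' h)
  | _ => rfl

theorem NLabel.avoids_of_rename {c c' : S.Chan} {l : NLabel S} (h : (l.rename c c').Avoids c') :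
    l.Avoids c := by
  cases l with
  | send d v => exact fun hd => h ((congrArg _ hd).trans (chanRen_self c c'))
  | recv d v => exact fun hd => h ((congrArg _ hd).trans (chanRen_self c c'))
  | _ => trivial

theorem NLabel.avoids_rename {c c' d : S.Chan} (hd : d ≠ c) (hd' : d ≠ c') {l : NLabel S} :
    (l.rename c c').Avoids d ↔ l.Avoids d := by
  have : ∀ e, chanRen c c' e = d ↔ e = d := by
    intro e
    by_cases he : e = c
    · rw [he, chanRen_self]
      exact ⟨fun h => absurd h.symm hd', fun h => absurd h.symm hd⟩
    · rw [chanRen_of_ne c' he]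
  cases l <;> simp [NLabel.rename, NLabel.Avoids, this]

theorem Net.renameChan_res_self (c c' : S.Chan) (M : Net S) :
    (Net.res c M).renameChan c c' = .res c M := by simp [Net.renameChan]

theorem Net.renameChan_res_ne {c d : S.Chan} (c' : S.Chan) (h : d ≠ c) (M : Net S) :
    (Net.res d M).renameChan c c' = .res d (M.renameChan c c') := by simp [Net.renameChan, h]

theorem NTrans.rename {c c' : S.Chan} (hc : S.rng c' = S.rng c) {l : NLabel S} {M M' : Net S}
    (h : NTrans l M M') : ¬ M.HasChan c' →
      NTrans (l.rename c c') (M.renameChan c c') (M'.renameChan c c') := by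
  induction h with
  | pos n I P P' μ h hP => exact fun _ => .pos _ _ _ _ _ _ (hP.rename hc)
  | sensread n I P P' μ h s v hv hP =>
    exact fun _ => .sensread _ _ _ _ _ _ s v hv (hP.rename hc)
  | actunchg n I P P' μ h a v hv hP =>
    exact fun _ => .actunchg _ _ _ _ _ _ a v hv (hP.rename hc)
  | loccom n I P P' μ h hP => exact fun _ => .loccom _ _ _ _ _ _ (hP.rename hc)
  | actchg n I P P' μ h a v w hw hwv hP =>
    exact fun _ => .actchg _ _ _ _ _ _ a v w hw hwv (hP.rename hc)
  | snd n I P P' μ h d v hP hd =>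
    exact fun _ => .snd _ _ _ _ _ _ _ v (hP.rename hc) (by rwa [rng_chanRen hc])
  | rcv n I P P' μ h d v hP hd =>
    exact fun _ => .rcv _ _ _ _ _ _ _ v (hP.rename hc) (by rwa [rng_chanRen hc])
  | glbcomL M M' N N' d v h k _ _ hd ih1 ih2 =>
    intro hn
    exact .glbcomL _ _ _ _ _ v h k (ih1 fun h => hn (Or.inl h)) (ih2 fun h => hn (Or.inr h))
      (by rwa [rng_chanRen hc])
  | glbcomR M M' N N' d v h k _ _ hd ih1 ih2 =>
    intro hn
    exact .glbcomR _ _ _ _ _ v h k (ih1 fun h => hn (Or.inl h)) (ih2 fun h => hn (Or.inr h))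
      (by rwa [rng_chanRen hc])
  | parL l M M' N _ ih => exact fun hn => .parL _ _ _ _ (ih fun h => hn (Or.inl h))
  | parR l M N N' _ ih => exact fun hn => .parR _ _ _ _ (ih fun h => hn (Or.inr h))
  | res l d M M' h hl ih =>
    intro hn
    by_cases hd : d = c
    · subst hd
      rw [Net.renameChan_res_self, Net.renameChan_res_self, NLabel.rename_of_avoids c' hl]
      exact .res _ _ _ _ h hl
    · rw [Net.renameChan_res_ne c' hd, Net.renameChan_res_ne c' hd]
      exact .res _ _ _ _ (ih fun h => hn (Or.inr h))
        ((NLabel.avoids_rename hd fun h => hn (Or.inl h)).2 hl)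

/-- Renaming back, as in `PTrans.of_rename`, is not available here: renaming stops at a restriction
of `c`, so `c` may still occur in the renamed network and need not be fresh. Induction on the
network is used instead. -/
theorem NTrans.of_rename {c c' : S.Chan} (hc : S.rng c' = S.rng c) {M : Net S} :
    ∀ {l : NLabel S} {X : Net S}, ¬ M.HasChan c' → NTrans l (M.renameChan c c') X →
      ∃ l₀ M', NTrans l₀ M M' ∧ l = l₀.rename c c' ∧ X = M'.renameChan c c' := by
  induction M with
  | zero => intro l X _ h; cases h
  | node d =>
    obtain ⟨n, I, P, μ, k⟩ := d
    intro l X hn h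
    have hP : ¬ P.HasChan c' := hn
    simp only [Net.renameChan] at h
    cases h with
    | pos _ _ _ P' _ _ h =>
      obtain ⟨l₀, Q, h1, h2, rfl⟩ := h.of_rename hc hP
      cases l₀ <;> simp only [PLabel.rename, reduceCtorEq, PLabel.pos.injEq] at h2
      subst h2
      exact ⟨.tau, _, .pos _ _ _ _ _ _ h1, rfl, rfl⟩
    | sensread _ _ _ P' _ _ s v hv h =>
      obtain ⟨l₀, Q, h1, h2, rfl⟩ := h.of_rename hc hP
      cases l₀ <;> simp only [PLabel.rename, reduceCtorEq, PLabel.sense.injEq] at h2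
      obtain ⟨rfl, rfl⟩ := h2
      exact ⟨.tau, _, .sensread _ _ _ _ _ _ _ _ hv h1, rfl, rfl⟩
    | actunchg _ _ _ P' _ _ a v hv h =>
      obtain ⟨l₀, Q, h1, h2, rfl⟩ := h.of_rename hc hP
      cases l₀ <;> simp only [PLabel.rename, reduceCtorEq, PLabel.write.injEq] at h2
      obtain ⟨rfl, rfl⟩ := h2
      exact ⟨.tau, _, .actunchg _ _ _ _ _ _ _ _ hv h1, rfl, rfl⟩
    | loccom _ _ _ P' _ _ h =>
      obtain ⟨l₀, Q, h1, h2, rfl⟩ := h.of_rename hc hP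
      cases l₀ <;> simp only [PLabel.rename, reduceCtorEq] at h2
      exact ⟨.tau, _, .loccom _ _ _ _ _ _ h1, rfl, rfl⟩
    | actchg _ _ _ P' _ _ a v w hw hwv h =>
      obtain ⟨l₀, Q, h1, h2, rfl⟩ := h.of_rename hc hP
      cases l₀ <;> simp only [PLabel.rename, reduceCtorEq, PLabel.write.injEq] at h2
      obtain ⟨rfl, rfl⟩ := h2
      exact ⟨.act a, _, .actchg _ _ _ _ _ _ _ _ _ hw hwv h1, rfl, rfl⟩
    | snd _ _ _ P' _ _ d v h hd =>
      obtain ⟨l₀, Q, h1, h2, rfl⟩ := h.of_rename hc hP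
      cases l₀ <;> simp only [PLabel.rename, reduceCtorEq, PLabel.send.injEq] at h2
      obtain ⟨rfl, rfl⟩ := h2
      rw [rng_chanRen hc] at hd
      exact ⟨.send _ v k, _, .snd _ _ _ _ _ _ _ _ h1 hd, rfl, rfl⟩
    | rcv _ _ _ P' _ _ d v h hd =>
      obtain ⟨l₀, Q, h1, h2, rfl⟩ := h.of_rename hc hP
      cases l₀ <;> simp only [PLabel.rename, reduceCtorEq, PLabel.recv.injEq] at h2
      obtain ⟨rfl, rfl⟩ := h2
      rw [rng_chanRen hc] at hd
      exact ⟨.recv _ v k, _, .rcv _ _ _ _ _ _ _ _ h1 hd, rfl, rfl⟩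
  | par M N ihM ihN =>
    intro l X hn h
    have hM : ¬ M.HasChan c' := fun h => hn (Or.inl h)
    have hN : ¬ N.HasChan c' := fun h => hn (Or.inr h)
    -- Channels of labels occur free, hence differ from `c'`. Away from `c'` the renaming is
    -- injective, so two labels that fit together after renaming did so before.
    have ne : ∀ {M : Net S}, ¬ M.HasChan c' → ∀ {d v k M'},
        (NTrans (.send d v k) M M' ∨ NTrans (.recv d v k) M M') → d ≠ c' := by
      rintro M hM d v k M' (h | h)
      · exact h.avoids fun h => hM h.hasChan
      · exact h.avoids fun h => hM h.hasChan
    simp only [Net.renameChan] at h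
    cases h with
    | glbcomL _ M' _ N' d v k k' h h' hd =>
      obtain ⟨l₁, M1, h1, e1, rfl⟩ := ihM hM h
      obtain ⟨l₂, N1, h2, e2, rfl⟩ := ihN hN h'
      cases l₁ <;> simp only [NLabel.rename, reduceCtorEq, NLabel.send.injEq] at e1
      cases l₂ <;> simp only [NLabel.rename, reduceCtorEq, NLabel.recv.injEq] at e2
      obtain ⟨rfl, rfl, rfl⟩ := e1
      obtain ⟨e2, rfl, rfl⟩ := e2
      have := chanRen_injective (ne hM (Or.inl h1)) (ne hN (Or.inr h2)) e2
      subst this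
      rw [rng_chanRen hc] at hd
      exact ⟨.tau, _, .glbcomL _ _ _ _ _ _ _ _ h1 h2 hd, rfl, rfl⟩
    | glbcomR _ M' _ N' d v k k' h h' hd =>
      obtain ⟨l₁, M1, h1, e1, rfl⟩ := ihM hM h
      obtain ⟨l₂, N1, h2, e2, rfl⟩ := ihN hN h'
      cases l₁ <;> simp only [NLabel.rename, reduceCtorEq, NLabel.recv.injEq] at e1
      cases l₂ <;> simp only [NLabel.rename, reduceCtorEq, NLabel.send.injEq] at e2
      obtain ⟨rfl, rfl, rfl⟩ := e1
      obtain ⟨e2, rfl, rfl⟩ := e2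
      have := chanRen_injective (ne hM (Or.inr h1)) (ne hN (Or.inl h2)) e2
      subst this
      rw [rng_chanRen hc] at hd
      exact ⟨.tau, _, .glbcomR _ _ _ _ _ _ _ _ h1 h2 hd, rfl, rfl⟩
    | parL _ _ M' _ h =>
      obtain ⟨l₁, M1, h1, rfl, rfl⟩ := ihM hM h
      exact ⟨l₁, _, .parL _ _ _ _ h1, rfl, rfl⟩
    | parR _ _ _ N' h =>
      obtain ⟨l₁, N1, h1, rfl, rfl⟩ := ihN hN h
      exact ⟨l₁, _, .parR _ _ _ _ h1, rfl, rfl⟩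
  | res d M ih =>
    intro l X hn h
    by_cases hd : d = c
    · subst hd
      rw [Net.renameChan_res_self] at h
      cases h with
      | res _ _ _ M' h hl =>
        exact ⟨l, _, .res _ _ _ _ h hl, (NLabel.rename_of_avoids c' hl).symm,
          (Net.renameChan_res_self d c' M').symm⟩
    · rw [Net.renameChan_res_ne c' hd] at h
      cases h with
      | res _ _ _ M' h hl =>
        obtain ⟨l₁, M1, h1, rfl, rfl⟩ := ih (fun h => hn (Or.inr h)) h
        exact ⟨l₁, _, .res _ _ _ _ h1 ((NLabel.avoids_rename hd fun h => hn (Or.inl h)).1 hl), rfl,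
          (Net.renameChan_res_ne c' hd M1).symm⟩

theorem NTrans.not_tau_rename {c c' : S.Chan} (hc : S.rng c' = S.rng c) {M : Net S}
    (hM : ¬ M.HasChan c') (h : ¬ ∃ X, NTrans .tau M X) :
    ¬ ∃ X, NTrans .tau (M.renameChan c c') X := by
  rintro ⟨X, hX⟩
  obtain ⟨l, M', h1, h2, -⟩ := hX.of_rename hc hM
  cases l <;> simp only [NLabel.rename, reduceCtorEq] at h2
  exact h ⟨M', h1⟩

theorem NTrans.tau_rename {c c' : S.Chan} (hc : S.rng c' = S.rng c) {M : Net S}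
    (hM : ¬ M.HasChan c') (h : ¬ ∃ X, NTrans .tau (M.renameChan c c') X) :
    ¬ ∃ X, NTrans .tau M X :=
  fun ⟨_, hX⟩ => h ⟨_, hX.rename hc hM⟩

theorem NTime.rename {c c' : S.Chan} (hc : S.rng c' = S.rng c) {M M' : Net S}
    (h : NTime M M') : ¬ M.HasChan c' → NTime (M.renameChan c c') (M'.renameChan c c') := by
  induction h with
  | timestat n I P P' h hP hn =>
    exact fun hM => .timestat _ _ _ _ _ (hP.rename hc hM)
      (NTrans.not_tau_rename (M := .node _) hc hM hn)
  | timemob n I P P' h k hP hn hk =>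
    exact fun hM => .timemob _ _ _ _ _ _ (hP.rename hc hM)
      (NTrans.not_tau_rename (M := .node _) hc hM hn) hk
  | timepar M M' N N' _ _ hn ih1 ih2 =>
    exact fun hM => .timepar _ _ _ _ (ih1 fun h => hM (Or.inl h)) (ih2 fun h => hM (Or.inr h))
      (NTrans.not_tau_rename (M := .par M N) hc hM hn)
  | timezero => exact fun _ => .timezero
  | res d M M' h ih =>
    intro hM
    by_cases hd : d = c
    · subst hd
      rw [Net.renameChan_res_self, Net.renameChan_res_self]
      exact .res _ _ _ h
    · rw [Net.renameChan_res_ne c' hd, Net.renameChan_res_ne c' hd]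
      exact .res _ _ _ (ih fun h => hM (Or.inr h))

theorem NTime.of_rename {c c' : S.Chan} (hc : S.rng c' = S.rng c) {M : Net S} :
    ∀ {X : Net S}, ¬ M.HasChan c' → NTime (M.renameChan c c') X →
      ∃ M', NTime M M' ∧ X = M'.renameChan c c' := by
  induction M with
  | zero =>
    intro X _ h
    cases h
    exact ⟨_, .timezero, rfl⟩
  | node d =>
    obtain ⟨n, I, P, μ, k⟩ := d
    intro X hM h
    have hP : ¬ P.HasChan c' := hM
    simp only [Net.renameChan] at h
    cases h with
    | timestat _ _ _ P' _ h hn =>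
      obtain ⟨Q, h1, rfl⟩ := h.of_rename hc hP
      exact ⟨_, .timestat _ _ _ _ _ h1 (NTrans.tau_rename (M := .node _) hc hM hn), rfl⟩
    | timemob _ _ _ P' _ k h hn hk =>
      obtain ⟨Q, h1, rfl⟩ := h.of_rename hc hP
      exact ⟨_, .timemob _ _ _ _ _ _ h1 (NTrans.tau_rename (M := .node _) hc hM hn) hk, rfl⟩
  | par M N ihM ihN =>
    intro X hM h
    simp only [Net.renameChan] at h
    cases h with
    | timepar _ M' _ N' h h' hn =>
      obtain ⟨M1, h1, rfl⟩ := ihM (fun h => hM (Or.inl h)) h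
      obtain ⟨N1, h2, rfl⟩ := ihN (fun h => hM (Or.inr h)) h'
      exact ⟨_, .timepar _ _ _ _ h1 h2 (NTrans.tau_rename (M := .par M N) hc hM hn), rfl⟩
  | res d M ih =>
    intro X hM h
    by_cases hd : d = c
    · subst hd
      rw [Net.renameChan_res_self] at h
      cases h with
      | res _ _ M' h =>
        exact ⟨_, .res _ _ _ h, (Net.renameChan_res_self d c' M').symm⟩
    · rw [Net.renameChan_res_ne c' hd] at h
      cases h with
      | res _ _ M' h =>
        obtain ⟨M1, h1, rfl⟩ := ih (fun h => hM (Or.inr h)) h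
        exact ⟨_, .res _ _ _ h1, (Net.renameChan_res_ne c' hd M1).symm⟩

/-! ### Structural congruence up to strong bisimilarity of the processes in nodes -/

/-- Structural congruence of networks, with strongly bisimilar processes in nodes. -/
inductive NEq : Net S → Net S → Prop where
  | refl (M : Net S) : NEq M M
  | symm {M N : Net S} : NEq M N → NEq N M
  | trans {M N O : Net S} : NEq M N → NEq N O → NEq M O
  | alpha (c c' : S.Chan) (M : Net S) : S.rng c' = S.rng c → ¬ M.HasChan c' →
      NEq (.res c M) (.res c' (M.renameChan c c'))
  | node (d : Dev S) {Q : Proc S 0 0} : PBisim d.proc Q →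
      NEq (.node d) (.node { d with proc := Q })
  | par_zero (M : Net S) : NEq (.par M .zero) M
  | par_comm (M N : Net S) : NEq (.par M N) (.par N M)
  | par_assoc (M N O : Net S) : NEq (.par (.par M N) O) (.par M (.par N O))
  | res_zero (c : S.Chan) : NEq (.res c .zero) .zero
  | res_comm (c d : S.Chan) (M : Net S) : NEq (.res c (.res d M)) (.res d (.res c M))
  | res_par (c : S.Chan) (M N : Net S) : ¬ M.FreeChan c →
      NEq (.res c (.par M N)) (.par M (.res c N))
  | congr_par {M M' N N' : Net S} : NEq M M' → NEq N N' → NEq (.par M N) (.par M' N')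
  | congr_res (c : S.Chan) {M M' : Net S} : NEq M M' → NEq (.res c M) (.res c M')

theorem NCong.nEq {M N : Net S} (h : NCong M N) : NEq M N := by
  induction h with
  | refl M => exact .refl M
  | symm _ ih => exact ih.symm
  | trans _ _ ih1 ih2 => exact ih1.trans ih2
  | alpha c c' M hc hM => exact .alpha c c' M hc hM
  | node d h => exact .node d h.pbisim
  | par_zero M => exact .par_zero M
  | par_comm M N => exact .par_comm M N
  | par_assoc M N O => exact .par_assoc M N O
  | res_zero c => exact .res_zero c
  | res_comm c d M => exact .res_comm c d M
  | res_par c M N h => exact .res_par c M N h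
  | congr_par _ _ ih1 ih2 => exact .congr_par ih1 ih2
  | congr_res c _ ih => exact .congr_res c ih

/-- The untimed transitions of the first network are matched by the second one. -/
def NStepSim (M N : Net S) : Prop :=
  ∀ l M', NTrans l M M' → ∃ N', NTrans l N N' ∧ NEq M' N'

/-! ### Untimed transitions along the laws of structural congruence -/

theorem NStepSim.alpha {c c' : S.Chan} {M : Net S} (hc : S.rng c' = S.rng c)
    (hM : ¬ M.HasChan c') : NStepSim (.res c M) (.res c' (M.renameChan c c')) ∧
      NStepSim (.res c' (M.renameChan c c')) (.res c M) := by
  constructor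
  · intro l X h
    cases h with
    | res _ _ _ M' h hl =>
      have h' := h.rename hc hM
      rw [NLabel.rename_of_avoids c' hl] at h'
      exact ⟨_, .res _ _ _ _ h' (h.avoids fun h => hM h.hasChan),
        .alpha c c' M' hc fun h2 => hM (h.hasChan h2)⟩
  · intro l X h
    cases h with
    | res _ _ _ M' h hl =>
      obtain ⟨l₀, M1, h1, rfl, rfl⟩ := h.of_rename hc hM
      have hl' := NLabel.avoids_of_rename hl
      rw [NLabel.rename_of_avoids c' hl']
      exact ⟨_, .res _ _ _ _ h1 hl', (NEq.alpha c c' M1 hc fun h2 => hM (h1.hasChan h2)).symm⟩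

theorem NStepSim.node {d : Dev S} {Q : Proc S 0 0} (hd : PBisim d.proc Q) :
    NStepSim (.node d) (.node { d with proc := Q }) := by
  obtain ⟨n, I, P, μ, k⟩ := d
  intro l X h
  cases h with
  | pos _ _ _ P' _ _ h =>
    obtain ⟨Q', hQ, e⟩ := hd.sim h
    exact ⟨_, .pos _ _ _ _ _ _ hQ, .node ⟨n, I, P', μ, k⟩ e⟩
  | sensread _ _ _ P' _ _ s v hv h =>
    obtain ⟨Q', hQ, e⟩ := hd.sim h
    exact ⟨_, .sensread _ _ _ _ _ _ s v hv hQ, .node ⟨n, I, P', μ, k⟩ e⟩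
  | actunchg _ _ _ P' _ _ a v hv h =>
    obtain ⟨Q', hQ, e⟩ := hd.sim h
    exact ⟨_, .actunchg _ _ _ _ _ _ a v hv hQ, .node ⟨n, I, P', μ, k⟩ e⟩
  | loccom _ _ _ P' _ _ h =>
    obtain ⟨Q', hQ, e⟩ := hd.sim h
    exact ⟨_, .loccom _ _ _ _ _ _ hQ, .node ⟨n, I, P', μ, k⟩ e⟩
  | actchg _ _ _ P' _ _ a v w hw hwv h =>
    obtain ⟨Q', hQ, e⟩ := hd.sim h
    exact ⟨_, .actchg _ _ _ _ _ _ a v w hw hwv hQ, .node ⟨n, I.setAct a v, P', μ, k⟩ e⟩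
  | snd _ _ _ P' _ _ c v h hc =>
    obtain ⟨Q', hQ, e⟩ := hd.sim h
    exact ⟨_, .snd _ _ _ _ _ _ c v hQ hc, .node ⟨n, I, P', μ, k⟩ e⟩
  | rcv _ _ _ P' _ _ c v h hc =>
    obtain ⟨Q', hQ, e⟩ := hd.sim h
    exact ⟨_, .rcv _ _ _ _ _ _ c v hQ hc, .node ⟨n, I, P', μ, k⟩ e⟩

theorem NTrans.par_zero {l : NLabel S} {M X : Net S} (h : NTrans l (.par M .zero) X) :
    ∃ M', X = .par M' .zero ∧ NTrans l M M' := by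
  cases h with
  | glbcomL _ _ _ _ _ _ _ _ _ h => cases h
  | glbcomR _ _ _ _ _ _ _ _ _ h => cases h
  | parL _ _ M' _ h => exact ⟨M', rfl, h⟩
  | parR _ _ _ _ h => cases h

theorem NStepSim.par_comm (M N : Net S) : NStepSim (.par M N) (.par N M) := by
  intro l X h
  cases h with
  | glbcomL _ M' _ N' c v h k h1 h2 hc =>
    exact ⟨_, .glbcomR _ _ _ _ c v h k h2 h1 hc, .par_comm _ _⟩
  | glbcomR _ M' _ N' c v h k h1 h2 hc =>
    exact ⟨_, .glbcomL _ _ _ _ c v h k h2 h1 hc, .par_comm _ _⟩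
  | parL _ _ M' _ h => exact ⟨_, .parR _ _ _ _ h, .par_comm _ _⟩
  | parR _ _ _ N' h => exact ⟨_, .parL _ _ _ _ h, .par_comm _ _⟩

theorem NStepSim.par_assoc (M N O : Net S) :
    NStepSim (.par (.par M N) O) (.par M (.par N O)) := by
  intro l X h
  cases h with
  | glbcomL _ M' _ N' c v h k h1 h2 hc =>
    cases h1 with
    | parL _ _ M' _ h1 =>
      exact ⟨_, .glbcomL _ _ _ _ c v h k h1 (.parR _ _ _ _ h2) hc, .par_assoc _ _ _⟩
    | parR _ _ _ M' h1 =>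
      exact ⟨_, .parR _ _ _ _ (.glbcomL _ _ _ _ c v h k h1 h2 hc), .par_assoc _ _ _⟩
  | glbcomR _ M' _ N' c v h k h1 h2 hc =>
    cases h1 with
    | parL _ _ M' _ h1 =>
      exact ⟨_, .glbcomR _ _ _ _ c v h k h1 (.parR _ _ _ _ h2) hc, .par_assoc _ _ _⟩
    | parR _ _ _ M' h1 =>
      exact ⟨_, .parR _ _ _ _ (.glbcomR _ _ _ _ c v h k h1 h2 hc), .par_assoc _ _ _⟩
  | parL _ _ M' _ h =>
    cases h with
    | glbcomL _ M' _ N' c v h k h1 h2 hc =>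
      exact ⟨_, .glbcomL _ _ _ _ c v h k h1 (.parL _ _ _ _ h2) hc, .par_assoc _ _ _⟩
    | glbcomR _ M' _ N' c v h k h1 h2 hc =>
      exact ⟨_, .glbcomR _ _ _ _ c v h k h1 (.parL _ _ _ _ h2) hc, .par_assoc _ _ _⟩
    | parL _ _ M' _ h => exact ⟨_, .parL _ _ _ _ h, .par_assoc _ _ _⟩
    | parR _ _ _ N' h => exact ⟨_, .parR _ _ _ _ (.parL _ _ _ _ h), .par_assoc _ _ _⟩
  | parR _ _ _ N' h => exact ⟨_, .parR _ _ _ _ (.parR _ _ _ _ h), .par_assoc _ _ _⟩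

theorem NStepSim.assoc_par (M N O : Net S) :
    NStepSim (.par M (.par N O)) (.par (.par M N) O) := by
  intro l X h
  cases h with
  | glbcomL _ M' _ N' c v h k h1 h2 hc =>
    cases h2 with
    | parL _ _ M' _ h2 =>
      exact ⟨_, .parL _ _ _ _ (.glbcomL _ _ _ _ c v h k h1 h2 hc), (NEq.par_assoc _ _ _).symm⟩
    | parR _ _ _ M' h2 =>
      exact ⟨_, .glbcomL _ _ _ _ c v h k (.parL _ _ _ _ h1) h2 hc, (NEq.par_assoc _ _ _).symm⟩
  | glbcomR _ M' _ N' c v h k h1 h2 hc =>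
    cases h2 with
    | parL _ _ M' _ h2 =>
      exact ⟨_, .parL _ _ _ _ (.glbcomR _ _ _ _ c v h k h1 h2 hc), (NEq.par_assoc _ _ _).symm⟩
    | parR _ _ _ M' h2 =>
      exact ⟨_, .glbcomR _ _ _ _ c v h k (.parL _ _ _ _ h1) h2 hc, (NEq.par_assoc _ _ _).symm⟩
  | parR _ _ _ M' h =>
    cases h with
    | glbcomL _ M' _ N' c v h k h1 h2 hc =>
      exact ⟨_, .glbcomL _ _ _ _ c v h k (.parR _ _ _ _ h1) h2 hc, (NEq.par_assoc _ _ _).symm⟩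
    | glbcomR _ M' _ N' c v h k h1 h2 hc =>
      exact ⟨_, .glbcomR _ _ _ _ c v h k (.parR _ _ _ _ h1) h2 hc, (NEq.par_assoc _ _ _).symm⟩
    | parL _ _ M' _ h =>
      exact ⟨_, .parL _ _ _ _ (.parR _ _ _ _ h), (NEq.par_assoc _ _ _).symm⟩
    | parR _ _ _ N' h => exact ⟨_, .parR _ _ _ _ h, (NEq.par_assoc _ _ _).symm⟩
  | parL _ _ N' _ h => exact ⟨_, .parL _ _ _ _ (.parL _ _ _ _ h), (NEq.par_assoc _ _ _).symm⟩

theorem NStepSim.res_comm (c d : S.Chan) (M : Net S) :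
    NStepSim (.res c (.res d M)) (.res d (.res c M)) := by
  intro l X h
  cases h with
  | res _ _ _ X h hl =>
    cases h with
    | res _ _ _ M' h hl' =>
      exact ⟨_, .res _ _ _ _ (.res _ _ _ _ h hl) hl', .res_comm _ _ _⟩

theorem NStepSim.res_par {c : S.Chan} {M : Net S} (hM : ¬ M.FreeChan c) (N : Net S) :
    NStepSim (.res c (.par M N)) (.par M (.res c N)) := by
  intro l X h
  cases h with
  | res _ _ _ X h hl =>
    cases h with
    | glbcomL _ M' _ N' d v h k h1 h2 hd =>
      exact ⟨_, .glbcomL _ _ _ _ d v h k h1 (.res _ _ _ _ h2 (h1.avoids hM)) hd,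
        .res_par _ _ _ fun h => hM (h1.freeChan h)⟩
    | glbcomR _ M' _ N' d v h k h1 h2 hd =>
      exact ⟨_, .glbcomR _ _ _ _ d v h k h1 (.res _ _ _ _ h2 (h1.avoids hM)) hd,
        .res_par _ _ _ fun h => hM (h1.freeChan h)⟩
    | parL _ _ M' _ h =>
      exact ⟨_, .parL _ _ _ _ h, .res_par _ _ _ fun h' => hM (h.freeChan h')⟩
    | parR _ _ _ N' h => exact ⟨_, .parR _ _ _ _ (.res _ _ _ _ h hl), .res_par _ _ _ hM⟩

theorem NStepSim.par_res {c : S.Chan} {M : Net S} (hM : ¬ M.FreeChan c) (N : Net S) :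
    NStepSim (.par M (.res c N)) (.res c (.par M N)) := by
  intro l X h
  cases h with
  | glbcomL _ M' _ N' d v h k h1 h2 hd =>
    cases h2 with
    | res _ _ _ N' h2 hl =>
      exact ⟨_, .res _ _ _ _ (.glbcomL _ _ _ _ d v h k h1 h2 hd) trivial,
        (NEq.res_par _ _ _ fun h => hM (h1.freeChan h)).symm⟩
  | glbcomR _ M' _ N' d v h k h1 h2 hd =>
    cases h2 with
    | res _ _ _ N' h2 hl =>
      exact ⟨_, .res _ _ _ _ (.glbcomR _ _ _ _ d v h k h1 h2 hd) trivial,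
        (NEq.res_par _ _ _ fun h => hM (h1.freeChan h)).symm⟩
  | parL _ _ M' _ h =>
    exact ⟨_, .res _ _ _ _ (.parL _ _ _ _ h) (h.avoids hM),
      (NEq.res_par _ _ _ fun h' => hM (h.freeChan h')).symm⟩
  | parR _ _ _ N' h =>
    cases h with
    | res _ _ _ N' h hl =>
      exact ⟨_, .res _ _ _ _ (.parR _ _ _ _ h) hl, (NEq.res_par _ _ _ hM).symm⟩

theorem NStepSim.congr_par {M M' N N' : Net S} (hM : NEq M M') (hN : NEq N N')
    (ihM : NStepSim M M') (ihN : NStepSim N N') : NStepSim (.par M N) (.par M' N') := by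
  intro l X h
  cases h with
  | glbcomL _ _ _ _ d v h k h1 h2 hd =>
    obtain ⟨M1, h3, e⟩ := ihM _ _ h1
    obtain ⟨N1, h4, e'⟩ := ihN _ _ h2
    exact ⟨_, .glbcomL _ _ _ _ d v h k h3 h4 hd, .congr_par e e'⟩
  | glbcomR _ _ _ _ d v h k h1 h2 hd =>
    obtain ⟨M1, h3, e⟩ := ihM _ _ h1
    obtain ⟨N1, h4, e'⟩ := ihN _ _ h2
    exact ⟨_, .glbcomR _ _ _ _ d v h k h3 h4 hd, .congr_par e e'⟩
  | parL _ _ _ _ h =>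
    obtain ⟨M1, h3, e⟩ := ihM _ _ h
    exact ⟨_, .parL _ _ _ _ h3, .congr_par e hN⟩
  | parR _ _ _ _ h =>
    obtain ⟨N1, h3, e⟩ := ihN _ _ h
    exact ⟨_, .parR _ _ _ _ h3, .congr_par hM e⟩

theorem NStepSim.congr_res {c : S.Chan} {M M' : Net S} (ih : NStepSim M M') :
    NStepSim (.res c M) (.res c M') := by
  intro l X h
  cases h with
  | res _ _ _ _ h hl =>
    obtain ⟨M1, h3, e⟩ := ih _ _ h
    exact ⟨_, .res _ _ _ _ h3 hl, .congr_res c e⟩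

/-- Both directions are proved together because symmetry is a constructor of `NEq`. The side
conditions of alpha-conversion and of scope extrusion persist in the residuals, as transitions
create no channel names. -/
theorem NEq.stepSim {M N : Net S} (h : NEq M N) : NStepSim M N ∧ NStepSim N M := by
  induction h with
  | refl M => exact ⟨fun l M' h => ⟨M', h, .refl _⟩, fun l M' h => ⟨M', h, .refl _⟩⟩
  | symm _ ih => exact ih.symm
  | trans _ _ ih1 ih2 =>
    refine ⟨fun l X h => ?_, fun l X h => ?_⟩
    · obtain ⟨Y, hY, e⟩ := ih1.1 l X h
      obtain ⟨Z, hZ, e'⟩ := ih2.1 l Y hY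
      exact ⟨Z, hZ, e.trans e'⟩
    · obtain ⟨Y, hY, e⟩ := ih2.2 l X h
      obtain ⟨Z, hZ, e'⟩ := ih1.2 l Y hY
      exact ⟨Z, hZ, e.trans e'⟩
  | alpha c c' M hc hM => exact NStepSim.alpha hc hM
  | node d h => exact ⟨.node h, .node (d := { d with proc := _ }) h.symm⟩
  | par_zero M =>
    refine ⟨fun l X h => ?_, fun l X h => ⟨_, .parL _ _ _ _ h, (NEq.par_zero X).symm⟩⟩
    obtain ⟨M', rfl, h'⟩ := h.par_zero
    exact ⟨M', h', .par_zero _⟩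
  | par_comm M N => exact ⟨.par_comm M N, .par_comm N M⟩
  | par_assoc M N O => exact ⟨.par_assoc M N O, .assoc_par M N O⟩
  | res_zero c =>
    refine ⟨fun l X h => ?_, fun l X h => ?_⟩
    · cases h with
      | res _ _ _ _ h _ => cases h
    · cases h
  | res_comm c d M => exact ⟨.res_comm c d M, .res_comm d c M⟩
  | res_par c M N h => exact ⟨.res_par h N, .par_res h N⟩
  | congr_par h1 h2 ih1 ih2 =>
    exact ⟨.congr_par h1 h2 ih1.1 ih2.1, .congr_par h1.symm h2.symm ih1.2 ih2.2⟩
  | congr_res c _ ih => exact ⟨.congr_res ih.1, .congr_res ih.2⟩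

theorem NEq.sim {M N : Net S} (h : NEq M N) {l : NLabel S} {M' : Net S} (hM : NTrans l M M') :
    ∃ N', NTrans l N N' ∧ NEq M' N' := h.stepSim.1 l M' hM

theorem NEq.not_tau {M N : Net S} (h : NEq M N) (hM : ¬ ∃ M', NTrans .tau M M') :
    ¬ ∃ N', NTrans .tau N N' := by
  rintro ⟨N', hN⟩
  obtain ⟨M', hM', -⟩ := h.symm.sim hN
  exact hM ⟨M', hM'⟩

/-- The timed transitions of the first network are matched by the second one. -/
def NTimeSim (M N : Net S) : Prop := ∀ M', NTime M M' → ∃ N', NTime N N' ∧ NEq M' N'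

/-! ### Timed transitions along the laws of structural congruence -/

theorem NTimeSim.node {d : Dev S} {Q : Proc S 0 0} (hd : PBisim d.proc Q) :
    NTimeSim (.node d) (.node { d with proc := Q }) := by
  have e := NEq.node d hd
  obtain ⟨n, I, P, μ, k⟩ := d
  intro X h
  cases h with
  | timestat _ _ _ P' _ h hn =>
    obtain ⟨Q', hQ, e'⟩ := hd.simTime h
    exact ⟨_, .timestat _ _ _ _ _ hQ (e.not_tau hn), .node ⟨n, I, P', .stat, k⟩ e'⟩
  | timemob _ _ _ P' _ k' h hn hk =>
    obtain ⟨Q', hQ, e'⟩ := hd.simTime h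
    exact ⟨_, .timemob _ _ _ _ _ _ hQ (e.not_tau hn) hk, .node ⟨n, I, P', .mob, k'⟩ e'⟩

/-- The negative premises are transferred by the untimed result in the form `NEq.not_tau`. It is
applied to the whole network first, and the absence of `τ` in a newly grouped component follows from
that. -/
theorem NEq.timeSim {M N : Net S} (h : NEq M N) : NTimeSim M N ∧ NTimeSim N M := by
  induction h with
  | refl M => exact ⟨fun M' h => ⟨M', h, .refl _⟩, fun M' h => ⟨M', h, .refl _⟩⟩
  | symm _ ih => exact ih.symm
  | trans _ _ ih1 ih2 =>
    refine ⟨fun X h => ?_, fun X h => ?_⟩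
    · obtain ⟨Y, hY, e⟩ := ih1.1 X h
      obtain ⟨Z, hZ, e'⟩ := ih2.1 Y hY
      exact ⟨Z, hZ, e.trans e'⟩
    · obtain ⟨Y, hY, e⟩ := ih2.2 X h
      obtain ⟨Z, hZ, e'⟩ := ih1.2 Y hY
      exact ⟨Z, hZ, e.trans e'⟩
  | alpha c c' M hc hM =>
    refine ⟨fun X h => ?_, fun X h => ?_⟩
    · cases h with
      | res _ _ M' h =>
        exact ⟨_, .res _ _ _ (h.rename hc hM), .alpha c c' M' hc fun h2 => hM (h.hasChan h2)⟩
    · cases h with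
      | res _ _ M' h =>
        obtain ⟨M1, h1, rfl⟩ := h.of_rename hc hM
        exact ⟨_, .res _ _ _ h1, (NEq.alpha c c' M1 hc fun h2 => hM (h1.hasChan h2)).symm⟩
  | node d h => exact ⟨.node h, .node (d := { d with proc := _ }) h.symm⟩
  | par_zero M =>
    refine ⟨fun X h => ?_, fun X h => ?_⟩
    · cases h with
      | timepar _ M' _ _ h h' _ =>
        cases h'
        exact ⟨M', h, .par_zero _⟩
    · exact ⟨_, .timepar _ _ _ _ h .timezero ((NEq.par_zero M).symm.not_tau h.not_tau),
        (NEq.par_zero X).symm⟩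
  | par_comm M N =>
    have key : ∀ M N : Net S, NTimeSim (.par M N) (.par N M) := by
      intro M N X h
      have hn := (NEq.par_comm M N).not_tau h.not_tau
      cases h with
      | timepar _ _ _ _ h h' _ => exact ⟨_, .timepar _ _ _ _ h' h hn, .par_comm _ _⟩
    exact ⟨key M N, key N M⟩
  | par_assoc M N O =>
    refine ⟨fun X h => ?_, fun X h => ?_⟩
    · have hn := (NEq.par_assoc M N O).not_tau h.not_tau
      cases h with
      | timepar _ _ _ _ h h' _ =>
        cases h with
        | timepar _ _ _ _ h1 h2 _ =>
          exact ⟨_, .timepar _ _ _ _ h1 (.timepar _ _ _ _ h2 h'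
            fun ⟨_, hU⟩ => hn ⟨_, .parR _ _ _ _ hU⟩) hn, .par_assoc _ _ _⟩
    · have hn := (NEq.par_assoc M N O).symm.not_tau h.not_tau
      cases h with
      | timepar _ _ _ _ h h' _ =>
        cases h' with
        | timepar _ _ _ _ h1 h2 _ =>
          exact ⟨_, .timepar _ _ _ _ (.timepar _ _ _ _ h h1
            fun ⟨_, hU⟩ => hn ⟨_, .parL _ _ _ _ hU⟩) h2 hn, (NEq.par_assoc _ _ _).symm⟩
  | res_zero c =>
    refine ⟨fun X h => ?_, fun X h => ?_⟩
    · cases h with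
      | res _ _ _ h =>
        cases h
        exact ⟨_, .timezero, .res_zero c⟩
    · cases h
      exact ⟨_, .res _ _ _ .timezero, (NEq.res_zero c).symm⟩
  | res_comm c d M =>
    have key : ∀ c d, NTimeSim (.res c (.res d M)) (.res d (.res c M)) := by
      intro c d X h
      cases h with
      | res _ _ _ h =>
        cases h with
        | res _ _ _ h => exact ⟨_, .res _ _ _ (.res _ _ _ h), .res_comm _ _ _⟩
    exact ⟨key c d, key d c⟩
  | res_par c M N hM =>
    refine ⟨fun X h => ?_, fun X h => ?_⟩
    · have hn := (NEq.res_par c M N hM).not_tau h.not_tau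
      cases h with
      | res _ _ _ h =>
        cases h with
        | timepar _ M' _ _ h h' _ =>
          exact ⟨_, .timepar _ _ _ _ h (.res _ _ _ h') hn,
            .res_par _ _ _ fun h2 => hM (h.freeChan h2)⟩
    · have hn := (NEq.res_par c M N hM).symm.not_tau h.not_tau
      cases h with
      | timepar _ M' _ _ h h' _ =>
        cases h' with
        | res _ _ _ h' =>
          exact ⟨_, .res _ _ _ (.timepar _ _ _ _ h h'
            fun ⟨_, hU⟩ => hn ⟨_, .res _ _ _ _ hU trivial⟩),
            (NEq.res_par _ _ _ fun h2 => hM (h.freeChan h2)).symm⟩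
  | congr_par h1 h2 ih1 ih2 =>
    have key : ∀ {M M' N N' : Net S}, NEq M M' → NEq N N' → NTimeSim M M' → NTimeSim N N' →
        NTimeSim (.par M N) (.par M' N') := by
      intro M M' N N' h1 h2 i1 i2 X h
      have hn := (NEq.congr_par h1 h2).not_tau h.not_tau
      cases h with
      | timepar _ _ _ _ h h' _ =>
        obtain ⟨M1, h3, e⟩ := i1 _ h
        obtain ⟨N1, h4, e'⟩ := i2 _ h'
        exact ⟨_, .timepar _ _ _ _ h3 h4 hn, .congr_par e e'⟩
    exact ⟨key h1 h2 ih1.1 ih2.1, key h1.symm h2.symm ih1.2 ih2.2⟩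
  | congr_res c _ ih =>
    have key : ∀ {M M' : Net S}, NTimeSim M M' → NTimeSim (.res c M) (.res c M') := by
      intro M M' i X h
      cases h with
      | res _ _ _ h =>
        obtain ⟨M1, h3, e⟩ := i _ h
        exact ⟨_, .res _ _ _ h3, .congr_res c e⟩
    exact ⟨key ih.1, key ih.2⟩

theorem NEq.simTime {M N : Net S} (h : NEq M N) {M' : Net S} (hM : NTime M M') :
    ∃ N', NTime N N' ∧ NEq M' N' := h.timeSim.1 M' hM

/-! ### Structural congruence and sensor updates -/

theorem Dev.update_proc (s : S.Sens) (h : S.Loc) (v : S.Val) (d : Dev S) :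
    (d.update s h v).proc = d.proc := by
  unfold Dev.update
  split_ifs <;> rfl

theorem Dev.update_with_proc (s : S.Sens) (h : S.Loc) (v : S.Val) (d : Dev S)
    (Q : Proc S 0 0) : Dev.update s h v { d with proc := Q } =
      { Dev.update s h v d with proc := Q } := by
  unfold Dev.update
  split_ifs <;> rfl

theorem Net.hasChan_update (s : S.Sens) (h : S.Loc) (v : S.Val) (c : S.Chan) (M : Net S) :
    (M.update s h v).HasChan c ↔ M.HasChan c := by
  induction M <;> simp_all [Net.update, Net.HasChan, Dev.update_proc]

theorem Net.freeChan_update (s : S.Sens) (h : S.Loc) (v : S.Val) (c : S.Chan) (M : Net S) :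
    (M.update s h v).FreeChan c ↔ M.FreeChan c := by
  induction M <;> simp_all [Net.update, Net.FreeChan, Dev.update_proc]

theorem Net.renameChan_update (s : S.Sens) (h : S.Loc) (v : S.Val) (c c' : S.Chan) (M : Net S) :
    (M.renameChan c c').update s h v = (M.update s h v).renameChan c c' := by
  induction M with
  | zero => rfl
  | node d => simp [Net.update, Net.renameChan, Dev.update_with_proc, Dev.update_proc]
  | par M N ihM ihN => simp [Net.update, Net.renameChan, ihM, ihN]
  | res d M ih =>
    by_cases hd : d = c
    · subst hd
      rw [Net.renameChan_res_self, Net.update, Net.renameChan_res_self]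
    · rw [Net.renameChan_res_ne c' hd, Net.update, Net.update, Net.renameChan_res_ne c' hd, ih]

theorem NEq.update {M N : Net S} (h : NEq M N) (s : S.Sens) (k : S.Loc) (v : S.Val) :
    NEq (M.update s k v) (N.update s k v) := by
  induction h with
  | refl M => exact .refl _
  | symm _ ih => exact ih.symm
  | trans _ _ ih1 ih2 => exact ih1.trans ih2
  | alpha c c' M hc hM =>
    rw [Net.update, Net.update, Net.renameChan_update]
    exact .alpha c c' _ hc fun h => hM ((M.hasChan_update s k v c').1 h)
  | @node d Q h =>
    rw [Net.update, Net.update, Dev.update_with_proc s k v d Q]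
    exact .node (Dev.update s k v d) (by rwa [Dev.update_proc])
  | par_zero M => exact .par_zero _
  | par_comm M N => exact .par_comm _ _
  | par_assoc M N O => exact .par_assoc _ _ _
  | res_zero c => exact .res_zero c
  | res_comm c d M => exact .res_comm c d _
  | res_par c M N h => exact .res_par c _ _ fun h' => h ((M.freeChan_update s k v c).1 h')
  | congr_par _ _ ih1 ih2 => exact .congr_par ih1 ih2
  | congr_res c _ ih => exact .congr_res c ih

/-! ### Nodes of structurally congruent networks -/

/-- A node without its process. -/
def Dev.shell (d : Dev S) : S.Node × Iface S × Mob × S.Loc := (d.name, d.iface, d.mob, d.loc)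

theorem Net.devs_renameChan_shell (c c' : S.Chan) (M : Net S) :
    (M.renameChan c c').devs.map Dev.shell = M.devs.map Dev.shell := by
  induction M with
  | zero => rfl
  | node d => rfl
  | par M N ihM ihN => simp [Net.renameChan, Net.devs, ihM, ihN]
  | res d M ih =>
    by_cases hd : d = c
    · subst hd
      rw [Net.renameChan_res_self]
    · rw [Net.renameChan_res_ne c' hd]
      exact ih

theorem NEq.shells {M N : Net S} (h : NEq M N) :
    (M.devs.map Dev.shell).Perm (N.devs.map Dev.shell) := by
  induction h with
  | refl M => exact .refl _
  | symm _ ih => exact ih.symm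
  | trans _ _ ih1 ih2 => exact ih1.trans ih2
  | alpha c c' M hc hM =>
    simp only [Net.devs, Net.devs_renameChan_shell]
    exact .refl _
  | node d h => exact .refl _
  | par_zero M => simp [Net.devs]
  | par_comm M N =>
    simp only [Net.devs, List.map_append]
    exact List.perm_append_comm
  | par_assoc M N O => simp [Net.devs]
  | res_zero c => exact .refl _
  | res_comm c d M => exact .refl _
  | res_par c M N h => exact .refl _
  | congr_par _ _ ih1 ih2 =>
    simp only [Net.devs, List.map_append]
    exact ih1.append ih2
  | congr_res c _ ih => exact ih

/-- The nodes of a network, each one with the restricted channels around it. -/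
def Net.hdevs : Net S → List (Dev S × Set S.Chan)
  | .zero => []
  | .node d => [(d, ∅)]
  | .par M N => M.hdevs ++ N.hdevs
  | .res c M => M.hdevs.map fun x => (x.1, insert c x.2)

/-- Nodes that differ by bisimilar processes, up to hidden channels. -/
def HRel (x y : Dev S × Set S.Chan) : Prop :=
  x.1.shell = y.1.shell ∧ HBisim x.2 x.1.proc y.2 y.1.proc

theorem HRel.refl (x : Dev S × Set S.Chan) : HRel x x := ⟨rfl, (PBisim.refl _).hbisim _⟩

theorem HRel.symm {x y : Dev S × Set S.Chan} (h : HRel x y) : HRel y x :=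
  ⟨h.1.symm, h.2.symm⟩

theorem HRel.trans {x y z : Dev S × Set S.Chan} (h : HRel x y) (h' : HRel y z) : HRel x z :=
  ⟨h.1.trans h'.1, h.2.trans h'.2⟩

/-- Every node of the first network has a counterpart in the second one. -/
def HSim (M N : Net S) : Prop := ∀ x ∈ M.hdevs, ∃ y ∈ N.hdevs, HRel x y

theorem HSim.of_subset {M N : Net S} (h : M.hdevs ⊆ N.hdevs) : HSim M N :=
  fun x hx => ⟨x, h hx, HRel.refl x⟩

/-- Renaming of `c` to `c'` in a node where `c` is not restricted. -/
noncomputable def hdevRen (c c' : S.Chan) (x : Dev S × Set S.Chan) : Dev S × Set S.Chan :=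
  (open Classical in
    if c ∈ x.2 then x.1 else { x.1 with proc := x.1.proc.renameChan c c' }, x.2)

theorem hdevRen_of_mem {c : S.Chan} (c' : S.Chan) {x : Dev S × Set S.Chan} (h : c ∈ x.2) :
    hdevRen c c' x = x := by
  simp [hdevRen, h]

theorem hdevRen_of_notMem {c : S.Chan} (c' : S.Chan) {x : Dev S × Set S.Chan} (h : c ∉ x.2) :
    hdevRen c c' x = ({ x.1 with proc := x.1.proc.renameChan c c' }, x.2) := by
  simp [hdevRen, h]

theorem Net.hdevs_renameChan (c c' : S.Chan) (M : Net S) :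
    (M.renameChan c c').hdevs = M.hdevs.map (hdevRen c c') := by
  induction M with
  | zero => rfl
  | node d => simp [Net.renameChan, Net.hdevs, hdevRen]
  | par M N ihM ihN => rw [Net.renameChan, Net.hdevs, Net.hdevs, ihM, ihN, List.map_append]
  | res d M ih =>
    by_cases hd : d = c
    · subst hd
      rw [Net.renameChan_res_self, Net.hdevs, List.map_map]
      apply List.map_congr_left
      intro x _
      exact (hdevRen_of_mem c' (Set.mem_insert _ _)).symm
    · rw [Net.renameChan_res_ne c' hd, Net.hdevs, ih, Net.hdevs, List.map_map, List.map_map]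
      apply List.map_congr_left
      intro x _
      by_cases hx : c ∈ x.2
      · rw [Function.comp, Function.comp, hdevRen_of_mem c' hx,
          hdevRen_of_mem c' (Set.mem_insert_of_mem _ hx)]
      · rw [Function.comp, Function.comp, hdevRen_of_notMem c' hx, hdevRen_of_notMem]
        rintro (h | h)
        exacts [hd h.symm, hx h]

theorem Net.hasChan_of_mem_hdevs {c : S.Chan} {M : Net S} :
    ∀ {x}, x ∈ M.hdevs → x.1.proc.HasChan c → M.HasChan c := by
  induction M with
  | zero => intro x hx; simp [Net.hdevs] at hx
  | node d =>
    intro x hx h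
    simp only [Net.hdevs, List.mem_singleton] at hx
    subst hx
    exact h
  | par M N ihM ihN =>
    intro x hx h
    rcases List.mem_append.1 hx with hx | hx
    exacts [Or.inl (ihM hx h), Or.inr (ihN hx h)]
  | res d M ih =>
    intro x hx h
    obtain ⟨y, hy, rfl⟩ := List.mem_map.1 hx
    exact Or.inr (ih hy h)

theorem Net.mem_hdevs_of_hasChan {c : S.Chan} {M : Net S} (hM : ¬ M.FreeChan c) :
    ∀ {x}, x ∈ M.hdevs → c ∈ x.2 ∨ ¬ x.1.proc.HasChan c := by
  induction M with
  | zero => intro x hx; simp [Net.hdevs] at hx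
  | node d =>
    intro x hx
    simp only [Net.hdevs, List.mem_singleton] at hx
    subst hx
    exact Or.inr hM
  | par M N ihM ihN =>
    intro x hx
    rcases List.mem_append.1 hx with hx | hx
    exacts [ihM (fun h => hM (Or.inl h)) hx, ihN (fun h => hM (Or.inr h)) hx]
  | res d M ih =>
    intro x hx
    obtain ⟨y, hy, rfl⟩ := List.mem_map.1 hx
    by_cases hd : d = c
    · exact Or.inl (hd ▸ Set.mem_insert _ _)
    · exact (ih (fun h => hM ⟨hd, h⟩) hy).imp_left (Set.mem_insert_of_mem _)

theorem HSim.congr_res {M N : Net S} (c : S.Chan) (h : HSim M N) :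
    HSim (.res c M) (.res c N) := by
  intro x hx
  obtain ⟨y, hy, rfl⟩ := List.mem_map.1 hx
  obtain ⟨z, hz, e⟩ := h y hy
  exact ⟨_, List.mem_map_of_mem hz, e.1, e.2.insert c⟩

theorem HSim.congr_par {M M' N N' : Net S} (h : HSim M M') (h' : HSim N N') :
    HSim (.par M N) (.par M' N') := by
  intro x hx
  rcases List.mem_append.1 hx with hx | hx
  · obtain ⟨y, hy, e⟩ := h x hx
    exact ⟨y, List.mem_append_left _ hy, e⟩
  · obtain ⟨y, hy, e⟩ := h' x hx
    exact ⟨y, List.mem_append_right _ hy, e⟩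

/-- A derivation of `NEq` between networks without restrictions may pass through networks with
restrictions, so a node is followed together with the channels hidden around it. Alpha-conversion is
absorbed by `HBisim.rename` and scope extrusion by `HBisim.insert_fresh`. When nothing is hidden,
plain strong bisimilarity remains (`HBisim.pbisim`). -/
theorem NEq.hSim {M N : Net S} (h : NEq M N) : HSim M N ∧ HSim N M := by
  induction h with
  | refl M => exact ⟨.of_subset fun _ => id, .of_subset fun _ => id⟩
  | symm _ ih => exact ih.symm
  | trans _ _ ih1 ih2 =>
    refine ⟨fun x hx => ?_, fun x hx => ?_⟩
    · obtain ⟨y, hy, e⟩ := ih1.1 x hx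
      obtain ⟨z, hz, e'⟩ := ih2.1 y hy
      exact ⟨z, hz, e.trans e'⟩
    · obtain ⟨y, hy, e⟩ := ih2.2 x hx
      obtain ⟨z, hz, e'⟩ := ih1.2 y hy
      exact ⟨z, hz, e.trans e'⟩
  | alpha c c' M hc hM =>
    have key : ∀ x ∈ M.hdevs, HRel (x.1, insert c x.2)
        ((hdevRen c c' x).1, insert c' (hdevRen c c' x).2) := by
      intro x hx
      have hP : ¬ x.1.proc.HasChan c' := fun h => hM (Net.hasChan_of_mem_hdevs hx h)
      -- An inner restriction of `c` shadows the outer one. The renaming then leaves this node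
      -- alone, and only the unused channel `c'` is hidden in addition.
      by_cases hcx : c ∈ x.2
      · rw [hdevRen_of_mem c' hcx, Set.insert_eq_of_mem hcx]
        exact ⟨rfl, (HBisim.insert_fresh (Or.inr hP)).symm⟩
      · rw [hdevRen_of_notMem c' hcx]
        exact ⟨rfl, HBisim.rename hc hP x.2⟩
    constructor
    · intro x hx
      obtain ⟨y, hy, rfl⟩ := List.mem_map.1 hx
      refine ⟨_, ?_, key y hy⟩
      rw [Net.hdevs, Net.hdevs_renameChan, List.map_map]
      exact List.mem_map.2 ⟨y, hy, rfl⟩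
    · intro x hx
      rw [Net.hdevs, Net.hdevs_renameChan, List.map_map] at hx
      obtain ⟨y, hy, rfl⟩ := List.mem_map.1 hx
      exact ⟨_, List.mem_map_of_mem hy, (key y hy).symm⟩
  | node d h =>
    refine ⟨fun x hx => ?_, fun x hx => ?_⟩
    · rw [List.mem_singleton.1 hx]
      exact ⟨_, List.mem_singleton.2 rfl, rfl, h.hbisim ∅⟩
    · rw [List.mem_singleton.1 hx]
      exact ⟨_, List.mem_singleton.2 rfl, rfl, h.symm.hbisim ∅⟩
  | par_zero M =>
    exact ⟨.of_subset (by simp [Net.hdevs]), .of_subset (by simp [Net.hdevs])⟩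
  | par_comm M N =>
    exact ⟨.of_subset (by simp [Net.hdevs]), .of_subset (by simp [Net.hdevs])⟩
  | par_assoc M N O =>
    exact ⟨.of_subset (by simp [Net.hdevs]), .of_subset (by simp [Net.hdevs])⟩
  | res_zero c =>
    exact ⟨.of_subset (by simp [Net.hdevs]), .of_subset (by simp [Net.hdevs])⟩
  | res_comm c d M =>
    have key : ∀ c d, HSim (.res c (.res d M)) (.res d (.res c M)) := by
      intro c d
      apply HSim.of_subset
      intro x hx
      simp only [Net.hdevs, List.map_map] at hx ⊢
      obtain ⟨y, hy, rfl⟩ := List.mem_map.1 hx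
      exact List.mem_map.2 ⟨y, hy, by simp [Set.insert_comm]⟩
    exact ⟨key c d, key d c⟩
  | res_par c M N hM =>
    have key : ∀ y ∈ M.hdevs, HRel (y.1, insert c y.2) y := fun y hy =>
      ⟨rfl, HBisim.insert_fresh (Net.mem_hdevs_of_hasChan hM hy)⟩
    refine ⟨fun x hx => ?_, fun x hx => ?_⟩
    · obtain ⟨y, hy, rfl⟩ := List.mem_map.1 hx
      rcases List.mem_append.1 hy with hy | hy
      · exact ⟨y, List.mem_append_left _ hy, key y hy⟩
      · exact ⟨_, List.mem_append_right _ (List.mem_map_of_mem hy), HRel.refl _⟩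
    · rcases List.mem_append.1 hx with hx | hx
      · exact ⟨_, List.mem_map_of_mem (List.mem_append_left _ hx), (key x hx).symm⟩
      · obtain ⟨y, hy, rfl⟩ := List.mem_map.1 hx
        exact ⟨_, List.mem_map_of_mem (List.mem_append_right _ hy), HRel.refl _⟩
  | congr_par _ _ ih1 ih2 => exact ⟨ih1.1.congr_par ih2.1, ih1.2.congr_par ih2.2⟩
  | congr_res c _ ih => exact ⟨ih.1.congr_res c, ih.2.congr_res c⟩

/-! ### From labelled transitions to reductions -/

/-- The axioms of the untimed process transitions: a prefix fires. -/
inductive PHead : PLabel S → Proc S 0 0 → Proc S 0 0 → Prop where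
  | snd (c : S.Chan) (v : S.Val) (P Q : Proc S 0 0) :
      PHead (.send c v) (.send c (.val v) P Q) P
  | rcv (c : S.Chan) (v : S.Val) (P : Proc S 1 0) (Q : Proc S 0 0) :
      PHead (.recv c v) (.recv c P Q) (P.inst v)
  | sensor (s : S.Sens) (v : S.Val) (P : Proc S 1 0) :
      PHead (.sense s v) (.sense s P) (P.inst v)
  | actuator (a : S.Act) (v : S.Val) (P : Proc S 0 0) :
      PHead (.write a v) (.write a (.val v) P) P
  | pos (h : S.Loc) (P : Proc S 1 0) : PHead (.pos h) (.pos P) (P.inst (S.coord h))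

theorem PHead.rename (c c' : S.Chan) {l : PLabel S} {X X' : Proc S 0 0} (h : PHead l X X') :
    PHead (l.rename c c') (X.renameChan c c') (X'.renameChan c c') := by
  cases h with
  | snd d v P Q => exact .snd _ _ _ _
  | rcv d v P Q =>
    rw [Proc.renameChan_inst]
    exact .rcv _ _ _ _
  | sensor s v P =>
    rw [Proc.renameChan_inst]
    exact .sensor _ _ _
  | actuator a v P => exact .actuator _ _ _
  | pos h P =>
    rw [Proc.renameChan_inst]
    exact .pos _ _

theorem PCong.par_left_comm {n m : ℕ} (P Q R : Proc S n m) :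
    PCong (.par P (.par Q R)) (.par Q (.par P R)) :=
  ((PCong.par_assoc P Q R).symm.trans (.congr_par (.par_comm P Q) (.refl R))).trans
    (.par_assoc Q P R)

theorem PCong.par_par_comm {n m : ℕ} (P Q R T : Proc S n m) :
    PCong (.par (.par P Q) (.par R T)) (.par (.par P R) (.par Q T)) :=
  ((PCong.par_assoc P Q _).trans (.congr_par (.refl P) (.par_left_comm Q R T))).trans
    (PCong.par_assoc P R _).symm

theorem PCong.cond_of_true {b : Guard S 0} (P Q : Proc S 0 0) (hb : b.eval Fin.elim0 = true) :
    PCong (.cond b P Q) P :=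
  .cond_true b P Q fun ρ => (congrArg b.eval (Subsingleton.elim ρ _)).trans hb

theorem PCong.cond_of_false {b : Guard S 0} (P Q : Proc S 0 0) (hb : b.eval Fin.elim0 = false) :
    PCong (.cond b P Q) Q :=
  .cond_false b P Q fun ρ => (congrArg b.eval (Subsingleton.elim ρ _)).trans hb

/-- A visible transition is caused by a single prefix. Structural congruence unfolds recursion,
resolves conditionals and gathers the idle components in `R`, so that an axiom of the reduction
semantics applies to `X`. -/
theorem PTrans.head {l : PLabel S} {P P' : Proc S 0 0} (h : PTrans l P P') : l ≠ .tau →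
    ∃ X X' R, PHead l X X' ∧ PCong P (.par X R) ∧ PCong P' (.par X' R) := by
  have base : ∀ {l : PLabel S} {X X' : Proc S 0 0}, PHead l X X' →
      ∃ Y Y' R, PHead l Y Y' ∧ PCong X (.par Y R) ∧ PCong X' (.par Y' R) :=
    fun {l X X'} h => ⟨X, X', .nil, h, (PCong.par_nil X).symm, (PCong.par_nil X').symm⟩
  induction h with
  | snd c v P Q => exact fun _ => base (.snd _ _ _ _)
  | rcv c v P Q => exact fun _ => base (.rcv _ _ _ _)
  | sensor s v P => exact fun _ => base (.sensor _ _ _)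
  | actuator a v P => exact fun _ => base (.actuator _ _ _)
  | pos h P => exact fun _ => base (.pos _ _)
  | comL => exact fun h => (h rfl).elim
  | comR => exact fun h => (h rfl).elim
  | parL l P P' Q _ ih =>
    intro hl
    obtain ⟨X, X', R, h, h1, h2⟩ := ih hl
    exact ⟨X, X', .par R Q, h, (PCong.congr_par h1 (.refl Q)).trans (.par_assoc _ _ _),
      (PCong.congr_par h2 (.refl Q)).trans (.par_assoc _ _ _)⟩
  | parR l P Q Q' _ ih =>
    intro hl
    obtain ⟨X, X', R, h, h1, h2⟩ := ih hl
    exact ⟨X, X', .par P R, h, (PCong.congr_par (.refl P) h1).trans (.par_left_comm _ _ _),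
      (PCong.congr_par (.refl P) h2).trans (.par_left_comm _ _ _)⟩
  | fix l P Q _ ih =>
    intro hl
    obtain ⟨X, X', R, h, h1, h2⟩ := ih hl
    exact ⟨X, X', R, h, (PCong.unfold P).trans h1, h2⟩
  | condT l b P Q R hb _ ih =>
    intro hl
    obtain ⟨X, X', R, h, h1, h2⟩ := ih hl
    exact ⟨X, X', R, h, (PCong.cond_of_true P Q hb).trans h1, h2⟩
  | condF l b P Q R hb _ ih =>
    intro hl
    obtain ⟨X, X', R, h, h1, h2⟩ := ih hl
    exact ⟨X, X', R, h, (PCong.cond_of_false P Q hb).trans h1, h2⟩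

theorem PTrans.com_head {l : PLabel S} {P P' : Proc S 0 0} (h : PTrans l P P') : l = .tau →
    ∃ c v A B Q T R, S.rng c = .intra ∧
      PCong P (.par (.par (.send c (.val v) A B) (.recv c Q T)) R) ∧
      PCong P' (.par (.par A (Q.inst v)) R) := by
  have base : ∀ {c v} {P P' Q Q' : Proc S 0 0}, PTrans (.send c v) P P' →
      PTrans (.recv c v) Q Q' → S.rng c = .intra → ∃ c v A B Q₁ T R, S.rng c = .intra ∧
      PCong (.par P Q) (.par (.par (.send c (.val v) A B) (.recv c Q₁ T)) R) ∧
      PCong (.par P' Q') (.par (.par A (Q₁.inst v)) R) := by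
    intro c v P P' Q Q' hP hQ hc
    obtain ⟨X, X', R, h, h1, h2⟩ := hP.head (by simp)
    obtain ⟨Y, Y', T, h', h3, h4⟩ := hQ.head (by simp)
    cases h
    cases h'
    exact ⟨_, _, _, _, _, _, _, hc, (PCong.congr_par h1 h3).trans (.par_par_comm _ _ _ _),
      (PCong.congr_par h2 h4).trans (.par_par_comm _ _ _ _)⟩
  induction h with
  | snd c v P Q => exact fun h => nomatch h
  | rcv c v P Q => exact fun h => nomatch h
  | sensor s v P => exact fun h => nomatch h
  | actuator a v P => exact fun h => nomatch h
  | pos h P => exact fun h => nomatch h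
  | comL c v P P' Q Q' hP hQ hc => exact fun _ => base hP hQ hc
  | comR c v P P' Q Q' hP hQ hc =>
    intro _
    obtain ⟨c, v, A, B, Q, T, R, h, h1, h2⟩ := base hQ hP hc
    exact ⟨c, v, A, B, Q, T, R, h, (PCong.par_comm _ _).trans h1, (PCong.par_comm _ _).trans h2⟩
  | parL l P P' Q _ ih =>
    intro hl
    obtain ⟨c, v, A, B, Q, T, R, h, h1, h2⟩ := ih hl
    exact ⟨c, v, A, B, Q, T, _, h, (PCong.congr_par h1 (.refl _)).trans (.par_assoc _ _ _),
      (PCong.congr_par h2 (.refl _)).trans (.par_assoc _ _ _)⟩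
  | parR l P Q Q' _ ih =>
    intro hl
    obtain ⟨c, v, A, B, Q, T, R, h, h1, h2⟩ := ih hl
    exact ⟨c, v, A, B, Q, T, _, h, (PCong.congr_par (.refl _) h1).trans (.par_left_comm _ _ _),
      (PCong.congr_par (.refl _) h2).trans (.par_left_comm _ _ _)⟩
  | fix l P Q _ ih =>
    intro hl
    obtain ⟨c, v, A, B, Q, T, R, h, h1, h2⟩ := ih hl
    exact ⟨c, v, A, B, Q, T, R, h, (PCong.unfold P).trans h1, h2⟩
  | condT l b P Q R hb _ ih =>
    intro hl
    obtain ⟨c, v, A, B, Q, T, R, h, h1, h2⟩ := ih hl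
    exact ⟨c, v, A, B, Q, T, R, h, (PCong.cond_of_true _ _ hb).trans h1, h2⟩
  | condF l b P Q R hb _ ih =>
    intro hl
    obtain ⟨c, v, A, B, Q, T, R, h, h1, h2⟩ := ih hl
    exact ⟨c, v, A, B, Q, T, R, h, (PCong.cond_of_false _ _ hb).trans h1, h2⟩

/-- This is `parp` for one node. A product of one node ends in `zero`, which `parn` supplies and
structural congruence removes. -/
theorem RedI.addPar_node {ω : ILabel S} {d d' : Dev S} (h : RedI ω (.node d) (.node d'))
    (hn : d.name = d'.name) (R : Proc S 0 0) :
    RedI ω (.node (d.addPar R)) (.node (d'.addPar R)) :=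
  .struct ω _ _ _ _ (NCong.par_zero _).symm
    (.parp ω [(d, d', R)] (by simpa using hn) (.parn ω _ _ .zero h)) (.par_zero _)

theorem RedI.node_of_head {ω : ILabel S} {n : S.Node} {I I' : Iface S} {μ : Mob} {h : S.Loc}
    {P P' X X' R : Proc S 0 0} (hP : PCong P (.par X R)) (hP' : PCong P' (.par X' R))
    (hr : RedI ω (.node ⟨n, I, X, μ, h⟩) (.node ⟨n, I', X', μ, h⟩)) :
    RedI ω (.node ⟨n, I, P, μ, h⟩) (.node ⟨n, I', P', μ, h⟩) :=
  .struct ω _ _ _ _ (.node ⟨n, I, P, μ, h⟩ hP) (hr.addPar_node rfl R)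
    (NCong.node ⟨n, I', P', μ, h⟩ hP').symm

/-! ### Fresh channels and extrusion of restrictions -/

theorem Proc.finite_hasChan {n m : ℕ} (P : Proc S n m) : {c | P.HasChan c}.Finite := by
  induction P with
  | nil => exact Set.finite_empty
  | sleep P ih => exact ih
  | pos P ih => exact ih
  | sense s P ih => exact ih
  | write a e P ih => exact ih
  | par P Q ihP ihQ => exact ihP.union ihQ
  | send c e P Q ihP ihQ =>
    exact ((Set.finite_singleton c).union (ihP.union ihQ)).subset fun d hd =>
      hd.imp (fun h => h.symm) id
  | recv c P Q ihP ihQ =>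
    exact ((Set.finite_singleton c).union (ihP.union ihQ)).subset fun d hd =>
      hd.imp (fun h => h.symm) id
  | cond b P Q ihP ihQ => exact ihP.union ihQ
  | pvar X => exact Set.finite_empty
  | fix P ih => exact ih

theorem Net.finite_hasChan (M : Net S) : {c | M.HasChan c}.Finite := by
  induction M with
  | zero => exact Set.finite_empty
  | node d => exact d.proc.finite_hasChan
  | par M N ihM ihN => exact ihM.union ihN
  | res c M ih =>
    exact ((Set.finite_singleton c).union ih).subset fun d hd => hd.imp (fun h => h.symm) id

theorem exists_fresh_chan (c : S.Chan) {F : Set S.Chan} (hF : F.Finite) :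
    ∃ c', S.rng c' = S.rng c ∧ c' ∉ F := by
  obtain ⟨c', h1, h2⟩ := (S.infinite_chan c).exists_notMem_finite hF
  exact ⟨c', h1, h2⟩

theorem NCong.congr_resList (L : List S.Chan) {M N : Net S} (h : NCong M N) :
    NCong (.resList L M) (.resList L N) := by
  induction L with
  | nil => exact h
  | cons c L ih => exact .congr_res c ih

theorem NCong.resList_par {L : List S.Chan} {N : Net S} (hL : ∀ c ∈ L, ¬ N.HasChan c)
    (M : Net S) : NCong (.par (.resList L M) N) (.resList L (.par M N)) := by
  induction L with
  | nil => exact .refl _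
  | cons c L ih =>
    have h1 : ¬ N.FreeChan c := fun h => hL c List.mem_cons_self h.hasChan
    refine (NCong.par_comm _ _).trans ((NCong.res_par c N _ h1).symm.trans (.congr_res c ?_))
    exact (NCong.par_comm _ _).trans (ih fun d hd => hL d (List.mem_cons_of_mem c hd))

theorem Net.renameChan_resList {c : S.Chan} (c' : S.Chan) {L : List S.Chan} (hL : c ∉ L)
    (M : Net S) : (Net.resList L M).renameChan c c' = .resList L (M.renameChan c c') := by
  induction L with
  | nil => rfl
  | cons d L ih =>
    rw [List.mem_cons, not_or] at hL
    exact (Net.renameChan_res_ne c' (Ne.symm hL.1) _).trans (congrArg (Net.res d) (ih hL.2))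

theorem NCong.par_left_comm (M N O : Net S) :
    NCong (.par M (.par N O)) (.par N (.par M O)) :=
  ((NCong.par_assoc M N O).symm.trans (.congr_par (.par_comm M N) (.refl O))).trans
    (.par_assoc N M O)

theorem NCong.par_par_comm (M N O U : Net S) :
    NCong (.par (.par M N) (.par O U)) (.par (.par M O) (.par N U)) :=
  ((NCong.par_assoc M N _).trans (.congr_par (.refl M) (.par_left_comm N O U))).trans
    (NCong.par_assoc M O _).symm

/-- The process label of a communication label. -/
inductive ComLabel (c : S.Chan) (k : S.Loc) : NLabel S → PLabel S → Prop where
  | send (v : S.Val) : ComLabel c k (.send c v k) (.send c v)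
  | recv (v : S.Val) : ComLabel c k (.recv c v k) (.recv c v)

/-- A network that communicates is a node that communicates in a static context. -/
theorem NTrans.com_head {c : S.Chan} {k : S.Loc} {l : NLabel S} {M M' : Net S}
    (h : NTrans l M M') : ∀ {p : PLabel S}, ComLabel c k l p → ∀ F : Set S.Chan, F.Finite →
    ∃ (L : List S.Chan) (n : S.Node) (I : Iface S) (X X' R : Proc S 0 0) (μ : Mob) (N : Net S),
      (∀ x ∈ L, x ∉ F) ∧ PHead p X X' ∧
      NCong M (.resList L (.par (.node ⟨n, I, .par X R, μ, k⟩) N)) ∧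
      NCong M' (.resList L (.par (.node ⟨n, I, .par X' R, μ, k⟩) N)) := by
  have base : ∀ {p : PLabel S} {P P' : Proc S 0 0}, PTrans p P P' → p ≠ .tau →
      ∀ (n : S.Node) (I : Iface S) (μ : Mob) (k : S.Loc) (F : Set S.Chan),
      ∃ (L : List S.Chan) (n₁ : S.Node) (I₁ : Iface S) (X X' R : Proc S 0 0) (μ₁ : Mob)
        (N : Net S), (∀ x ∈ L, x ∉ F) ∧ PHead p X X' ∧
        NCong (.node ⟨n, I, P, μ, k⟩) (.resList L (.par (.node ⟨n₁, I₁, .par X R, μ₁, k⟩) N)) ∧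
        NCong (.node ⟨n, I, P', μ, k⟩)
          (.resList L (.par (.node ⟨n₁, I₁, .par X' R, μ₁, k⟩) N)) := by
    intro p P P' hP hp n I μ k F
    obtain ⟨X, X', R, h, h1, h2⟩ := hP.head hp
    exact ⟨[], n, I, X, X', R, μ, .zero, by simp, h,
      (NCong.node ⟨n, I, P, μ, k⟩ h1).trans (NCong.par_zero _).symm,
      (NCong.node ⟨n, I, P', μ, k⟩ h2).trans (NCong.par_zero _).symm⟩
  induction h with
  | snd n I P P' μ k d v hP hd =>
    intro p hp F hF
    cases hp
    exact base hP (by simp) n I μ _ F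
  | rcv n I P P' μ k d v hP hd =>
    intro p hp F hF
    cases hp
    exact base hP (by simp) n I μ _ F
  | parL l M M' N _ ih =>
    intro p hp F hF
    obtain ⟨L, n, I, X, X', R, μ, O, h1, h2, h3, h4⟩ := ih hp _ (hF.union N.finite_hasChan)
    have hL : ∀ c ∈ L, ¬ N.HasChan c := fun c hc h => h1 c hc (Or.inr h)
    refine ⟨L, n, I, X, X', R, μ, .par O N, fun x hx h => h1 x hx (Or.inl h), h2, ?_, ?_⟩
    · exact ((NCong.congr_par h3 (.refl N)).trans (NCong.resList_par hL _)).trans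
        (NCong.congr_resList L (.par_assoc _ _ _))
    · exact ((NCong.congr_par h4 (.refl N)).trans (NCong.resList_par hL _)).trans
        (NCong.congr_resList L (.par_assoc _ _ _))
  | parR l N M M' _ ih =>
    intro p hp F hF
    obtain ⟨L, n, I, X, X', R, μ, O, h1, h2, h3, h4⟩ := ih hp _ (hF.union N.finite_hasChan)
    have hL : ∀ c ∈ L, ¬ N.HasChan c := fun c hc h => h1 c hc (Or.inr h)
    refine ⟨L, n, I, X, X', R, μ, .par O N, fun x hx h => h1 x hx (Or.inl h), h2, ?_, ?_⟩
    · exact (((NCong.par_comm _ _).trans (NCong.congr_par h3 (.refl N))).trans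
        (NCong.resList_par hL _)).trans (NCong.congr_resList L (.par_assoc _ _ _))
    · exact (((NCong.par_comm _ _).trans (NCong.congr_par h4 (.refl N))).trans
        (NCong.resList_par hL _)).trans (NCong.congr_resList L (.par_assoc _ _ _))
  | res l e M M' _ hl ih =>
    intro p hp F hF
    -- The restriction of `e` is itself renamed to a fresh `e'`, since `e` may belong to `F`.
    -- Avoiding `e` in `L` lets this renaming pass below the restrictions already extruded.
    obtain ⟨L, n, I, X, X', R, μ, O, h1, h2, h3, h4⟩ := ih hp _ (hF.insert e)
    set Y := Net.resList L (.par (.node ⟨n, I, .par X R, μ, k⟩) O) with hY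
    set Y' := Net.resList L (.par (.node ⟨n, I, .par X' R, μ, k⟩) O) with hY'
    obtain ⟨e', he, hf⟩ :=
      exists_fresh_chan e ((hF.union Y.finite_hasChan).union Y'.finite_hasChan)
    have heL : e ∉ L := fun h => h1 e h (Set.mem_insert e F)
    have hp' : p.rename e e' = p := by
      apply PLabel.rename_of_not_on
      cases hp <;> exact fun h => hl h
    refine ⟨e' :: L, n, I, X.renameChan e e', X'.renameChan e e', R.renameChan e e', μ,
      O.renameChan e e', ?_, hp' ▸ h2.rename e e', ?_, ?_⟩
    · intro x hx h
      rcases List.mem_cons.1 hx with rfl | hx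
      · exact hf (Or.inl (Or.inl h))
      · exact h1 x hx (Set.mem_insert_of_mem e h)
    · refine (NCong.congr_res e h3).trans ?_
      have := NCong.alpha e e' Y he fun h => hf (Or.inl (Or.inr h))
      rwa [hY, Net.renameChan_resList e' heL, ← hY] at this
    · refine (NCong.congr_res e h4).trans ?_
      have := NCong.alpha e e' Y' he fun h => hf (Or.inr h)
      rwa [hY', Net.renameChan_resList e' heL, ← hY'] at this
  | _ => exact fun h => nomatch h

theorem RedI.resList {ω : ILabel S} (L : List S.Chan) {M N : Net S} (h : RedI ω M N) :
    RedI ω (.resList L M) (.resList L N) := by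
  induction L with
  | nil => exact h
  | cons c L ih => exact .res ω c _ _ ih

theorem RedI.glbcom_par {c : S.Chan} {v : S.Val} {h k : S.Loc} {M M' N N' : Net S}
    (hM : NTrans (.send c v k) M M') (hN : NTrans (.recv c v h) N N')
    (hc : (S.rng c).Covers (S.dist h k)) : RedI .tau (.par M N) (.par M' N') := by
  obtain ⟨L, n, I, X, X', R, μ, O, h1, h2, h3, h4⟩ := hM.com_head (.send v) _
    (N.finite_hasChan.union N'.finite_hasChan)
  set Y := Net.par (.node ⟨n, I, .par X R, μ, k⟩) O with hY
  set Y' := Net.par (.node ⟨n, I, .par X' R, μ, k⟩) O with hY'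
  -- The restrictions of the receiver are extruded after those of the sender, so they have to avoid
  -- the channels of the sender as already exposed.
  obtain ⟨K, m, J, Z, Z', T, ν, U, h1', h2', h3', h4'⟩ := hN.com_head (.recv v) _
    (Y.finite_hasChan.union Y'.finite_hasChan)
  have key : ∀ {A B C D E G : Net S}, NCong A (.resList L (.par D E)) →
      NCong B (.resList K (.par C G)) → (∀ x ∈ L, ¬ B.HasChan x) →
      (∀ x ∈ K, ¬ (Net.par D E).HasChan x) →
      NCong (.par A B) (.resList L (.resList K (.par (.par D C) (.par E G)))) := by
    intro A B C D E G hA hB hL hK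
    refine ((NCong.congr_par hA (.refl B)).trans (NCong.resList_par hL _)).trans
      (NCong.congr_resList L ?_)
    refine (NCong.congr_par (.refl _) hB).trans ((NCong.par_comm _ _).trans
      ((NCong.resList_par hK _).trans (NCong.congr_resList K ?_)))
    exact (NCong.par_comm _ _).trans (.par_par_comm _ _ _ _)
  refine .struct .tau _ _ _ _ (key h3 h3' (fun x hx h => h1 x hx (Or.inl h))
    (fun x hx h => h1' x hx (Or.inl h))) (RedI.resList L (RedI.resList K (.parn _ _ _ _ ?_)))
    (key h4 h4' (fun x hx h => h1 x hx (Or.inr h)) (fun x hx h => h1' x hx (Or.inr h))).symm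
  cases h2 with
  | snd _ _ _ B =>
  cases h2' with
  | rcv _ _ Q W =>
  have hg := RedI.glbcom n m I J c v X' B Q W μ ν k h (by rwa [S.dist_comm])
  have h0 : ∀ A B : Net S, NCong (.par A (.par B .zero)) (.par A B) := fun A B =>
    .congr_par (.refl A) (.par_zero B)
  refine .struct .tau _ _ _ _ (h0 _ _).symm (.parp .tau
    [(⟨n, I, .send c (.val v) X' B, μ, k⟩, ⟨n, I, X', μ, k⟩, R),
      (⟨m, J, .recv c Q W, ν, h⟩, ⟨m, J, Q.inst v, ν, h⟩, T)] (by simp) ?_) (h0 _ _)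
  exact .struct .tau _ _ _ _ (h0 _ _) hg (h0 _ _).symm

/-- The transition label of an instantaneous reduction. -/
def ILabel.toN : ILabel S → NLabel S
  | .tau => .tau
  | .act a => .act a

theorem NTrans.redI {l : NLabel S} {M M' : Net S} (h : NTrans l M M') :
    ∀ ω : ILabel S, l = ω.toN → RedI ω M M' := by
  induction h with
  | pos n I P P' μ h hP =>
    intro ω hω
    cases ω <;> simp only [ILabel.toN, reduceCtorEq] at hω
    obtain ⟨X, X', R, hh, h1, h2⟩ := hP.head (by simp)
    cases hh
    exact RedI.node_of_head h1 h2 (.pos _ _ _ _ _)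
  | sensread n I P P' μ h s v hv hP =>
    intro ω hω
    cases ω <;> simp only [ILabel.toN, reduceCtorEq] at hω
    obtain ⟨X, X', R, hh, h1, h2⟩ := hP.head (by simp)
    cases hh
    exact RedI.node_of_head h1 h2 (.sensread _ _ _ _ _ _ _ hv)
  | actunchg n I P P' μ h a v hv hP =>
    intro ω hω
    cases ω <;> simp only [ILabel.toN, reduceCtorEq] at hω
    obtain ⟨X, X', R, hh, h1, h2⟩ := hP.head (by simp)
    cases hh
    exact RedI.node_of_head h1 h2 (.actunchg _ _ _ _ _ _ _ hv)
  | loccom n I P P' μ h hP =>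
    intro ω hω
    cases ω <;> simp only [ILabel.toN, reduceCtorEq] at hω
    obtain ⟨c, v, A, B, Q, T, R, hc, h1, h2⟩ := hP.com_head rfl
    exact RedI.node_of_head h1 h2 (.loccom _ _ _ _ _ _ _ _ _ _ hc)
  | actchg n I P P' μ h a v w hw hwv hP =>
    intro ω hω
    cases ω <;> simp only [ILabel.toN, reduceCtorEq, NLabel.act.injEq] at hω
    subst hω
    obtain ⟨X, X', R, hh, h1, h2⟩ := hP.head (by simp)
    cases hh
    exact RedI.node_of_head h1 h2 (.actchg _ _ _ _ _ _ _ _ hw hwv)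
  | snd n I P P' μ h d v _ _ => intro ω hω; cases ω <;> simp [ILabel.toN] at hω
  | rcv n I P P' μ h d v _ _ => intro ω hω; cases ω <;> simp [ILabel.toN] at hω
  | glbcomL M M' N N' c v h k hM hN hc =>
    intro ω hω
    cases ω <;> simp only [ILabel.toN, reduceCtorEq] at hω
    exact .glbcom_par hM hN hc
  | glbcomR M M' N N' c v h k hM hN hc =>
    intro ω hω
    cases ω <;> simp only [ILabel.toN, reduceCtorEq] at hω
    exact .struct _ _ _ _ _ (.par_comm _ _) (.glbcom_par hN hM hc) (.par_comm _ _)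
  | parL l M M' N _ ih => exact fun ω hω => .parn ω _ _ _ (ih ω hω)
  | parR l M N N' _ ih =>
    exact fun ω hω => .struct ω _ _ _ _ (.par_comm _ _) (.parn ω _ _ _ (ih ω hω)) (.par_comm _ _)
  | res l c M M' _ _ ih => exact fun ω hω => .res ω c _ _ (ih ω hω)

/-! ### From reductions to labelled transitions -/

theorem NTrans.addPar_node {l : NLabel S} {d : Dev S} {X : Net S} (h : NTrans l (.node d) X)
    (R : Proc S 0 0) : ∃ d', X = .node d' ∧ d'.name = d.name ∧
      NTrans l (.node (d.addPar R)) (.node (d'.addPar R)) := by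
  cases h with
  | pos n I P P' μ h hP => exact ⟨_, rfl, rfl, .pos _ _ _ _ _ _ (.parL _ _ _ _ hP)⟩
  | sensread n I P P' μ h s v hv hP =>
    exact ⟨_, rfl, rfl, .sensread _ _ _ _ _ _ s v hv (.parL _ _ _ _ hP)⟩
  | actunchg n I P P' μ h a v hv hP =>
    exact ⟨_, rfl, rfl, .actunchg _ _ _ _ _ _ a v hv (.parL _ _ _ _ hP)⟩
  | loccom n I P P' μ h hP => exact ⟨_, rfl, rfl, .loccom _ _ _ _ _ _ (.parL _ _ _ _ hP)⟩
  | actchg n I P P' μ h a v w hw hwv hP =>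
    exact ⟨_, rfl, rfl, .actchg _ _ _ _ _ _ a v w hw hwv (.parL _ _ _ _ hP)⟩
  | snd n I P P' μ h d v hP hd => exact ⟨_, rfl, rfl, .snd _ _ _ _ _ _ d v (.parL _ _ _ _ hP) hd⟩
  | rcv n I P P' μ h d v hP hd => exact ⟨_, rfl, rfl, .rcv _ _ _ _ _ _ d v (.parL _ _ _ _ hP) hd⟩

/-- Transitions act on nodes in place and remain possible when idle processes are added. The list
`E` retains the order, the names and the added processes, which are used to match nodes afterwards.
-/
theorem NTrans.addPar_prod {D : List (Dev S × Proc S 0 0)} :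
    ∀ {l : NLabel S} {X : Net S}, NTrans l (Net.prod (D.map fun x => .node x.1)) X →
    ∃ E : List (Dev S × Proc S 0 0),
      E.map (fun x => (x.1.name, x.2)) = D.map (fun x => (x.1.name, x.2)) ∧
      X = Net.prod (E.map fun x => .node x.1) ∧
      NTrans l (Net.prod (D.map fun x => .node (x.1.addPar x.2)))
        (Net.prod (E.map fun x => .node (x.1.addPar x.2))) := by
  induction D with
  | nil => intro l X h; cases h
  | cons x D ih =>
    intro l X h
    simp only [Net.prod, List.map_cons, List.foldr_cons] at h
    cases h with
    | glbcomL _ M' _ N' c v h k h1 h2 hc =>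
      obtain ⟨d, rfl, hd, h1'⟩ := h1.addPar_node x.2
      obtain ⟨E, hE, rfl, h2'⟩ := ih h2
      exact ⟨(d, x.2) :: E, by simp [hE, hd], rfl, .glbcomL _ _ _ _ c v h k h1' h2' hc⟩
    | glbcomR _ M' _ N' c v h k h1 h2 hc =>
      obtain ⟨d, rfl, hd, h1'⟩ := h1.addPar_node x.2
      obtain ⟨E, hE, rfl, h2'⟩ := ih h2
      exact ⟨(d, x.2) :: E, by simp [hE, hd], rfl, .glbcomR _ _ _ _ c v h k h1' h2' hc⟩
    | parL _ _ M' _ h =>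
      obtain ⟨d, rfl, hd, h1'⟩ := h.addPar_node x.2
      exact ⟨(d, x.2) :: D, by simp [hd], rfl, .parL _ _ _ _ h1'⟩
    | parR _ _ _ N' h =>
      obtain ⟨E, hE, rfl, h2'⟩ := ih h
      exact ⟨x :: E, by simp [hE], rfl, .parR _ _ _ _ h2'⟩

theorem Net.devs_prod {α : Type*} (f : α → Dev S) (D : List α) :
    (Net.prod (D.map fun x => .node (f x))).devs = D.map f := by
  induction D with
  | nil => rfl
  | cons x D ih => exact congrArg (f x :: ·) ih

theorem Net.hdevs_prod {α : Type*} (f : α → Dev S) (D : List α) :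
    (Net.prod (D.map fun x => .node (f x))).hdevs = D.map fun x => (f x, ∅) := by
  induction D with
  | nil => rfl
  | cons x D ih => exact congrArg ((f x, ∅) :: ·) ih

theorem NEq.node_of_shell {d e : Dev S} (h : d.shell = e.shell) (h' : PBisim d.proc e.proc) :
    NEq (.node d) (.node e) := by
  obtain ⟨n, I, P, μ, k⟩ := d
  obtain ⟨m, J, Q, ν, k'⟩ := e
  simp only [Dev.shell, Prod.mk.injEq] at h
  obtain ⟨rfl, rfl, rfl, rfl⟩ := h
  exact .node ⟨n, I, P, μ, k⟩ h'

/-- `NEq` may permute nodes, and adding a different process to each of them is compatible with it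
only because distinct names tell the nodes apart. The counterpart given by `NEq.hSim` has the same
name, hence sits at the same position; its process is bisimilar because nothing is hidden in a
product. -/
theorem NEq.addPar_prod {D E : List (Dev S × Proc S 0 0)}
    (hk : D.map (fun x => (x.1.name, x.2)) = E.map (fun x => (x.1.name, x.2)))
    (hE : (E.map fun x => x.1.name).Nodup)
    (h : NEq (Net.prod (D.map fun x => .node x.1)) (Net.prod (E.map fun x => .node x.1))) :
    NEq (Net.prod (D.map fun x => .node (x.1.addPar x.2)))
      (Net.prod (E.map fun x => .node (x.1.addPar x.2))) := by
  have hs := h.hSim.1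
  have h2 : List.Forall₂ (fun x y : Dev S × Proc S 0 0 =>
      (x.1.name, x.2) = (y.1.name, y.2)) D E := by
    rw [← List.forall₂_eq_eq_eq, List.forall₂_map_left_iff, List.forall₂_map_right_iff] at hk
    exact hk
  have h3 : List.Forall₂ (fun x y : Dev S × Proc S 0 0 =>
      NEq (.node (x.1.addPar x.2)) (.node (y.1.addPar y.2))) D E := by
    rw [List.forall₂_iff_zip] at h2 ⊢
    refine ⟨h2.1, fun {x y} hxy => ?_⟩
    have hx := (List.of_mem_zip hxy).1
    have hy := (List.of_mem_zip hxy).2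
    have hxy' := h2.2 hxy
    rw [Prod.mk.injEq] at hxy'
    obtain ⟨z, hz, e⟩ := hs (x.1, ∅) (by
      rw [Net.hdevs_prod]
      exact List.mem_map.2 ⟨x, hx, rfl⟩)
    rw [Net.hdevs_prod] at hz
    obtain ⟨w, hw, rfl⟩ := List.mem_map.1 hz
    have hwy : w = y := by
      refine List.inj_on_of_nodup_map hE hw hy ?_
      have := congrArg Prod.fst e.1
      exact this.symm.trans hxy'.1
    subst hwy
    exact NEq.node_of_shell e.1 (e.2.pbisim.par (hxy'.2 ▸ PBisim.refl _))
  clear hk hE h hs h2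
  induction h3 with
  | nil => exact .refl _
  | cons h _ ih => exact .congr_par h ih

/-- The names of the nodes of a network. -/
def Net.names (M : Net S) : List S.Node := M.devs.map Dev.name

theorem NEq.names {M N : Net S} (h : NEq M N) : M.names.Perm N.names := by
  have := h.shells.map Prod.fst
  rwa [List.map_map, List.map_map] at this

/-- Distinctness of names matters in the case `parp` only: the induction hypothesis gives the
residual up to `NEq`, and `NEq.addPar_prod` is what allows the added processes to be put back. -/
theorem RedI.ntrans {ω : ILabel S} {M M' : Net S} (h : RedI ω M M') : M.names.Nodup →
    ∃ M'', NTrans ω.toN M M'' ∧ NEq M'' M' := by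
  induction h with
  | pos n I P μ h => exact fun _ => ⟨_, .pos _ _ _ _ _ _ (.pos _ _), .refl _⟩
  | sensread n I s v P μ h hv =>
    exact fun _ => ⟨_, .sensread _ _ _ _ _ _ s v hv (.sensor _ _ _), .refl _⟩
  | actunchg n I a v P μ h hv =>
    exact fun _ => ⟨_, .actunchg _ _ _ _ _ _ a v hv (.actuator _ _ _), .refl _⟩
  | actchg n I a v w P μ h hw hwv =>
    exact fun _ => ⟨_, .actchg _ _ _ _ _ _ a v w hw hwv (.actuator _ _ _), .refl _⟩
  | loccom n I c v P R Q T μ h hc =>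
    exact fun _ => ⟨_, .loccom _ _ _ _ _ _ (.comL c v _ _ _ _ (.snd _ _ _ _) (.rcv _ _ _ _) hc),
      .refl _⟩
  | glbcom n m I J c v P R Q T μ ν h k hc =>
    have hc' : S.rng c ≠ .intra := fun h => by
      rw [h] at hc
      exact hc
    exact fun _ => ⟨_, .glbcomL _ _ _ _ c v k h (.snd _ _ _ _ _ _ _ _ (.snd _ _ _ _) hc')
      (.rcv _ _ _ _ _ _ _ _ (.rcv _ _ _ _) hc') (by rwa [S.dist_comm]), .refl _⟩
  | parp ω L hL _ ih =>
    intro hn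
    have hn' : (L.map fun t => t.1.name).Nodup := by
      rw [Net.names, Net.devs_prod, List.map_map] at hn
      exact hn
    obtain ⟨X, hX, e⟩ := ih (by
      rw [Net.names, Net.devs_prod, List.map_map]
      exact hn')
    have hX' : NTrans ω.toN (Net.prod ((L.map fun t => (t.1, t.2.2)).map fun x => .node x.1)) X := by
      rw [List.map_map]
      exact hX
    obtain ⟨E, hE, rfl, hX2⟩ := hX'.addPar_prod
    rw [List.map_map] at hX2
    refine ⟨_, hX2, ?_⟩
    have hk : E.map (fun x => (x.1.name, x.2)) =
        (L.map fun t => (t.2.1, t.2.2)).map (fun x => (x.1.name, x.2)) := by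
      rw [hE, List.map_map, List.map_map]
      apply List.map_congr_left
      intro t ht
      simp only [Function.comp, hL t ht]
    have := NEq.addPar_prod hk (by
      rw [List.map_map]
      refine (List.map_congr_left ?_ : _ = L.map fun t => t.1.name) ▸ hn'
      intro t ht
      exact (hL t ht).symm) (by
      rw [List.map_map]
      exact e)
    rw [List.map_map] at this
    exact this
  | parn ω M M' N _ ih =>
    intro hn
    rw [Net.names, Net.devs, List.map_append] at hn
    obtain ⟨X, hX, e⟩ := ih hn.of_append_left
    exact ⟨_, .parL _ _ _ _ hX, .congr_par e (.refl N)⟩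
  | res ω c M M' _ ih =>
    intro hn
    obtain ⟨X, hX, e⟩ := ih hn
    exact ⟨_, .res _ _ _ _ hX (by cases ω <;> trivial), .congr_res c e⟩
  | struct ω M N N' M' h1 _ h2 ih =>
    intro hn
    obtain ⟨X, hX, e⟩ := ih (h1.nEq.names.nodup_iff.1 hn)
    obtain ⟨Y, hY, e'⟩ := h1.nEq.symm.sim hX
    exact ⟨Y, hY, (e'.symm.trans e).trans h2.nEq⟩

/-- This makes the negative premises of the timed rules agree in the two semantics. -/
theorem redI_tau_iff {M : Net S} (hn : M.names.Nodup) :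
    (∃ M', RedI .tau M M') ↔ ∃ M', NTrans .tau M M' := by
  constructor
  · rintro ⟨M', h⟩
    obtain ⟨X, hX, -⟩ := h.ntrans hn
    exact ⟨X, hX⟩
  · rintro ⟨M', h⟩
    exact ⟨M', h.redI .tau rfl⟩

/-! ### Timed reductions and timed transitions -/

theorem Proc.prod_append {n m : ℕ} (A B : List (Proc S n m)) :
    PCong (Proc.prod (A ++ B)) (.par (Proc.prod A) (Proc.prod B)) := by
  induction A with
  | nil => exact ((PCong.par_comm _ _).trans (.par_nil _)).symm
  | cons P A ih => exact (PCong.congr_par (.refl P) ih).trans (PCong.par_assoc _ _ _).symm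

/-- Only `nil`, sleeps and timeouts let time pass. Unfolding recursion, resolving conditionals and
regrouping therefore lead to the normal form required by the axioms of `→_σ`. -/
theorem PTime.prod {P P' : Proc S 0 0} (h : PTime P P') :
    ∃ (A : List (Proc S 0 0 × Proc S 0 0)) (R : List (Proc S 0 0)),
      (∀ p ∈ A, IsTimeout p.1 p.2) ∧
      PCong P (.par (.prod (A.map Prod.fst)) (.prod (R.map .sleep))) ∧
      PCong P' (.par (.prod (A.map Prod.snd)) (.prod R)) := by
  have nil_par : ∀ P : Proc S 0 0, PCong (.par .nil P) P := fun P =>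
    (PCong.par_comm _ _).trans (.par_nil P)
  induction h with
  | timenil => exact ⟨[], [], by simp, (nil_par _).symm, (nil_par _).symm⟩
  | delay P =>
    exact ⟨[], [P], by simp, ((nil_par _).trans (.par_nil _)).symm,
      ((nil_par _).trans (.par_nil _)).symm⟩
  | timeout R Q h =>
    exact ⟨[(R, Q)], [], by simpa using h, ((PCong.par_nil _).trans (.par_nil _)).symm,
      ((PCong.par_nil _).trans (.par_nil _)).symm⟩
  | timepar P P' Q Q' _ _ _ ih1 ih2 =>
    obtain ⟨A, R, h1, h2, h3⟩ := ih1
    obtain ⟨B, T, h4, h5, h6⟩ := ih2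
    refine ⟨A ++ B, R ++ T, fun p hp => (List.mem_append.1 hp).elim (h1 p) (h4 p), ?_, ?_⟩
    · rw [List.map_append, List.map_append]
      exact ((PCong.congr_par h2 h5).trans (.par_par_comm _ _ _ _)).trans
        (PCong.congr_par (Proc.prod_append _ _) (Proc.prod_append _ _)).symm
    · rw [List.map_append]
      exact ((PCong.congr_par h3 h6).trans (.par_par_comm _ _ _ _)).trans
        (PCong.congr_par (Proc.prod_append _ _) (Proc.prod_append _ _)).symm
  | fix P Q _ ih =>
    obtain ⟨A, R, h1, h2, h3⟩ := ih
    exact ⟨A, R, h1, (PCong.unfold P).trans h2, h3⟩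
  | condT b P Q R hb _ ih =>
    obtain ⟨A, R, h1, h2, h3⟩ := ih
    exact ⟨A, R, h1, (PCong.cond_of_true _ _ hb).trans h2, h3⟩
  | condF b P Q R hb _ ih =>
    obtain ⟨A, R, h1, h2, h3⟩ := ih
    exact ⟨A, R, h1, (PCong.cond_of_false _ _ hb).trans h2, h3⟩

theorem NTime.redT {M M' : Net S} (h : NTime M M') : M.names.Nodup → RedT M M' := by
  have node : ∀ {n : S.Node} {I : Iface S} {μ : Mob} {h : S.Loc} {P Q : Proc S 0 0},
      PCong P Q → (¬ ∃ X, NTrans .tau (.node ⟨n, I, P, μ, h⟩) X) →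
      ¬ ∃ X, RedI .tau (.node ⟨n, I, Q, μ, h⟩) X := by
    intro n I μ h P Q e hn
    rw [redI_tau_iff (by simp [Net.names, Net.devs])]
    exact (NCong.node ⟨n, I, P, μ, h⟩ e).nEq.not_tau hn
  induction h with
  | timestat n I P P' h hP hn =>
    intro _
    obtain ⟨A, R, h1, h2, h3⟩ := hP.prod
    exact .struct _ _ _ _ (.node ⟨n, I, P, .stat, h⟩ h2) (.timestat n I h A R h1 (node h2 hn))
      (NCong.node ⟨n, I, P', .stat, h⟩ h3).symm
  | timemob n I P P' h k hP hn hk =>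
    intro _
    obtain ⟨A, R, h1, h2, h3⟩ := hP.prod
    exact .struct _ _ _ _ (.node ⟨n, I, P, .mob, h⟩ h2) (.timemob n I h k A R h1 (node h2 hn) hk)
      (NCong.node ⟨n, I, P', .mob, k⟩ h3).symm
  | timepar M M' N N' _ _ hn ih1 ih2 =>
    intro h
    have h' := h
    rw [Net.names, Net.devs, List.map_append] at h'
    exact .timepar _ _ _ _ (ih1 h'.of_append_left) (ih2 h'.of_append_right)
      (by rwa [redI_tau_iff h])
  | timezero => exact fun _ => .timezero
  | res c M M' _ ih => exact fun h => .res c _ _ (ih h)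

theorem PTime.of_prod {A : List (Proc S 0 0 × Proc S 0 0)} {R : List (Proc S 0 0)}
    (hA : ∀ p ∈ A, IsTimeout p.1 p.2)
    (hn : ¬ ∃ X, PTrans .tau (.par (.prod (A.map Prod.fst)) (.prod (R.map .sleep))) X) :
    PTime (.par (.prod (A.map Prod.fst)) (.prod (R.map .sleep)))
      (.par (.prod (A.map Prod.snd)) (.prod R)) := by
  have h1 : ∀ A : List (Proc S 0 0 × Proc S 0 0), (∀ p ∈ A, IsTimeout p.1 p.2) →
      (¬ ∃ X, PTrans .tau (Proc.prod (A.map Prod.fst)) X) →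
      PTime (Proc.prod (A.map Prod.fst)) (Proc.prod (A.map Prod.snd)) := by
    intro A
    induction A with
    | nil => exact fun _ _ => .timenil
    | cons p A ih =>
      intro h hn
      exact .timepar _ _ _ _ (.timeout _ _ (h p List.mem_cons_self))
        (ih (fun q hq => h q (List.mem_cons_of_mem p hq)) fun ⟨X, hX⟩ => hn ⟨_, .parR _ _ _ _ hX⟩) hn
  have h2 : ∀ R : List (Proc S 0 0), (¬ ∃ X, PTrans .tau (Proc.prod (R.map .sleep)) X) →
      PTime (Proc.prod (R.map .sleep)) (Proc.prod R) := by
    intro R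
    induction R with
    | nil => exact fun _ => .timenil
    | cons p R ih =>
      intro hn
      exact .timepar _ _ _ _ (.delay _) (ih fun ⟨X, hX⟩ => hn ⟨_, .parR _ _ _ _ hX⟩) hn
  exact .timepar _ _ _ _ (h1 A hA fun ⟨X, hX⟩ => hn ⟨_, .parL _ _ _ _ hX⟩)
    (h2 R fun ⟨X, hX⟩ => hn ⟨_, .parR _ _ _ _ hX⟩) hn

theorem RedT.ntime {M M' : Net S} (h : RedT M M') : M.names.Nodup →
    ∃ M'', NTime M M'' ∧ NEq M'' M' := by
  induction h with
  | timestat n I h A R hA hn =>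
    intro hd
    rw [redI_tau_iff hd] at hn
    exact ⟨_, .timestat _ _ _ _ _ (PTime.of_prod hA fun ⟨X, hX⟩ =>
      hn ⟨_, .loccom _ _ _ _ _ _ hX⟩) hn, .refl _⟩
  | timemob n I h k A R hA hn hk =>
    intro hd
    rw [redI_tau_iff hd] at hn
    exact ⟨_, .timemob _ _ _ _ _ _ (PTime.of_prod hA fun ⟨X, hX⟩ =>
      hn ⟨_, .loccom _ _ _ _ _ _ hX⟩) hn hk, .refl _⟩
  | timepar M M' N N' _ _ hn ih1 ih2 =>
    intro hd
    rw [redI_tau_iff hd] at hn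
    rw [Net.names, Net.devs, List.map_append] at hd
    obtain ⟨X, hX, e⟩ := ih1 hd.of_append_left
    obtain ⟨Y, hY, e'⟩ := ih2 hd.of_append_right
    exact ⟨_, .timepar _ _ _ _ hX hY hn, .congr_par e e'⟩
  | timezero => exact fun _ => ⟨_, .timezero, .refl _⟩
  | res c M M' _ ih =>
    intro hd
    obtain ⟨X, hX, e⟩ := ih hd
    exact ⟨_, .res _ _ _ hX, .congr_res c e⟩
  | struct M N N' M' h1 _ h2 ih =>
    intro hn
    obtain ⟨X, hX, e⟩ := ih (h1.nEq.names.nodup_iff.1 hn)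
    obtain ⟨Y, hY, e'⟩ := h1.nEq.symm.simTime hX
    exact ⟨Y, hY, (e'.symm.trans e).trans h2.nEq⟩

/-! ### Barbs -/

/-- As in `NTrans.com_head`, the restrictions around the node are extruded after being renamed away
from `F`, so that they can be moved across any parallel component. -/
theorem Net.exists_head {M : Net S} : ∀ {d : Dev S}, d ∈ M.devs → ∀ F : Set S.Chan, F.Finite →
    ∃ (L : List S.Chan) (e : Dev S) (N : Net S), (∀ x ∈ L, x ∉ F) ∧ e.shell = d.shell ∧
      NCong M (.resList L (.par (.node e) N)) := by
  induction M with
  | zero => intro d hd; simp [Net.devs] at hd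
  | node e =>
    intro d hd F hF
    rw [List.mem_singleton.1 hd]
    exact ⟨[], e, .zero, by simp, rfl, (NCong.par_zero _).symm⟩
  | par M N ihM ihN =>
    intro d hd F hF
    rcases List.mem_append.1 hd with hd | hd
    · obtain ⟨L, e, O, h1, h2, h3⟩ := ihM hd _ (hF.union N.finite_hasChan)
      exact ⟨L, e, .par O N, fun x hx h => h1 x hx (Or.inl h), h2,
        ((NCong.congr_par h3 (.refl N)).trans
          (NCong.resList_par (fun x hx h => h1 x hx (Or.inr h)) _)).trans
          (NCong.congr_resList L (.par_assoc _ _ _))⟩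
    · obtain ⟨L, e, O, h1, h2, h3⟩ := ihN hd _ (hF.union M.finite_hasChan)
      exact ⟨L, e, .par O M, fun x hx h => h1 x hx (Or.inl h), h2,
        ((NCong.par_comm _ _).trans ((NCong.congr_par h3 (.refl M)).trans
          (NCong.resList_par (fun x hx h => h1 x hx (Or.inr h)) _))).trans
          (NCong.congr_resList L (.par_assoc _ _ _))⟩
  | res c M ih =>
    intro d hd F hF
    obtain ⟨L, e, O, h1, h2, h3⟩ := ih hd _ (hF.insert c)
    set Y := Net.resList L (.par (.node e) O) with hY
    obtain ⟨c', hc, hf⟩ := exists_fresh_chan c (hF.union Y.finite_hasChan)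
    have hcL : c ∉ L := fun h => h1 c h (Set.mem_insert c F)
    refine ⟨c' :: L, { e with proc := e.proc.renameChan c c' }, O.renameChan c c', ?_, h2, ?_⟩
    · intro x hx h
      rcases List.mem_cons.1 hx with rfl | hx
      · exact hf (Or.inl h)
      · exact h1 x hx (Set.mem_insert_of_mem c h)
    · refine (NCong.congr_res c h3).trans ?_
      have := NCong.alpha c c' Y hc fun h => hf (Or.inr h)
      rwa [hY, Net.renameChan_resList c' hcL, ← hY] at this

theorem Net.devs_resList (L : List S.Chan) (M : Net S) : (Net.resList L M).devs = M.devs := by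
  induction L with
  | nil => rfl
  | cons c L ih => exact ih

/-- Structural congruence preserves the interfaces and locations of the nodes (`NEq.shells`), and
conversely every node can be brought to the front (`Net.exists_head`). -/
theorem barb_iff {M : Net S} {a : S.Act} {h : S.Loc} {v : S.Val} :
    Barb M a h v ↔ ∃ d ∈ M.devs, d.loc = h ∧ d.iface.act a = some v := by
  constructor
  · rintro ⟨L, d, M', e, h1, h2⟩
    have hd : d.shell ∈ (Net.resList L (.par (.node d) M')).devs.map Dev.shell := by
      rw [Net.devs_resList]
      exact List.mem_map_of_mem List.mem_cons_self
    rw [← e.nEq.shells.mem_iff] at hd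
    obtain ⟨d', hd', h'⟩ := List.mem_map.1 hd
    simp only [Dev.shell, Prod.mk.injEq] at h'
    exact ⟨d', hd', h'.2.2.2.trans h1, by rw [h'.2.1, h2]⟩
  · rintro ⟨d, hd, h1, h2⟩
    obtain ⟨L, e, N, -, h3, h4⟩ := Net.exists_head hd ∅ Set.finite_empty
    simp only [Dev.shell, Prod.mk.injEq] at h3
    exact ⟨L, e, N, h4, h3.2.2.2.trans h1, by rw [h3.2.1, h2]⟩

theorem NEq.barb {M N : Net S} (h : NEq M N) {a : S.Act} {k : S.Loc} {v : S.Val}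
    (hM : Barb M a k v) : Barb N a k v := by
  rw [barb_iff] at hM ⊢
  obtain ⟨d, hd, h1, h2⟩ := hM
  have hd' := h.shells.mem_iff.1 (List.mem_map_of_mem hd)
  obtain ⟨e, he, h'⟩ := List.mem_map.1 hd'
  simp only [Dev.shell, Prod.mk.injEq] at h'
  exact ⟨e, he, h'.2.2.2.trans h1, by rw [h'.2.1, h2]⟩

/-! ### Preservation of well-formedness -/

/-- The part of a node on which its compatibility with other nodes depends: its name and the
domains of its interface. -/
def Dev.key (d : Dev S) : S.Node × Set S.Act × Set S.Sens :=
  (d.name, {a | d.iface.act a = none}, {s | d.iface.sens s = none})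

/-- Two nodes with these keys can live in the same network. -/
def KeyCompat (x y : S.Node × Set S.Act × Set S.Sens) : Prop :=
  x.1 ≠ y.1 ∧ (∀ a, a ∈ x.2.1 ∨ a ∈ y.2.1) ∧ ∀ s, s ∉ S.locDep → s ∈ x.2.2 ∨ s ∈ y.2.2

def Net.keys (M : Net S) : List (S.Node × Set S.Act × Set S.Sens) := M.devs.map Dev.key

theorem Net.wf_iff {M : Net S} : M.WF ↔ M.keys.Pairwise KeyCompat ∧ ∀ d ∈ M.devs, d.WF := by
  rw [Net.keys, List.pairwise_map]
  constructor
  · intro h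
    exact ⟨(h.names.and (h.acts.and h.sens)).imp fun h => h, h.dev⟩
  · rintro ⟨h1, h2⟩
    exact ⟨h1.imp fun h => h.1, h1.imp fun h => h.2.1, h1.imp fun h => h.2.2, h2⟩

theorem Net.wf_par_iff {M N : Net S} : (Net.par M N).WF ↔
    M.WF ∧ N.WF ∧ ∀ x ∈ M.keys, ∀ y ∈ N.keys, KeyCompat x y := by
  simp only [Net.wf_iff, Net.keys, Net.devs, List.map_append, List.pairwise_append,
    List.mem_append, or_imp, forall_and]
  tauto

theorem Net.WF.left {M N : Net S} (h : (Net.par M N).WF) : M.WF := (Net.wf_par_iff.1 h).1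

theorem Net.WF.names_nodup {M : Net S} (h : M.WF) : M.names.Nodup :=
  List.pairwise_map.2 h.names

theorem NEq.keys {M N : Net S} (h : NEq M N) : M.keys.Perm N.keys := by
  have := h.shells.map fun x =>
    ((x.1, {a | x.2.1.act a = none}, {s | x.2.1.sens s = none}) :
      S.Node × Set S.Act × Set S.Sens)
  rwa [List.map_map, List.map_map] at this

theorem Net.WF.par_congr {M N O : Net S} (h : (Net.par M O).WF) (hN : N.WF)
    (hk : ∀ x ∈ N.keys, x ∈ M.keys) : (Net.par N O).WF := by
  rw [Net.wf_par_iff] at h ⊢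
  exact ⟨hN, h.2.1, fun x hx => h.2.2 x (hk x hx)⟩

theorem Net.WF.par_nEq {M N O : Net S} (h : (Net.par M O).WF) (hN : N.WF) (e : NEq M N) :
    (Net.par N O).WF :=
  h.par_congr hN fun x hx => e.keys.mem_iff.2 hx

theorem Iface.setAct_eq_none {I : Iface S} {a : S.Act} {w : S.Val} (h : I.act a = some w)
    (v : S.Val) (b : S.Act) : (I.setAct a v).act b = none ↔ I.act b = none := by
  by_cases hb : b = a
  · subst hb
    simp [Iface.setAct, h]
  · simp [Iface.setAct, hb]

/-- A write changes an actuator only if it already has a value, so the domains of the interfaces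
never vary. Compatibility of nodes, and with it well-formedness in a context, is thus an invariant.
-/
theorem NTrans.keys {l : NLabel S} {M M' : Net S} (h : NTrans l M M') : M'.keys = M.keys := by
  induction h with
  | actchg n I P P' μ h a v w hw _ _ =>
    have := Set.ext fun b => Iface.setAct_eq_none hw v b
    exact congrArg (fun A => [(n, A, {s | I.sens s = none})]) this
  | parL l M M' N _ ih => simp only [Net.keys, Net.devs, List.map_append] at ih ⊢; rw [ih]
  | parR l M M' N _ ih => simp only [Net.keys, Net.devs, List.map_append] at ih ⊢; rw [ih]
  | glbcomL M M' N N' c v h k _ _ _ ih1 ih2 =>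
    simp only [Net.keys, Net.devs, List.map_append] at ih1 ih2 ⊢; rw [ih1, ih2]
  | glbcomR M M' N N' c v h k _ _ _ ih1 ih2 =>
    simp only [Net.keys, Net.devs, List.map_append] at ih1 ih2 ⊢; rw [ih1, ih2]
  | res l c M M' _ _ ih => exact ih
  | _ => rfl

theorem NTime.keys {M M' : Net S} (h : NTime M M') : M'.keys = M.keys := by
  induction h with
  | timepar M M' N N' _ _ _ ih1 ih2 =>
    simp only [Net.keys, Net.devs, List.map_append] at ih1 ih2 ⊢; rw [ih1, ih2]
  | res c M M' _ ih => exact ih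
  | _ => rfl

theorem Dev.WF.of_uses {d d' : Dev S} (h : d.WF) (hg : d'.proc.GuardedRec)
    (hu : ∀ u, d'.proc.Uses u → d.proc.Uses u) (hs : d'.iface.sens = d.iface.sens)
    (ha : ∀ a, d'.iface.act a = none ↔ d.iface.act a = none) (hm : d'.mob = d.mob) : d'.WF where
  guarded := hg
  reads s hd := hs ▸ h.reads s ((Proc.reads_iff s _).2 (hu _ ((Proc.reads_iff s _).1 hd)))
  writes a hd := by
    have := h.writes a ((Proc.writes_iff a _).2 (hu _ ((Proc.writes_iff a _).1 hd)))
    rw [← Option.ne_none_iff_exists'] at this ⊢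
    exact fun hn => this ((ha a).1 hn)
  stationary s hl hv := hm ▸ h.stationary s hl (hs ▸ hv)
  typed s v hv := h.typed s v (hs ▸ hv)
  finite_act := h.finite_act.subset fun a hn h => hn ((ha a).2 h)

theorem NTrans.wf_dev {l : NLabel S} {M M' : Net S} (h : NTrans l M M') :
    (∀ d ∈ M.devs, d.WF) → ∀ d ∈ M'.devs, d.WF := by
  have node : ∀ {l : PLabel S} {n : S.Node} {I : Iface S} {P P' : Proc S 0 0} {μ : Mob}
      {h : S.Loc}, PTrans l P P' → (∀ d ∈ (Net.node ⟨n, I, P, μ, h⟩).devs, d.WF) →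
      ∀ d ∈ (Net.node ⟨n, I, P', μ, h⟩).devs, d.WF := by
    intro l n I P P' μ h hP hd d hd'
    rw [List.mem_singleton.1 hd']
    have hd := hd _ List.mem_cons_self
    exact hd.of_uses (hP.guardedRec hd.guarded) (fun u => hP.uses) rfl (fun a => Iff.rfl) rfl
  induction h with
  | pos n I P P' μ h hP => exact node hP
  | sensread n I P P' μ h s v _ hP => exact node hP
  | actunchg n I P P' μ h a v _ hP => exact node hP
  | loccom n I P P' μ h hP => exact node hP
  | snd n I P P' μ h c v hP _ => exact node hP
  | rcv n I P P' μ h c v hP _ => exact node hP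
  | actchg n I P P' μ h a v w hw _ hP =>
    intro hd d hd'
    rw [List.mem_singleton.1 hd']
    have hd := hd _ List.mem_cons_self
    exact hd.of_uses (hP.guardedRec hd.guarded) (fun u => hP.uses) rfl
      (Iface.setAct_eq_none hw v) rfl
  | glbcomL M M' N N' c v h k _ _ _ ih1 ih2 =>
    intro hd d hd'
    simp only [Net.devs, List.mem_append] at hd hd'
    exact hd'.elim (ih1 (fun d h => hd d (Or.inl h)) d) (ih2 (fun d h => hd d (Or.inr h)) d)
  | glbcomR M M' N N' c v h k _ _ _ ih1 ih2 =>
    intro hd d hd'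
    simp only [Net.devs, List.mem_append] at hd hd'
    exact hd'.elim (ih1 (fun d h => hd d (Or.inl h)) d) (ih2 (fun d h => hd d (Or.inr h)) d)
  | parL l M M' N _ ih =>
    intro hd d hd'
    simp only [Net.devs, List.mem_append] at hd hd'
    exact hd'.elim (ih (fun d h => hd d (Or.inl h)) d) fun h => hd d (Or.inr h)
  | parR l M N N' _ ih =>
    intro hd d hd'
    simp only [Net.devs, List.mem_append] at hd hd'
    exact hd'.elim (fun h => hd d (Or.inl h)) (ih (fun d h => hd d (Or.inr h)) d)
  | res l c M M' _ _ ih => exact ih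

theorem NTime.wf_dev {M M' : Net S} (h : NTime M M') :
    (∀ d ∈ M.devs, d.WF) → ∀ d ∈ M'.devs, d.WF := by
  induction h with
  | timestat n I P P' h hP _ =>
    intro hd d hd'
    rw [List.mem_singleton.1 hd']
    have hd := hd _ List.mem_cons_self
    exact hd.of_uses (hP.guardedRec hd.guarded) (fun u => hP.uses) rfl (fun a => Iff.rfl) rfl
  | timemob n I P P' h k hP _ _ =>
    intro hd d hd'
    rw [List.mem_singleton.1 hd']
    have hd := hd _ List.mem_cons_self
    exact hd.of_uses (hP.guardedRec hd.guarded) (fun u => hP.uses) rfl (fun a => Iff.rfl) rfl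
  | timepar M M' N N' _ _ _ ih1 ih2 =>
    intro hd d hd'
    simp only [Net.devs, List.mem_append] at hd hd'
    exact hd'.elim (ih1 (fun d h => hd d (Or.inl h)) d) (ih2 (fun d h => hd d (Or.inr h)) d)
  | timezero => exact id
  | res c M M' _ ih => exact ih

theorem NTrans.wf {l : NLabel S} {M M' : Net S} (h : NTrans l M M') (hM : M.WF) : M'.WF := by
  rw [Net.wf_iff] at hM ⊢
  exact ⟨h.keys ▸ hM.1, h.wf_dev hM.2⟩

theorem NTime.wf {M M' : Net S} (h : NTime M M') (hM : M.WF) : M'.WF := by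
  rw [Net.wf_iff] at hM ⊢
  exact ⟨h.keys ▸ hM.1, h.wf_dev hM.2⟩

theorem ETrans.wf {α : ELabel S} {M M' : Net S} (h : ETrans α M M') (hM : M.WF) : M'.WF := by
  cases h with
  | tau _ _ h => exact h.wf hM
  | tick _ _ h => exact h.wf hM
  | act a _ _ h => exact h.wf hM
  | sndObs c v h k _ _ ht _ => exact ht.wf hM
  | rcvObs c v h k _ _ ht _ => exact ht.wf hM
  | sensEnv s h v _ hv => exact hM.update hv h
  | actEnv a h v _ hb => exact hM

/-! ### Weak transitions of networks -/

def TauStar : Net S → Net S → Prop := Relation.ReflTransGen (NTrans .tau)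

/-- Weak extensional transitions on all networks. -/
def EWeak : ELabel S → Net S → Net S → Prop
  | .tau, M, M' => TauStar M M'
  | α, M, M' => ∃ M₁ M₂, TauStar M M₁ ∧ ETrans α M₁ M₂ ∧ TauStar M₂ M'

theorem TauStar.wf {M M' : Net S} (h : TauStar M M') (hM : M.WF) : M'.WF := by
  induction h with
  | refl => exact hM
  | tail _ h ih => exact h.wf ih

theorem EWeak.mk {α : ELabel S} {M M₁ M₂ M' : Net S} (h1 : TauStar M M₁) (h2 : ETrans α M₁ M₂)
    (h3 : TauStar M₂ M') : EWeak α M M' := by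
  cases α with
  | tau =>
    cases h2 with
    | tau _ _ h => exact (h1.tail h).trans h3
  | _ => exact ⟨_, _, h1, h2, h3⟩

theorem EWeak.of_eTrans {α : ELabel S} {M M' : Net S} (h : ETrans α M M') : EWeak α M M' :=
  .mk .refl h .refl

theorem EWeak.cases {α : ELabel S} {M M' : Net S} (h : EWeak α M M') :
    (α = .tau ∧ TauStar M M') ∨
      ∃ M₁ M₂, TauStar M M₁ ∧ ETrans α M₁ M₂ ∧ TauStar M₂ M' := by
  cases α with
  | tau => exact Or.inl ⟨rfl, h⟩
  | _ => exact Or.inr h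

theorem EWeak.wf {α : ELabel S} {M M' : Net S} (h : EWeak α M M') (hM : M.WF) : M'.WF := by
  rcases h.cases with ⟨-, h⟩ | ⟨M₁, M₂, h1, h2, h3⟩
  · exact h.wf hM
  · exact h3.wf (h2.wf (h1.wf hM))

theorem EWeak.trans_tau {α : ELabel S} {M M₁ M₂ M' : Net S} (h1 : TauStar M M₁)
    (h2 : EWeak α M₁ M₂) (h3 : TauStar M₂ M') : EWeak α M M' := by
  rcases h2.cases with ⟨rfl, h⟩ | ⟨_, _, h, h', h''⟩
  · exact (h1.trans h).trans h3
  · exact .mk (h1.trans h) h' (h''.trans h3)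

theorem TauStar.toWNet {M M' : Net S} (h : TauStar M M') (hM : M.WF) (hM' : M'.WF) :
    WNet.WeakTau ⟨M, hM⟩ ⟨M', hM'⟩ := by
  induction h with
  | refl => exact .refl
  | tail h1 h2 ih => exact (ih (TauStar.wf h1 hM)).tail (.tau _ _ h2)

theorem WNet.WeakTau.toNet {M M' : WNet S} (h : WNet.WeakTau M M') : TauStar M.1 M'.1 :=
  h.lift Subtype.val fun A B (h : ETrans .tau A.1 B.1) => by
    cases h with
    | tau _ _ h => exact h

theorem EWeak.toWNet {α : ELabel S} {M M' : Net S} (h : EWeak α M M') (hM : M.WF)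
    (hM' : M'.WF) : WNet.Weak α ⟨M, hM⟩ ⟨M', hM'⟩ := by
  cases α with
  | tau => exact TauStar.toWNet h hM hM'
  | _ =>
    obtain ⟨M₁, M₂, h1, h2, h3⟩ := h
    exact ⟨⟨M₁, h1.wf hM⟩, ⟨M₂, h2.wf (h1.wf hM)⟩, h1.toWNet _ _, h2, h3.toWNet _ _⟩

theorem WNet.Weak.toNet {α : ELabel S} {M M' : WNet S} (h : WNet.Weak α M M') :
    EWeak α M.1 M'.1 := by
  cases α with
  | tau => exact WNet.WeakTau.toNet h
  | _ =>
    obtain ⟨M₁, M₂, h1, h2, h3⟩ := h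
    exact ⟨M₁.1, M₂.1, h1.toNet, h2, h3.toNet⟩

/-! ### Weak bisimilarity of networks -/

/-- Weak bisimilarity as a relation on all networks; it relates only well-formed ones. -/
def Bis (M N : Net S) : Prop :=
  ∃ (hM : M.WF) (hN : N.WF), Bisimilar (⟨M, hM⟩ : WNet S) ⟨N, hN⟩

theorem Bis.symm {M N : Net S} (h : Bis M N) : Bis N M := by
  obtain ⟨hM, hN, R, hR, h⟩ := h
  exact ⟨hN, hM, R, hR, hR.symm _ _ h⟩

theorem Bis.sim {M N : Net S} (h : Bis M N) {α : ELabel S} {M' : Net S} (hM' : ETrans α M M') :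
    ∃ N', EWeak α N N' ∧ Bis M' N' := by
  obtain ⟨hM, hN, R, hR, h⟩ := h
  obtain ⟨N', h1, h2⟩ := hR.sim _ _ h α ⟨M', hM'.wf hM⟩ hM'
  exact ⟨N'.1, h1.toNet, _, N'.2, R, hR, h2⟩

theorem Bis.coind {R : Net S → Net S → Prop} (hs : ∀ M N, R M N → R N M)
    (hw : ∀ M N, R M N → M.WF)
    (h : ∀ M N, R M N → ∀ α M', ETrans α M M' → ∃ N', EWeak α N N' ∧ R M' N')
    {M N : Net S} (hR : R M N) : Bis M N := by
  refine ⟨hw _ _ hR, hw _ _ (hs _ _ hR), fun A B => R A.1 B.1, ⟨fun A B => hs _ _, ?_⟩, hR⟩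
  intro A B hAB α A' hA
  obtain ⟨N', h1, h2⟩ := h _ _ hAB α A'.1 hA
  exact ⟨⟨N', hw _ _ (hs _ _ h2)⟩, h1.toWNet B.2 _, h2⟩

theorem Bis.simTau {M N : Net S} (h : Bis M N) {M' : Net S} (hM' : TauStar M M') :
    ∃ N', TauStar N N' ∧ Bis M' N' := by
  induction hM' with
  | refl => exact ⟨N, .refl, h⟩
  | tail _ ht ih =>
    obtain ⟨N₁, h1, h2⟩ := ih
    obtain ⟨N₂, h3, h4⟩ := h2.sim (.tau _ _ ht)
    exact ⟨N₂, h1.trans h3, h4⟩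

theorem Bis.simWeak {M N : Net S} (h : Bis M N) {α : ELabel S} {M' : Net S}
    (hM' : EWeak α M M') : ∃ N', EWeak α N N' ∧ Bis M' N' := by
  rcases hM'.cases with ⟨rfl, h'⟩ | ⟨M₁, M₂, h1, h2, h3⟩
  · exact h.simTau h'
  · obtain ⟨N₁, h4, h5⟩ := h.simTau h1
    obtain ⟨N₂, h6, h7⟩ := h5.sim h2
    obtain ⟨N₃, h8, h9⟩ := h7.simTau h3
    exact ⟨N₃, h6.trans_tau h4 h8, h9⟩

theorem Bis.trans {M N O : Net S} (h1 : Bis M N) (h2 : Bis N O) : Bis M O := by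
  refine Bis.coind (R := fun M O => ∃ N, Bis M N ∧ Bis N O) ?_ ?_ ?_ ⟨N, h1, h2⟩
  · rintro M O ⟨N, h1, h2⟩
    exact ⟨N, h2.symm, h1.symm⟩
  · rintro M O ⟨N, h1, h2⟩
    exact h1.1
  · rintro M O ⟨N, h1, h2⟩ α M' hM
    obtain ⟨N', h3, h4⟩ := h1.sim hM
    obtain ⟨O', h5, h6⟩ := h2.simWeak h3
    exact ⟨O', h5, N', h4, h6⟩

theorem NEq.eSim {M N : Net S} (h : NEq M N) {α : ELabel S} {M' : Net S} (hM : ETrans α M M') :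
    ∃ N', ETrans α N N' ∧ NEq M' N' := by
  cases hM with
  | tau _ _ ht =>
    obtain ⟨N', h1, h2⟩ := h.sim ht
    exact ⟨N', .tau _ _ h1, h2⟩
  | tick _ _ ht =>
    obtain ⟨N', h1, h2⟩ := h.simTime ht
    exact ⟨N', .tick _ _ h1, h2⟩
  | act a _ _ ht =>
    obtain ⟨N', h1, h2⟩ := h.sim ht
    exact ⟨N', .act _ _ _ h1, h2⟩
  | sndObs c v k k' _ _ ht hc =>
    obtain ⟨N', h1, h2⟩ := h.sim ht
    exact ⟨N', .sndObs _ _ _ _ _ _ h1 hc, h2⟩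
  | rcvObs c v k k' _ _ ht hc =>
    obtain ⟨N', h1, h2⟩ := h.sim ht
    exact ⟨N', .rcvObs _ _ _ _ _ _ h1 hc, h2⟩
  | sensEnv s k v _ hv => exact ⟨_, .sensEnv s k v N hv, h.update s k v⟩
  | actEnv a k v _ hb => exact ⟨_, .actEnv a k v N (h.barb hb), h⟩

theorem NEq.bis {M N : Net S} (h : NEq M N) (hM : M.WF) (hN : N.WF) : Bis M N := by
  refine Bis.coind (R := fun M N => NEq M N ∧ M.WF ∧ N.WF) ?_ ?_ ?_ ⟨h, hM, hN⟩
  · exact fun M N h => ⟨h.1.symm, h.2.2, h.2.1⟩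
  · exact fun M N h => h.2.1
  · rintro M N ⟨h, hM, hN⟩ α M' hM'
    obtain ⟨N', h1, h2⟩ := h.eSim hM'
    exact ⟨N', .of_eTrans h1, h2, hM'.wf hM, h1.wf hN⟩

/-- The answer of `M` to the `τ`-transitions of `N` consists of `τ`-transitions, hence is empty. -/
theorem Bis.not_tau {M N N' : Net S} (h : Bis M N) (hM : ¬ ∃ M', NTrans .tau M M')
    (hN : TauStar N N') : Bis M N' := by
  obtain ⟨M', h1, h2⟩ := h.symm.simTau hN
  rcases h1.cases_head with rfl | ⟨X, hX, -⟩
  · exact h2.symm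
  · exact (hM ⟨X, hX⟩).elim

/-- Without `τ`-transitions, weak transitions start with their visible action. -/
theorem EWeak.head {α : ELabel S} {M M' : Net S} (h : EWeak α M M') (hα : α ≠ .tau)
    (hM : ¬ ∃ M', NTrans .tau M M') : ∃ M₁, ETrans α M M₁ := by
  rcases h.cases with ⟨h, -⟩ | ⟨M₁, M₂, h1, h2, h3⟩
  · exact (hα h).elim
  · rcases Relation.ReflTransGen.cases_head h1 with rfl | ⟨X, hX, -⟩
    · exact ⟨M₂, h2⟩
    · exact (hM ⟨X, hX⟩).elim

/-! ### Parallel composition and restriction -/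

theorem TauStar.parL {M M' : Net S} (h : TauStar M M') (O : Net S) :
    TauStar (.par M O) (.par M' O) :=
  h.lift (fun X => Net.par X O) fun _ _ h => .parL _ _ _ _ h

theorem TauStar.res {M M' : Net S} (h : TauStar M M') (c : S.Chan) :
    TauStar (.res c M) (.res c M') :=
  h.lift (Net.res c) fun _ _ h => .res _ _ _ _ h trivial

theorem Barb.parL {M : Net S} {a : S.Act} {h : S.Loc} {v : S.Val} (hb : Barb M a h v)
    (O : Net S) : Barb (.par M O) a h v := by
  rw [barb_iff] at hb ⊢
  obtain ⟨d, hd, h'⟩ := hb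
  exact ⟨d, List.mem_append_left _ hd, h'⟩

theorem Barb.parR {M : Net S} {a : S.Act} {h : S.Loc} {v : S.Val} (hb : Barb M a h v)
    (O : Net S) : Barb (.par O M) a h v := by
  rw [barb_iff] at hb ⊢
  obtain ⟨d, hd, h'⟩ := hb
  exact ⟨d, List.mem_append_right _ hd, h'⟩

theorem barb_par {M O : Net S} {a : S.Act} {h : S.Loc} {v : S.Val}
    (hb : Barb (.par M O) a h v) : Barb M a h v ∨ Barb O a h v := by
  simp only [barb_iff] at hb ⊢
  obtain ⟨d, hd, h'⟩ := hb
  exact (List.mem_append.1 hd).imp (fun hd => ⟨d, hd, h'⟩) fun hd => ⟨d, hd, h'⟩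

theorem barb_res {M : Net S} {c : S.Chan} {a : S.Act} {h : S.Loc} {v : S.Val} :
    Barb (.res c M) a h v ↔ Barb M a h v := by
  simp only [barb_iff]
  rfl

/-- A communication of `B` with `O` is an observable label of `B`. The answer of `A` has no leading
`τ`, so it starts with the same communication and gives a `τ` of `A | O`. The hypothesis on `B`
cannot be dropped, since a weak answer may ignore `τ`-transitions of `B`. -/
theorem Bis.par_not_tau {A B O : Net S} (h : Bis A B) (hA : ¬ ∃ X, NTrans .tau (.par A O) X)
    (hB : ¬ ∃ X, NTrans .tau B X) : ¬ ∃ X, NTrans .tau (.par B O) X := by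
  have hA' : ¬ ∃ X, NTrans .tau A X := fun ⟨X, hX⟩ => hA ⟨_, .parL _ _ _ _ hX⟩
  rintro ⟨X, hX⟩
  cases hX with
  | parL _ _ B' _ h => exact hB ⟨_, h⟩
  | parR _ _ _ O' h => exact hA ⟨_, .parR _ _ _ _ h⟩
  | glbcomL _ B' _ O' c v k k' h1 h2 hc =>
    obtain ⟨A', h3, -⟩ := h.symm.sim (.sndObs c v k' k _ _ h1 (by rwa [S.dist_comm]))
    obtain ⟨A₁, h4⟩ := h3.head (by simp) hA'
    cases h4 with
    | sndObs _ _ k'' _ _ _ h5 hc' =>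
      exact hA ⟨_, .glbcomL _ _ _ _ _ _ _ _ h5 h2 (by rwa [S.dist_comm])⟩
  | glbcomR _ B' _ O' c v k k' h1 h2 hc =>
    obtain ⟨A', h3, -⟩ := h.symm.sim (.rcvObs c v k k' _ _ h1 (by rwa [S.dist_comm]))
    obtain ⟨A₁, h4⟩ := h3.head (by simp) hA'
    cases h4 with
    | rcvObs _ _ k'' _ _ _ h5 hc' =>
      exact hA ⟨_, .glbcomR _ _ _ _ _ _ _ _ h5 h2 (by rwa [S.dist_comm])⟩

theorem Bis.par_sim {A B O : Net S} (h : Bis A B) {α : ELabel S} {X : Net S}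
    (hX : ETrans α (.par A O) X) :
    ∃ A' B' O', X = .par A' O' ∧ EWeak α (.par B O) (.par B' O') ∧ Bis A' B' := by
  cases hX with
  | tau _ _ hX =>
    cases hX with
    | parL _ _ A' _ hA =>
      obtain ⟨B', h1, h2⟩ := h.sim (.tau _ _ hA)
      exact ⟨A', B', O, rfl, TauStar.parL h1 O, h2⟩
    | parR _ _ _ O' hO => exact ⟨A, B, O', rfl, .of_eTrans (.tau _ _ (.parR _ _ _ _ hO)), h⟩
    | glbcomL _ A' _ O' c v k k' h1 h2 hc =>
      obtain ⟨B', h3, h4⟩ := h.sim (.sndObs c v k' k _ _ h1 (by rwa [S.dist_comm]))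
      obtain ⟨B₁, B₂, h5, h6, h7⟩ := h3
      cases h6 with
      | sndObs _ _ k'' _ _ _ h6 hc' =>
        exact ⟨A', B', O', rfl, .mk (h5.parL O)
          (.tau _ _ (.glbcomL _ _ _ _ _ _ _ _ h6 h2 (by rwa [S.dist_comm]))) (h7.parL O'), h4⟩
    | glbcomR _ A' _ O' c v k k' h1 h2 hc =>
      obtain ⟨B', h3, h4⟩ := h.sim (.rcvObs c v k k' _ _ h1 (by rwa [S.dist_comm]))
      obtain ⟨B₁, B₂, h5, h6, h7⟩ := h3
      cases h6 with
      | rcvObs _ _ k'' _ _ _ h6 hc' =>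
        exact ⟨A', B', O', rfl, .mk (h5.parL O)
          (.tau _ _ (.glbcomR _ _ _ _ _ _ _ _ h6 h2 (by rwa [S.dist_comm]))) (h7.parL O'), h4⟩
  | tick _ _ hX =>
    cases hX with
    | timepar _ A' _ O' hA hO hn =>
      obtain ⟨B', ⟨B₁, B₂, h1, h2, h3⟩, h4⟩ := h.sim (.tick _ _ hA)
      cases h2 with
      | tick _ _ h2 =>
        have hB : Bis A B₁ := h.not_tau (fun ⟨X, hX⟩ => hn ⟨_, .parL _ _ _ _ hX⟩) h1
        exact ⟨A', B', O', rfl, .mk (h1.parL O)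
          (.tick _ _ (.timepar _ _ _ _ h2 hO (hB.par_not_tau hn h2.not_tau))) (h3.parL O'), h4⟩
  | act a _ _ hX =>
    cases hX with
    | parL _ _ A' _ hA =>
      obtain ⟨B', ⟨B₁, B₂, h1, h2, h3⟩, h4⟩ := h.sim (.act a _ _ hA)
      cases h2 with
      | act _ _ _ h2 =>
        exact ⟨A', B', O, rfl, .mk (h1.parL O) (.act _ _ _ (.parL _ _ _ _ h2)) (h3.parL O), h4⟩
    | parR _ _ _ O' hO => exact ⟨A, B, O', rfl, .of_eTrans (.act _ _ _ (.parR _ _ _ _ hO)), h⟩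
  | sndObs c v k k' _ _ hX hc =>
    cases hX with
    | parL _ _ A' _ hA =>
      obtain ⟨B', ⟨B₁, B₂, h1, h2, h3⟩, h4⟩ := h.sim (.sndObs c v k k' _ _ hA hc)
      cases h2 with
      | sndObs _ _ _ _ _ _ h2 hc =>
        exact ⟨A', B', O, rfl, .mk (h1.parL O) (.sndObs _ _ _ _ _ _ (.parL _ _ _ _ h2) hc)
          (h3.parL O), h4⟩
    | parR _ _ _ O' hO =>
      exact ⟨A, B, O', rfl, .of_eTrans (.sndObs _ _ _ _ _ _ (.parR _ _ _ _ hO) hc), h⟩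
  | rcvObs c v k k' _ _ hX hc =>
    cases hX with
    | parL _ _ A' _ hA =>
      obtain ⟨B', ⟨B₁, B₂, h1, h2, h3⟩, h4⟩ := h.sim (.rcvObs c v k k' _ _ hA hc)
      cases h2 with
      | rcvObs _ _ _ _ _ _ h2 hc =>
        exact ⟨A', B', O, rfl, .mk (h1.parL O) (.rcvObs _ _ _ _ _ _ (.parL _ _ _ _ h2) hc)
          (h3.parL O), h4⟩
    | parR _ _ _ O' hO =>
      exact ⟨A, B, O', rfl, .of_eTrans (.rcvObs _ _ _ _ _ _ (.parR _ _ _ _ hO) hc), h⟩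
  | sensEnv s k v _ hv =>
    obtain ⟨B', ⟨B₁, B₂, h1, h2, h3⟩, h4⟩ := h.sim (.sensEnv s k v _ hv)
    cases h2 with
    | sensEnv _ _ _ _ _ =>
      exact ⟨_, B', O.update s k v, rfl, .mk (h1.parL O) (.sensEnv s k v _ hv) (h3.parL _), h4⟩
  | actEnv a k v _ hb =>
    rcases barb_par hb with hb | hb
    · obtain ⟨B', ⟨B₁, B₂, h1, h2, h3⟩, h4⟩ := h.sim (.actEnv a k v _ hb)
      cases h2 with
      | actEnv _ _ _ _ hb =>
        exact ⟨A, B', O, rfl, .mk (h1.parL O) (.actEnv a k v _ (hb.parL O)) (h3.parL _), h4⟩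
    · exact ⟨A, B, O, rfl, .of_eTrans (.actEnv a k v _ (hb.parR B)), h⟩

theorem Bis.par {A B O : Net S} (h : Bis A B) (hA : (Net.par A O).WF) (hB : (Net.par B O).WF) :
    Bis (.par A O) (.par B O) := by
  refine Bis.coind (R := fun M N => ∃ A B O, M = .par A O ∧ N = .par B O ∧ Bis A B ∧
    M.WF ∧ N.WF) ?_ ?_ ?_ ⟨A, B, O, rfl, rfl, h, hA, hB⟩
  · rintro M N ⟨A, B, O, rfl, rfl, h, hA, hB⟩
    exact ⟨B, A, O, rfl, rfl, h.symm, hB, hA⟩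
  · rintro M N ⟨A, B, O, rfl, rfl, h, hA, hB⟩
    exact hA
  · rintro M N ⟨A, B, O, rfl, rfl, h, hA, hB⟩ α M' hM'
    obtain ⟨A', B', O', rfl, h1, h2⟩ := h.par_sim hM'
    exact ⟨_, h1, A', B', O', rfl, rfl, h2, hM'.wf hA, h1.wf hB⟩

/-- Whether a label crosses the restriction depends on the label alone, so every transition that
answers it crosses the restriction as well. -/
theorem ETrans.of_res {α : ELabel S} {c : S.Chan} {A X : Net S} (h : ETrans α (.res c A) X) :
    ∃ A', X = .res c A' ∧ ETrans α A A' ∧ ∀ B B', ETrans α B B' →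
      ETrans α (.res c B) (.res c B') := by
  cases h with
  | tau _ _ h =>
    cases h with
    | res _ _ _ A' h hl =>
      refine ⟨A', rfl, .tau _ _ h, fun B B' hB => ?_⟩
      cases hB with
      | tau _ _ hB => exact .tau _ _ (.res _ _ _ _ hB hl)
  | tick _ _ h =>
    cases h with
    | res _ _ A' h =>
      refine ⟨A', rfl, .tick _ _ h, fun B B' hB => ?_⟩
      cases hB with
      | tick _ _ hB => exact .tick _ _ (.res _ _ _ hB)
  | act a _ _ h =>
    cases h with
    | res _ _ _ A' h hl =>
      refine ⟨A', rfl, .act _ _ _ h, fun B B' hB => ?_⟩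
      cases hB with
      | act _ _ _ hB => exact .act _ _ _ (.res _ _ _ _ hB hl)
  | sndObs d v k k' _ _ h hc =>
    cases h with
    | res _ _ _ A' h hl =>
      refine ⟨A', rfl, .sndObs _ _ _ _ _ _ h hc, fun B B' hB => ?_⟩
      cases hB with
      | sndObs _ _ _ _ _ _ hB hc => exact .sndObs _ _ _ _ _ _ (.res _ _ _ _ hB hl) hc
  | rcvObs d v k k' _ _ h hc =>
    cases h with
    | res _ _ _ A' h hl =>
      refine ⟨A', rfl, .rcvObs _ _ _ _ _ _ h hc, fun B B' hB => ?_⟩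
      cases hB with
      | rcvObs _ _ _ _ _ _ hB hc => exact .rcvObs _ _ _ _ _ _ (.res _ _ _ _ hB hl) hc
  | sensEnv s k v _ hv =>
    refine ⟨_, rfl, .sensEnv s k v A hv, fun B B' hB => ?_⟩
    cases hB with
    | sensEnv => exact .sensEnv s k v (.res c B) hv
  | actEnv a k v _ hb =>
    refine ⟨_, rfl, .actEnv a k v A (barb_res.1 hb), fun B B' hB => ?_⟩
    cases hB with
    | actEnv _ _ _ _ hb => exact .actEnv a k v _ (barb_res.2 hb)

theorem Bis.res {A B : Net S} (h : Bis A B) (c : S.Chan) : Bis (.res c A) (.res c B) := by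
  refine Bis.coind (R := fun M N => ∃ A B, M = .res c A ∧ N = .res c B ∧ Bis A B) ?_ ?_ ?_
    ⟨A, B, rfl, rfl, h⟩
  · rintro M N ⟨A, B, rfl, rfl, h⟩
    exact ⟨B, A, rfl, rfl, h.symm⟩
  · rintro M N ⟨A, B, rfl, rfl, h⟩
    exact h.1.res c
  · rintro M N ⟨A, B, rfl, rfl, h⟩ α M' hM'
    obtain ⟨A', rfl, h1, h2⟩ := hM'.of_res
    obtain ⟨B', h3, h4⟩ := h.sim h1
    rcases h3.cases with ⟨rfl, h3⟩ | ⟨B₁, B₂, h5, h6, h7⟩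
    · exact ⟨_, h3.res c, A', B', rfl, rfl, h4⟩
    · exact ⟨_, .mk (h5.res c) (h2 _ _ h6) (h7.res c), A', B', rfl, rfl, h4⟩

/-! ### Sensor updates -/

theorem Dev.update_update (s : S.Sens) (h : S.Loc) (v w : S.Val) (d : Dev S) :
    (d.update s h v).update s h w = d.update s h w := by
  by_cases hc : d.loc = h ∧ ∃ w, d.iface.sens s = some w
  · have e : d.update s h v = { d with iface := d.iface.setSens s v } := if_pos hc
    have hc' : d.loc = h ∧ ∃ w, (d.iface.setSens s v).sens s = some w :=
      ⟨hc.1, v, by simp [Iface.setSens]⟩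
    have e' : d.update s h w = { d with iface := d.iface.setSens s w } := if_pos hc
    have e'' : Dev.update s h w { d with iface := d.iface.setSens s v } =
      { d with iface := (d.iface.setSens s v).setSens s w } := if_pos hc'
    rw [e, e', e'']
    congr 1
    simp only [Iface.setSens, Iface.mk.injEq, and_true]
    funext s'
    split_ifs <;> rfl
  · have e : d.update s h v = d := if_neg hc
    rw [e]

theorem Net.update_update (s : S.Sens) (h : S.Loc) (v w : S.Val) (M : Net S) :
    (M.update s h v).update s h w = M.update s h w := by
  induction M <;> simp_all [Net.update, Dev.update_update]

/-- A bound on the number of untimed transitions of a network before the next tick. -/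
def Net.work : Net S → ℕ
  | .zero => 0
  | .node d => d.proc.work
  | .par M N => M.work + N.work
  | .res _ M => M.work

theorem Net.work_update (s : S.Sens) (h : S.Loc) (v : S.Val) (M : Net S) :
    (M.update s h v).work = M.work := by
  induction M <;> simp_all [Net.update, Net.work, Dev.update_proc]

/-- Every untimed transition involves at least one process transition in some node, and
`PTrans.work_lt` applies there. -/
theorem NTrans.work_lt {l : NLabel S} {M M' : Net S} (h : NTrans l M M') :
    (∀ d ∈ M.devs, d.WF) → M'.work < M.work := by
  have node : ∀ {l : PLabel S} {n : S.Node} {I I' : Iface S} {P P' : Proc S 0 0} {μ : Mob}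
      {h : S.Loc}, PTrans l P P' → (∀ d ∈ (Net.node ⟨n, I, P, μ, h⟩).devs, d.WF) →
      (Net.node ⟨n, I', P', μ, h⟩).work < (Net.node ⟨n, I, P, μ, h⟩).work :=
    fun hP hd => hP.work_lt (hd _ List.mem_cons_self).guarded
  induction h with
  | pos n I P P' μ h hP => exact node hP
  | sensread n I P P' μ h s v _ hP => exact node hP
  | actunchg n I P P' μ h a v _ hP => exact node hP
  | loccom n I P P' μ h hP => exact node hP
  | snd n I P P' μ h c v hP _ => exact node hP
  | rcv n I P P' μ h c v hP _ => exact node hP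
  | actchg n I P P' μ h a v w hw _ hP => exact node hP
  | glbcomL M M' N N' c v h k _ _ _ ih1 ih2 =>
    intro hd
    simp only [Net.devs, List.mem_append] at hd
    exact Nat.add_lt_add (ih1 fun d h => hd d (Or.inl h)) (ih2 fun d h => hd d (Or.inr h))
  | glbcomR M M' N N' c v h k _ _ _ ih1 ih2 =>
    intro hd
    simp only [Net.devs, List.mem_append] at hd
    exact Nat.add_lt_add (ih1 fun d h => hd d (Or.inl h)) (ih2 fun d h => hd d (Or.inr h))
  | parL l M M' N _ ih =>
    intro hd
    simp only [Net.devs, List.mem_append] at hd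
    exact Nat.add_lt_add_right (ih fun d h => hd d (Or.inl h)) _
  | parR l M N N' _ ih =>
    intro hd
    simp only [Net.devs, List.mem_append] at hd
    exact Nat.add_lt_add_left (ih fun d h => hd d (Or.inr h)) _
  | res l c M M' _ _ ih => exact ih

/-- Communications do not consult interfaces, and an update changes neither the process nor the
location of a node. -/
theorem NTrans.update_com {l : NLabel S} {M M' : Net S} (h : NTrans l M M') {c : S.Chan}
    {k : S.Loc} (s : S.Sens) (k' : S.Loc) (w : S.Val) : ∀ {p : PLabel S}, ComLabel c k l p →
    NTrans l (M.update s k' w) (M'.update s k' w) := by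
  induction h with
  | snd n I P P' μ h d v hP hd =>
    intro p hp
    have e := Dev.update_with_proc s k' w ⟨n, I, P, μ, h⟩ P'
    have hpr := Dev.update_proc s k' w ⟨n, I, P, μ, h⟩
    have hl : (Dev.update s k' w ⟨n, I, P, μ, h⟩).loc = h := by
      unfold Dev.update; split_ifs <;> rfl
    simp only [Net.update]
    rw [e]
    generalize Dev.update s k' w ⟨n, I, P, μ, h⟩ = d at *
    obtain ⟨n', I', P₁, μ', h'⟩ := d
    cases hpr
    cases hl
    exact .snd _ _ _ _ _ _ _ _ hP hd
  | rcv n I P P' μ h d v hP hd =>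
    intro p hp
    have e := Dev.update_with_proc s k' w ⟨n, I, P, μ, h⟩ P'
    have hpr := Dev.update_proc s k' w ⟨n, I, P, μ, h⟩
    have hl : (Dev.update s k' w ⟨n, I, P, μ, h⟩).loc = h := by
      unfold Dev.update; split_ifs <;> rfl
    simp only [Net.update]
    rw [e]
    generalize Dev.update s k' w ⟨n, I, P, μ, h⟩ = d at *
    obtain ⟨n', I', P₁, μ', h'⟩ := d
    cases hpr
    cases hl
    exact .rcv _ _ _ _ _ _ _ _ hP hd
  | parL l M M' N _ ih => exact fun hp => .parL _ _ _ _ (ih hp)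
  | parR l M N N' _ ih => exact fun hp => .parR _ _ _ _ (ih hp)
  | res l c M M' _ hl ih => exact fun hp => .res _ _ _ _ (ih hp) hl
  | _ => exact fun hp => nomatch hp

/-- The sensor at a location can be set so that a given `τ`-transition stays possible. -/
theorem NTrans.update_tau {l : NLabel S} {M M' : Net S} (h : NTrans l M M') {s : S.Sens}
    (k : S.Loc) {v : S.Val} (hv : v ∈ S.dom s) : l = .tau → (∀ d ∈ M.devs, d.WF) →
    ∃ w ∈ S.dom s, NTrans .tau (M.update s k w) (M'.update s k w) := by
  have node : ∀ {n : S.Node} {I : Iface S} {P P' : Proc S 0 0} {μ : Mob} {h : S.Loc} (w : S.Val),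
      (∀ J, Dev.update s k w ⟨n, I, P, μ, h⟩ = ⟨n, J, P, μ, h⟩ → I.act = J.act →
        NTrans .tau (.node ⟨n, J, P, μ, h⟩) (.node ⟨n, J, P', μ, h⟩)) →
      NTrans .tau ((Net.node ⟨n, I, P, μ, h⟩).update s k w)
        ((Net.node ⟨n, I, P', μ, h⟩).update s k w) := by
    intro n I P P' μ h w hJ
    have e := Dev.update_with_proc s k w ⟨n, I, P, μ, h⟩ P'
    have hs : ∃ J, Dev.update s k w ⟨n, I, P, μ, h⟩ = ⟨n, J, P, μ, h⟩ ∧ I.act = J.act := by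
      unfold Dev.update
      split_ifs
      exacts [⟨_, rfl, rfl⟩, ⟨_, rfl, rfl⟩]
    obtain ⟨J, h1, h2⟩ := hs
    simp only [Net.update]
    rw [e, h1]
    exact hJ J h1 h2
  induction h with
  -- The transition does not depend on `s`; any value of the domain will do, and `v` is one.
  | pos n I P P' μ h hP => exact fun _ _ => ⟨v, hv, node v fun J _ _ => .pos _ _ _ _ _ _ hP⟩
  | sensread n I P P' μ h s' v' hs hP =>
    intro _ hd
    by_cases hc : s' = s
    · subst hc
      -- The sensor is set to the very value that is read. Well-formedness puts this value in the
      -- domain of the sensor, so the update is a legitimate one.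
      refine ⟨v', (hd _ List.mem_cons_self).typed _ _ hs, node v' fun J hJ _ =>
        .sensread _ _ _ _ _ _ s' v' ?_ hP⟩
      unfold Dev.update at hJ
      split_ifs at hJ
      · cases hJ
        simp [Iface.setSens]
      · cases hJ
        exact hs
    · refine ⟨v, hv, node v fun J hJ _ => .sensread _ _ _ _ _ _ s' v' ?_ hP⟩
      unfold Dev.update at hJ
      split_ifs at hJ
      · cases hJ
        simpa [Iface.setSens, hc] using hs
      · cases hJ
        exact hs
  | actunchg n I P P' μ h a v' ha hP =>
    exact fun _ _ => ⟨v, hv, node v fun J _ hJ => .actunchg _ _ _ _ _ _ a v' (hJ ▸ ha) hP⟩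
  | loccom n I P P' μ h hP =>
    exact fun _ _ => ⟨v, hv, node v fun J _ _ => .loccom _ _ _ _ _ _ hP⟩
  | glbcomL M M' N N' c v' h k' h1 h2 hc =>
    exact fun _ _ => ⟨v, hv, .glbcomL _ _ _ _ c v' h k' (h1.update_com s k v (.send v'))
      (h2.update_com s k v (.recv v')) hc⟩
  | glbcomR M M' N N' c v' h k' h1 h2 hc =>
    exact fun _ _ => ⟨v, hv, .glbcomR _ _ _ _ c v' h k' (h1.update_com s k v (.recv v'))
      (h2.update_com s k v (.send v')) hc⟩
  | parL l M M' N _ ih =>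
    intro hl hd
    simp only [Net.devs, List.mem_append] at hd
    obtain ⟨w, hw, h⟩ := ih hl fun d h => hd d (Or.inl h)
    exact ⟨w, hw, .parL _ _ _ _ h⟩
  | parR l M N N' _ ih =>
    intro hl hd
    simp only [Net.devs, List.mem_append] at hd
    obtain ⟨w, hw, h⟩ := ih hl fun d h => hd d (Or.inr h)
    exact ⟨w, hw, .parR _ _ _ _ h⟩
  | res l c M M' _ hl ih =>
    intro hl hd
    obtain ⟨w, hw, h⟩ := ih hl hd
    exact ⟨w, hw, .res _ _ _ _ h trivial⟩
  | _ => exact fun hl => nomatch hl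

/-! ### The rank argument for sensor updates -/

theorem TauStar.work {M M' : Net S} (h : TauStar M M') (hM : M.WF) :
    M'.work < M.work ∨ M' = M := by
  induction h with
  | refl => exact Or.inr rfl
  | tail h1 h2 ih =>
    have := h2.work_lt (TauStar.wf h1 hM).dev
    rcases ih with ih | rfl
    · exact Or.inl (this.trans ih)
    · exact Or.inl this

/-- Sequences of `τ`-transitions and of updates of the sensor `s` at `h`. -/
def UStar (s : S.Sens) (h : S.Loc) : Net S → Net S → Prop :=
  Relation.ReflTransGen fun X X' => NTrans .tau X X' ∨ ∃ w ∈ S.dom s, X' = X.update s h w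

/-- A `τ`-transition strictly lowers the work, an update keeps it, and successive updates of the
same sensor at the same location collapse into the last one. A path that loses no work is therefore
at most one update. -/
theorem UStar.work {s : S.Sens} {h : S.Loc} {M M' : Net S} (hU : UStar s h M M') (hM : M.WF) :
    M'.WF ∧ (M'.work < M.work ∨ M' = M ∨ ∃ w, M' = M.update s h w) := by
  induction hU with
  | refl => exact ⟨hM, Or.inr (Or.inl rfl)⟩
  | tail h1 h2 ih =>
    obtain ⟨hw, ih⟩ := ih
    rcases h2 with h2 | ⟨w, hwd, rfl⟩
    · refine ⟨h2.wf hw, Or.inl ?_⟩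
      have := h2.work_lt hw.dev
      rcases ih with ih | rfl | ⟨w, rfl⟩
      · exact this.trans ih
      · exact this
      · rwa [Net.work_update] at this
    · refine ⟨hw.update hwd h, ?_⟩
      rw [Net.work_update]
      rcases ih with ih | rfl | ⟨w', rfl⟩
      · exact Or.inl ih
      · exact Or.inr (Or.inr ⟨w, rfl⟩)
      · exact Or.inr (Or.inr ⟨w, Net.update_update _ _ _ _ _⟩)

theorem TauStar.uStar {s : S.Sens} {h : S.Loc} {M M' : Net S} (hT : TauStar M M') :
    UStar s h M M' := by
  induction hT with
  | refl => exact .refl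
  | tail _ h ih => exact ih.tail (Or.inl h)

/-- Each `τ`-transition is replayed after the sensor has been set to a value that permits it
(`NTrans.update_tau`). Earlier values are overwritten, so these updates do not interfere with one
another. -/
theorem TauStar.update_uStar {s : S.Sens} (h : S.Loc) {v : S.Val} (hv : v ∈ S.dom s)
    {M M' : Net S} (hT : TauStar M M') (hM : M.WF) :
    ∃ w, UStar s h (M.update s h v) (M'.update s h w) := by
  induction hT with
  | refl => exact ⟨v, .refl⟩
  | @tail X Y h1 h2 ih =>
    obtain ⟨w, ih⟩ := ih
    obtain ⟨w', hw', h3⟩ := h2.update_tau h hv rfl (TauStar.wf h1 hM).dev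
    refine ⟨w', (ih.tail (Or.inr ⟨w', hw', ?_⟩)).tail (Or.inl h3)⟩
    exact (Net.update_update _ _ _ _ _).symm

theorem Bis.simU {s : S.Sens} {h : S.Loc} {X X' Y : Net S} (hX : UStar s h X X')
    (hB : Bis X Y) : ∃ Y', UStar s h Y Y' ∧ Bis X' Y' := by
  induction hX with
  | refl => exact ⟨Y, .refl, hB⟩
  | tail _ hs ih =>
    obtain ⟨Y₁, h1, h2⟩ := ih
    rcases hs with hs | ⟨w, hw, rfl⟩
    · obtain ⟨Y', h3, h4⟩ := h2.sim (.tau _ _ hs)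
      exact ⟨Y', h1.trans (TauStar.uStar h3), h4⟩
    · obtain ⟨Y', ⟨Y₂, Y₃, h3, h4, h5⟩, h6⟩ := h2.sim (.sensEnv s h w _ hw)
      cases h4 with
      | sensEnv _ _ _ _ _ =>
        exact ⟨Y', ((h1.trans h3.uStar).tail (Or.inr ⟨w, hw, rfl⟩)).trans h5.uStar, h6⟩

/-- The least work of a network that is bisimilar to `M`. -/
noncomputable def Net.rank (M : Net S) : ℕ := sInf {w | ∃ Y, Bis M Y ∧ Y.work = w}

theorem Bis.refl {M : Net S} (hM : M.WF) : Bis M M := (NEq.refl M).bis hM hM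

theorem Net.WF.exists_rank {M : Net S} (hM : M.WF) : ∃ Y, Bis M Y ∧ Y.work = M.rank :=
  Nat.sInf_mem (s := {w | ∃ Y, Bis M Y ∧ Y.work = w}) ⟨_, M, .refl hM, rfl⟩

theorem Bis.rank_le {M Y : Net S} (h : Bis M Y) : M.rank ≤ Y.work := Nat.sInf_le ⟨Y, h, rfl⟩

/-- A member of minimal work of the class of `X` can follow the path without gaining work, and it
ends in the class of `X'`. -/
theorem UStar.rank_le {s : S.Sens} {h : S.Loc} {X X' : Net S} (hU : UStar s h X X')
    (hX : X.WF) : X'.rank ≤ X.rank := by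
  obtain ⟨Y, h1, h2⟩ := hX.exists_rank
  obtain ⟨Y', h3, h4⟩ := h1.simU hU
  have := (h3.work h1.2.1).2
  refine h4.rank_le.trans (h2 ▸ ?_)
  rcases this with h | rfl | ⟨w, rfl⟩
  · exact h.le
  · exact le_rfl
  · exact (Net.work_update _ _ _ _).le

theorem Bis.rank_eq {M N : Net S} (h : Bis M N) : M.rank = N.rank := by
  have key : ∀ {M N : Net S}, Bis M N → M.rank ≤ N.rank := by
    intro M N h
    obtain ⟨Y, h1, h2⟩ := h.2.1.exists_rank
    exact h2 ▸ (h.trans h1).rank_le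
  exact le_antisymm (key h) (key h.symm)

/-- The answer of `N` to a sensor update, replayed from the updated network. -/
theorem Bis.update_path {s : S.Sens} (h : S.Loc) {v : S.Val} (hv : v ∈ S.dom s) {M N : Net S}
    (hB : Bis M N) : ∃ Z N', UStar s h (N.update s h v) Z ∧ TauStar (Z.update s h v) N' ∧
      Bis (M.update s h v) N' := by
  obtain ⟨N', ⟨N₁, N₂, h3, h4, h5⟩, h6⟩ := hB.sim (.sensEnv s h v _ hv)
  cases h4 with
  | sensEnv _ _ _ _ _ =>
    obtain ⟨w, h7⟩ := h3.update_uStar h hv hB.2.1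
    exact ⟨_, N', h7, by rwa [Net.update_update], h6⟩

/-- The answer of `N` leads to some `N'` bisimilar to the updated `M`; it remains to compare `N'`
with the updated `N`. By `Bis.update_path`, `N'` is reached from the updated `N` by `τ`-transitions
and updates of `s` at `h`. Ranks do not increase along such a path, so by symmetry both updated
networks have the same rank, and the rank is constant on the path. A network `Y` of minimal work,
bisimilar to the updated `N`, can then follow the path only by updates, since a `τ`-transition would
bring its work below the rank. Both `N'` and the updated `N` turn out to be bisimilar to `Y.update s
h v`. -/
theorem Bis.update {s : S.Sens} (h : S.Loc) {v : S.Val} (hv : v ∈ S.dom s) {M N : Net S}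
    (hB : Bis M N) : Bis (M.update s h v) (N.update s h v) := by
  have hle : ∀ {M N : Net S}, Bis M N → (M.update s h v).rank ≤ (N.update s h v).rank := by
    intro M N hB
    obtain ⟨Z, N', h1, h2, h3⟩ := hB.update_path h hv
    rw [h3.rank_eq]
    exact UStar.rank_le ((h1.tail (Or.inr ⟨v, hv, rfl⟩)).trans h2.uStar) (hB.2.1.update hv h)
  have heq := le_antisymm (hle hB) (hle hB.symm)
  have hN := hB.2.1.update hv h
  obtain ⟨Y, hY, hr⟩ := hN.exists_rank
  have hYw := hY.2.1
  -- The last stretch of a path: an update to `v` followed by `τ`-transitions. If the rank at its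
  -- end is still `Y.work`, then `Y₁`, which has the work of `Y`, can contribute no `τ`-transition
  -- either before or after its update.
  have step : ∀ {X Y₁ : Net S}, Bis X Y₁ → Y₁ = Y ∨ (∃ w, Y₁ = Y.update s h w) →
      ∀ {X'}, TauStar (X.update s h v) X' → X'.rank = Y.work → Bis X' (Y.update s h v) := by
    intro X Y₁ hX hY₁ X' hX' hr'
    obtain ⟨Y', ⟨Y₂, Y₃, h1, h2, h3⟩, h4⟩ := hX.sim (.sensEnv s h v _ hv)
    cases h2 with
    | sensEnv _ _ _ _ _ =>
      obtain ⟨Y'', h5, h6⟩ := h4.simTau hX'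
      have h7 : TauStar (Y₂.update s h v) Y'' := h3.trans h5
      have hw : Y₁.work = Y.work ∧ Y₁.update s h v = Y.update s h v := by
        rcases hY₁ with rfl | ⟨w, rfl⟩
        · exact ⟨rfl, rfl⟩
        · exact ⟨Net.work_update _ _ _ _, Net.update_update _ _ _ _ _⟩
      have hle := hr' ▸ h6.rank_le
      have hY₂ := h1.wf hX.2.1
      have e1 := h1.work hX.2.1
      have e2 := h7.work (hY₂.update hv h)
      rw [Net.work_update] at e2
      -- The end `Y''` has at least the work of `Y₁`, so no `τ`-transition occurred before the
      -- update.
      have e1' : Y₂ = Y₁ := by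
        rcases e1 with e1 | e1
        · rcases e2 with e2 | e2
          · omega
          · rw [e2, Net.work_update] at hle
            omega
        · exact e1
      subst e1'
      rcases e2 with e2 | rfl
      · omega
      · rwa [← hw.2]
  obtain ⟨Z, N', h1, h2, h3⟩ := hB.update_path h hv
  have hM : Bis N' (Y.update s h v) := by
    obtain ⟨Y₁, h4, h5⟩ := hY.simU h1
    have hr' : N'.rank = Y.work := by rw [← h3.rank_eq, heq, hr]
    -- The work of `Y₁` is at least the rank at the end of the path, which is `Y.work`; hence no
    -- work was lost in following the path to `Z`.
    have hle : Y.work ≤ Y₁.work := by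
      rw [← hr']
      exact (UStar.rank_le (((Relation.ReflTransGen.refl (a := Z)).tail
        (Or.inr ⟨v, hv, rfl⟩)).trans h2.uStar) (h1.work hN).1).trans h5.rank_le
    exact step h5 ((h4.work hYw).2.resolve_left hle.not_gt) h2 hr'
  -- The same stretch with no `τ`-transitions: updating twice to `v` is the same as updating once.
  have hN' : Bis (N.update s h v) (Y.update s h v) :=
    step hY (Or.inl rfl) (by rw [Net.update_update]; exact .refl) hr.symm
  exact h3.trans (hM.trans hN'.symm)

/-! ### Bisimilarity is a barbed relation -/

theorem TauStar.reds {M M' : Net S} (h : TauStar M M') (hM : M.WF) (hM' : M'.WF) :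
    WNet.Reds ⟨M, hM⟩ ⟨M', hM'⟩ := by
  induction h with
  | refl => exact .refl
  | tail h1 h2 ih => exact (ih (TauStar.wf h1 hM)).tail (Or.inl (h2.redI .tau rfl))

theorem Bisimilar.bis {M N : WNet S} (h : Bisimilar M N) : Bis M.1 N.1 := ⟨M.2, N.2, h⟩

/-- Reductions are exchanged for transitions by the harmony results. The resulting defect is an
`NEq`, which is contained in bisimilarity (`NEq.bis`). Barbs are the labels `actEnv`. -/
theorem isBarbedRel_bisimilar : IsBarbedRel (S := S) Bisimilar where
  symm M N h := h.bis.symm.2.2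
  red M N h := by
    constructor
    · rintro M' (hr | hr)
      · obtain ⟨X, h1, h2⟩ := hr.ntrans M.2.names_nodup
        obtain ⟨N', h3, h4⟩ := h.bis.sim (.tau _ _ h1)
        exact ⟨⟨N', h4.2.1⟩, TauStar.reds h3 N.2 h4.2.1,
          ((h2.symm.bis M'.2 h4.1).trans h4).2.2⟩
      · obtain ⟨X, h1, h2⟩ := hr.ntime M.2.names_nodup
        obtain ⟨N', ⟨N₁, N₂, h3, h5, h6⟩, h4⟩ := h.bis.sim (.tick _ _ h1)
        cases h5 with
        | tick _ _ h5 =>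
          have hN₁ := h3.wf N.2
          have hN₂ := h5.wf hN₁
          exact ⟨⟨N', h4.2.1⟩, (Relation.ReflTransGen.tail (h3.reds N.2 hN₁)
            (show WNet.Red ⟨N₁, hN₁⟩ ⟨N₂, hN₂⟩ from Or.inr (h5.redT hN₁.names_nodup))).trans
              (h6.reds hN₂ h4.2.1),
            ((h2.symm.bis M'.2 h4.1).trans h4).2.2⟩
    · intro a M' hr
      obtain ⟨X, h1, h2⟩ := RedI.ntrans hr M.2.names_nodup
      obtain ⟨N', ⟨N₁, N₂, h3, h5, h6⟩, h4⟩ := h.bis.sim (.act a _ _ h1)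
      cases h5 with
      | act _ _ _ h5 =>
        have hN₁ := h3.wf N.2
        have hN₂ := h5.wf hN₁
        exact ⟨⟨N₁, hN₁⟩, ⟨N₂, hN₂⟩, ⟨N', h4.2.1⟩, h3.reds N.2 hN₁, h5.redI (.act a) rfl,
          h6.reds hN₂ h4.2.1, ((h2.symm.bis M'.2 h4.1).trans h4).2.2⟩
  barb M N h a k v hb := by
    obtain ⟨N', ⟨N₁, N₂, h3, h5, h6⟩, h4⟩ := h.bis.sim (.actEnv a k v _ hb)
    cases h5 with
    | actEnv _ _ _ _ hb =>
      exact ⟨⟨N₁, h3.wf N.2⟩, h3.reds N.2 _, hb⟩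
  ctx M N h :=
    ⟨fun O hM hN => (h.bis.par hM hN).2.2, fun c => (h.bis.res c).2.2,
      fun s k v hv => (h.bis.update k hv).2.2⟩

theorem Bisimilar.barbedCong {M N : WNet S} (h : Bisimilar M N) : BarbedCong M N :=
  ⟨_, isBarbedRel_bisimilar, h⟩

/-! ### Reduction barbed congruence in terms of labelled transitions -/

/-- `→*` in terms of labelled transitions. -/
def Steps : Net S → Net S → Prop :=
  Relation.ReflTransGen fun M M' => NTrans .tau M M' ∨ NTime M M'

theorem Steps.wf {M M' : Net S} (h : Steps M M') (hM : M.WF) : M'.WF := by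
  induction h with
  | refl => exact hM
  | tail _ h ih => exact h.elim (fun h => h.wf ih) fun h => h.wf ih

theorem NEq.steps {M N M' : Net S} (h : NEq M N) (hM : Steps M M') :
    ∃ N', Steps N N' ∧ NEq M' N' := by
  induction hM with
  | refl => exact ⟨N, .refl, h⟩
  | tail _ hs ih =>
    obtain ⟨N₁, h1, h2⟩ := ih
    rcases hs with hs | hs
    · obtain ⟨N', h3, h4⟩ := h2.sim hs
      exact ⟨N', h1.tail (Or.inl h3), h4⟩
    · obtain ⟨N', h3, h4⟩ := h2.simTime hs
      exact ⟨N', h1.tail (Or.inr h3), h4⟩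

theorem WNet.Reds.steps {M M' : WNet S} (h : WNet.Reds M M') :
    ∃ X, Steps M.1 X ∧ NEq X M'.1 := by
  induction h with
  | refl => exact ⟨M.1, .refl, .refl _⟩
  | @tail A B _ hs ih =>
    obtain ⟨X, h1, h2⟩ := ih
    rcases hs with hs | hs
    · obtain ⟨Y, h3, h4⟩ := hs.ntrans A.2.names_nodup
      obtain ⟨Z, h5, h6⟩ := h2.symm.sim h3
      exact ⟨Z, h1.tail (Or.inl h5), h6.symm.trans h4⟩
    · obtain ⟨Y, h3, h4⟩ := hs.ntime A.2.names_nodup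
      obtain ⟨Z, h5, h6⟩ := h2.symm.simTime h3
      exact ⟨Z, h1.tail (Or.inr h5), h6.symm.trans h4⟩

/-- Reduction barbed congruence up to `NEq`, as a relation on all networks; it relates only
well-formed ones. -/
def CongE (M N : Net S) : Prop :=
  M.WF ∧ N.WF ∧ ∃ X Y : WNet S, NEq M X.1 ∧ BarbedCong X Y ∧ NEq Y.1 N

theorem isBarbedRel_barbedCong : IsBarbedRel (S := S) BarbedCong := isGreatest_barbedCong.1

theorem BarbedCong.congE {M N : WNet S} (h : BarbedCong M N) : CongE M.1 N.1 :=
  ⟨M.2, N.2, M, N, .refl _, h, .refl _⟩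

theorem CongE.symm {M N : Net S} (h : CongE M N) : CongE N M := by
  obtain ⟨hM, hN, X, Y, h1, h2, h3⟩ := h
  exact ⟨hN, hM, Y, X, h3.symm, isBarbedRel_barbedCong.symm _ _ h2, h1.symm⟩

theorem CongE.congr {M N M' N' : Net S} (h : CongE M N) (hM : NEq M M') (hN : NEq N N')
    (hM' : M'.WF) (hN' : N'.WF) : CongE M' N' := by
  obtain ⟨-, -, X, Y, h1, h2, h3⟩ := h
  exact ⟨hM', hN', X, Y, hM.symm.trans h1, h2, h3.trans hN⟩

/-- The move is carried along `NEq` to `X`, translated into a reduction, answered by `Y`, and the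
answer is translated back and carried along `NEq` to `N`. -/
theorem CongE.step {M N M' : Net S} (h : CongE M N) (hM : NTrans .tau M M' ∨ NTime M M') :
    ∃ N', Steps N N' ∧ CongE M' N' := by
  obtain ⟨hM₀, hN₀, X, Y, h1, h2, h3⟩ := h
  have hr : ∃ X' : WNet S, WNet.Red X X' ∧ NEq M' X'.1 := by
    rcases hM with hM | hM
    · obtain ⟨X', h4, h5⟩ := h1.sim hM
      exact ⟨⟨X', h4.wf X.2⟩, Or.inl (h4.redI .tau rfl), h5⟩
    · obtain ⟨X', h4, h5⟩ := h1.simTime hM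
      exact ⟨⟨X', h4.wf X.2⟩, Or.inr (h4.redT X.2.names_nodup), h5⟩
  have hM' : M'.WF := hM.elim (fun h => h.wf hM₀) fun h => h.wf hM₀
  obtain ⟨X', h4, h5⟩ := hr
  obtain ⟨Y', h6, h7⟩ := (isBarbedRel_barbedCong.red _ _ h2).1 X' h4
  obtain ⟨Z, h8, h9⟩ := h6.steps
  obtain ⟨N', h10, h11⟩ := h3.steps h8
  exact ⟨N', h10, hM', h10.wf hN₀, X', Y', h5, h7, h9.symm.trans h11⟩

theorem CongE.act {M N M' : Net S} (h : CongE M N) {a : S.Act} (hM : NTrans (.act a) M M') :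
    ∃ N₁ N₂ N', Steps N N₁ ∧ NTrans (.act a) N₁ N₂ ∧ Steps N₂ N' ∧ CongE M' N' := by
  obtain ⟨hM₀, hN₀, X, Y, h1, h2, h3⟩ := h
  obtain ⟨X', h4, h5⟩ := h1.sim hM
  obtain ⟨Y₁, Y₂, Y', h6, h7, h8, h9⟩ :=
    (isBarbedRel_barbedCong.red _ _ h2).2 a ⟨X', h4.wf X.2⟩ (h4.redI (.act a) rfl)
  obtain ⟨Z₁, h10, h11⟩ := h6.steps
  obtain ⟨N₁, h12, h13⟩ := h3.steps h10
  obtain ⟨Z₂, h14, h15⟩ := RedI.ntrans h7 Y₁.2.names_nodup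
  obtain ⟨N₂, h16, h17⟩ := (h11.symm.trans h13).sim h14
  obtain ⟨Z', h18, h19⟩ := h8.steps
  obtain ⟨N', h20, h21⟩ := (h15.symm.trans h17).steps h18
  exact ⟨N₁, N₂, N', h12, h16, h20, hM.wf hM₀, h20.wf (h16.wf (h12.wf hN₀)), ⟨X', h4.wf X.2⟩, Y',
    h5, h9, h19.symm.trans h21⟩

theorem CongE.barb {M N : Net S} (h : CongE M N) {a : S.Act} {k : S.Loc} {v : S.Val}
    (hM : Barb M a k v) : ∃ N', Steps N N' ∧ Barb N' a k v := by
  obtain ⟨hM₀, hN₀, X, Y, h1, h2, h3⟩ := h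
  obtain ⟨Y', h4, h5⟩ := isBarbedRel_barbedCong.barb _ _ h2 a k v (h1.barb hM)
  obtain ⟨Z, h6, h7⟩ := h4.steps
  obtain ⟨N', h8, h9⟩ := h3.steps h6
  exact ⟨N', h8, (h7.symm.trans h9).barb h5⟩

theorem CongE.par {M N O : Net S} (h : CongE M N) (hM : (Net.par M O).WF)
    (hN : (Net.par N O).WF) : CongE (.par M O) (.par N O) := by
  obtain ⟨hM₀, hN₀, X, Y, h1, h2, h3⟩ := h
  exact ⟨hM, hN, ⟨.par X.1 O, hM.par_nEq X.2 h1⟩, ⟨.par Y.1 O, hN.par_nEq Y.2 h3.symm⟩,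
    .congr_par h1 (.refl O), (isBarbedRel_barbedCong.ctx _ _ h2).1 O _ _, .congr_par h3 (.refl O)⟩

theorem CongE.update {M N : Net S} (h : CongE M N) {s : S.Sens} (k : S.Loc) {v : S.Val}
    (hv : v ∈ S.dom s) : CongE (M.update s k v) (N.update s k v) := by
  obtain ⟨hM₀, hN₀, X, Y, h1, h2, h3⟩ := h
  exact ⟨hM₀.update hv k, hN₀.update hv k, X.update s k v hv, Y.update s k v hv, h1.update s k v,
    (isBarbedRel_barbedCong.ctx _ _ h2).2.2 s k v hv, h3.update s k v⟩

/-! ### Actuators of networks -/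

/-- The actuator belongs to a node of the network. -/
def Net.HasAct (a : S.Act) (M : Net S) : Prop := ∃ x ∈ M.keys, a ∉ x.2.1

theorem Net.hasAct_par {a : S.Act} {M N : Net S} :
    (Net.par M N).HasAct a ↔ M.HasAct a ∨ N.HasAct a := by
  simp only [Net.HasAct, Net.keys, Net.devs, List.map_append, List.mem_append, or_and_right,
    exists_or]

theorem Net.hasAct_iff {a : S.Act} {M : Net S} :
    M.HasAct a ↔ ∃ d ∈ M.devs, d.iface.act a ≠ none := by
  simp [Net.HasAct, Net.keys, Dev.key]

theorem Net.WF.not_hasAct {M N : Net S} (h : (Net.par M N).WF) {a : S.Act} (hM : M.HasAct a) :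
    ¬ N.HasAct a := by
  obtain ⟨x, hx, h1⟩ := hM
  rintro ⟨y, hy, h2⟩
  exact (((Net.wf_par_iff.1 h).2.2 x hx y hy).2.1 a).elim h1 h2

theorem NTrans.hasAct {l : NLabel S} {M M' : Net S} (h : NTrans l M M') {a : S.Act} :
    l = .act a → M.HasAct a := by
  induction h with
  | actchg n I P P' μ h b v w hw _ _ =>
    rintro ⟨⟩
    exact Net.hasAct_iff.2 ⟨_, List.mem_cons_self, by simp [hw]⟩
  | parL l M M' N _ ih => exact fun h => Net.hasAct_par.2 (Or.inl (ih h))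
  | parR l M M' N _ ih => exact fun h => Net.hasAct_par.2 (Or.inr (ih h))
  | res l c M M' _ _ ih => exact ih
  | _ => exact fun h => nomatch h

theorem Barb.hasAct {M : Net S} {a : S.Act} {h : S.Loc} {v : S.Val} (hb : Barb M a h v) :
    M.HasAct a := by
  obtain ⟨d, hd, -, h'⟩ := barb_iff.1 hb
  exact Net.hasAct_iff.2 ⟨d, hd, by simp [h']⟩

theorem NTrans.shell_eq {l : NLabel S} {M M' : Net S} (h : NTrans l M M') :
    (∀ a, l ≠ .act a) → M'.devs.map Dev.shell = M.devs.map Dev.shell := by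
  induction h with
  | actchg n I P P' μ h b v w _ _ _ => exact fun h => (h b rfl).elim
  | glbcomL M M' N N' c v h k _ _ _ ih1 ih2 =>
    intro _
    simp only [Net.devs, List.map_append]
    rw [ih1 (by simp), ih2 (by simp)]
  | glbcomR M M' N N' c v h k _ _ _ ih1 ih2 =>
    intro _
    simp only [Net.devs, List.map_append]
    rw [ih1 (by simp), ih2 (by simp)]
  | parL l M M' N _ ih =>
    intro h
    simp only [Net.devs, List.map_append]
    rw [ih h]
  | parR l M M' N _ ih =>
    intro h
    simp only [Net.devs, List.map_append]
    rw [ih h]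
  | res l c M M' _ _ ih => exact ih
  | _ => exact fun _ => rfl

theorem TauStar.shell_eq {M M' : Net S} (h : TauStar M M') :
    M'.devs.map Dev.shell = M.devs.map Dev.shell := by
  induction h with
  | refl => rfl
  | tail _ h ih => exact (h.shell_eq (by simp)).trans ih

theorem TauStar.keys {M M' : Net S} (h : TauStar M M') : M'.keys = M.keys := by
  induction h with
  | refl => rfl
  | tail _ h ih => exact h.keys.trans ih

/-- Interfaces and locations are untouched by `τ`-transitions, so a barb that is reached by them was
already there. -/
theorem TauStar.barb {M M' : Net S} (h : TauStar M M') {a : S.Act} {k : S.Loc} {v : S.Val}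
    (hb : Barb M' a k v) : Barb M a k v := by
  rw [barb_iff] at hb ⊢
  obtain ⟨d, hd, h1, h2⟩ := hb
  have := List.mem_map_of_mem (f := Dev.shell) hd
  rw [h.shell_eq] at this
  obtain ⟨e, he, h'⟩ := List.mem_map.1 this
  simp only [Dev.shell, Prod.mk.injEq] at h'
  exact ⟨e, he, h'.2.2.2.trans h1, by rw [h'.2.1, h2]⟩

/-! ### Quiet and dead networks -/

/-- The only untimed transitions of the network are changes of actuators. -/
def Quiet (T : Net S) : Prop := ∀ l X, NTrans l T X → ∃ a, l = .act a

theorem Quiet.par {T U : Net S} (hT : Quiet T) (hU : Quiet U) : Quiet (.par T U) := by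
  intro l X h
  cases h with
  | parL _ _ T' _ h => exact hT _ _ h
  | parR _ _ _ U' h => exact hU _ _ h
  | glbcomL _ _ _ _ _ _ _ _ h _ _ =>
    obtain ⟨a, ha⟩ := hT _ _ h
    cases ha
  | glbcomR _ _ _ _ _ _ _ _ h _ _ =>
    obtain ⟨a, ha⟩ := hT _ _ h
    cases ha

/-- A communication between two networks. -/
def ComStep (M N M' N' : Net S) : Prop := ∃ c v h k, (S.rng c).Covers (S.dist h k) ∧
  ((NTrans (.send c v k) M M' ∧ NTrans (.recv c v h) N N') ∨
    (NTrans (.recv c v h) M M' ∧ NTrans (.send c v k) N N'))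

theorem ComStep.tau {M N M' N' : Net S} (h : ComStep M N M' N') :
    NTrans .tau (.par M N) (.par M' N') := by
  obtain ⟨c, v, h, k, hc, ⟨h1, h2⟩ | ⟨h1, h2⟩⟩ := h
  · exact .glbcomL _ _ _ _ c v h k h1 h2 hc
  · exact .glbcomR _ _ _ _ c v h k h1 h2 hc

theorem NTrans.tau_par {M N Z : Net S} (h : NTrans .tau (.par M N) Z) :
    (∃ M', NTrans .tau M M' ∧ Z = .par M' N) ∨ (∃ N', NTrans .tau N N' ∧ Z = .par M N') ∨
      ∃ M' N', ComStep M N M' N' ∧ Z = .par M' N' := by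
  cases h with
  | parL _ _ M' _ h => exact Or.inl ⟨M', h, rfl⟩
  | parR _ _ _ N' h => exact Or.inr (Or.inl ⟨N', h, rfl⟩)
  | glbcomL _ M' _ N' c v h k h1 h2 hc =>
    exact Or.inr (Or.inr ⟨M', N', ⟨c, v, h, k, hc, Or.inl ⟨h1, h2⟩⟩, rfl⟩)
  | glbcomR _ M' _ N' c v h k h1 h2 hc =>
    exact Or.inr (Or.inr ⟨M', N', ⟨c, v, h, k, hc, Or.inr ⟨h1, h2⟩⟩, rfl⟩)

theorem NTrans.act_par {a : S.Act} {M N Z : Net S} (h : NTrans (.act a) (.par M N) Z) :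
    (∃ M', NTrans (.act a) M M' ∧ Z = .par M' N) ∨ ∃ N', NTrans (.act a) N N' ∧ Z = .par M N' := by
  cases h with
  | parL _ _ M' _ h => exact Or.inl ⟨M', h, rfl⟩
  | parR _ _ _ N' h => exact Or.inr ⟨N', h, rfl⟩

theorem Quiet.com {T : Net S} (hT : Quiet T) {N : Net S} {M' N' : Net S} :
    ¬ ComStep N T M' N' := by
  rintro ⟨c, v, h, k, hc, ⟨h1, h2⟩ | ⟨h1, h2⟩⟩ <;>
  · obtain ⟨a, ha⟩ := hT _ _ h2
    cases ha

/-- A quiet partner neither moves silently nor communicates. Its changes of actuators carry other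
labels, so the transition belongs to `N`. -/
theorem Quiet.tau_par {T : Net S} (hT : Quiet T) {N Z : Net S} (h : NTrans .tau (.par N T) Z) :
    ∃ N', NTrans .tau N N' ∧ Z = .par N' T := by
  rcases h.tau_par with h | ⟨N', h, -⟩ | ⟨M', N', h, -⟩
  · exact h
  · obtain ⟨a, ha⟩ := hT _ _ h
    cases ha
  · exact (hT.com h).elim

theorem Quiet.tauStar_par {T : Net S} (hT : Quiet T) {N Z : Net S} (h : TauStar (.par N T) Z) :
    ∃ N', TauStar N N' ∧ Z = .par N' T := by
  induction h with
  | refl => exact ⟨N, .refl, rfl⟩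
  | tail _ hs ih =>
    obtain ⟨N₁, h1, rfl⟩ := ih
    obtain ⟨N', h2, rfl⟩ := hT.tau_par hs
    exact ⟨N', h1.tail h2, rfl⟩

theorem Quiet.comStep_par {T : Net S} (hT : Quiet T) {N O Z X : Net S}
    (h : ComStep (.par N T) O Z X) : ∃ N', Z = .par N' T ∧ ComStep N O N' X := by
  obtain ⟨c, v, h, k, hc, ⟨h1, h2⟩ | ⟨h1, h2⟩⟩ := h
  · cases h1 with
    | parL _ _ N' _ h1 => exact ⟨N', rfl, c, v, h, k, hc, Or.inl ⟨h1, h2⟩⟩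
    | parR _ _ _ _ h1 =>
      obtain ⟨a, ha⟩ := hT _ _ h1
      cases ha
  · cases h1 with
    | parL _ _ N' _ h1 => exact ⟨N', rfl, c, v, h, k, hc, Or.inr ⟨h1, h2⟩⟩
    | parR _ _ _ _ h1 =>
      obtain ⟨a, ha⟩ := hT _ _ h1
      cases ha

/-- Next to a network that blocks time, only `τ`-transitions are possible. -/
theorem Steps.tauStar_of_block {T : Net S} (hT : Quiet T) (hb : ∀ X, ¬ NTime T X) {N Y : Net S}
    (h : Steps (.par N T) Y) : ∃ N', TauStar N N' ∧ Y = .par N' T := by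
  induction h with
  | refl => exact ⟨N, .refl, rfl⟩
  | tail _ hs ih =>
    obtain ⟨N₁, h1, rfl⟩ := ih
    rcases hs with hs | hs
    · obtain ⟨N', h2, rfl⟩ := hT.tau_par hs
      exact ⟨N', h1.tail h2, rfl⟩
    · cases hs with
      | timepar _ _ _ _ _ h _ => exact (hb _ h).elim

/-- Next to a network that lets time pass exactly once, there is at most one tick. -/
theorem Steps.of_tick {T T' : Net S} (hT : Quiet T) (hT' : Quiet T')
    (hb : ∀ X, ¬ NTime T' X) (ht : ∀ X, NTime T X → X = T') {N Y : Net S}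
    (h : Steps (.par N T) Y) : (∃ N', TauStar N N' ∧ Y = .par N' T) ∨
      ∃ N', EWeak .tick N N' ∧ Y = .par N' T' := by
  induction h with
  | refl => exact Or.inl ⟨N, .refl, rfl⟩
  | tail _ hs ih =>
    rcases ih with ⟨N₁, h1, rfl⟩ | ⟨N₁, h1, rfl⟩
    · rcases hs with hs | hs
      · obtain ⟨N', h2, rfl⟩ := hT.tau_par hs
        exact Or.inl ⟨N', h1.tail h2, rfl⟩
      · cases hs with
        | timepar _ N' _ U h2 h3 _ =>
          cases ht _ h3
          exact Or.inr ⟨N', .mk h1 (.tick _ _ h2) .refl, rfl⟩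
    · rcases hs with hs | hs
      · obtain ⟨N', h2, rfl⟩ := hT'.tau_par hs
        exact Or.inr ⟨N', h1.trans_tau .refl (.single h2), rfl⟩
      · cases hs with
        | timepar _ _ _ _ _ h _ => exact (hb _ h).elim

/-- The network can only let time pass, without any change. -/
structure Dead (D : Net S) : Prop where
  not_trans : ∀ l X, ¬ NTrans l D X
  time : NTime D D
  time_eq : ∀ X, NTime D X → X = D
  update : ∀ s h v, D.update s h v = D

theorem Dead.quiet {D : Net S} (h : Dead D) : Quiet D := fun l X hX => (h.not_trans l X hX).elim

theorem dead_zero : Dead (.zero : Net S) where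
  not_trans _ _ h := nomatch h
  time := .timezero
  time_eq X h := by cases h; rfl
  update _ _ _ := rfl

theorem Dead.par {D E : Net S} (hD : Dead D) (hE : Dead E) : Dead (.par D E) := by
  have hn : ∀ l X, ¬ NTrans l (.par D E) X := by
    intro l X h
    cases h with
    | parL _ _ _ _ h => exact hD.not_trans _ _ h
    | parR _ _ _ _ h => exact hE.not_trans _ _ h
    | glbcomL _ _ _ _ _ _ _ _ h _ _ => exact hD.not_trans _ _ h
    | glbcomR _ _ _ _ _ _ _ _ h _ _ => exact hD.not_trans _ _ h
  refine ⟨hn, .timepar _ _ _ _ hD.time hE.time fun ⟨X, h⟩ => hn _ X h, ?_, ?_⟩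
  · intro X h
    cases h with
    | timepar _ _ _ _ h1 h2 _ => rw [hD.time_eq _ h1, hE.time_eq _ h2]
  · intro s h v
    simp only [Net.update, hD.update, hE.update]

/-! ### Gadgets -/

/-- The interface with the single actuator `a`, set to `v`. -/
noncomputable def Iface.single (a : S.Act) (v : S.Val) : Iface S where
  sens := fun _ => none
  act := open Classical in fun a' => if a' = a then some v else none

theorem Iface.single_act (a : S.Act) (v : S.Val) : (Iface.single a v).act a = some v := by
  simp [Iface.single]

theorem Iface.single_act_of_eq_some {a b : S.Act} {v w : S.Val}
    (h : (Iface.single a v).act b = some w) : b = a ∧ v = w := by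
  by_cases hb : b = a
  · subst hb
    simpa [Iface.single] using h
  · simp [Iface.single, hb] at h

theorem Iface.single_setAct (a : S.Act) (v w : S.Val) :
    (Iface.single a v).setAct a w = .single a w := by
  simp only [Iface.single, Iface.setAct, Iface.mk.injEq, true_and]
  funext a'
  split_ifs <;> rfl

/-- A stationary node with a single actuator and no sensors. -/
noncomputable def gadget (m : S.Node) (a : S.Act) (k : S.Loc) (v : S.Val) (P : Proc S 0 0) :
    Net S := .node ⟨m, .single a v, P, .stat, k⟩

theorem gadget_update (m : S.Node) (a : S.Act) (k : S.Loc) (v : S.Val) (P : Proc S 0 0)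
    (s : S.Sens) (h : S.Loc) (w : S.Val) :
    (gadget m a k v P).update s h w = gadget m a k v P := by
  simp [gadget, Net.update, Dev.update, Iface.single]

theorem gadget_hasAct (m : S.Node) (a : S.Act) (k : S.Loc) (v : S.Val) (P : Proc S 0 0) :
    (gadget m a k v P).HasAct a :=
  Net.hasAct_iff.2 ⟨_, List.mem_cons_self, by simp [Iface.single]⟩

theorem gadget_keys (m : S.Node) (a : S.Act) (k : S.Loc) (v : S.Val) (P : Proc S 0 0) :
    (gadget m a k v P).keys = [(m, {b | b ≠ a}, Set.univ)] := by
  simp [gadget, Net.keys, Net.devs, Dev.key, Iface.single]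

/-- The node name and the actuator do not belong to the network. -/
def Fresh (m : S.Node) (a : S.Act) (M : Net S) : Prop := ∀ x ∈ M.keys, x.1 ≠ m ∧ a ∈ x.2.1

theorem Fresh.not_hasAct {m : S.Node} {a : S.Act} {M : Net S} (h : Fresh m a M) :
    ¬ M.HasAct a := fun ⟨x, hx, h'⟩ => h' (h x hx).2

theorem Net.WF.par_gadget {M : Net S} (hM : M.WF) {m : S.Node} {a : S.Act} (hf : Fresh m a M)
    (k : S.Loc) (v : S.Val) {P : Proc S 0 0} (hg : P.GuardedRec) (hr : ∀ s, ¬ P.Reads s)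
    (hw : ∀ b, P.Writes b → b = a) : (Net.par M (gadget m a k v P)).WF := by
  rw [Net.wf_par_iff]
  refine ⟨hM, ?_, ?_⟩
  · refine ⟨List.pairwise_singleton _ _, List.pairwise_singleton _ _,
      List.pairwise_singleton _ _, ?_⟩
    intro d hd
    rw [List.mem_singleton.1 hd]
    refine ⟨hg, fun s hs => (hr s hs).elim, ?_, ?_, ?_, ?_⟩
    · intro b hb
      rw [hw b hb]
      exact ⟨v, Iface.single_act a v⟩
    · rintro s - ⟨w, h⟩
      cases h
    · intro s w h
      cases h
    · refine (Set.finite_singleton a).subset fun b hb => ?_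
      by_contra hba
      exact hb (if_neg hba)
  · intro x hx y hy
    rw [gadget_keys, List.mem_singleton] at hy
    subst hy
    refine ⟨(hf x hx).1, fun b => ?_, fun s _ => Or.inr trivial⟩
    by_cases hb : b = a
    · exact Or.inl (hb ▸ (hf x hx).2)
    · exact Or.inr hb

/-- Finitely many nodes with finitely many actuators each leave fresh names of both kinds; the
condition `finite_act` of well-formedness is used here. -/
theorem exists_fresh {M N : Net S} (hM : M.WF) (hN : N.WF) :
    ∃ m a, Fresh m a M ∧ Fresh m a N := by
  have hA : ∀ {M : Net S}, M.WF → {a | M.HasAct a}.Finite := by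
    intro M hM
    have : {a | M.HasAct a} = ⋃ d ∈ {d | d ∈ M.devs}, {a | d.iface.act a ≠ none} := by
      ext a
      simp [Net.hasAct_iff]
    rw [this]
    exact (List.finite_toSet M.devs).biUnion fun d hd => (hM.dev d hd).finite_act
  have := S.infinite_node
  have := S.infinite_act
  obtain ⟨m, hm⟩ := (((M.keys.map Prod.fst).finite_toSet).union
    ((N.keys.map Prod.fst).finite_toSet)).exists_notMem
  obtain ⟨a, ha⟩ := ((hA hM).union (hA hN)).exists_notMem
  refine ⟨m, a, fun x hx => ⟨fun h => hm (Or.inl ?_), ?_⟩, fun x hx => ⟨fun h => hm (Or.inr ?_), ?_⟩⟩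
  · exact List.mem_map.2 ⟨x, hx, h⟩
  · by_contra h
    exact ha (Or.inl ⟨x, hx, h⟩)
  · exact List.mem_map.2 ⟨x, hx, h⟩
  · by_contra h
    exact ha (Or.inr ⟨x, hx, h⟩)

theorem dead_gadget (m : S.Node) (a : S.Act) (k : S.Loc) (v : S.Val) :
    Dead (gadget m a k v .nil) := by
  have hn : ∀ l X, ¬ NTrans l (gadget m a k v .nil) X := by
    intro l X h
    cases h with
    | pos _ _ _ _ _ _ h => cases h
    | sensread _ _ _ _ _ _ _ _ _ h => cases h
    | actunchg _ _ _ _ _ _ _ _ _ h => cases h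
    | loccom _ _ _ _ _ _ h => cases h
    | actchg _ _ _ _ _ _ _ _ _ _ _ h => cases h
    | snd _ _ _ _ _ _ _ _ h _ => cases h
    | rcv _ _ _ _ _ _ _ _ h _ => cases h
  refine ⟨hn, .timestat _ _ _ _ _ .timenil fun ⟨X, h⟩ => hn _ X h, ?_, gadget_update m a k v _⟩
  intro X h
  cases h with
  | timestat _ _ _ _ _ h _ =>
    cases h with
    | timenil => rfl
    | timeout _ _ h => cases h

/-- A gadget whose process can only write a value that differs from the current one. -/
theorem gadget_write {m : S.Node} {a : S.Act} {k : S.Loc} {v w : S.Val} (hvw : v ≠ w)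
    {P P' : Proc S 0 0} (hP : ∀ p X, PTrans p P X → p = .write a w ∧ X = P') {l : NLabel S}
    {X : Net S} (h : NTrans l (gadget m a k v P) X) : l = .act a ∧ X = gadget m a k w P' := by
  cases h with
  | pos _ _ _ _ _ _ h => cases (hP _ _ h).1
  | sensread _ _ _ _ _ _ _ _ _ h => cases (hP _ _ h).1
  | actunchg _ _ _ _ _ _ b v' hb h =>
    cases (hP _ _ h).1
    exact (hvw (Iface.single_act_of_eq_some hb).2).elim
  | loccom _ _ _ _ _ _ h => cases (hP _ _ h).1
  | actchg _ _ _ _ _ _ b v' w' _ _ h =>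
    obtain ⟨h1, rfl⟩ := hP _ _ h
    cases h1
    rw [Iface.single_setAct]
    exact ⟨rfl, rfl⟩
  | snd _ _ _ _ _ _ _ _ h _ => cases (hP _ _ h).1
  | rcv _ _ _ _ _ _ _ _ h _ => cases (hP _ _ h).1

/-- The two values must differ: writing the current value would be silent. -/
theorem gadget_fire {m : S.Node} {a : S.Act} {k : S.Loc} {v w : S.Val} (hvw : v ≠ w)
    {P P' : Proc S 0 0} (hP : PTrans (.write a w) P P') :
    NTrans (.act a) (gadget m a k v P) (gadget m a k w P') := by
  have := NTrans.actchg m (.single a v) P P' .stat k a w v (Iface.single_act a v) hvw hP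
  rwa [Iface.single_setAct] at this

theorem gadget_not_trans {m : S.Node} {a : S.Act} {k : S.Loc} {v : S.Val}
    {P : Proc S 0 0} (hP : ∀ p X, ¬ PTrans p P X) {l : NLabel S} {X : Net S} :
    ¬ NTrans l (gadget m a k v P) X := by
  intro h
  cases h with
  | pos _ _ _ _ _ _ h => exact hP _ _ h
  | sensread _ _ _ _ _ _ _ _ _ h => exact hP _ _ h
  | actunchg _ _ _ _ _ _ _ _ _ h => exact hP _ _ h
  | loccom _ _ _ _ _ _ h => exact hP _ _ h
  | actchg _ _ _ _ _ _ _ _ _ _ _ h => exact hP _ _ h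
  | snd _ _ _ _ _ _ _ _ h _ => exact hP _ _ h
  | rcv _ _ _ _ _ _ _ _ h _ => exact hP _ _ h

theorem PTrans.of_write {p : PLabel S} {a : S.Act} {v : S.Val} {P X : Proc S 0 0}
    (h : PTrans p (.write a (.val v) P) X) : p = .write a v ∧ X = P := by
  cases h
  exact ⟨rfl, rfl⟩

theorem PTime.not_write {a : S.Act} {e : Term S 0} {P X : Proc S 0 0} :
    ¬ PTime (.write a e P) X := by
  intro h
  cases h with
  | timeout _ _ h => cases h

theorem gadget_not_time {m : S.Node} {a : S.Act} {k : S.Loc} {v : S.Val}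
    {P : Proc S 0 0} (hP : ∀ X, ¬ PTime P X) {X : Net S} : ¬ NTime (gadget m a k v P) X := by
  intro h
  cases h with
  | timestat _ _ _ _ _ h _ => exact hP _ h

/-! ### Clocks -/

variable (S) in
/-- The data of a node that controls the passage of time. -/
structure Clock where
  name : S.Node
  act : S.Act
  loc : S.Loc
  off : S.Val
  on : S.Val
  ne : off ≠ on

/-- `fix X. a!on.σ.a!off.X` -/
def Clock.proc (c : Clock S) : Proc S 0 0 :=
  .fix (.write c.act (.val c.on) (.sleep (.write c.act (.val c.off) (.pvar 0))))

/-- The clock blocks time. -/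
noncomputable def Clock.idle (c : Clock S) : Net S := gadget c.name c.act c.loc c.off c.proc

/-- The clock lets time pass once. -/
noncomputable def Clock.armed (c : Clock S) : Net S :=
  gadget c.name c.act c.loc c.on (.sleep (.write c.act (.val c.off) c.proc))

/-- The clock has noticed the passage of time. -/
noncomputable def Clock.due (c : Clock S) : Net S :=
  gadget c.name c.act c.loc c.on (.write c.act (.val c.off) c.proc)

theorem Clock.unfold (c : Clock S) :
    Proc.unfold (.write c.act (.val c.on) (.sleep (.write c.act (.val c.off) (.pvar 0)))) =
      (.write c.act (.val c.on) (.sleep (.write c.act (.val c.off) c.proc)) : Proc S 0 0) := by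
  simp [Proc.unfold, Proc.psubst, Clock.proc]

theorem Clock.proc_trans (c : Clock S) {p : PLabel S} {X : Proc S 0 0} (h : PTrans p c.proc X) :
    p = .write c.act c.on ∧ X = .sleep (.write c.act (.val c.off) c.proc) := by
  cases h with
  | fix _ _ _ h =>
    rw [c.unfold] at h
    exact h.of_write

theorem Clock.idle_inv (c : Clock S) {l : NLabel S} {X : Net S} (h : NTrans l c.idle X) :
    l = .act c.act ∧ X = c.armed :=
  gadget_write c.ne (fun _ _ h => c.proc_trans h) h

theorem Clock.idle_fire (c : Clock S) : NTrans (.act c.act) c.idle c.armed :=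
  gadget_fire c.ne (.fix _ _ _ (c.unfold ▸ .actuator _ _ _))

/-- A pending write has no timed transition. Since it changes the actuator, it is no `τ` either:
time stands still until the clock is fired, and the firing is an observable `→_a`. -/
theorem Clock.idle_block (c : Clock S) (X : Net S) : ¬ NTime c.idle X := by
  refine gadget_not_time fun Y h => ?_
  cases h with
  | timeout _ _ h => cases h
  | fix _ _ h =>
    rw [c.unfold] at h
    exact PTime.not_write h

theorem Clock.due_inv (c : Clock S) {l : NLabel S} {X : Net S} (h : NTrans l c.due X) :
    l = .act c.act ∧ X = c.idle :=
  gadget_write c.ne.symm (fun _ _ h => h.of_write) h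

theorem Clock.due_fire (c : Clock S) : NTrans (.act c.act) c.due c.idle :=
  gadget_fire c.ne.symm (.actuator _ _ _)

theorem Clock.due_block (c : Clock S) (X : Net S) : ¬ NTime c.due X :=
  gadget_not_time fun _ => PTime.not_write

theorem Clock.armed_inv (c : Clock S) {l : NLabel S} {X : Net S} : ¬ NTrans l c.armed X :=
  gadget_not_trans fun p Y h => by cases h

theorem Clock.armed_time (c : Clock S) : NTime c.armed c.due :=
  .timestat _ _ _ _ _ (.delay _) fun ⟨_, h⟩ => c.armed_inv h

theorem Clock.armed_time_eq (c : Clock S) {X : Net S} (h : NTime c.armed X) : X = c.due := by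
  cases h with
  | timestat _ _ _ _ _ h _ =>
    cases h with
    | delay => rfl
    | timeout _ _ h => cases h

theorem Clock.idle_wf (c : Clock S) {M : Net S} (hM : M.WF) (hf : Fresh c.name c.act M) :
    (Net.par M c.idle).WF := by
  refine hM.par_gadget hf _ _ ⟨trivial, trivial⟩ (fun s h => h) ?_
  rintro b (h | h | h)
  · exact h.symm
  · exact h.symm
  · exact h.elim

theorem Clock.idle_quiet (c : Clock S) : Quiet c.idle := fun _ _ h => ⟨_, (c.idle_inv h).1⟩

theorem Clock.due_quiet (c : Clock S) : Quiet c.due := fun _ _ h => ⟨_, (c.due_inv h).1⟩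

theorem Clock.armed_quiet (c : Clock S) : Quiet c.armed := fun _ _ h => (c.armed_inv h).elim

theorem not_time_par_left {T : Net S} (h : ∀ X, ¬ NTime T X) (D X : Net S) :
    ¬ NTime (.par T D) X := by
  intro hX
  cases hX with
  | timepar _ _ _ _ h' _ _ => exact h _ h'

theorem Net.WF.of_devs {M N : Net S} (h : M.WF) (e : N.devs = M.devs) : N.WF :=
  ⟨e ▸ h.names, e ▸ h.acts, e ▸ h.sens, e ▸ h.dev⟩

/-- A change of an actuator of `T` is performed by `T`. -/
theorem NTrans.act_par_right {N T Z : Net S} {a : S.Act} (h : NTrans (.act a) (.par N T) Z)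
    (hw : (Net.par N T).WF) (ha : T.HasAct a) : ∃ T', NTrans (.act a) T T' ∧ Z = .par N T' := by
  rcases h.act_par with ⟨M', h, -⟩ | h
  · exact (hw.not_hasAct (h.hasAct rfl) ha).elim
  · exact h

theorem Dead.act_par {K D Z : Net S} (hD : Dead D) {a : S.Act}
    (h : NTrans (.act a) (.par K D) Z) : ∃ K', NTrans (.act a) K K' ∧ Z = .par K' D := by
  rcases h.act_par with h | ⟨D', h, -⟩
  · exact h
  · exact (hD.not_trans _ _ h).elim

/-- A clock that has noticed the passage of time is told from one that has not. -/
theorem CongE.not_armed_due {c : Clock S} {D : Net S} (hD : Dead D) {A B : Net S} :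
    ¬ CongE (.par A (.par c.armed D)) (.par B (.par c.due D)) := by
  intro h
  obtain ⟨m, b, hA, hB⟩ := exists_fresh h.1 h.2.1
  have wf : ∀ {M : Net S}, M.WF → Fresh m b M →
      (Net.par M (gadget m b c.loc c.off (.write b (.val c.on) .nil))).WF := by
    intro M hM hf
    refine hM.par_gadget hf _ _ trivial (fun s h => h) ?_
    rintro b' (h | h)
    · exact h.symm
    · exact h.elim
  -- A second blocker, on a fresh actuator `b`, keeps the armed clock from ticking and becoming due
  -- in the course of its answer.
  set O := gadget m b c.loc c.off (.write b (.val c.on) .nil) with hO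
  have hOi : ∀ l X, NTrans l O X → l = .act b := fun l X hX =>
    (gadget_write c.ne (fun _ _ h => h.of_write) hX).1
  have hOq : Quiet O := fun l X hX => ⟨b, hOi l X hX⟩
  have hOb : ∀ X, ¬ NTime O X := fun X => gadget_not_time fun _ => PTime.not_write
  have hc := (h.par (wf h.1 hA) (wf h.2.1 hB)).symm
  obtain ⟨N₁, N₂, N', h1, h2, -, -⟩ :=
    hc.act (.parL _ _ _ _ (.parR _ _ _ _ (.parL _ _ _ _ c.due_fire)))
  have hW := h1.wf (wf h.1 hA)
  obtain ⟨Z, h3, rfl⟩ := h1.tauStar_of_block hOq hOb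
  obtain ⟨A', h4, rfl⟩ := (c.armed_quiet.par hD.quiet).tauStar_par h3
  have ha : (Net.par c.armed D).HasAct c.act :=
    Net.hasAct_par.2 (Or.inl (gadget_hasAct _ _ _ _ _))
  -- No component can perform the change of `c.act`: the armed clock and `D` have no untimed
  -- transitions, `A'` does not own the actuator by well-formedness, and `O` changes only `b`, which
  -- is fresh.
  rcases h2.act_par with ⟨Y, h2, -⟩ | ⟨Y, h2, -⟩
  · obtain ⟨T, h5, -⟩ := h2.act_par_right hW.left ha
    obtain ⟨K, h6, -⟩ := hD.act_par h5
    exact c.armed_inv h6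
  · cases hOi _ _ h2
    exact hA.not_hasAct (Net.hasAct_par.2 (Or.inr ha))

/-- The passage of time is controlled by firing the clock twice. -/
theorem CongE.tick {c : Clock S} {D : Net S} (hD : Dead D) {M N M' : Net S}
    (h : CongE (.par M (.par c.idle D)) (.par N (.par c.idle D))) (hM : NTime M M') :
    ∃ N', EWeak .tick N N' ∧ CongE (.par M' (.par c.idle D)) (.par N' (.par c.idle D)) := by
  have hq := c.idle_quiet.par hD.quiet
  have hb := not_time_par_left c.idle_block D
  have hq1 := c.armed_quiet.par hD.quiet
  have ht1 : ∀ X, NTime (.par c.armed D) X → X = .par c.due D := by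
    intro X hX
    cases hX with
    | timepar _ _ _ _ h1 h2 _ => rw [c.armed_time_eq h1, hD.time_eq _ h2]
  have hq2 := c.due_quiet.par hD.quiet
  have hb2 := not_time_par_left c.due_block D
  -- Firing the clock on the left forces the one on the right to be fired too, as no other node owns
  -- its actuator.
  obtain ⟨N₁, N₂, N₃, s1, s2, s3, h1⟩ := h.act (.parR _ _ _ _ (.parL _ _ _ _ c.idle_fire))
  have hW := s1.wf h.2.1
  obtain ⟨Na, t1, rfl⟩ := s1.tauStar_of_block hq hb
  obtain ⟨T, u2, rfl⟩ := s2.act_par_right hW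
    (Net.hasAct_par.2 (Or.inl (gadget_hasAct _ _ _ _ _)))
  obtain ⟨K, w2, rfl⟩ := hD.act_par u2
  cases (c.idle_inv w2).2
  -- The right-hand side may have ticked too early, but then its due clock would be equated with an
  -- armed one.
  rcases s3.of_tick hq1 hq2 hb2 ht1 with ⟨Nb, t2, rfl⟩ | ⟨Nb, -, rfl⟩
  swap
  · exact (h1.not_armed_due hD).elim
  have hD' : NTime (.par c.armed D) (.par c.due D) := by
    refine .timepar _ _ _ _ c.armed_time hD.time ?_
    rintro ⟨X, hX⟩
    obtain ⟨a, ha⟩ := hq1 _ _ hX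
    cases ha
  obtain ⟨Y, s4, h2⟩ := h1.step (Or.inr (.timepar _ _ _ _ hM hD' (by
    rintro ⟨X, hX⟩
    obtain ⟨M₁, hM₁, -⟩ := hq1.tau_par hX
    exact hM.not_tau ⟨M₁, hM₁⟩)))
  -- The left clock is now due; an answer without a tick would leave an armed clock on the right.
  rcases s4.of_tick hq1 hq2 hb2 ht1 with ⟨Nc, -, rfl⟩ | ⟨Nc, t3, rfl⟩
  · exact (h2.symm.not_armed_due hD).elim
  -- The second firing makes both clocks idle again. Due and idle clocks both block time, so no
  -- further tick slips in.
  obtain ⟨N₄, N₅, N₆, s5, s6, s7, h3⟩ := h2.act (.parR _ _ _ _ (.parL _ _ _ _ c.due_fire))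
  have hW := s5.wf h2.2.1
  obtain ⟨Nd, t4, rfl⟩ := s5.tauStar_of_block hq2 hb2
  obtain ⟨T, u6, rfl⟩ := s6.act_par_right hW
    (Net.hasAct_par.2 (Or.inl (gadget_hasAct _ _ _ _ _)))
  obtain ⟨K, w6, rfl⟩ := hD.act_par u6
  cases (c.due_inv w6).2
  obtain ⟨Ne, t5, rfl⟩ := s7.tauStar_of_block hq hb
  exact ⟨Ne, t3.trans_tau (t1.trans t2) (t4.trans t5), h3⟩

/-! ### Tests for communications -/

/-- `O₀` offers a communication that tests for `α`; the test succeeds if `a` changes in `O₁`. -/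
structure Test (α : ELabel S) (a : S.Act) (O₀ O₁ O₂ : Net S) : Prop where
  com_only : ∀ l X, NTrans l O₀ X → l ≠ .tau ∧ ∀ b, l ≠ .act b
  start : ∀ N N', ETrans α N N' → ComStep N O₀ N' O₁
  com : ∀ N N' X, ComStep N O₀ N' X →
    Quiet X ∧ ((∀ Z, ¬ NTrans (.act a) X Z) ∨ (X = O₁ ∧ ETrans α N N'))
  fire : NTrans (.act a) O₁ O₂
  fire_eq : ∀ Z, NTrans (.act a) O₁ Z → Z = O₂
  dead : Dead O₂

theorem ComStep.keys {M N M' N' : Net S} (h : ComStep M N M' N') : M'.keys = M.keys := by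
  obtain ⟨c, v, h, k, hc, ⟨h1, h2⟩ | ⟨h1, h2⟩⟩ := h <;> exact h1.keys

theorem ComStep.parL {N O N' X : Net S} (h : ComStep N O N' X) (T : Net S) :
    ComStep (.par N T) O (.par N' T) X := by
  obtain ⟨c, v, h, k, hc, h'⟩ := h
  exact ⟨c, v, h, k, hc, h'.imp (And.imp_left (.parL _ _ _ _)) (And.imp_left (.parL _ _ _ _))⟩

/-- With time blocked by `T`, a path consists of `τ`-transitions of `N` with at most one
communication with `O₀` among them. After the communication the tester is quiet, and either it is
unable to change `a`, or the communication was an instance of `α`. -/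
theorem Test.steps {α : ELabel S} {a : S.Act} {O₀ O₁ O₂ T : Net S} (ht : Test α a O₀ O₁ O₂)
    (hT : Quiet T) (hb : ∀ X, ¬ NTime T X) {N Y : Net S} (h : Steps (.par (.par N T) O₀) Y) :
    (∃ N', TauStar N N' ∧ Y = .par (.par N' T) O₀) ∨
      ∃ N' X, N'.keys = N.keys ∧ Y = .par (.par N' T) X ∧ Quiet X ∧
        ((∀ Z, ¬ NTrans (.act a) X Z) ∨ (X = O₁ ∧ EWeak α N N')) := by
  have block : ∀ {N X Z : Net S}, ¬ NTime (.par (.par N T) X) Z := by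
    intro N X Z h
    cases h with
    | timepar _ _ _ _ h _ _ =>
      cases h with
      | timepar _ _ _ _ _ h _ => exact hb _ h
  induction h with
  | refl => exact Or.inl ⟨N, .refl, rfl⟩
  | tail _ hs ih =>
    rcases ih with ⟨N₁, h1, rfl⟩ | ⟨N₁, X, h1, rfl, h2, h3⟩
    · rcases hs with hs | hs
      · rcases hs.tau_par with ⟨Z, hZ, rfl⟩ | ⟨O', hO, -⟩ | ⟨Z, X, hZ, rfl⟩
        · obtain ⟨N', hN, rfl⟩ := hT.tau_par hZ
          exact Or.inl ⟨N', h1.tail hN, rfl⟩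
        · exact ((ht.com_only _ _ hO).1 rfl).elim
        · obtain ⟨N', rfl, hN⟩ := hT.comStep_par hZ
          obtain ⟨h4, h5⟩ := ht.com _ _ _ hN
          exact Or.inr ⟨N', X, hN.keys.trans h1.keys, rfl, h4,
            h5.imp_right fun h5 => ⟨h5.1, .mk h1 h5.2 .refl⟩⟩
      · exact (block hs).elim
    · rcases hs with hs | hs
      · obtain ⟨Z, hZ, rfl⟩ := h2.tau_par hs
        obtain ⟨N', hN, rfl⟩ := hT.tau_par hZ
        exact Or.inr ⟨N', X, hN.keys.trans h1, rfl, h2,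
          h3.imp_right fun h3 => ⟨h3.1, h3.2.trans_tau .refl (.single hN)⟩⟩
      · exact (block hs).elim

theorem Net.hasAct_congr {a : S.Act} {M N : Net S} (h : M.keys = N.keys) :
    M.HasAct a ↔ N.HasAct a := by
  unfold Net.HasAct
  rw [h]

/-- The left-hand side performs `α` with the tester, which then changes `a`. As `a` belongs neither
to `N` nor to `T`, only the tester can provide the answering change of `a`, and it can do so only
after a communication with label `α`. -/
theorem Test.sim {α : ELabel S} {a : S.Act} {O₀ O₁ O₂ T : Net S} (ht : Test α a O₀ O₁ O₂)
    (hT : Quiet T) (hb : ∀ X, ¬ NTime T X) {M N M' : Net S}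
    (h : CongE (.par (.par M T) O₀) (.par (.par N T) O₀)) (ha : ¬ (Net.par N T).HasAct a)
    (hM : ETrans α M M') :
    ∃ N', EWeak α N N' ∧ CongE (.par (.par M' T) O₂) (.par (.par N' T) O₂) := by
  obtain ⟨Y, s1, h1⟩ := h.step (Or.inl ((ht.start _ _ hM).parL T).tau)
  obtain ⟨Y₁, Y₂, Y₃, s2, s3, s4, h2⟩ := h1.act (.parR _ _ _ _ ht.fire)
  rw [Net.hasAct_par, not_or] at ha
  have no : ∀ {N' X Z : Net S}, N'.keys = N.keys → NTrans (.act a) (.par (.par N' T) X) Z →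
      ∃ X', NTrans (.act a) X X' ∧ Z = .par (.par N' T) X' := by
    intro N' X Z hk hZ
    rcases hZ.act_par with ⟨W, hW, -⟩ | hZ
    · rcases hW.act_par with ⟨_, hW, -⟩ | ⟨_, hW, -⟩
      · exact (ha.1 ((Net.hasAct_congr hk).1 (hW.hasAct rfl))).elim
      · exact (ha.2 (hW.hasAct rfl)).elim
    · exact hZ
  rcases ht.steps hT hb (s1.trans s2) with ⟨N₁, t1, rfl⟩ | ⟨N₁, X, hk, rfl, hq, hX⟩
  · obtain ⟨X', hX', -⟩ := no t1.keys s3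
    exact ((ht.com_only _ _ hX').2 a rfl).elim
  · obtain ⟨X', hX', rfl⟩ := no hk s3
    rcases hX with hX | ⟨rfl, t1⟩
    · exact (hX _ hX').elim
    · cases ht.fire_eq _ hX'
      obtain ⟨N₂, t2, rfl⟩ : ∃ N₂, TauStar N₁ N₂ ∧ Y₃ = .par (.par N₂ T) O₂ := by
        have hq : ∀ {Z}, Steps (.par (.par N₁ T) O₂) Z →
            ∃ N₂, TauStar N₁ N₂ ∧ Z = .par (.par N₂ T) O₂ := by
          intro Z hZ
          induction hZ with
          | refl => exact ⟨N₁, .refl, rfl⟩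
          | tail _ hs ih =>
            obtain ⟨N₂, h3, rfl⟩ := ih
            rcases hs with hs | hs
            · obtain ⟨Z, hZ, rfl⟩ := ht.dead.quiet.tau_par hs
              obtain ⟨N', hN, rfl⟩ := hT.tau_par hZ
              exact ⟨N', h3.tail hN, rfl⟩
            · cases hs with
              | timepar _ _ _ _ hs _ _ =>
                cases hs with
                | timepar _ _ _ _ _ hs _ => exact (hb _ hs).elim
        exact hq s4
      exact ⟨N₂, t1.trans_tau .refl t2, h2⟩

/-! ### Testers for outputs and inputs -/

theorem Range.Covers.ne_intra {r : Range} {d : ℕ} (h : r.Covers d) : r ≠ .intra := by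
  rintro rfl
  exact h

/-- `[e = v]` -/
noncomputable def eqGuard {n : ℕ} (v : S.Val) (e : Term S n) : Guard S n :=
  ⟨[e], open Classical in fun l => decide (l = [v])⟩

/-- `[e = v] a!w.nil; nil` -/
noncomputable def ifWrite {n : ℕ} (v : S.Val) (e : Term S n) (a : S.Act) (w : S.Val) :
    Proc S n 0 := .cond (eqGuard v e) (.write a (.val w) .nil) .nil

theorem eqGuard_eval {v v' : S.Val} {ρ : Fin 0 → S.Val} :
    (eqGuard v (.val v')).eval ρ = true ↔ v' = v := by
  simp [eqGuard, Guard.eval, Term.eval]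

theorem PTrans.ifWrite {p : PLabel S} {v v' w : S.Val} {a : S.Act} {X : Proc S 0 0}
    (h : PTrans p (ifWrite v (.val v') a w) X) : v' = v ∧ p = .write a w ∧ X = .nil := by
  cases h with
  | condT _ _ _ _ _ hb h => exact ⟨eqGuard_eval.1 hb, h.of_write⟩
  | condF _ _ _ _ _ hb h => cases h

/-- Placed at the observing location `k`, the tester receives exactly what is observable there. It
compares the value received with `v`, since reception alone does not determine the label; a wrong
value leads to `nil` and never to a change of `a`. The timeout branch is irrelevant, as the clock
blocks time. -/
theorem test_send {c : S.Chan} {v : S.Val} {k : S.Loc} (m : S.Node) (a : S.Act)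
    {off on : S.Val} (hv : off ≠ on) :
    Test (.sendObs c v k) a (gadget m a k off (.recv c (ifWrite v (.var 0) a on) .nil))
      (gadget m a k off (ifWrite v (.val v) a on)) (gadget m a k on .nil) := by
  have inv : ∀ {l X}, NTrans l (gadget m a k off (.recv c (ifWrite v (.var 0) a on) .nil)) X →
      ∃ w, l = .recv c w k ∧ X = gadget m a k off (ifWrite v (.val w) a on) := by
    intro l X h
    cases h with
    | pos _ _ _ _ _ _ h => cases h
    | sensread _ _ _ _ _ _ _ _ _ h => cases h
    | actunchg _ _ _ _ _ _ _ _ _ h => cases h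
    | loccom _ _ _ _ _ _ h => cases h
    | actchg _ _ _ _ _ _ _ _ _ _ _ h => cases h
    | snd _ _ _ _ _ _ _ _ h _ => cases h
    | rcv _ _ _ _ _ _ _ w h _ =>
      cases h
      exact ⟨w, rfl, rfl⟩
  have inv' : ∀ {w l X}, NTrans l (gadget m a k off (ifWrite v (.val w) a on)) X →
      w = v ∧ l = .act a ∧ X = gadget m a k on .nil := by
    intro w l X h
    refine ⟨?_, gadget_write hv (fun p X h => h.ifWrite.2) h⟩
    by_contra hw
    exact gadget_not_trans (fun p X h => hw h.ifWrite.1) h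
  refine ⟨?_, ?_, ?_, ?_, ?_, dead_gadget m a k on⟩
  · intro l X h
    obtain ⟨w, rfl, -⟩ := inv h
    exact ⟨by simp, by simp⟩
  · intro N N' h
    cases h with
    | sndObs _ _ h _ _ _ hN hc =>
      exact ⟨c, v, k, h, by rwa [S.dist_comm], Or.inl ⟨hN, .rcv _ _ _ _ _ _ _ _ (.rcv _ _ _ _)
        hc.ne_intra⟩⟩
  · rintro N N' X ⟨d, w, h, h', hc, ⟨h1, h2⟩ | ⟨h1, h2⟩⟩
    · obtain ⟨w', e, rfl⟩ := inv h2
      cases e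
      refine ⟨fun l X hX => ⟨a, (inv' hX).2.1⟩, ?_⟩
      by_cases hw : w = v
      · subst hw
        exact Or.inr ⟨rfl, .sndObs _ _ _ _ _ _ h1 (by rwa [S.dist_comm])⟩
      · exact Or.inl fun Z hZ => hw (inv' hZ).1
    · obtain ⟨w', e, -⟩ := inv h2
      cases e
  · exact gadget_fire hv (.condT _ _ _ _ _ (eqGuard_eval.2 rfl) (.actuator _ _ _))
  · exact fun Z hZ => (inv' hZ).2.2

/-- Here the tester chooses both the value and the location of the sender, so its communication
determines the label and no comparison is needed. -/
theorem test_recv {c : S.Chan} {v : S.Val} {k : S.Loc} (m : S.Node) (a : S.Act)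
    {off on : S.Val} (hv : off ≠ on) :
    Test (.recvObs c v k) a (gadget m a k off (.send c (.val v) (.write a (.val on) .nil) .nil))
      (gadget m a k off (.write a (.val on) .nil)) (gadget m a k on .nil) := by
  have inv : ∀ {l X},
      NTrans l (gadget m a k off (.send c (.val v) (.write a (.val on) .nil) .nil)) X →
      l = .send c v k ∧ X = gadget m a k off (.write a (.val on) .nil) := by
    intro l X h
    cases h with
    | pos _ _ _ _ _ _ h => cases h
    | sensread _ _ _ _ _ _ _ _ _ h => cases h
    | actunchg _ _ _ _ _ _ _ _ _ h => cases h
    | loccom _ _ _ _ _ _ h => cases h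
    | actchg _ _ _ _ _ _ _ _ _ _ _ h => cases h
    | rcv _ _ _ _ _ _ _ _ h _ => cases h
    | snd _ _ _ _ _ _ _ w h _ =>
      cases h
      exact ⟨rfl, rfl⟩
  have inv' : ∀ {l X}, NTrans l (gadget m a k off (.write a (.val on) .nil)) X →
      l = .act a ∧ X = gadget m a k on .nil := fun h =>
    gadget_write hv (fun p X h => h.of_write) h
  refine ⟨?_, ?_, ?_, ?_, ?_, dead_gadget m a k on⟩
  · intro l X h
    cases (inv h).1
    exact ⟨by simp, by simp⟩
  · intro N N' h
    cases h with
    | rcvObs _ _ h _ _ _ hN hc =>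
      exact ⟨c, v, h, k, by rwa [S.dist_comm], Or.inr ⟨hN, .snd _ _ _ _ _ _ _ _ (.snd _ _ _ _)
        hc.ne_intra⟩⟩
  · rintro N N' X ⟨d, w, h, h', hc, ⟨h1, h2⟩ | ⟨h1, h2⟩⟩
    · cases (inv h2).1
    · obtain ⟨e, rfl⟩ := inv h2
      cases e
      exact ⟨fun l X hX => ⟨a, (inv' hX).1⟩,
        Or.inr ⟨rfl, .rcvObs _ _ _ _ _ _ h1 (by rwa [S.dist_comm])⟩⟩
  · exact gadget_fire hv (.actuator _ _ _)
  · exact fun Z hZ => (inv' hZ).2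

/-! ### Completeness -/

/-- Congruence next to an idle clock and a dead network. -/
def ClockCong (M N : Net S) : Prop :=
  ∃ (c : Clock S) (D : Net S), Dead D ∧ CongE (.par M (.par c.idle D)) (.par N (.par c.idle D))

theorem ClockCong.test {c : Clock S} {D : Net S} (hD : Dead D) {M N M' : Net S}
    (h : CongE (.par M (.par c.idle D)) (.par N (.par c.idle D))) {α : ELabel S} (k : S.Loc)
    {P₀ P₁ : S.Act → Proc S 0 0}
    (ht : ∀ m a, Test α a (gadget m a k c.off (P₀ a)) (gadget m a k c.off (P₁ a))
      (gadget m a k c.on .nil)) (hg : ∀ a, (P₀ a).GuardedRec) (hr : ∀ a s, ¬ (P₀ a).Reads s)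
    (hw : ∀ a b, (P₀ a).Writes b → b = a) (hM : ETrans α M M') :
    ∃ N', EWeak α N N' ∧ ClockCong M' N' := by
  obtain ⟨m, a, hfM, hfN⟩ := exists_fresh h.1 h.2.1
  have h' := h.par (h.1.par_gadget hfM k c.off (hg a) (hr a) (hw a))
    (h.2.1.par_gadget hfN k c.off (hg a) (hr a) (hw a))
  obtain ⟨N', h1, h2⟩ := (ht m a).sim (c.idle_quiet.par hD.quiet)
    (not_time_par_left c.idle_block D) h' hfN.not_hasAct hM
  -- The spent tester is moved into the garbage, which keeps the shape required by `ClockCong`.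
  have e : ∀ X : Net S, NEq (.par (.par X (.par c.idle D)) (gadget m a k c.on .nil))
      (.par X (.par c.idle (.par D (gadget m a k c.on .nil)))) := fun X =>
    (NEq.par_assoc _ _ _).trans (.congr_par (.refl X) (.par_assoc _ _ _))
  exact ⟨N', h1, c, _, hD.par (dead_gadget m a k c.on), h2.congr (e M') (e N')
    (h2.1.of_devs (by simp [Net.devs])) (h2.2.1.of_devs (by simp [Net.devs]))⟩

/-- The idle clock turns every answer `→*` into `⟹`. The labels are then treated one by one:
reduction closure for `τ` and actuator changes, the clock for ticks, testers for communications,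
contextuality for sensor updates and barb preservation for actuator values. -/
theorem ClockCong.sim {M N : Net S} (h : ClockCong M N) {α : ELabel S} {M' : Net S}
    (hM : ETrans α M M') : ∃ N', EWeak α N N' ∧ ClockCong M' N' := by
  obtain ⟨c, D, hD, h⟩ := h
  have hq := c.idle_quiet.par hD.quiet
  have hb := not_time_par_left c.idle_block D
  have hM₀ := hM
  cases hM with
  | tau _ _ hM =>
    obtain ⟨Y, s, h1⟩ := h.step (Or.inl (.parL _ _ _ _ hM))
    obtain ⟨N', t, rfl⟩ := s.tauStar_of_block hq hb
    exact ⟨N', t, c, D, hD, h1⟩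
  | tick _ _ hM =>
    obtain ⟨N', t, h1⟩ := h.tick hD hM
    exact ⟨N', t, c, D, hD, h1⟩
  | act a _ _ hM =>
    obtain ⟨Y₁, Y₂, Y₃, s1, s2, s3, h1⟩ := h.act (.parL _ _ _ _ hM)
    obtain ⟨N₁, t1, rfl⟩ := s1.tauStar_of_block hq hb
    rcases s2.act_par with ⟨N₂, t2, rfl⟩ | ⟨T, t2, -⟩
    · obtain ⟨N', t3, rfl⟩ := s3.tauStar_of_block hq hb
      exact ⟨N', .mk t1 (.act _ _ _ t2) t3, c, D, hD, h1⟩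
    -- An actuator of `M` belongs neither to the clock nor to the garbage, so the change must come
    -- from the network under test.
    · exact (h.1.not_hasAct (hM.hasAct rfl) (t2.hasAct rfl)).elim
  | sndObs d v k' k _ _ _ hc =>
    refine ClockCong.test hD h k (fun m a => test_send m a c.ne)
      (fun a => ⟨⟨trivial, trivial⟩, trivial⟩) ?_ ?_ hM₀
    · rintro a s ((h | h) | h) <;> exact h
    · rintro a b (((h | h) | h) | h)
      · exact h.symm
      all_goals exact h.elim
  | rcvObs d v k' k _ _ _ hc =>
    refine ClockCong.test hD h k (fun m a => test_recv m a c.ne)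
      (fun a => ⟨trivial, trivial⟩) ?_ ?_ hM₀
    · rintro a s (h | h) <;> exact h
    · rintro a b ((h | h) | h)
      · exact h.symm
      all_goals exact h.elim
  | sensEnv s k v _ hv =>
    refine ⟨_, .of_eTrans (.sensEnv s k v N hv), c, D, hD, ?_⟩
    have := h.update k hv
    simpa only [Net.update, hD.update, Clock.idle, gadget_update] using this
  | actEnv a k v _ hb' =>
    obtain ⟨Y, s, h1⟩ := h.barb (hb'.parL _)
    obtain ⟨N', t, rfl⟩ := s.tauStar_of_block hq hb
    rcases barb_par h1 with h1 | h1
    -- The barb reached by `τ`-transitions is already one of `N`, so `N` answers without moving and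
    -- the original pair is kept. This matters because barb preservation does not relate the network
    -- reached.
    · exact ⟨N, .of_eTrans (.actEnv a k v N (t.barb h1)), c, D, hD, h⟩
    · exact (h.1.not_hasAct hb'.hasAct h1.hasAct).elim

theorem ClockCong.bis {M N : Net S} (h : ClockCong M N) : Bis M N := by
  refine Bis.coind (R := ClockCong) ?_ ?_ (fun M N h α M' hM => h.sim hM) h
  · rintro M N ⟨c, D, hD, h⟩
    exact ⟨c, D, hD, h.symm⟩
  · rintro M N ⟨c, D, hD, h⟩
    exact h.1.left

theorem NTrans.nonempty_loc {l : NLabel S} {M M' : Net S} (h : NTrans l M M') :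
    Nonempty S.Loc := by
  induction h with
  | pos n I P P' μ h => exact ⟨h⟩
  | sensread n I P P' μ h => exact ⟨h⟩
  | actunchg n I P P' μ h => exact ⟨h⟩
  | loccom n I P P' μ h => exact ⟨h⟩
  | actchg n I P P' μ h => exact ⟨h⟩
  | snd n I P P' μ h => exact ⟨h⟩
  | rcv n I P P' μ h => exact ⟨h⟩
  | glbcomL _ _ _ _ _ _ h => exact ⟨h⟩
  | glbcomR _ _ _ _ _ _ h => exact ⟨h⟩
  | parL _ _ _ _ _ ih => exact ih
  | parR _ _ _ _ _ ih => exact ih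
  | res _ _ _ _ _ _ ih => exact ih

theorem exists_time [IsEmpty S.Loc] (M : Net S) : ∃ M', NTime M M' := by
  induction M with
  | zero => exact ⟨_, .timezero⟩
  | node d => exact isEmptyElim d.loc
  | par M N ihM ihN =>
    obtain ⟨M', hM⟩ := ihM
    obtain ⟨N', hN⟩ := ihN
    exact ⟨_, .timepar _ _ _ _ hM hN fun ⟨X, hX⟩ =>
      not_nonempty_iff.2 ‹IsEmpty S.Loc› hX.nonempty_loc⟩
  | res c M ih =>
    obtain ⟨M', hM⟩ := ih
    exact ⟨_, .res _ _ _ hM⟩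

/-- Without locations there is no place for a clock, but there are no nodes either: the only
transitions are ticks, which are always possible. -/
theorem bis_of_isEmpty [IsEmpty S.Loc] {M N : Net S} (hM : M.WF) (hN : N.WF) : Bis M N := by
  refine Bis.coind (R := fun M N => M.WF ∧ N.WF) (fun M N h => h.symm) (fun M N h => h.1) ?_
    ⟨hM, hN⟩
  rintro M N ⟨hM, hN⟩ α M' h
  have no : ∀ {l : NLabel S} {X : Net S}, ¬ NTrans l M X := fun h =>
    not_nonempty_iff.2 ‹IsEmpty S.Loc› h.nonempty_loc
  cases h with
  | tau _ _ h => exact (no h).elim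
  | tick _ _ h =>
    obtain ⟨N', h'⟩ := exists_time N
    exact ⟨N', .of_eTrans (.tick _ _ h'), h.wf hM, h'.wf hN⟩
  | act _ _ _ h => exact (no h).elim
  | sndObs _ _ _ _ _ _ h _ => exact (no h).elim
  | rcvObs _ _ _ _ _ _ h _ => exact (no h).elim
  | sensEnv _ k _ _ _ => exact isEmptyElim k
  | actEnv _ k _ _ _ => exact isEmptyElim k

theorem BarbedCong.bisimilar {M N : WNet S} (h : BarbedCong M N) : Bisimilar M N := by
  rcases isEmpty_or_nonempty S.Loc with hl | ⟨⟨k⟩⟩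
  · exact (bis_of_isEmpty M.2 N.2).2.2
  · obtain ⟨m, a, hM, hN⟩ := exists_fresh M.2 N.2
    obtain ⟨off, on, hv⟩ := S.nontrivial_val
    -- Any location will do for the clock, and two distinct values serve as its states.
    let c : Clock S := ⟨m, a, k, off, on, hv⟩
    have h' := h.congE.par (c.idle_wf M.2 hM) (c.idle_wf N.2 hN)
    have e : ∀ X : Net S, NEq (.par X c.idle) (.par X (.par c.idle .zero)) := fun X =>
      .congr_par (.refl X) (NEq.par_zero _).symm
    have hc : ClockCong M.1 N.1 := ⟨c, .zero, dead_zero, h'.congr (e _) (e _)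
      (h'.1.of_devs (by simp [Net.devs])) (h'.2.1.of_devs (by simp [Net.devs]))⟩
    exact hc.bis.2.2

end IoT

/-- Full abstraction: on well-formed networks, weak bisimilarity over the extensional labelled
transition semantics coincides with reduction barbed congruence. -/
theorem mainTheorem1 (S : IoT.Sig.{u}) (M N : IoT.WNet S) :
    IoT.Bisimilar M N ↔ IoT.BarbedCong M N := by
  exact ⟨IoT.Bisimilar.barbedCong, IoT.BarbedCong.bisimilar⟩
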